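/- **Theorem 2.** Work on a randomized word RAM: a program over finitely many variables and a random access memory, with words of $O(\log n)$ bits, where arithmetic and comparison of words, memory access, drawing a uniformly random integer from $\{0,\dots,r\}$ for a word $r$, and inserting an edge into or deleting an edge from the output graph take unit time. There are a randomized algorithm (one preprocessing program, one update program and the constant in the word length, all independent of $n$) and exponents $k,d\in\mathbb N$ such that for every $a\in\mathbb N$ there is a constant $C$ with the following property. Let $G_0$ be any simple unweighted undirected graph on $n$ vertices, with $m_0$ edges, given to the algorithm by its adjacency matrix. After preprocessing, the graph undergoes $n^a$ updates, each of which inserts or deletes one edge, giving graphs $G_1,G_2,\dots$; after each update the update program is run, and $H_t$ denotes the output graph after $t$ updates. The updates are chosen by an adaptive adversary, i.e. the $(t+1)$-st update is an arbitrary function of $G_0,H_0,\dots,G_t,H_t$. Then, for every such $G_0$ and every adversary, with probability at least $1-n^{-a}$ all of the following hold: 1. preprocessing takes at most $C n^{d}$ steps, and every single update is processed in at most $C\sqrt n\,\log^k n$ steps (so the worst-case update time is $\tilde O(\sqrt n)$); 2. for all $0\le t\le n^a$, $H_t$ is a $3$-spanner of $G_t$, i.e. a subgraph with $\operatorname{dist}_{G_t}(u,v)\le\operatorname{dist}_{H_t}(u,v)\le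 3\operatorname{dist}_{G_t}(u,v)$ for all vertices $u,v$, and it has at most $C n^{1.5}\log^k n$ edges; 3. for all $0\le t\le n^a$, the total recourse satisfies $\sum_{i=1}^{t}|E(H_i)\,\triangle\,E(H_{i-1})|\le C\log^k n\cdot\bigl(t+\min\{m_0,n^{1.5}\}\bigr)$; in particular the amortized recourse is $\tilde O(1)$ when starting from the empty graph, and over any $t\ge n^{1.5}$ updates from any initial graph. -/

import Mathlib

/-!
Randomized word-RAM programs, dynamic graph algorithms run by them against an adaptive adversary,
and spanners.
-/

namespace DynSpanner

/-! ### Spanners -/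

/-- `H` is an `α`-spanner of `G`: a subgraph of `G` (on the same vertex set) with
`dist_G u v ≤ dist_H u v ≤ α * dist_G u v` for all vertices `u`, `v`. The distance `edist` between
vertices in different components is `⊤`. -/
def IsSpanner {V : Type*} (α : ℕ) (G H : SimpleGraph V) : Prop :=
  H ≤ G ∧ ∀ u v : V, G.edist u v ≤ H.edist u v ∧ H.edist u v ≤ (α : ℕ∞) * G.edist u v

/-! ### A randomized word RAM

Programs are structured programs over finitely many variables and a random access memory. Every
variable and every memory cell holds a word, i.e. a natural number below `2 ^ w`. -/

/-- Binary word operations. -/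
inductive Op
  | add | sub | mul | div | mod | lt | eq

/-- Addition and multiplication are modulo `2 ^ w`; subtraction is truncated at `0`; `lt` and `eq`
are the tests with outcome `1` (true) or `0` (false). -/
def Op.eval (w : ℕ) : Op → ℕ → ℕ → ℕ
  | .add, a, b => (a + b) % 2 ^ w
  | .sub, a, b => a - b
  | .mul, a, b => (a * b) % 2 ^ w
  | .div, a, b => a / b
  | .mod, a, b => a % b
  | .lt, a, b => if a < b then 1 % 2 ^ w else 0
  | .eq, a, b => if a = b then 1 % 2 ^ w else 0

/-- Expressions: constants, variables, memory reads (indirect addressing) and word operations. -/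
inductive Expr
  | const (k : ℕ)
  | var (x : ℕ)
  | read (addr : Expr)
  | op (o : Op) (a b : Expr)

/-- Commands. `rand x e` sets `x` to a uniformly random element of `{0, …, e}`. `putEdge` and
`cutEdge` insert an edge into, and remove an edge from, the output graph. -/
inductive Cmd
  | nop
  | assign (x : ℕ) (e : Expr)
  | write (addr e : Expr)
  | rand (x : ℕ) (e : Expr)
  | putEdge (a b : Expr)
  | cutEdge (a b : Expr)
  | seq (p q : Cmd)
  | cond (e : Expr) (p q : Cmd)
  | loop (e : Expr) (p : Cmd)

/-- State of the machine: variables, memory, and the (write-only) output graph on `n` vertices. -/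
structure State (n : ℕ) where
  var : ℕ → ℕ
  mem : ℕ → ℕ
  out : SimpleGraph (Fin n)

/-- Value of an expression. -/
def Expr.eval (w : ℕ) {n : ℕ} (s : State n) : Expr → ℕ
  | .const k => k % 2 ^ w
  | .var x => s.var x
  | .read a => s.mem (a.eval w s)
  | .op o a b => o.eval w (a.eval w s) (b.eval w s)

/-- Assign a value to a variable. -/
def State.setVar {n : ℕ} (s : State n) (x v : ℕ) : State n :=
  { s with var := Function.update s.var x v }

/-- Write a value to a memory cell. -/
def State.setMem {n : ℕ} (s : State n) (i v : ℕ) : State n :=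
  { s with mem := Function.update s.mem i v }

/-- The graph on `n` vertices with the single edge `{a, b}`; it has no edge if `a = b` or if `a` or
`b` is not a vertex. -/
def wordEdge (n a b : ℕ) : SimpleGraph (Fin n) :=
  if h : a < n ∧ b < n then SimpleGraph.edge ⟨a, h.1⟩ ⟨b, h.2⟩ else ⊥

/-- One step of the machine on the command `c` in state `s`: the list of commands by which `c` is
to be replaced, and the new state. A step costs one unit of time. (A program is one fixed finite
object, so a step performs at most a constant number of word operations.) -/
noncomputable def step (w : ℕ) {n : ℕ} (s : State n) : Cmd → PMF (List Cmd × State n)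
  | .nop => PMF.pure ([], s)
  | .assign x e => PMF.pure ([], s.setVar x (e.eval w s))
  | .write a e => PMF.pure ([], s.setMem (a.eval w s) (e.eval w s))
  | .rand x e => (PMF.uniformOfFintype (Fin (e.eval w s + 1))).map
      fun r => ([], s.setVar x (r : ℕ))
  | .putEdge a b => PMF.pure ([], { s with out := s.out ⊔ wordEdge n (a.eval w s) (b.eval w s) })
  | .cutEdge a b => PMF.pure ([], { s with out := s.out \ wordEdge n (a.eval w s) (b.eval w s) })
  | .seq p q => PMF.pure ([p, q], s)
  | .cond e p q => PMF.pure ([if e.eval w s ≠ 0 then p else q], s)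
  | .loop e p => PMF.pure (if e.eval w s ≠ 0 then [p, .loop e p] else [], s)

/-- `run w B K s` executes the commands in the list `K` one after the other from state `s`. The
outcome is `some s'` if they halt in state `s'` after at most `B` steps, and `none` if they need
more than `B` steps. -/
noncomputable def run (w : ℕ) {n : ℕ} : ℕ → List Cmd → State n → PMF (Option (State n))
  | _, [], s => PMF.pure (some s)
  | 0, _ :: _, _ => PMF.pure none
  | B + 1, c :: K, s => (step w s c).bind fun r => run w B (r.1 ++ K) r.2

/-! ### Dynamic graph algorithms and adaptive adversaries -/

/-- A dynamic graph algorithm: a program for preprocessing, a program that is run after every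
update, and the constant `c` in the word length `O(log n)`. None of these depends on `n`. -/
structure Algorithm where
  prep : Cmd
  upd : Cmd
  c : ℕ

/-- The word length on graphs with `n` vertices (`Nat.size n` is the number of bits of `n`). -/
def Algorithm.wordLength (𝒜 : Algorithm) (n : ℕ) : ℕ := 𝒜.c * Nat.size n

open Classical in
/-- The state before preprocessing: variable `0` holds `n`, the memory holds the adjacency matrix
of the initial graph row by row, everything else is `0`, and the output graph has no edges. -/
noncomputable def initState {n : ℕ} (G : SimpleGraph (Fin n)) : State n where
  var := fun x => if x = 0 then n else 0
  mem := fun i => if ∃ u v : Fin n, i = u * n + v ∧ G.Adj u v then 1 else 0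
  out := ⊥

/-- An update names a pair of distinct vertices: the edge between them is inserted if it is absent
and deleted if it is present. -/
abbrev Update (n : ℕ) := {p : Fin n × Fin n // p.1 ≠ p.2}

/-- The graph after an update. -/
def Update.apply {n : ℕ} (p : Update n) (G : SimpleGraph (Fin n)) : SimpleGraph (Fin n) :=
  symmDiff G (SimpleGraph.edge p.1.1 p.1.2)

open Classical in
/-- The update `p` of `G` is announced to the machine: variable `0` holds `1` for an insertion and
`0` for a deletion, variables `1` and `2` hold the two endpoints. -/
noncomputable def Update.announce {n : ℕ} (p : Update n) (G : SimpleGraph (Fin n))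
    (s : State n) : State n :=
  ((s.setVar 0 (if G.Adj p.1.1 p.1.2 then 0 else 1)).setVar 1 p.1.1).setVar 2 p.1.2

/-- The history of a run: the pairs (current graph, output of the algorithm), newest first. The
history after `t` updates has `t + 1` entries. -/
abbrev History (n : ℕ) := List (SimpleGraph (Fin n) × SimpleGraph (Fin n))

/-- The strategy of an adaptive adversary: the next update may depend on all previous graphs and
all previous outputs of the algorithm. -/
abbrev Adversary (n : ℕ) := History n → Update n

/-- The random outcome of running the algorithm `𝒜` on the initial graph `G₀` for a given number
of updates chosen by the adversary: the history and the final state of the machine, or `none` if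
preprocessing took more than `B₀` steps or some update took more than `B` steps. -/
noncomputable def play (𝒜 : Algorithm) (B₀ B : ℕ) {n : ℕ} (G₀ : SimpleGraph (Fin n))
    (adv : Adversary n) : ℕ → PMF (Option (History n × State n))
  | 0 => (run (𝒜.wordLength n) B₀ [𝒜.prep] (initState G₀)).map
      fun r => r.map fun s => ([(G₀, s.out)], s)
  | t + 1 => (play 𝒜 B₀ B G₀ adv t).bind fun
      | none => PMF.pure none
      | some ([], _) => PMF.pure none
      | some (x :: l, s) =>
          (run (𝒜.wordLength n) B [𝒜.upd] ((adv (x :: l)).announce x.1 s)).map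
            fun r => r.map fun s' => (((adv (x :: l)).apply x.1, s'.out) :: x :: l, s')

/-- The total recourse of a history: the number of edge insertions and deletions in the output
graph, summed over all updates. -/
noncomputable def recourse {n : ℕ} : History n → ℕ
  | x :: y :: l => (symmDiff x.2 y.2).edgeSet.ncard + recourse (y :: l)
  | _ => 0

end DynSpanner

/-!
The algorithm keeps a spanner of size `O(n ^ 1.5)` deterministically and within deterministic time
bounds; chance enters only into the recourse, through random witnesses.

Let `s` be about `√n`. The vertices are divided into buckets of `s` consecutive vertices. An edge
is a pair `(v, a)` with `v < a`. If `v` has edges to the bucket of `a` that have been there for a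
while, one of them is designated as the edge from `v` to its *center* in this bucket. For a pair
`{c, a}` inside a bucket, the *candidates* are the common neighbours of `c` and `a` before both of
them, and a random candidate `w` is the *witness* of the pair. The output consists of the edges to
centers, the edges `(w, c)` and `(w, a)` to witnesses, and the *explicit* edges, which are those
that were inserted recently. An edge `(v, a)` that is not explicit is replaced by the path
`v - c - w - a`, where `c` is the center of `v` in the bucket of `a` and `w` is the witness of
`{c, a}`, which exists because `v` is a candidate (`Ok.isSpanner`). There are at most `n * s`
edges to centers and at most `2 * n * s` edges to witnesses. One step of a *background pass* of
length `T = n * s` is made after each update: it processes one pair, making all its candidates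
*active* and redrawing its witness, and it scans one bucket of one vertex, so that every edge
ceases to be explicit after two passes. Hence there are `O(T)` explicit edges
(`Ok.card_edges_le`). Witnesses are drawn uniformly from the active candidates only, so the
insertion of an edge does not interfere with any witness. The loops of the update program run over
one bucket, and there are `O(log n)` of them.

When `(v, a)` is deleted, the pairs `{a, b}` with witness `v` lose it and draw a new one. An
update inserts into the output only a few edges besides those to newly drawn witnesses
(`Ok.inserted_le`), so the recourse is bounded by the number of draws, and this by the number of
lost witnesses. An adaptive adversary sees the output and could delete edges `(v, a)` with many
such pairs. In expectation over the draws, their number is the sum over `b` of the weights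
`1 / m`, where `m` is the number of active candidates of `{a, b}`; a weight is frozen when the
edge `(v, b)` is deleted. Deleting `v` from the candidates lowers the harmonic number of `m` by
`1 / m`, so the sum of the expected losses is amortized against a potential made of harmonic
numbers and frozen weights, which grows only by `O(log n)` per update (`pot_upd`).

The losses are concentrated around these sums in spite of the adaptivity of the adversary. The
difficulty is that the adversary determines when witnesses are redrawn, so a pair may be redrawn
until the outcome suits the adversary. Therefore a pair that loses its witness in update `r`
redraws not only then but also in the updates `r + 2 ^ i`, whatever happens in the meantime. If
the last draw of a pair was between `2 ^ i` and `2 ^ (i + 1)` updates ago, then the pair did not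
lose its witness in the last `2 ^ (i + 1)` updates, so this draw was already scheduled at time
`t₀ = t - 2 ^ (i + 1)` (`exists_counted`). For a fixed time `t₀`, an edge `(v, a)` and a final
time, the exponential moment `mart` counts only pairs whose last draw is determined by what is
known at time `t₀` and has taken place. It starts at `1`, and its conditional expectation
increases by at most `1` per update, whatever the adversary does (`mart_step`). Markov's
inequality and a union bound over the edges, the times and the logarithmically many `t₀`
(`Cfg.Law.bad`) show that with high probability no moment is ever large, and then the number of
losses in every update is bounded in terms of the weights (`card_lostSet_le`).

For the initial graph, all edges are inserted as explicit ones. If there are more than `s ^ 3` of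
them, two background passes are made as part of the preprocessing. These draws are not analyzed:
at most one witness per pair is lost that stems from them (`card_unsampled`), which is within the
allowance of `n ^ 1.5` in that case.

The programs are analyzed in two layers. `Rep` relates the memory to abstract data, and `ExecS`
says that a program halts in time, that its final states satisfy a predicate, and that its effect
on the table of witnesses is to redraw a given list of them. The remaining argument is about the
abstract data and this list.
-/

namespace DynSpanner

/-! ### Executions with a time bound -/

theorem run_nil (w : ℕ) {n : ℕ} (B : ℕ) (s : State n) : run w B [] s = PMF.pure (some s) := by
  cases B <;> rfl

theorem run_succ_cons (w : ℕ) {n : ℕ} (B : ℕ) (c : Cmd) (K : List Cmd) (s : State n) :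
    run w (B + 1) (c :: K) s = (step w s c).bind fun r => run w B (r.1 ++ K) r.2 := rfl

theorem run_le_run_succ (w : ℕ) {n : ℕ} (B : ℕ) (K : List Cmd) (s x : State n) :
    run w B K s (some x) ≤ run w (B + 1) K s (some x) := by
  induction B generalizing K s with
  | zero =>
    cases K with
    | nil => simp [run_nil]
    | cons c K => simp [run]
  | succ B ih =>
    cases K with
    | nil => simp [run_nil]
    | cons c K =>
      rw [run_succ_cons, run_succ_cons, PMF.bind_apply, PMF.bind_apply]
      exact ENNReal.tsum_le_tsum fun r => mul_le_mul_right (ih _ _) _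

theorem run_mono (w : ℕ) {n : ℕ} {B B' : ℕ} (h : B ≤ B') (K : List Cmd) (s x : State n) :
    run w B K s (some x) ≤ run w B' K s (some x) := by
  induction h with
  | refl => rfl
  | step _ ih => exact ih.trans (run_le_run_succ w _ K s x)

/-- From state `s`, the command `c` halts within `b` steps, and the final state has distribution
`μ`. It is phrased with an arbitrary continuation `K`, so that commands can be composed. -/
def Exec (w : ℕ) {n : ℕ} (c : Cmd) (s : State n) (b : ℕ) (μ : PMF (State n)) : Prop :=
  ∀ (K : List Cmd) (B : ℕ) (x : State n),
    (μ.bind fun s' => run w B K s') (some x) ≤ run w (b + B) (c :: K) s (some x)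

section Exec
variable {w n : ℕ} {s : State n}

theorem Exec.mono {c : Cmd} {b b' : ℕ} {μ : PMF (State n)} (h : Exec w c s b μ) (hb : b ≤ b') :
    Exec w c s b' μ := fun K B x =>
  (h K B x).trans (run_mono w (by omega) _ _ _)

theorem Exec.of_step {c : Cmd} {μ : PMF (State n)}
    (h : step w s c = μ.map fun s' => ([], s')) : Exec w c s 1 μ := fun K B x => by
  rw [add_comm, run_succ_cons, h, PMF.bind_map]
  exact le_of_eq rfl

theorem Exec.of_step_pure {c : Cmd} {s' : State n}
    (h : step w s c = PMF.pure ([], s')) : Exec w c s 1 (PMF.pure s') :=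
  Exec.of_step (by rw [h, PMF.pure_map])

theorem bind_le_bind {α β γ : Type*} (μ : PMF α) {f g : α → PMF β} (φ : γ → β) (x : γ)
    (h : ∀ a ∈ μ.support, f a (φ x) ≤ g a (φ x)) : μ.bind f (φ x) ≤ μ.bind g (φ x) := by
  rw [PMF.bind_apply, PMF.bind_apply]
  refine ENNReal.tsum_le_tsum fun a => ?_
  by_cases ha : a ∈ μ.support
  · exact mul_le_mul_right (h a ha) _
  · rw [PMF.mem_support_iff, not_not] at ha
    simp [ha]

theorem run_cons_cons_ge {p q : Cmd} {b₁ b₂ : ℕ} {μ : PMF (State n)} {ν : State n → PMF (State n)}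
    (hp : Exec w p s b₁ μ) (hq : ∀ s' ∈ μ.support, Exec w q s' b₂ (ν s'))
    (K : List Cmd) (B : ℕ) (x : State n) :
    ((μ.bind ν).bind fun s' => run w B K s') (some x) ≤
      run w (b₁ + b₂ + B) (p :: q :: K) s (some x) := by
  rw [PMF.bind_bind, add_assoc]
  exact (bind_le_bind μ some x fun s' hs' => hq s' hs' K B x).trans (hp (q :: K) (b₂ + B) x)

theorem Exec.seq {p q : Cmd} {b₁ b₂ : ℕ} {μ : PMF (State n)} {ν : State n → PMF (State n)}
    (hp : Exec w p s b₁ μ) (hq : ∀ s' ∈ μ.support, Exec w q s' b₂ (ν s')) :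
    Exec w (.seq p q) s (1 + b₁ + b₂) (μ.bind ν) := fun K B x => by
  refine (run_cons_cons_ge hp hq K B x).trans (le_of_eq ?_)
  rw [show 1 + b₁ + b₂ + B = (b₁ + b₂ + B) + 1 by ring, run_succ_cons]
  simp [step]

theorem Exec.cond_pos {e : Expr} {p q : Cmd} {b : ℕ} {μ : PMF (State n)} (he : e.eval w s ≠ 0)
    (hp : Exec w p s b μ) : Exec w (.cond e p q) s (1 + b) μ := fun K B x => by
  refine (hp K B x).trans (le_of_eq ?_)
  rw [show 1 + b + B = (b + B) + 1 by ring, run_succ_cons]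
  simp [step, he]

theorem Exec.cond_neg {e : Expr} {p q : Cmd} {b : ℕ} {μ : PMF (State n)} (he : e.eval w s = 0)
    (hp : Exec w q s b μ) : Exec w (.cond e p q) s (1 + b) μ := fun K B x => by
  refine (hp K B x).trans (le_of_eq ?_)
  rw [show 1 + b + B = (b + B) + 1 by ring, run_succ_cons]
  simp [step, he]

theorem Exec.loop_pos {e : Expr} {p : Cmd} {b₁ b₂ : ℕ} {μ : PMF (State n)}
    {ν : State n → PMF (State n)} (he : e.eval w s ≠ 0)
    (hp : Exec w p s b₁ μ) (hq : ∀ s' ∈ μ.support, Exec w (.loop e p) s' b₂ (ν s')) :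
    Exec w (.loop e p) s (1 + b₁ + b₂) (μ.bind ν) := fun K B x => by
  refine (run_cons_cons_ge hp hq K B x).trans (le_of_eq ?_)
  rw [show 1 + b₁ + b₂ + B = (b₁ + b₂ + B) + 1 by ring, run_succ_cons]
  simp [step, he]

theorem Exec.loop_neg {e : Expr} {p : Cmd} (he : e.eval w s = 0) :
    Exec w (.loop e p) s 1 (PMF.pure s) := Exec.of_step_pure (by simp [step, he])

/-- A command that halts within the time bound never runs out of time. -/
theorem Exec.run_eq {c : Cmd} {b B : ℕ} {μ : PMF (State n)} (h : Exec w c s b μ) (hB : b ≤ B) :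
    run w B [c] s = μ.map some := by
  have h1 : ∀ x, (μ.map some) (some x) ≤ run w B [c] s (some x) := fun x => by
    have := (h.mono hB) [] 0 x
    simpa [run_nil, PMF.map, Function.comp_def] using this
  have h2 : ∀ r, (μ.map some) r ≤ run w B [c] s r := by
    rintro (_ | x)
    · have : (μ.map some) none = 0 := by
        rw [PMF.apply_eq_zero_iff, PMF.mem_support_map_iff]
        simp
      simp [this]
    · exact h1 x
  by_contra hne
  obtain ⟨r, hr⟩ : ∃ r, (μ.map some) r ≠ run w B [c] s r := by
    by_contra hall
    push Not at hall
    exact hne (PMF.ext fun r => (hall r).symm)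
  have hlt := ENNReal.tsum_lt_tsum (f := μ.map some) (g := run w B [c] s) (i := r)
    (by rw [PMF.tsum_coe]; exact ENNReal.one_ne_top) h2 (lt_of_le_of_ne (h2 r) hr)
  rw [PMF.tsum_coe, PMF.tsum_coe] at hlt
  exact lt_irrefl _ hlt

end Exec

/-! ### Resampling of witnesses -/

/-- A table of witnesses: the pair `p` has witness `v` if the entry is `v + 1`, and no witness if
the entry is `0`. -/
abbrev Tok := ℕ × ℕ → ℕ

/-- Resample the witness of `p` uniformly from `A`. -/
noncomputable def sampleTok (p : ℕ × ℕ) (A : Finset ℕ) (y : Tok) : PMF Tok :=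
  if h : A.Nonempty then
    (PMF.uniformOfFinset A h).map fun v => Function.update y p (v + 1)
  else PMF.pure (Function.update y p 0)

/-- Resample witnesses one after the other. -/
noncomputable def sampleAll : List ((ℕ × ℕ) × Finset ℕ) → Tok → PMF Tok
  | [], y => PMF.pure y
  | z :: l, y => (sampleTok z.1 z.2 y).bind (sampleAll l)

theorem sampleAll_append (l l' : List ((ℕ × ℕ) × Finset ℕ)) (y : Tok) :
    sampleAll (l ++ l') y = (sampleAll l y).bind (sampleAll l') := by
  induction l generalizing y with
  | nil => simp [sampleAll]
  | cons z l ih =>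
    simp only [List.cons_append, sampleAll, PMF.bind_bind]
    congr 1
    funext y'
    exact ih y'

theorem sampleAll_singleton (p : ℕ × ℕ) (A : Finset ℕ) (y : Tok) :
    sampleAll [(p, A)] y = sampleTok p A y := by
  change (sampleTok p A y).bind PMF.pure = _
  rw [PMF.bind_pure]

/-- A number of steps that suffices for `c` if every loop makes at most `N` iterations. -/
def Cmd.cost (N : ℕ) : Cmd → ℕ
  | .seq p q => 1 + p.cost N + q.cost N
  | .cond _ p q => 1 + (p.cost N + q.cost N)
  | .loop _ p => N * (1 + p.cost N) + 1
  | _ => 1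

/-- The address of entry `(i, j, l)` of array number `k`, for indices below `D`. -/
def addr (D k i j l : ℕ) : ℕ := ((k * D + i) * D + j) * D + l

/-- The table of witnesses in memory: array number `5`. -/
def tokOf (D : ℕ) {n : ℕ} (s : State n) : Tok := fun p =>
  if p.1 < D ∧ p.2 < D then s.mem (addr D 5 p.1 p.2 0) else 0

/-- The command `c` halts within `b` steps in a state that satisfies `R`, and its effect on the
table of witnesses is to resample the witnesses in the list `l`. -/
def ExecS (D w : ℕ) {n : ℕ} (c : Cmd) (s : State n) (b : ℕ) (l : List ((ℕ × ℕ) × Finset ℕ))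
    (R : State n → Prop) : Prop :=
  ∃ μ, Exec w c s b μ ∧ (∀ s' ∈ μ.support, R s') ∧ μ.map (tokOf D) = sampleAll l (tokOf D s)

/-- The command `c` is deterministic from `s` and halts within `b` steps in a state that
satisfies `R`. -/
def Tri (w : ℕ) {n : ℕ} (c : Cmd) (s : State n) (b : ℕ) (R : State n → Prop) : Prop :=
  ∃ s', Exec w c s b (PMF.pure s') ∧ R s'

section Rules
variable {D w n : ℕ} {s : State n} {N : ℕ}

theorem ExecS.of_tri {c : Cmd} {b : ℕ} {R : State n → Prop}
    (h : Tri w c s b fun s' => tokOf D s' = tokOf D s ∧ R s') : ExecS D w c s b [] R := by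
  obtain ⟨s', h1, h2, h3⟩ := h
  refine ⟨_, h1, by simpa using h3, ?_⟩
  rw [PMF.pure_map, h2]; rfl

theorem ExecS.imp {c : Cmd} {b : ℕ} {l} {R R' : State n → Prop} (h : ExecS D w c s b l R)
    (hR : ∀ s', R s' → R' s') : ExecS D w c s b l R' := by
  obtain ⟨μ, h1, h2, h3⟩ := h
  exact ⟨μ, h1, fun s' hs' => hR _ (h2 s' hs'), h3⟩

theorem ExecS.mono {c : Cmd} {b b' : ℕ} {l} {R : State n → Prop} (h : ExecS D w c s b l R)
    (hb : b ≤ b') : ExecS D w c s b' l R := by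
  obtain ⟨μ, h1, h2, h3⟩ := h
  exact ⟨μ, h1.mono hb, h2, h3⟩

theorem ExecS.seq' {p q : Cmd} {b₁ b₂ : ℕ} {l₁ l₂} {R : State n → Prop}
    (hp : ExecS D w p s b₁ l₁ fun s' => ExecS D w q s' b₂ l₂ R) :
    ExecS D w (.seq p q) s (1 + b₁ + b₂) (l₁ ++ l₂) R := by
  classical
  obtain ⟨μ, h1, h2, h3⟩ := hp
  choose! ν hν using h2
  refine ⟨μ.bind ν, h1.seq fun s' hs' => (hν s' hs').1, ?_, ?_⟩
  · intro s' hs'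
    obtain ⟨s₁, hs₁, hs₂⟩ := (PMF.mem_support_bind_iff _ _ _).1 hs'
    exact (hν s₁ hs₁).2.1 s' hs₂
  · rw [PMF.map_bind, sampleAll_append, ← h3, PMF.bind_map]
    ext y
    rw [PMF.bind_apply, PMF.bind_apply]
    refine tsum_congr fun s₁ => ?_
    by_cases hs₁ : s₁ ∈ μ.support
    · rw [(hν s₁ hs₁).2.2]; rfl
    · rw [PMF.mem_support_iff, not_not] at hs₁
      simp [hs₁]

theorem ExecS.seq {p q : Cmd} {l₁ l₂} {R : State n → Prop}
    (hp : ExecS D w p s (p.cost N) l₁ fun s' => ExecS D w q s' (q.cost N) l₂ R) :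
    ExecS D w (.seq p q) s ((Cmd.seq p q).cost N) (l₁ ++ l₂) R := ExecS.seq' hp

theorem ExecS.seq_nil {p q : Cmd} {l} {R : State n → Prop}
    (hp : ExecS D w p s (p.cost N) [] fun s' => ExecS D w q s' (q.cost N) l R) :
    ExecS D w (.seq p q) s ((Cmd.seq p q).cost N) l R := ExecS.seq' (l₁ := []) hp

theorem ExecS.cond {e : Expr} {p q : Cmd} {l} {R : State n → Prop}
    (h1 : e.eval w s ≠ 0 → ExecS D w p s (p.cost N) l R)
    (h2 : e.eval w s = 0 → ExecS D w q s (q.cost N) l R) :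
    ExecS D w (.cond e p q) s ((Cmd.cond e p q).cost N) l R := by
  by_cases he : e.eval w s = 0
  · obtain ⟨μ, h3, h4⟩ := h2 he
    exact ⟨μ, (Exec.cond_neg he h3).mono (by simp only [Cmd.cost]; omega), h4⟩
  · obtain ⟨μ, h3, h4⟩ := h1 he
    exact ⟨μ, (Exec.cond_pos he h3).mono (by simp only [Cmd.cost]; omega), h4⟩

theorem Tri.seq {p q : Cmd} {R : State n → Prop}
    (hp : Tri w p s (p.cost N) fun s' => Tri w q s' (q.cost N) R) :
    Tri w (.seq p q) s ((Cmd.seq p q).cost N) R := by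
  obtain ⟨s₁, h1, s₂, h2, h3⟩ := hp
  refine ⟨s₂, ?_, h3⟩
  have := h1.seq (ν := fun _ => PMF.pure s₂) (by simpa using h2)
  rw [PMF.pure_bind] at this
  exact this

theorem Tri.cond {e : Expr} {p q : Cmd} {R : State n → Prop}
    (h1 : e.eval w s ≠ 0 → Tri w p s (p.cost N) R)
    (h2 : e.eval w s = 0 → Tri w q s (q.cost N) R) :
    Tri w (.cond e p q) s ((Cmd.cond e p q).cost N) R := by
  by_cases he : e.eval w s = 0
  · obtain ⟨μ, h3, h4⟩ := h2 he
    exact ⟨μ, (Exec.cond_neg he h3).mono (by simp only [Cmd.cost]; omega), h4⟩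
  · obtain ⟨μ, h3, h4⟩ := h1 he
    exact ⟨μ, (Exec.cond_pos he h3).mono (by simp only [Cmd.cost]; omega), h4⟩

theorem Tri.nop {R : State n → Prop} (h : R s) : Tri w .nop s (Cmd.nop.cost N) R :=
  ⟨s, Exec.of_step_pure rfl, h⟩

theorem Tri.assign {x : ℕ} {e : Expr} {R : State n → Prop} (h : R (s.setVar x (e.eval w s))) :
    Tri w (.assign x e) s ((Cmd.assign x e).cost N) R :=
  ⟨_, Exec.of_step_pure rfl, h⟩

theorem Tri.write {a e : Expr} {R : State n → Prop}
    (h : R (s.setMem (a.eval w s) (e.eval w s))) :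
    Tri w (.write a e) s ((Cmd.write a e).cost N) R :=
  ⟨_, Exec.of_step_pure rfl, h⟩

theorem Tri.putEdge {a b : Expr} {R : State n → Prop}
    (h : R { s with out := s.out ⊔ wordEdge n (a.eval w s) (b.eval w s) }) :
    Tri w (.putEdge a b) s ((Cmd.putEdge a b).cost N) R :=
  ⟨_, Exec.of_step_pure rfl, h⟩

theorem Tri.cutEdge {a b : Expr} {R : State n → Prop}
    (h : R { s with out := s.out \ wordEdge n (a.eval w s) (b.eval w s) }) :
    Tri w (.cutEdge a b) s ((Cmd.cutEdge a b).cost N) R :=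
  ⟨_, Exec.of_step_pure rfl, h⟩

/-- A loop that counts the variable `j` up to the value of `e`. -/
def forLoop (j : ℕ) (e : Expr) (body : Cmd) : Cmd :=
  .loop (.op .lt (.var j) e) (.seq body (.assign j (.op .add (.var j) (.const 1))))

/-- The lists of resampled witnesses of the iterations `i, …, i + m - 1`, concatenated. -/
def catList {α : Type*} (l : ℕ → List α) : ℕ → ℕ → List α
  | _, 0 => []
  | i, m + 1 => l i ++ catList l (i + 1) m

/-- The invariant `I i` holds before iteration `i`; the lists of resampled witnesses are
concatenated. -/
theorem ExecS.loop_aux {e : Expr} {body : Cmd} {b M : ℕ} {l} {I : ℕ → State n → Prop}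
    (hI : ∀ i ≤ M, ∀ s, I i s → (e.eval w s ≠ 0 ↔ i < M))
    (hbody : ∀ i < M, ∀ s, I i s → ExecS D w body s b (l i) (I (i + 1)))
    (m i : ℕ) (him : i + m = M) (s : State n) (hs : I i s) :
    ExecS D w (.loop e body) s (m * (1 + b) + 1) (catList l i m) (I M) := by
  classical
  induction m generalizing i s with
  | zero =>
    refine ⟨PMF.pure s, ?_, ?_, ?_⟩
    · refine (Exec.loop_neg ?_).mono (by omega)
      by_contra h
      have := (hI i (by omega) s hs).1 h
      omega
    · simp only [PMF.support_pure, Set.mem_singleton_iff, forall_eq]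
      have : i = M := by omega
      rwa [← this]
    · rw [PMF.pure_map]; rfl
  | succ m ih =>
    obtain ⟨μ, e1, e2, e3⟩ := hbody i (by omega) s hs
    have e4 : ∀ s' ∈ μ.support, ExecS D w (.loop e body) s' (m * (1 + b) + 1)
        (catList l (i + 1) m) (I M) := fun s' hs' => ih (i + 1) (by omega) s' (e2 s' hs')
    choose! ν hν using e4
    refine ⟨μ.bind ν, ?_, ?_, ?_⟩
    · exact (Exec.loop_pos ((hI i (by omega) s hs).2 (by omega)) e1 fun s' hs' =>
        (hν s' hs').1).mono (by rw [add_mul]; omega)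
    · intro s' hs'
      obtain ⟨s₁, hs₁, hs₂⟩ := (PMF.mem_support_bind_iff _ _ _).1 hs'
      exact (hν s₁ hs₁).2.1 s' hs₂
    · rw [PMF.map_bind, catList, sampleAll_append, ← e3, PMF.bind_map]
      ext y
      rw [PMF.bind_apply, PMF.bind_apply]
      refine tsum_congr fun s₁ => ?_
      by_cases hs₁ : s₁ ∈ μ.support
      · rw [(hν s₁ hs₁).2.2]; rfl
      · rw [PMF.mem_support_iff, not_not] at hs₁
        simp [hs₁]

theorem ExecS.forLoop {j : ℕ} {e : Expr} {body : Cmd} {M : ℕ} {l} {I : ℕ → State n → Prop}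
    (hM : M < 2 ^ w) (hMN : M ≤ N)
    (hI : ∀ i ≤ M, ∀ s, I i s → s.var j = i ∧ e.eval w s = M)
    (hbody : ∀ i < M, ∀ s, I i s → ExecS D w body s (body.cost N) (l i) fun s' =>
      s'.var j = i ∧ I (i + 1) (s'.setVar j (i + 1)))
    (hs : I 0 s) :
    ExecS D w (forLoop j e body) s ((forLoop j e body).cost N) (catList l 0 M) (I M) := by
  refine (ExecS.loop_aux (b := 1 + body.cost N + 1) ?_ ?_ M 0 (by omega) s hs).mono ?_
  · intro i hi s hs
    obtain ⟨h1, h2⟩ := hI i hi s hs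
    rcases Nat.lt_or_ge i M with hiM | hiM
    · simp [Expr.eval, Op.eval, h1, h2, hiM, Nat.mod_eq_of_lt (show 1 < 2 ^ w by omega)]
    · simp [Expr.eval, Op.eval, h1, h2, not_lt.2 hiM]
  · intro i hi s hs
    obtain ⟨h1, h2⟩ := hI i (by omega) s hs
    rw [← List.append_nil (l i)]
    refine ExecS.seq' ((hbody i hi s hs).imp fun s' hs' => ?_)
    refine ExecS.of_tri (Tri.assign (N := 0) ?_)
    have : (Expr.op .add (.var j) (.const 1)).eval w s' = i + 1 := by
      simp [Expr.eval, Op.eval, hs'.1, Nat.mod_eq_of_lt (show 1 < 2 ^ w by omega),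
        Nat.mod_eq_of_lt (show i + 1 < 2 ^ w by omega)]
    rw [this]
    exact ⟨rfl, hs'.2⟩
  · simp only [DynSpanner.forLoop, Cmd.cost]
    gcongr

/-- The nesting depth of loops. -/
def Cmd.depth : Cmd → ℕ
  | .seq p q => max p.depth q.depth
  | .cond _ p q => max p.depth q.depth
  | .loop _ p => p.depth + 1
  | _ => 0

/-- The number of iterations enters time bounds polynomially. -/
theorem Cmd.cost_le (N : ℕ) (c : Cmd) : c.cost N ≤ c.cost 1 * (N + 1) ^ c.depth := by
  have mono : ∀ {a b : ℕ}, a ≤ b → (N + 1) ^ a ≤ (N + 1) ^ b :=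
    fun h => Nat.pow_le_pow_right (by omega) h
  induction c with
  | seq p q ihp ihq =>
    simp only [Cmd.cost, Cmd.depth]
    have h1 := ihp.trans (Nat.mul_le_mul_left _ (mono (le_max_left p.depth q.depth)))
    have h2 := ihq.trans (Nat.mul_le_mul_left _ (mono (le_max_right p.depth q.depth)))
    have h3 : 1 ≤ (N + 1) ^ max p.depth q.depth := Nat.one_le_pow _ _ (by omega)
    nlinarith
  | cond e p q ihp ihq =>
    simp only [Cmd.cost, Cmd.depth]
    have h1 := ihp.trans (Nat.mul_le_mul_left _ (mono (le_max_left p.depth q.depth)))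
    have h2 := ihq.trans (Nat.mul_le_mul_left _ (mono (le_max_right p.depth q.depth)))
    have h3 : 1 ≤ (N + 1) ^ max p.depth q.depth := Nat.one_le_pow _ _ (by omega)
    nlinarith
  | loop e p ih =>
    simp only [Cmd.cost, Cmd.depth, pow_succ]
    have h3 : 1 ≤ (N + 1) ^ p.depth := Nat.one_le_pow _ _ (by omega)
    nlinarith
  | _ => simp [Cmd.cost, Cmd.depth]

end Rules

/-! ### Data in memory -/

/-- The parameters of the data structure on `n` vertices: the bucket size `s`, which is about `√n`,
and the word length `w`. -/
structure Par (n : ℕ) where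
  s : ℕ
  w : ℕ
  s_pos : 0 < s
  n_le : n ≤ s * s
  s_le : s * s ≤ 4 * n
  w_ge : 64 * (s * s) ^ 3 < 2 ^ w

/-- The side length of the arrays in memory. -/
def Par.D {n : ℕ} (P : Par n) : ℕ := P.s * P.s

/-- The length of a background pass. -/
def Par.T {n : ℕ} (P : Par n) : ℕ := n * P.s

section Addr
variable {D k i j l k' i' j' l' : ℕ}

theorem addr_inj (hi : i < D) (hj : j < D) (hl : l < D) (hi' : i' < D) (hj' : j' < D)
    (hl' : l' < D) :
    addr D k i j l = addr D k' i' j' l' ↔ k = k' ∧ i = i' ∧ j = j' ∧ l = l' := by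
  have key : ∀ {x y a b : ℕ}, a < D → b < D → (x * D + a = y * D + b ↔ x = y ∧ a = b) := by
    intro x y a b ha hb
    have hD : 0 < D := by omega
    constructor
    · intro h
      have h1 : (x * D + a) / D = (y * D + b) / D := by rw [h]
      have h2 : (x * D + a) % D = (y * D + b) % D := by rw [h]
      rw [add_comm, add_comm (y * D), Nat.add_mul_div_right _ _ hD,
        Nat.add_mul_div_right _ _ hD, Nat.div_eq_of_lt ha, Nat.div_eq_of_lt hb] at h1
      rw [add_comm, add_comm (y * D), Nat.add_mul_mod_self_right, Nat.add_mul_mod_self_right,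
        Nat.mod_eq_of_lt ha, Nat.mod_eq_of_lt hb] at h2
      exact ⟨by omega, h2⟩
    · rintro ⟨rfl, rfl⟩; rfl
  unfold addr
  rw [key hl hl', key hj hj', key hi hi']
  tauto

theorem le_addr (hk : 1 ≤ k) : D ^ 3 ≤ addr D k i j l := by
  have : 1 * D * D * D ≤ ((k * D + i) * D + j) * D + l := by
    refine le_add_right (Nat.mul_le_mul_right D (le_add_right (Nat.mul_le_mul_right D
      (le_add_right (Nat.mul_le_mul_right D hk)))))
  calc D ^ 3 = 1 * D * D * D := by ring
    _ ≤ _ := this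

theorem addr_lt (hk : k < 12) (hi : i < D) (hj : j < D) (hl : l < D) :
    addr D k i j l < 12 * D ^ 3 := by
  have h1 : k * D + i + 1 ≤ 12 * D := by nlinarith
  have h2 : (k * D + i) * D + j + 1 ≤ 12 * D * D := by nlinarith
  have h3 : ((k * D + i) * D + j) * D + l + 1 ≤ 12 * D * D * D := by nlinarith
  unfold addr
  calc _ < 12 * D * D * D := h3
    _ = _ := by ring

theorem mem_setMem_addr {n : ℕ} (σ : State n) (v : ℕ) (hi : i < D) (hj : j < D) (hl : l < D)
    (hi' : i' < D) (hj' : j' < D) (hl' : l' < D) :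
    (σ.setMem (addr D k i j l) v).mem (addr D k' i' j' l') =
      if k' = k ∧ i' = i ∧ j' = j ∧ l' = l then v else σ.mem (addr D k' i' j' l') := by
  simp only [State.setMem, Function.update_apply, addr_inj hi' hj' hl' hi hj hl]

end Addr

/-- An array that holds a list of the elements of `tot` without repetition, those of `act` first;
`pos` holds the positions, counted from `1`. -/
structure LOk (len a : ℕ) (L pos : ℕ → ℕ) (tot act : Finset ℕ) : Prop where
  sub : act ⊆ tot
  le : a ≤ len
  idx : ∀ i < len, L i ∈ tot ∧ pos (L i) = i + 1 ∧ (L i ∈ act ↔ i < a)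
  val : ∀ v ∈ tot, 1 ≤ pos v ∧ pos v ≤ len ∧ L (pos v - 1) = v

namespace LOk
variable {len a : ℕ} {L pos : ℕ → ℕ} {tot act : Finset ℕ}

theorem congr {L' pos' : ℕ → ℕ} (h : LOk len a L pos tot act) (hL : ∀ i < len, L' i = L i)
    (hp : ∀ v ∈ tot, pos' v = pos v) : LOk len a L' pos' tot act where
  sub := h.sub
  le := h.le
  idx i hi := by
    rw [hL i hi, hp _ (h.idx i hi).1]; exact h.idx i hi
  val v hv := by
    have := h.val v hv
    rw [hp v hv, hL _ (by omega)]; exact this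

theorem mem_act (h : LOk len a L pos tot act) {v : ℕ} (hv : v ∈ tot) : v ∈ act ↔ pos v ≤ a := by
  obtain ⟨h1, h2, h3⟩ := h.val v hv
  have := (h.idx (pos v - 1) (by omega)).2.2
  rw [h3] at this
  rw [this]; omega

theorem card_tot (h : LOk len a L pos tot act) : tot.card = len := by
  rw [← Finset.card_range len]
  refine (Finset.card_bij (fun i _ => L i) ?_ ?_ ?_).symm
  · intro i hi; exact (h.idx i (Finset.mem_range.1 hi)).1
  · intro i hi j hj hij
    have h1 := (h.idx i (Finset.mem_range.1 hi)).2.1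
    have h2 := (h.idx j (Finset.mem_range.1 hj)).2.1
    rw [show L i = L j from hij] at h1; omega
  · intro v hv
    have := h.val v hv
    exact ⟨pos v - 1, Finset.mem_range.2 (by omega), this.2.2⟩

theorem card_act (h : LOk len a L pos tot act) : act.card = a := by
  rw [← Finset.card_range a]
  refine (Finset.card_bij (fun i _ => L i) ?_ ?_ ?_).symm
  · intro i hi
    have := Finset.mem_range.1 hi
    exact (h.idx i (by have := h.le; omega)).2.2.2 this
  · intro i hi j hj hij
    have hle := h.le
    rw [Finset.mem_range] at hi hj
    have h1 := (h.idx i (by omega)).2.1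
    have h2 := (h.idx j (by omega)).2.1
    rw [show L i = L j from hij] at h1; omega
  · intro v hv
    have h1 := h.val v (h.sub hv)
    have h2 := (h.mem_act (h.sub hv)).1 hv
    exact ⟨pos v - 1, Finset.mem_range.2 (by omega), h1.2.2⟩

theorem append (h : LOk len a L pos tot act) {v : ℕ} (hv : v ∉ tot) :
    LOk (len + 1) a (Function.update L len v) (Function.update pos v (len + 1)) (insert v tot)
      act where
  sub := h.sub.trans (Finset.subset_insert _ _)
  le := by have := h.le; omega
  idx i hi := by
    by_cases hil : i = len
    · subst hil
      have : v ∉ act := fun hh => hv (h.sub hh)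
      have := h.le
      simp [*]
    · have := h.idx i (by omega)
      have hne : L i ≠ v := fun hh => hv (hh ▸ this.1)
      simp [hil, hne, this]
  val u hu := by
    rcases Finset.mem_insert.1 hu with rfl | hu
    · simp
    · have := h.val u hu
      have hne : u ≠ v := fun hh => hv (hh ▸ hu)
      have h2 : pos u - 1 ≠ len := by omega
      simp only [Function.update_apply, hne, if_false, h2, this]
      exact ⟨trivial, by omega, trivial⟩

theorem activate (h : LOk len a L pos tot act) : LOk len len L pos tot tot where
  sub := subset_rfl
  le := le_rfl
  idx i hi := by simp [h.idx i hi, hi]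
  val := h.val

/-- Remove an inactive element by moving the last element to its place. -/
theorem remove_inactive (h : LOk len a L pos tot act) {v : ℕ} (hv : v ∈ tot) (hva : v ∉ act) :
    LOk (len - 1) a (Function.update L (pos v - 1) (L (len - 1)))
      (Function.update pos (L (len - 1)) (pos v - 1 + 1)) (tot.erase v) act := by
  have h1 := h.val v hv
  have h2 := mt (h.mem_act hv).2 hva
  have h3 := h.idx (len - 1) (by omega)
  have hne : ∀ i < len, i ≠ pos v - 1 → L i ≠ v := by
    intro i hi hi' hh
    have := (h.idx i hi).2.1
    rw [hh] at this; omega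
  have hinj : ∀ i < len, L i = L (len - 1) → i = len - 1 := by
    intro i hi hh
    have := (h.idx i hi).2.1
    rw [hh, h3.2.1] at this; omega
  refine ⟨?_, by omega, ?_, ?_⟩
  · intro u hu
    exact Finset.mem_erase.2 ⟨fun hh => hva (hh ▸ hu), h.sub hu⟩
  · intro i hi
    have hi3 := h.idx i (by omega)
    by_cases hip : i = pos v - 1
    · subst hip
      have := hne (len - 1) (by omega) (by omega)
      simp [h3, this]
      have := h.le
      omega
    · have h4 := hne i (by omega) hip
      have h5 : L i ≠ L (len - 1) := fun hh => by have := hinj i (by omega) hh; omega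
      simp [hip, h4, h5, hi3]
  · intro u hu
    obtain ⟨huv, hu⟩ := Finset.mem_erase.1 hu
    have h4 := h.val u hu
    by_cases h5 : u = L (len - 1)
    · rw [← h5]
      simp
      have : pos u = len := by rw [h5, h3.2.1]; omega
      have : pos u ≠ pos v := fun hh => huv (by rw [← h4.2.2, hh, h1.2.2])
      omega
    · have h6 : pos u ≠ len := fun hh => h5 (by rw [← h4.2.2, hh])
      have h7 : pos u - 1 ≠ pos v - 1 := fun hh => huv (by rw [← h4.2.2, hh, h1.2.2])
      simp [h5, h7, h4]
      omega

/-- Deactivate an element by swapping it with the last active element. -/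
theorem deactivate (h : LOk len a L pos tot act) {v : ℕ} (hv : v ∈ act) :
    LOk len (a - 1) (Function.update (Function.update L (pos v - 1) (L (a - 1))) (a - 1) v)
      (Function.update (Function.update pos (L (a - 1)) (pos v - 1 + 1)) v (a - 1 + 1)) tot
      (act.erase v) := by
  have hvt := h.sub hv
  have h1 := h.val v hvt
  have h2 := (h.mem_act hvt).1 hv
  have hle := h.le
  have ha := h.idx (a - 1) (by omega)
  have hinj : ∀ i < len, ∀ j < len, L i = L j → i = j := by
    intro i hi j hj hij
    have e1 := (h.idx i hi).2.1
    have e2 := (h.idx j hj).2.1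
    rw [hij] at e1; omega
  have hLv : L (pos v - 1) = v := h1.2.2
  refine ⟨(Finset.erase_subset _ _).trans h.sub, by omega, ?_, ?_⟩
  · intro i hi
    have hii := h.idx i hi
    by_cases hia : i = a - 1
    · subst hia
      simp [hvt]
    · by_cases hip : i = pos v - 1
      · subst hip
        have e1 : L (a - 1) ≠ v := fun hh => hia
          ((hinj (a - 1) (by omega) (pos v - 1) (by omega) (by rw [hh, hLv])).symm)
        simp [hia, e1, ha]
        omega
      · have e1 : L i ≠ v := fun hh => hip
          (hinj i hi (pos v - 1) (by omega) (by rw [hh, hLv]))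
        have e2 : L i ≠ L (a - 1) := fun hh => hia (hinj i hi (a - 1) (by omega) hh)
        simp [hia, hip, e1, e2, hii]
        omega
  · intro u hu
    have huu := h.val u hu
    by_cases huv : u = v
    · subst huv
      simp
      omega
    · by_cases hua : u = L (a - 1)
      · subst hua
        have e1 : pos v ≠ a := fun hh => huv (by rw [← hh, hLv])
        have e2 : pos v - 1 ≠ a - 1 := by omega
        simp [huv, e2]
        omega
      · have e1 : pos u - 1 ≠ a - 1 := fun hh => hua (by rw [← hh, huu.2.2])
        have e2 : pos u - 1 ≠ pos v - 1 := fun hh => huv (by rw [← huu.2.2, hh, hLv])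
        simp [huv, hua, e1, e2, huu]

end LOk

/-- Change the value of a function of two variables at one place. -/
def upd2 {α : Type*} (f : ℕ → ℕ → α) (i j : ℕ) (v : α) : ℕ → ℕ → α :=
  fun i' j' => if i' = i ∧ j' = j then v else f i' j'

theorem upd2_self {α : Type*} (f : ℕ → ℕ → α) (i j : ℕ) (v : α) : upd2 f i j v i j = v := by
  simp [upd2]

/-- The number of references of the witness entry `o` of the pair `p` to the edge `(v, a)`. -/
def tokRef (o : ℕ) (p : ℕ × ℕ) (v a : ℕ) : ℕ :=
  if o = v + 1 then (if p.1 = a then 1 else 0) + (if p.2 = a then 1 else 0) else 0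

/-- The number of references of all witnesses to the edge `(v, a)`. -/
def tokCount (D : ℕ) (y : Tok) (v a : ℕ) : ℕ :=
  ∑ p ∈ Finset.range D ×ˢ Finset.range D, tokRef (y p) p v a

theorem tokCount_update (D : ℕ) (y : Tok) (o : ℕ) {p : ℕ × ℕ}
    (hp : p.1 < D ∧ p.2 < D) (v a : ℕ) :
    tokCount D (Function.update y p o) v a + tokRef (y p) p v a =
      tokCount D y v a + tokRef o p v a := by
  have hp' : p ∈ Finset.range D ×ˢ Finset.range D := by simpa using hp
  unfold tokCount
  rw [← Finset.add_sum_erase _ _ hp', ← Finset.add_sum_erase _ (fun q => tokRef (y q) q v a) hp']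
  have : ∑ x ∈ (Finset.range D ×ˢ Finset.range D).erase p,
      tokRef (Function.update y p o x) x v a =
      ∑ x ∈ (Finset.range D ×ˢ Finset.range D).erase p, tokRef (y x) x v a := by
    refine Finset.sum_congr rfl fun x hx => ?_
    rw [Function.update_of_ne (Finset.ne_of_mem_erase hx)]
  rw [this]
  simp
  ring

/-- The part of the data in memory other than the witnesses. The state `st v a` of the edge
`(v, a)`, `v < a`, is `0` if it is absent, `1` or `2` if it is explicit, i.e. kept in the output for
its own sake, and `3` if it is represented by other edges; `base` counts references to edges other
than those by witnesses; `cen v i` is `a + 1` if `a` is the center of `v` in bucket `i`; `tot` and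
`act` are the candidates and the active candidates for the witness of a pair; `la` and `bt` are the
log of updates: the vertex at which the edge was changed, and marks for the lost witnesses. -/
structure Abs where
  st : ℕ → ℕ → ℕ
  base : ℕ → ℕ → ℕ
  cen : ℕ → ℕ → ℕ
  tot : ℕ → ℕ → Finset ℕ
  act : ℕ → ℕ → Finset ℕ
  la : ℕ → ℕ → ℕ
  bt : ℕ → ℕ → ℕ → ℕ

/-- The state `σ` of the machine represents the data `M`. -/
structure Rep {n : ℕ} (P : Par n) (M : Abs) (σ : State n) : Prop where
  v3 : σ.var 3 = n
  v4 : σ.var 4 = P.s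
  v5 : σ.var 5 = P.D
  v6 : σ.var 6 = P.T
  st : ∀ v < P.D, ∀ a < P.D, σ.mem (addr P.D 1 v a 0) = M.st v a
  rc : ∀ v < P.D, ∀ a < P.D,
    σ.mem (addr P.D 3 v a 0) = M.base v a + tokCount P.D (tokOf P.D σ) v a
  cen : ∀ v < P.D, ∀ i < P.D, σ.mem (addr P.D 4 v i 0) = M.cen v i
  lst : ∀ x < P.D, ∀ y < P.D, LOk (σ.mem (addr P.D 7 x y 0)) (σ.mem (addr P.D 6 x y 0))
    (fun k => σ.mem (addr P.D 8 x y k)) (fun v => σ.mem (addr P.D 9 x y v)) (M.tot x y) (M.act x y)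
  tot : ∀ x < P.D, ∀ y < P.D, M.tot x y ⊆ Finset.range n
  la : ∀ x < P.D, ∀ j < P.D, σ.mem (addr P.D 10 x j 0) = M.la x j
  bt : ∀ x < P.D, ∀ j < P.D, ∀ i < P.D, σ.mem (addr P.D 11 x j i) = M.bt x j i
  out : ∀ u v : Fin n, σ.out.Adj u v ↔ u ≠ v ∧
    0 < M.base (min u v : ℕ) (max u v : ℕ) + tokCount P.D (tokOf P.D σ) (min u v : ℕ) (max u v : ℕ)

/-- The variables below `k` and the input part of the memory are the same in both states. -/
def Fr {n : ℕ} (P : Par n) (k : ℕ) (σ σ' : State n) : Prop :=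
  (∀ y < k, σ'.var y = σ.var y) ∧ ∀ i < P.D ^ 3, σ'.mem i = σ.mem i

theorem Fr.refl {n : ℕ} (P : Par n) (k : ℕ) (σ : State n) : Fr P k σ σ :=
  ⟨fun _ _ => rfl, fun _ _ => rfl⟩

theorem Fr.trans {n : ℕ} {P : Par n} {k : ℕ} {σ₁ σ₂ σ₃ : State n} (h : Fr P k σ₁ σ₂)
    (h' : Fr P k σ₂ σ₃) : Fr P k σ₁ σ₃ :=
  ⟨fun y hy => (h'.1 y hy).trans (h.1 y hy), fun i hi => (h'.2 i hi).trans (h.2 i hi)⟩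

theorem Fr.mono {n : ℕ} {P : Par n} {k k' : ℕ} {σ₁ σ₂ : State n} (h : Fr P k σ₁ σ₂)
    (hk : k' ≤ k) : Fr P k' σ₁ σ₂ :=
  ⟨fun y hy => h.1 y (by omega), h.2⟩

theorem Fr.of_setVar {n : ℕ} {P : Par n} {k x v : ℕ} {σ₁ σ₂ : State n} (h : Fr P k σ₁ σ₂)
    (hx : k ≤ x) : Fr P k σ₁ (σ₂.setVar x v) :=
  ⟨fun y hy => by
    rw [← h.1 y hy]
    exact Function.update_of_ne (by omega) _ _, h.2⟩

theorem Fr.setMem {n : ℕ} {P : Par n} {k' k i j l v : ℕ} {σ₁ σ₂ : State n} (h : Fr P k' σ₁ σ₂)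
    (hk : 1 ≤ k) : Fr P k' σ₁ (σ₂.setMem (addr P.D k i j l) v) :=
  ⟨h.1, fun y hy => by
    rw [← h.2 y hy]
    refine Function.update_of_ne ?_ _ _
    have := le_addr (D := P.D) (i := i) (j := j) (l := l) hk
    omega⟩

section Basic
variable {n : ℕ} (P : Par n)

theorem Par.D_pos : 0 < P.D := Nat.mul_pos P.s_pos P.s_pos
theorem Par.n_le_D : n ≤ P.D := P.n_le
theorem Par.s_le_D : P.s ≤ P.D := Nat.le_mul_of_pos_left _ P.s_pos
theorem Par.T_le : P.T ≤ P.D * P.D := Nat.mul_le_mul P.n_le_D P.s_le_D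
theorem Par.W_ge : 64 * P.D ^ 3 < 2 ^ P.w := P.w_ge

theorem Par.lt_W {x : ℕ} (h : x ≤ 64 * P.D * P.D) : x < 2 ^ P.w := by
  have h1 := P.W_ge
  have h2 := P.D_pos
  have : 64 * P.D * P.D ≤ 64 * P.D ^ 3 := by
    calc 64 * P.D * P.D = 64 * P.D * P.D * 1 := by ring
      _ ≤ 64 * P.D * P.D * P.D := Nat.mul_le_mul_left _ h2
      _ = _ := by ring
  omega

theorem Par.lt_W' {x : ℕ} (h : x ≤ 64 * P.D) : x < 2 ^ P.w := by
  refine P.lt_W (h.trans ?_)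
  exact Nat.le_mul_of_pos_right _ P.D_pos

theorem Par.addr_lt_W {k i j l : ℕ} (hk : k < 12) (hi : i < P.D) (hj : j < P.D) (hl : l < P.D) :
    addr P.D k i j l < 2 ^ P.w := by
  have := addr_lt hk hi hj hl
  have := P.W_ge
  omega

end Basic

/-! ### Expressions -/

/-- The sum of two expressions. -/
abbrev Expr.plus (a b : Expr) : Expr := .op .add a b
/-- The product of two expressions. -/
abbrev Expr.times (a b : Expr) : Expr := .op .mul a b

/-- The address of an array entry as an expression; variable `5` holds the side length. -/
def adE (k : ℕ) (e₁ e₂ e₃ : Expr) : Expr :=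
  .plus (.times (.plus (.times (.plus (.times (.const k) (.var 5)) e₁) (.var 5)) e₂) (.var 5)) e₃

/-- Read an array entry. -/
def rdE (k : ℕ) (e₁ e₂ e₃ : Expr) : Expr := .read (adE k e₁ e₂ e₃)

/-- The constant `0`. -/
def zE : Expr := .const 0

section Eval
variable {n : ℕ} {P : Par n} {σ : State n} {e e₁ e₂ e₃ : Expr} {x y i j l k : ℕ}

theorem eval_const (h : k < 2 ^ P.w) : (Expr.const k).eval P.w σ = k := Nat.mod_eq_of_lt h

theorem eval_add (h1 : e₁.eval P.w σ = x) (h2 : e₂.eval P.w σ = y) (h : x + y < 2 ^ P.w) :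
    (Expr.op .add e₁ e₂).eval P.w σ = x + y := by
  simp only [Expr.eval, Op.eval, h1, h2, Nat.mod_eq_of_lt h]

theorem eval_mul (h1 : e₁.eval P.w σ = x) (h2 : e₂.eval P.w σ = y) (h : x * y < 2 ^ P.w) :
    (Expr.op .mul e₁ e₂).eval P.w σ = x * y := by
  simp only [Expr.eval, Op.eval, h1, h2, Nat.mod_eq_of_lt h]

theorem eval_sub (h1 : e₁.eval P.w σ = x) (h2 : e₂.eval P.w σ = y) :
    (Expr.op .sub e₁ e₂).eval P.w σ = x - y := by
  simp only [Expr.eval, Op.eval, h1, h2]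

theorem eval_div (h1 : e₁.eval P.w σ = x) (h2 : e₂.eval P.w σ = y) :
    (Expr.op .div e₁ e₂).eval P.w σ = x / y := by
  simp only [Expr.eval, Op.eval, h1, h2]

theorem eval_mod (h1 : e₁.eval P.w σ = x) (h2 : e₂.eval P.w σ = y) :
    (Expr.op .mod e₁ e₂).eval P.w σ = x % y := by
  simp only [Expr.eval, Op.eval, h1, h2]

theorem Par.one_lt_W (P : Par n) : 1 < 2 ^ P.w := P.lt_W' (by have := P.D_pos; omega)

theorem eval_lt_ne (h1 : e₁.eval P.w σ = x) (h2 : e₂.eval P.w σ = y) :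
    (Expr.op .lt e₁ e₂).eval P.w σ ≠ 0 ↔ x < y := by
  simp only [Expr.eval, Op.eval, h1, h2, Nat.mod_eq_of_lt P.one_lt_W]
  split <;> simp_all

theorem eval_eq_ne (h1 : e₁.eval P.w σ = x) (h2 : e₂.eval P.w σ = y) :
    (Expr.op .eq e₁ e₂).eval P.w σ ≠ 0 ↔ x = y := by
  simp only [Expr.eval, Op.eval, h1, h2, Nat.mod_eq_of_lt P.one_lt_W]
  split <;> simp_all

theorem eval_zE : zE.eval P.w σ = 0 := Nat.zero_mod _

theorem eval_adE (h5 : σ.var 5 = P.D) (hk : k < 12) (h1 : e₁.eval P.w σ = i)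
    (h2 : e₂.eval P.w σ = j) (h3 : e₃.eval P.w σ = l) (hi : i < P.D) (hj : j < P.D)
    (hl : l < P.D) : (adE k e₁ e₂ e₃).eval P.w σ = addr P.D k i j l := by
  have hW := P.addr_lt_W hk hi hj hl
  have hD := P.D_pos
  have a1 : k * P.D ≤ k * P.D + i := by omega
  have a2 : k * P.D + i ≤ (k * P.D + i) * P.D := Nat.le_mul_of_pos_right _ hD
  have a3 : (k * P.D + i) * P.D + j ≤ ((k * P.D + i) * P.D + j) * P.D :=
    Nat.le_mul_of_pos_right _ hD
  unfold addr at hW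
  have h5' : (Expr.var 5).eval P.w σ = P.D := h5
  refine eval_add (eval_mul (eval_add (eval_mul (eval_add (eval_mul (eval_const ?_) h5' ?_) h1 ?_)
    h5' ?_) h2 ?_) h5' ?_) h3 hW
  · exact P.lt_W' (by omega)
  all_goals omega

theorem eval_rdE (h5 : σ.var 5 = P.D) (hk : k < 12) (h1 : e₁.eval P.w σ = i)
    (h2 : e₂.eval P.w σ = j) (h3 : e₃.eval P.w σ = l) (hi : i < P.D) (hj : j < P.D)
    (hl : l < P.D) : (rdE k e₁ e₂ e₃).eval P.w σ = σ.mem (addr P.D k i j l) := by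
  simp only [rdE, Expr.eval, eval_adE h5 hk h1 h2 h3 hi hj hl]

end Eval

/-! ### Single writes -/

section Writes
variable {n : ℕ} {P : Par n} {M : Abs} {σ : State n}

theorem tokOf_setMem_of_ne {k i j l v : ℕ} (hk : k ≠ 5) (hi : i < P.D) (hj : j < P.D)
    (hl : l < P.D) : tokOf P.D (σ.setMem (addr P.D k i j l) v) = tokOf P.D σ := by
  funext p
  unfold tokOf
  split_ifs with h
  · rw [mem_setMem_addr _ _ hi hj hl h.1 h.2 P.D_pos, if_neg]
    rintro ⟨h, -⟩
    exact hk h.symm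
  · rfl

theorem tokOf_setMem {i j v : ℕ} (hi : i < P.D) (hj : j < P.D) :
    tokOf P.D (σ.setMem (addr P.D 5 i j 0) v) = Function.update (tokOf P.D σ) (i, j) v := by
  funext p
  unfold tokOf
  by_cases h : p.1 < P.D ∧ p.2 < P.D
  · rw [if_pos h, mem_setMem_addr _ _ hi hj P.D_pos h.1 h.2 P.D_pos]
    by_cases hp : p = (i, j)
    · subst hp; simp
    · rw [Function.update_of_ne hp, if_pos h, if_neg]
      rintro ⟨-, h1, h2, -⟩
      exact hp (Prod.ext h1 h2)
  · rw [if_neg h, Function.update_of_ne, if_neg h]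
    rintro rfl
    exact h ⟨hi, hj⟩

theorem Rep.setVar (h : Rep P M σ) {x v : ℕ} (hx : 7 ≤ x) : Rep P M (σ.setVar x v) := by
  have hv : ∀ y < 7, (σ.setVar x v).var y = σ.var y := fun y hy =>
    Function.update_of_ne (by omega) _ _
  exact ⟨(hv 3 (by omega)).trans h.v3, (hv 4 (by omega)).trans h.v4, (hv 5 (by omega)).trans h.v5,
    (hv 6 (by omega)).trans h.v6, h.st, h.rc, h.cen, h.lst, h.tot, h.la, h.bt, h.out⟩

/-- A write to an array other than those of witnesses and of candidates. -/
theorem Rep.setMem (h : Rep P M σ) {k i j l v : ℕ} (hi : i < P.D) (hj : j < P.D) (hl : l < P.D)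
    {M' : Abs} (hk : k = 1 ∧ l = 0 ∧ M' = { M with st := upd2 M.st i j v } ∨
      k = 4 ∧ l = 0 ∧ M' = { M with cen := upd2 M.cen i j v } ∨
      k = 10 ∧ l = 0 ∧ M' = { M with la := upd2 M.la i j v } ∨
      k = 11 ∧ M' = { M with bt := upd2 M.bt i j (Function.update (M.bt i j) l v) }) :
    Rep P M' (σ.setMem (addr P.D k i j l) v) := by
  have hD := P.D_pos
  have ht := tokOf_setMem_of_ne (P := P) (σ := σ) (k := k) (i := i) (j := j) (l := l) (v := v)
    (by omega) hi hj hl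
  have key : ∀ {k' i' j' l' : ℕ}, i' < P.D → j' < P.D → l' < P.D →
      (σ.setMem (addr P.D k i j l) v).mem (addr P.D k' i' j' l') =
      if k' = k ∧ i' = i ∧ j' = j ∧ l' = l then v else σ.mem (addr P.D k' i' j' l') :=
    fun h1 h2 h3 => mem_setMem_addr _ _ hi hj hl h1 h2 h3
  have hlst : ∀ x < P.D, ∀ y < P.D, LOk ((σ.setMem (addr P.D k i j l) v).mem (addr P.D 7 x y 0))
      ((σ.setMem (addr P.D k i j l) v).mem (addr P.D 6 x y 0))
      (fun k' => (σ.setMem (addr P.D k i j l) v).mem (addr P.D 8 x y k'))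
      (fun v' => (σ.setMem (addr P.D k i j l) v).mem (addr P.D 9 x y v'))
      (M.tot x y) (M.act x y) := by
    intro x hx y hy
    have h0 := h.lst x hx y hy
    have hlen := h0.card_tot
    have hcard := Finset.card_le_card (h.tot x hx y hy)
    rw [Finset.card_range] at hcard
    have hnD := P.n_le_D
    rw [key hx hy hD, if_neg (by omega), key hx hy hD, if_neg (by omega)]
    refine h0.congr ?_ ?_
    · intro k' hk'
      rw [key hx hy (by omega), if_neg (by omega)]
    · intro u hu
      have := Finset.mem_range.1 (h.tot x hx y hy hu)
      rw [key hx hy (by omega), if_neg (by omega)]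
  rcases hk with ⟨rfl, rfl, rfl⟩ | ⟨rfl, rfl, rfl⟩ | ⟨rfl, rfl, rfl⟩ | ⟨rfl, rfl⟩
  all_goals
    refine ⟨h.v3, h.v4, h.v5, h.v6, ?_, ?_, ?_, hlst, h.tot, ?_, ?_, ?_⟩
    · intro x hx y hy
      rw [key hx hy hD, h.st x hx y hy]
      simp [upd2]
    · intro x hx y hy
      rw [key hx hy hD, h.rc x hx y hy, ht]
      simp
    · intro x hx y hy
      rw [key hx hy hD, h.cen x hx y hy]
      simp [upd2]
    · intro x hx y hy
      rw [key hx hy hD, h.la x hx y hy]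
      simp [upd2]
    · intro x hx y hy z hz
      rw [key hx hy hz, h.bt x hx y hy z hz]
      first
      | simp; done
      | simp only [upd2]
        grind
    · rw [ht]
      exact h.out

/-- A write of a witness `o - 1`. References that are not counted any more or that are not yet
counted are shifted to `base`. -/
theorem Rep.setTok (h : Rep P M σ) {x y o : ℕ} (hx : x < P.D) (hy : y < P.D)
    {base : ℕ → ℕ → ℕ}
    (hb : ∀ v a, base v a + tokRef o (x, y) v a =
      M.base v a + tokRef (tokOf P.D σ (x, y)) (x, y) v a) :
    Rep P { M with base := base } (σ.setMem (addr P.D 5 x y 0) o) := by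
  have hD := P.D_pos
  have ht := tokOf_setMem (P := P) (σ := σ) (v := o) hx hy
  have hc : ∀ v a, base v a + tokCount P.D (Function.update (tokOf P.D σ) (x, y) o) v a =
      M.base v a + tokCount P.D (tokOf P.D σ) v a := by
    intro v a
    have h1 := tokCount_update P.D (tokOf P.D σ) o (p := (x, y)) ⟨hx, hy⟩ v a
    have h2 := hb v a
    omega
  have key : ∀ {k' i' j' l' : ℕ}, k' ≠ 5 → i' < P.D → j' < P.D → l' < P.D →
      (σ.setMem (addr P.D 5 x y 0) o).mem (addr P.D k' i' j' l') = σ.mem (addr P.D k' i' j' l') :=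
    fun h0 h1 h2 h3 => by
      rw [mem_setMem_addr _ _ hx hy hD h1 h2 h3, if_neg (by tauto)]
  refine ⟨h.v3, h.v4, h.v5, h.v6, ?_, ?_, ?_, ?_, h.tot, ?_, ?_, ?_⟩
  · intro a ha b hb
    rw [key (by omega) ha hb hD]; exact h.st a ha b hb
  · intro a ha b hb
    rw [key (by omega) ha hb hD, ht, hc]; exact h.rc a ha b hb
  · intro a ha b hb
    rw [key (by omega) ha hb hD]; exact h.cen a ha b hb
  · intro a ha b hb
    have h0 := h.lst a ha b hb
    have hlen := h0.card_tot
    have hcard := Finset.card_le_card (h.tot a ha b hb)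
    rw [Finset.card_range] at hcard
    have hnD := P.n_le_D
    rw [key (by omega) ha hb hD, key (by omega) ha hb hD]
    refine h0.congr ?_ ?_
    · intro k' hk'
      exact key (by omega) ha hb (by omega)
    · intro u hu
      have := Finset.mem_range.1 (h.tot a ha b hb hu)
      exact key (by omega) ha hb (by omega)
  · intro a ha b hb
    rw [key (by omega) ha hb hD]; exact h.la a ha b hb
  · intro a ha b hb c hc
    rw [key (by omega) ha hb hc]; exact h.bt a ha b hb c hc
  · intro u v
    rw [ht, hc]; exact h.out u v

/-- Any change of the list of candidates of one pair. -/
theorem Rep.setList (h : Rep P M σ) {σ' : State n} {x y : ℕ} {t c : Finset ℕ} (hx : x < P.D)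
    (hy : y < P.D) (hvar : ∀ i < 7, σ'.var i = σ.var i) (hout : σ'.out = σ.out)
    (hmem : ∀ k i j l, i < P.D → j < P.D → l < P.D → (k < 6 ∨ 9 < k ∨ i ≠ x ∨ j ≠ y) →
      σ'.mem (addr P.D k i j l) = σ.mem (addr P.D k i j l))
    (hl : LOk (σ'.mem (addr P.D 7 x y 0)) (σ'.mem (addr P.D 6 x y 0))
      (fun k => σ'.mem (addr P.D 8 x y k)) (fun v => σ'.mem (addr P.D 9 x y v)) t c)
    (ht : t ⊆ Finset.range n) :
    Rep P { M with tot := upd2 M.tot x y t, act := upd2 M.act x y c } σ' ∧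
      tokOf P.D σ' = tokOf P.D σ := by
  have hD := P.D_pos
  have hk : tokOf P.D σ' = tokOf P.D σ := by
    funext p
    unfold tokOf
    split_ifs with hp
    · exact hmem 5 _ _ _ hp.1 hp.2 hD (by omega)
    · rfl
  refine ⟨⟨(hvar 3 (by omega)).trans h.v3, (hvar 4 (by omega)).trans h.v4,
    (hvar 5 (by omega)).trans h.v5, (hvar 6 (by omega)).trans h.v6, ?_, ?_, ?_, ?_, ?_, ?_, ?_, ?_⟩,
    hk⟩
  · intro a ha b hb
    rw [hmem _ _ _ _ ha hb hD (by omega)]; exact h.st a ha b hb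
  · intro a ha b hb
    rw [hmem _ _ _ _ ha hb hD (by omega), hk]; exact h.rc a ha b hb
  · intro a ha b hb
    rw [hmem _ _ _ _ ha hb hD (by omega)]; exact h.cen a ha b hb
  · intro a ha b hb
    by_cases hab : a = x ∧ b = y
    · obtain ⟨rfl, rfl⟩ := hab
      simpa only [upd2_self] using hl
    · have h0 := h.lst a ha b hb
      have hlen := h0.card_tot
      have hcard := Finset.card_le_card (h.tot a ha b hb)
      rw [Finset.card_range] at hcard
      have hnD := P.n_le_D
      have hab' : a ≠ x ∨ b ≠ y := by tauto
      simp only [upd2, hab, if_false]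
      rw [hmem _ _ _ _ ha hb hD (by tauto), hmem _ _ _ _ ha hb hD (by tauto)]
      refine h0.congr ?_ ?_
      · intro k' hk'
        exact hmem _ _ _ _ ha hb (by omega) (by tauto)
      · intro u hu
        have := Finset.mem_range.1 (h.tot a ha b hb hu)
        exact hmem _ _ _ _ ha hb (by omega) (by tauto)
  · intro a ha b hb
    simp only [upd2]
    split_ifs
    · exact ht
    · exact h.tot a ha b hb
  · intro a ha b hb
    rw [hmem _ _ _ _ ha hb hD (by omega)]; exact h.la a ha b hb
  · intro a ha b hb c hc
    rw [hmem _ _ _ _ ha hb hc (by omega)]; exact h.bt a ha b hb c hc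
  · intro u v
    rw [hk, hout]; exact h.out u v

end Writes

/-! ### References to edges -/

/-- Add a reference to an edge, so that it is in the output graph. -/
def incC (e₁ e₂ : Expr) : Cmd :=
  .seq (.write (adE 3 e₁ e₂ zE) (.plus (rdE 3 e₁ e₂ zE) (.const 1))) (.putEdge e₁ e₂)

/-- Remove a reference to an edge, and remove the edge from the output graph if this was the last
one. -/
def decC (e₁ e₂ : Expr) : Cmd :=
  .seq (.write (adE 3 e₁ e₂ zE) (.op .sub (rdE 3 e₁ e₂ zE) (.const 1)))
    (.cond (rdE 3 e₁ e₂ zE) .nop (.cutEdge e₁ e₂))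

/-- Draw a witness of the pair in variables `20` and `21`. -/
def drawC : Cmd :=
  .cond (rdE 6 (.var 20) (.var 21) zE)
    (.seq (.rand 23 (.op .sub (rdE 6 (.var 20) (.var 21) zE) (.const 1)))
      (.seq (.assign 22 (rdE 8 (.var 20) (.var 21) (.var 23)))
      (.seq (incC (.var 22) (.var 20)) (.seq (incC (.var 22) (.var 21))
      (.write (adE 5 (.var 20) (.var 21) zE) (.plus (.var 22) (.const 1))))))) .nop

/-- Resample the witness of the pair in variables `20` and `21`. -/
def resampleC : Cmd :=
  .seq (.assign 22 (rdE 5 (.var 20) (.var 21) zE)) <|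
  .seq (.write (adE 5 (.var 20) (.var 21) zE) zE) <|
  .seq (.cond (.var 22) (.seq (decC (.op .sub (.var 22) (.const 1)) (.var 20))
    (decC (.op .sub (.var 22) (.const 1)) (.var 21))) .nop) <|
  drawC

/-- The expression `e` has value `x` in every state with the same variables as `σ`. -/
def Ev {n : ℕ} (P : Par n) (σ : State n) (e : Expr) (x : ℕ) : Prop :=
  ∀ σ' : State n, σ'.var = σ.var → e.eval P.w σ' = x

section
variable {n : ℕ} {P : Par n} {M : Abs} {σ : State n}

theorem Ev.var {x v : ℕ} (h : σ.var x = v) : Ev P σ (.var x) v := fun σ' h' => by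
  rw [← h, ← h']; rfl

theorem eval_var {x v : ℕ} (h : σ.var x = v) : (Expr.var x).eval P.w σ = v := h

theorem Ev.self {e : Expr} {x : ℕ} (h : Ev P σ e x) : e.eval P.w σ = x := h σ rfl

theorem wordEdge_adj {v a : ℕ} (hv : v < n) (ha : a < n) (hva : v ≠ a) (x y : Fin n) :
    (wordEdge n v a).Adj x y ↔ ((x : ℕ) = v ∧ (y : ℕ) = a) ∨ ((x : ℕ) = a ∧ (y : ℕ) = v) := by
  unfold wordEdge
  rw [dif_pos ⟨hv, ha⟩, SimpleGraph.edge_adj]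
  simp only [Fin.ext_iff]
  constructor
  · rintro ⟨h | h, -⟩ <;> omega
  · intro h
    exact ⟨by omega, by omega⟩

theorem tokRef_le (o : ℕ) (p : ℕ × ℕ) (v a : ℕ) : tokRef o p v a ≤ 2 := by
  unfold tokRef; split_ifs <;> omega

theorem tokCount_le (D : ℕ) (y : Tok) (v a : ℕ) : tokCount D y v a ≤ 2 * (D * D) := by
  refine (Finset.sum_le_card_nsmul _ _ 2 fun p _ => tokRef_le _ _ _ _).trans (le_of_eq ?_)
  simp [mul_comm]

/-- The effect of a change of the reference count of one edge, together with the adaptation of the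
output graph. -/
theorem Rep.setBase (h : Rep P M σ) {v a c : ℕ} (hva : v < a) (ha : a < n)
    {H : SimpleGraph (Fin n)}
    (hH : ∀ x y : Fin n, H.Adj x y ↔ if ((x : ℕ) = v ∧ (y : ℕ) = a) ∨ ((x : ℕ) = a ∧ (y : ℕ) = v)
      then 0 < c + tokCount P.D (tokOf P.D σ) v a else σ.out.Adj x y) :
    Rep P { M with base := upd2 M.base v a c }
      { σ.setMem (addr P.D 3 v a 0) (c + tokCount P.D (tokOf P.D σ) v a) with out := H } := by
  have hD := P.D_pos
  have hn := P.n_le_D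
  have hv' : v < P.D := by omega
  have ha' : a < P.D := by omega
  have ht := tokOf_setMem_of_ne (P := P) (σ := σ) (k := 3)
    (v := c + tokCount P.D (tokOf P.D σ) v a) (by omega) hv' ha' hD
  have ht' : tokOf P.D { σ.setMem (addr P.D 3 v a 0) (c + tokCount P.D (tokOf P.D σ) v a) with
    out := H } = tokOf P.D σ := ht
  have key : ∀ {k' i' j' l' : ℕ}, k' ≠ 3 → i' < P.D → j' < P.D → l' < P.D →
      (σ.setMem (addr P.D 3 v a 0) (c + tokCount P.D (tokOf P.D σ) v a)).mem (addr P.D k' i' j' l')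
        = σ.mem (addr P.D k' i' j' l') :=
    fun h0 h1 h2 h3 => by
      rw [mem_setMem_addr _ _ hv' ha' hD h1 h2 h3, if_neg (by tauto)]
  refine ⟨h.v3, h.v4, h.v5, h.v6, ?_, ?_, ?_, ?_, h.tot, ?_, ?_, ?_⟩
  · intro x hx y hy
    exact (key (by omega) hx hy hD).trans (h.st x hx y hy)
  · intro x hx y hy
    rw [ht']
    refine (mem_setMem_addr _ _ hv' ha' hD hx hy hD).trans ?_
    by_cases hxy : x = v ∧ y = a
    · obtain ⟨rfl, rfl⟩ := hxy
      simp [upd2]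
    · rw [if_neg (by tauto), h.rc x hx y hy]
      simp [upd2, hxy]
  · intro x hx y hy
    exact (key (by omega) hx hy hD).trans (h.cen x hx y hy)
  · intro x hx y hy
    have h0 := h.lst x hx y hy
    have hlen := h0.card_tot
    have hcard := Finset.card_le_card (h.tot x hx y hy)
    rw [Finset.card_range] at hcard
    simp only
    rw [key (by omega) hx hy hD, key (by omega) hx hy hD]
    refine h0.congr ?_ ?_
    · intro k' hk'
      exact key (by omega) hx hy (by omega)
    · intro u hu
      have := Finset.mem_range.1 (h.tot x hx y hy hu)
      exact key (by omega) hx hy (by omega)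
  · intro x hx y hy
    exact (key (by omega) hx hy hD).trans (h.la x hx y hy)
  · intro x hx y hy z hz
    exact (key (by omega) hx hy hz).trans (h.bt x hx y hy z hz)
  · intro x y
    rw [ht']
    simp only
    rw [hH, h.out x y]
    have hxy : x = y ↔ (x : ℕ) = y := Fin.ext_iff
    by_cases hc : ((x : ℕ) = v ∧ (y : ℕ) = a) ∨ ((x : ℕ) = a ∧ (y : ℕ) = v)
    · rw [if_pos hc]
      have h1 : min (x : ℕ) y = v := by omega
      have h2 : max (x : ℕ) y = a := by omega
      rw [h1, h2, upd2_self]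
      have : x ≠ y := by rw [ne_eq, hxy]; omega
      tauto
    · rw [if_neg hc]
      have : ¬ (min (x : ℕ) y = v ∧ max (x : ℕ) y = a) := by omega
      simp only [upd2, this, if_false]

theorem Rep.tri_inc (h : Rep P M σ) {N : ℕ} {e₁ e₂ : Expr} {v a : ℕ} (h1 : Ev P σ e₁ v)
    (h2 : Ev P σ e₂ a) (hva : v < a) (ha : a < n) (hb : M.base v a ≤ 8) {R : State n → Prop}
    (K : ∀ σ', Rep P { M with base := upd2 M.base v a (M.base v a + 1) } σ' → σ'.var = σ.var →
      (∀ k, Fr P k σ σ') → tokOf P.D σ' = tokOf P.D σ →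
      (∀ k i j l, k ≠ 3 → i < P.D → j < P.D → l < P.D →
        σ'.mem (addr P.D k i j l) = σ.mem (addr P.D k i j l)) → R σ') :
    Tri P.w (incC e₁ e₂) σ ((incC e₁ e₂).cost N) R := by
  have hD := P.D_pos
  have hn := P.n_le_D
  have hv' : v < P.D := by omega
  have ha' : a < P.D := by omega
  have hrc := h.rc v hv' a ha'
  have hle := tokCount_le P.D (tokOf P.D σ) v a
  have hlt : σ.mem (addr P.D 3 v a 0) + 1 < 2 ^ P.w := P.lt_W (by
    have : 1 * 1 ≤ P.D * P.D := Nat.mul_le_mul hD hD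
    rw [hrc, mul_assoc]; omega)
  refine Tri.seq (Tri.write (Tri.putEdge ?_))
  rw [eval_adE h.v5 (by omega) h1.self h2.self eval_zE hv' ha' hD,
    eval_add (eval_rdE h.v5 (by omega) h1.self h2.self eval_zE hv' ha' hD)
      (eval_const P.one_lt_W) hlt, hrc,
    show M.base v a + tokCount P.D (tokOf P.D σ) v a + 1 =
      (M.base v a + 1) + tokCount P.D (tokOf P.D σ) v a by ring,
    h1 (σ.setMem _ _) rfl, h2 (σ.setMem _ _) rfl]
  refine K _ (h.setBase hva ha ?_) rfl ?_ ?_ ?_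
  · intro x y
    rw [SimpleGraph.sup_adj, wordEdge_adj (by omega) ha (by omega)]
    split_ifs with hc
    · simp [hc]
    · simp only [hc, or_false]
      rfl
  · intro k
    exact (Fr.refl P k σ).setMem (by omega)
  · exact tokOf_setMem_of_ne (P := P) (σ := σ) (by omega) hv' ha' hD
  · intro k i j l hk hi hj hl
    exact (mem_setMem_addr _ _ hv' ha' hD hi hj hl).trans (if_neg (by tauto))

theorem Rep.tri_dec (h : Rep P M σ) {N : ℕ} {e₁ e₂ : Expr} {v a : ℕ} (h1 : Ev P σ e₁ v)
    (h2 : Ev P σ e₂ a) (hva : v < a) (ha : a < n) (hb : 1 ≤ M.base v a) {R : State n → Prop}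
    (K : ∀ σ', Rep P { M with base := upd2 M.base v a (M.base v a - 1) } σ' → σ'.var = σ.var →
      (∀ k, Fr P k σ σ') → tokOf P.D σ' = tokOf P.D σ →
      (∀ k i j l, k ≠ 3 → i < P.D → j < P.D → l < P.D →
        σ'.mem (addr P.D k i j l) = σ.mem (addr P.D k i j l)) → R σ') :
    Tri P.w (decC e₁ e₂) σ ((decC e₁ e₂).cost N) R := by
  have hD := P.D_pos
  have hn := P.n_le_D
  have hv' : v < P.D := by omega
  have ha' : a < P.D := by omega
  have hrc := h.rc v hv' a ha'
  have e1 : (adE 3 e₁ e₂ zE).eval P.w σ = addr P.D 3 v a 0 :=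
    eval_adE h.v5 (by omega) h1.self h2.self eval_zE hv' ha' hD
  have e2 : (Expr.op .sub (rdE 3 e₁ e₂ zE) (.const 1)).eval P.w σ =
      M.base v a - 1 + tokCount P.D (tokOf P.D σ) v a := by
    rw [eval_sub (eval_rdE h.v5 (by omega) h1.self h2.self eval_zE hv' ha' hD)
      (eval_const P.one_lt_W), hrc]
    omega
  have e3 : (rdE 3 e₁ e₂ zE).eval P.w (σ.setMem (addr P.D 3 v a 0)
      (M.base v a - 1 + tokCount P.D (tokOf P.D σ) v a)) =
      M.base v a - 1 + tokCount P.D (tokOf P.D σ) v a := by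
    rw [eval_rdE (σ := σ.setMem (addr P.D 3 v a 0) _) h.v5 (by omega) (h1 (σ.setMem _ _) rfl)
      (h2 (σ.setMem _ _) rfl) eval_zE hv' ha' hD, mem_setMem_addr _ _ hv' ha' hD hv' ha' hD]
    simp
  have hfr : ∀ k, Fr P k σ (σ.setMem (addr P.D 3 v a 0)
      (M.base v a - 1 + tokCount P.D (tokOf P.D σ) v a)) :=
    fun k => (Fr.refl P k σ).setMem (by omega)
  have hmem : ∀ k i j l, k ≠ 3 → i < P.D → j < P.D → l < P.D → (σ.setMem (addr P.D 3 v a 0)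
      (M.base v a - 1 + tokCount P.D (tokOf P.D σ) v a)).mem (addr P.D k i j l) =
      σ.mem (addr P.D k i j l) := by
    intro k i j l hk hi hj hl
    exact (mem_setMem_addr _ _ hv' ha' hD hi hj hl).trans (if_neg (by tauto))
  refine Tri.seq (Tri.write ?_)
  rw [e1, e2]
  refine Tri.cond ?_ ?_ <;> rw [e3] <;> intro h0
  · refine Tri.nop (K _ (h.setBase hva ha (H := σ.out) ?_) rfl hfr
      (tokOf_setMem_of_ne (P := P) (σ := σ) (by omega) hv' ha' hD) hmem)
    intro x y
    split_ifs with hc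
    · rw [h.out x y]
      have h3 : min (x : ℕ) y = v := by omega
      have h4 : max (x : ℕ) y = a := by omega
      have h5 : x ≠ y := by rw [ne_eq, Fin.ext_iff]; omega
      rw [h3, h4]
      constructor
      · intro _; omega
      · intro _; exact ⟨h5, by omega⟩
    · rfl
  · refine Tri.cutEdge ?_
    rw [h1 (σ.setMem _ _) rfl, h2 (σ.setMem _ _) rfl]
    refine K _ (h.setBase hva ha ?_) rfl hfr
      (tokOf_setMem_of_ne (P := P) (σ := σ) (by omega) hv' ha' hD) hmem
    intro x y
    rw [SimpleGraph.sdiff_adj, wordEdge_adj (by omega) ha (by omega)]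
    split_ifs with hc
    · simp [hc, h0]
    · simp only [hc, not_false_iff, and_true]
      rfl

theorem Rep.of_base_eq (h : Rep P M σ) {M' : Abs} (hb : ∀ v a, M.base v a = M'.base v a)
    (hM : M' = { M with base := M'.base }) : Rep P M' σ := by
  have : M.base = M'.base := by funext v a; exact hb v a
  rw [hM, ← this]; exact h

/-- A uniformly random entry of a list without repetition is a uniformly random element. -/
theorem uniform_map_eq {A : Finset ℕ} (hA : A.Nonempty) {m : ℕ} {L : ℕ → ℕ} (hm : A.card = m + 1)
    (hmem : ∀ i < m + 1, L i ∈ A) (hinj : ∀ i < m + 1, ∀ j < m + 1, L i = L j → i = j) :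
    (PMF.uniformOfFintype (Fin (m + 1))).map (fun r : Fin (m + 1) => L r) = PMF.uniformOfFinset A hA := by
  classical
  have himg : (Finset.range (m + 1)).image L = A := by
    refine Finset.eq_of_subset_of_card_le ?_ ?_
    · intro v hv
      obtain ⟨i, hi, rfl⟩ := Finset.mem_image.1 hv
      exact hmem i (Finset.mem_range.1 hi)
    · rw [Finset.card_image_of_injOn, Finset.card_range, hm]
      intro i hi j hj hij
      simp only [Finset.coe_range, Set.mem_Iio] at hi hj
      exact hinj i hi j hj hij
  ext v
  rw [PMF.map_apply, PMF.uniformOfFinset_apply]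
  split_ifs with hv
  · rw [← himg] at hv
    obtain ⟨i, hi, rfl⟩ := Finset.mem_image.1 hv
    rw [Finset.mem_range] at hi
    rw [tsum_eq_single (⟨i, hi⟩ : Fin (m + 1)), hm]
    · simp
    · intro j hj
      rw [if_neg]
      intro hh
      exact hj (Fin.ext (hinj _ j.2 _ hi hh.symm))
  · rw [ENNReal.tsum_eq_zero]
    intro j
    rw [if_neg]
    rintro rfl
    exact hv (hmem j j.2)

theorem ExecS.seq_tri {D w N : ℕ} {s : State n} {p q : Cmd} {l} {R : State n → Prop}
    (hp : Tri w p s (p.cost N) fun s' => ExecS D w q s' (q.cost N) l R ∧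
      sampleAll l (tokOf D s') = sampleAll l (tokOf D s)) :
    ExecS D w (.seq p q) s ((Cmd.seq p q).cost N) l R := by
  obtain ⟨s', h1, ⟨μ, h2, h3, h4⟩, h5⟩ := hp
  refine ⟨μ, ?_, h3, by rw [h4, h5]⟩
  have := h1.seq (ν := fun _ => μ) (by simpa using h2)
  rw [PMF.pure_bind] at this
  exact this

theorem step_rand {w n m x : ℕ} {s : State n} {e : Expr} (he : e.eval w s = m) :
    step w s (.rand x e) = (PMF.uniformOfFintype (Fin (m + 1))).map
      fun r => ([], s.setVar x (r : ℕ)) := by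
  subst he; rfl

theorem sampleTok_update (p : ℕ × ℕ) (A : Finset ℕ) (y : Tok) (o : ℕ) :
    sampleTok p A (Function.update y p o) = sampleTok p A y := by
  unfold sampleTok
  simp

theorem tokRef_zero (p : ℕ × ℕ) (v a : ℕ) : tokRef 0 p v a = 0 := by simp [tokRef]

/-- The second half of resampling: a new witness is drawn for a pair without witness. -/
theorem Rep.execS_draw (h : Rep P M σ) {N x y : ℕ} (h20 : σ.var 20 = x) (h21 : σ.var 21 = y)
    (hx : x < P.D) (hy : y < P.D) (ht : tokOf P.D σ (x, y) = 0)
    (hA : ∀ v ∈ M.act x y, v < x ∧ v < y ∧ x < n ∧ y < n) (hb : ∀ v a, M.base v a ≤ 4)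
    {R : State n → Prop}
    (K : ∀ σ', Rep P M σ' → Fr P 22 σ σ' → (∀ p ≠ (x, y), tokOf P.D σ' p = tokOf P.D σ p) →
      ((M.act x y = ∅ ∧ tokOf P.D σ' (x, y) = 0) ∨ ∃ v ∈ M.act x y, tokOf P.D σ' (x, y) = v + 1) →
      R σ') :
    ExecS P.D P.w drawC σ (drawC.cost N) [((x, y), M.act x y)] R := by
  have hD := P.D_pos
  have hn := P.n_le_D
  have hl := h.lst x hx y hy
  have e6 : (rdE 6 (.var 20) (.var 21) zE).eval P.w σ = (M.act x y).card := by
    rw [eval_rdE h.v5 (by omega) (eval_var h20) (eval_var h21) eval_zE hx hy hD, hl.card_act]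
  refine ExecS.cond ?_ ?_ <;> rw [e6] <;> intro hcard
  · obtain ⟨m, hm⟩ : ∃ m, (M.act x y).card = m + 1 := ⟨(M.act x y).card - 1, by omega⟩
    have hne : (M.act x y).Nonempty := Finset.card_pos.1 (by omega)
    have hle := hl.le
    have hac := hl.card_act
    have htc := hl.card_tot
    have htn := Finset.card_le_card (h.tot x hx y hy)
    rw [Finset.card_range] at htn
    set L : ℕ → ℕ := fun k => σ.mem (addr P.D 8 x y k) with hL
    have hLmem : ∀ i < m + 1, L i ∈ M.act x y := fun i hi =>
      (hl.idx i (by omega)).2.2.2 (by omega)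
    have hLinj : ∀ i < m + 1, ∀ j < m + 1, L i = L j → i = j := by
      intro i hi j hj hij
      have h1 := (hl.idx i (by omega)).2.1
      have h2 := (hl.idx j (by omega)).2.1
      have h1' : σ.mem (addr P.D 9 x y (L i)) = i + 1 := h1
      have h2' : σ.mem (addr P.D 9 x y (L j)) = j + 1 := h2
      rw [hij] at h1'
      omega
    have e7 : (Expr.op .sub (rdE 6 (.var 20) (.var 21) zE) (.const 1)).eval P.w σ = m := by
      rw [eval_sub e6 (eval_const P.one_lt_W), hm]; rfl
    have hrest : ∀ i : ℕ, i < m + 1 → Tri P.w (.seq (.assign 22 (rdE 8 (.var 20) (.var 21) (.var 23)))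
        (.seq (incC (.var 22) (.var 20)) (.seq (incC (.var 22) (.var 21))
        (.write (adE 5 (.var 20) (.var 21) zE) (.plus (.var 22) (.const 1))))))
        (σ.setVar 23 i)
        ((Cmd.seq (.assign 22 (rdE 8 (.var 20) (.var 21) (.var 23)))
        (.seq (incC (.var 22) (.var 20)) (.seq (incC (.var 22) (.var 21))
        (.write (adE 5 (.var 20) (.var 21) zE) (.plus (.var 22) (.const 1)))))).cost N)
        (fun s' => R s' ∧ tokOf P.D s' = Function.update (tokOf P.D σ) (x, y) (L i + 1)) := by
      intro i hi
      obtain ⟨g1, g2, g3, g4⟩ := hA _ (hLmem i hi)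
      refine Tri.seq (Tri.assign ?_)
      have e8 : (rdE 8 (.var 20) (.var 21) (.var 23)).eval P.w (σ.setVar 23 i) = L i :=
        eval_rdE (σ := σ.setVar 23 i) h.v5 (by omega) (eval_var h20) (eval_var h21)
          (eval_var (by simp [State.setVar])) hx hy
          (by omega)
      rw [e8]
      set σ₁ := (σ.setVar 23 i).setVar 22 (L i) with hσ₁
      have r1 : Rep P M σ₁ := (h.setVar (by omega)).setVar (by omega)
      have v20 : σ₁.var 20 = x := h20
      have v21 : σ₁.var 21 = y := h21
      have v22 : σ₁.var 22 = L i := by simp [hσ₁, State.setVar]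
      have f1 : Fr P 22 σ σ₁ := ((Fr.refl P 22 σ).of_setVar (by omega)).of_setVar (by omega)
      refine Tri.seq (r1.tri_inc (Ev.var v22) (Ev.var v20) g1 g3 ((hb _ _).trans (by omega))
        fun σ₂ r2 w2 f2 t2 _ => ?_)
      have hb2 : upd2 M.base (L i) x (M.base (L i) x + 1) (L i) y ≤ 8 := by
        have := hb (L i) x
        have := hb (L i) y
        unfold upd2
        split_ifs <;> omega
      refine Tri.seq (r2.tri_inc (Ev.var ((congrFun w2 22).trans v22))
        (Ev.var ((congrFun w2 21).trans v21)) g2 g4 hb2 fun σ₃ r3 w3 f3 t3 _ => ?_)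
      have w4 : σ₃.var = σ₁.var := w3.trans w2
      have t4 : tokOf P.D σ₃ = tokOf P.D σ := t3.trans t2
      refine Tri.write ?_
      rw [eval_adE r3.v5 (by omega) (eval_var ((congrFun w4 20).trans v20))
        (eval_var ((congrFun w4 21).trans v21)) eval_zE hx hy hD,
        eval_add (eval_var ((congrFun w4 22).trans v22)) (eval_const P.one_lt_W)
        (P.lt_W' (by omega))]
      have ht' : tokOf P.D σ₃ (x, y) = 0 := by rw [t4, ht]
      have r4 := r3.setTok (o := L i + 1) (base := M.base) hx hy (by
        intro v a
        simp only [ht', tokRef_zero]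
        simp only [tokRef, upd2]
        grind)
      have t5 := tokOf_setMem (P := P) (σ := σ₃) (v := L i + 1) hx hy
      rw [t4] at t5
      refine ⟨K _ r4 ?_ ?_ ?_, t5⟩
      · exact ((f1.trans (f2 22)).trans (f3 22)).setMem (by omega)
      · intro p hp
        rw [t5, Function.update_of_ne hp]
      · exact Or.inr ⟨L i, hLmem i hi, by rw [t5, Function.update_self]⟩
    have : Nonempty (State n) := ⟨σ⟩
    choose! F hF1 hF2 hF3 using hrest
    set μ₀ := (PMF.uniformOfFintype (Fin (m + 1))).map fun r : Fin (m + 1) => (r : ℕ) with hμ₀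
    refine ⟨μ₀.map F, ?_, ?_, ?_⟩
    · have hr : Exec P.w (.rand 23 (.op .sub (rdE 6 (.var 20) (.var 21) zE) (.const 1))) σ 1
          (μ₀.map fun r => σ.setVar 23 r) := by
        refine Exec.of_step ?_
        rw [step_rand e7, hμ₀, PMF.map_comp]
        rfl
      have := hr.seq (ν := fun s' => PMF.pure (F (s'.var 23))) (by
        intro s' hs'
        obtain ⟨i, hi, rfl⟩ := (PMF.mem_support_map_iff _ _ _).1 hs'
        obtain ⟨r, -, rfl⟩ := (PMF.mem_support_map_iff _ _ _).1 hi
        have h23 : (σ.setVar 23 (r : ℕ)).var 23 = r := by simp [State.setVar]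
        rw [h23]
        exact hF1 r r.2)
      rw [PMF.bind_map] at this
      have hF : (fun s' => PMF.pure (F (s'.var 23))) ∘ (fun r => σ.setVar 23 r) = PMF.pure ∘ F := by
        funext i
        simp [State.setVar]
      rw [hF] at this
      exact this
    · intro s' hs'
      obtain ⟨i, hi, rfl⟩ := (PMF.mem_support_map_iff _ _ _).1 hs'
      obtain ⟨r, -, rfl⟩ := (PMF.mem_support_map_iff _ _ _).1 hi
      exact hF2 r r.2
    · rw [sampleAll_singleton, sampleTok, dif_pos hne, ← uniform_map_eq hne hm hLmem hLinj,
        PMF.map_comp, hμ₀, PMF.map_comp, PMF.map_comp]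
      congr 1
      funext r
      exact hF3 r r.2
  · have hempty : M.act x y = ∅ := Finset.card_eq_zero.1 hcard
    refine ⟨PMF.pure σ, Exec.of_step_pure rfl, ?_, ?_⟩
    · intro s' hs'
      rw [PMF.support_pure, Set.mem_singleton_iff] at hs'
      subst hs'
      exact K _ h (Fr.refl _ _ _) (fun _ _ => rfl) (Or.inl ⟨hempty, ht⟩)
    · rw [PMF.pure_map, sampleAll_singleton, sampleTok, dif_neg (by simp [hempty])]
      congr 1
      rw [← ht, Function.update_eq_self]

theorem Rep.execS_resample (h : Rep P M σ) {N x y : ℕ} (h20 : σ.var 20 = x) (h21 : σ.var 21 = y)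
    (hx : x < P.D) (hy : y < P.D)
    (ht : tokOf P.D σ (x, y) = 0 ∨ tokOf P.D σ (x, y) - 1 < x ∧ tokOf P.D σ (x, y) - 1 < y ∧
      x < n ∧ y < n)
    (hA : ∀ v ∈ M.act x y, v < x ∧ v < y ∧ x < n ∧ y < n) (hb : ∀ v a, M.base v a ≤ 4)
    {R : State n → Prop}
    (K : ∀ σ', Rep P M σ' → Fr P 22 σ σ' → (∀ p ≠ (x, y), tokOf P.D σ' p = tokOf P.D σ p) →
      ((M.act x y = ∅ ∧ tokOf P.D σ' (x, y) = 0) ∨ ∃ v ∈ M.act x y, tokOf P.D σ' (x, y) = v + 1) →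
      R σ') :
    ExecS P.D P.w resampleC σ (resampleC.cost N) [((x, y), M.act x y)] R := by
  have hD := P.D_pos
  have hn := P.n_le_D
  have h5 : σ.mem (addr P.D 5 x y 0) = tokOf P.D σ (x, y) := by simp [tokOf, hx, hy]
  set o := tokOf P.D σ (x, y) with ho
  have e5 : (rdE 5 (.var 20) (.var 21) zE).eval P.w σ = o := by
    rw [eval_rdE h.v5 (by omega) (eval_var h20) (eval_var h21) eval_zE hx hy hD, h5]
  refine ExecS.seq_tri (Tri.assign ⟨?_, rfl⟩)
  rw [e5]
  have r1 : Rep P M (σ.setVar 22 o) := h.setVar (by omega)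
  set σ₁ := σ.setVar 22 o with hσ₁
  have f1 : Fr P 22 σ σ₁ := (Fr.refl P 22 σ).of_setVar (by omega)
  have v20 : σ₁.var 20 = x := h20
  have v21 : σ₁.var 21 = y := h21
  have v22 : σ₁.var 22 = o := by simp [hσ₁, State.setVar]
  have t1 : tokOf P.D σ₁ = tokOf P.D σ := rfl
  refine ExecS.seq_tri (Tri.write ⟨?_, ?_⟩)
  · rw [eval_adE r1.v5 (by omega) (eval_var v20) (eval_var v21) eval_zE hx hy hD, eval_zE]
    have r2 := r1.setTok (o := 0) (base := fun v a => M.base v a + tokRef o (x, y) v a) hx hy (by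
      intro v a
      rw [tokRef_zero, add_zero, t1])
    have t2 := tokOf_setMem (P := P) (σ := σ₁) (v := 0) hx hy
    have f2 : Fr P 22 σ (σ₁.setMem (addr P.D 5 x y 0) 0) := f1.setMem (by omega)
    set σ₂ := σ₁.setMem (addr P.D 5 x y 0) 0 with hσ₂
    have w22 : σ₂.var 22 = o := v22
    have w20 : σ₂.var 20 = x := v20
    have w21 : σ₂.var 21 = y := v21
    -- once the references of the old witness are removed, it remains to draw a new one
    have fin : ∀ σ₃, Rep P M σ₃ → σ₃.var = σ₂.var → Fr P 22 σ₂ σ₃ →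
        tokOf P.D σ₃ = tokOf P.D σ₂ → ExecS P.D P.w drawC σ₃ (drawC.cost N)
          [((x, y), M.act x y)] R ∧
          sampleAll [((x, y), M.act x y)] (tokOf P.D σ₃) =
          sampleAll [((x, y), M.act x y)] (tokOf P.D σ₂) := by
      intro σ₃ r3 w3 f3 t3
      refine ⟨r3.execS_draw ((congrFun w3 20).trans w20) ((congrFun w3 21).trans w21) hx hy ?_ hA hb
        ?_, by rw [t3]⟩
      · rw [t3, t2, Function.update_self]
      · intro σ₄ r4 f4 t4 t5
        refine K σ₄ r4 (f2.trans (f3.trans f4)) ?_ t5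
        intro p hp
        rw [t4 p hp, t3, t2, Function.update_of_ne hp, t1]
    refine ExecS.seq_tri (Tri.cond ?_ ?_)
    · intro h0
      have h0' : o ≠ 0 := by
        rw [← w22]; exact h0
      obtain ⟨g1, g2, g3, g4⟩ := ht.resolve_left h0'
      have ev1 : ∀ {τ : State n}, τ.var = σ₂.var →
          Ev P τ (.op .sub (.var 22) (.const 1)) (o - 1) := fun {τ} hτ τ' hτ' =>
        eval_sub (eval_var ((congrFun (hτ'.trans hτ) 22).trans w22)) (eval_const P.one_lt_W)
      refine Tri.seq (r2.tri_dec (ev1 rfl) (Ev.var w20) g1 g3 ?_ fun σ₃ r3 w3 f3 t3 _ => ?_)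
      · have : o = o - 1 + 1 := by omega
        simp [tokRef, ← this]
        omega
      refine r3.tri_dec (ev1 w3) (Ev.var ((congrFun w3 21).trans w21)) g2 g4 ?_
        fun σ₄ r4 w4 f4 t4 _ => ?_
      · have : o = o - 1 + 1 := by omega
        simp only [upd2, tokRef, ← this]
        grind
      · refine fin σ₄ (r4.of_base_eq ?_ rfl) (w4.trans w3) ((f3 22).trans (f4 22)) (t4.trans t3)
        intro v a
        simp only [upd2, tokRef]
        grind
    · intro h0
      have h0' : o = 0 := by
        rw [← w22]; exact h0
      refine Tri.nop (fin σ₂ (r2.of_base_eq ?_ rfl) rfl (Fr.refl _ _ _) rfl)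
      intro v a
      simp [h0', tokRef_zero]
  · rw [eval_adE r1.v5 (by omega) (eval_var v20) (eval_var v21) eval_zE hx hy hD, sampleAll_singleton,
      sampleAll_singleton, tokOf_setMem hx hy, sampleTok_update]

end

/-! ### Lists of candidates -/

/-- Append the vertex in variable `8` to the list of the pair in variables `20` and `21`. -/
def appendC : Cmd :=
  .seq (.assign 22 (rdE 7 (.var 20) (.var 21) zE)) <|
  .seq (.write (adE 8 (.var 20) (.var 21) (.var 22)) (.var 8)) <|
  .seq (.write (adE 9 (.var 20) (.var 21) (.var 8)) (.plus (.var 22) (.const 1))) <|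
  .write (adE 7 (.var 20) (.var 21) zE) (.plus (.var 22) (.const 1))

/-- Make the vertex in variable `8` inactive for the pair in variables `20` and `21`. -/
def deactivateC : Cmd :=
  .cond (.op .lt (.var 22) (rdE 6 (.var 20) (.var 21) zE))
    (.seq (.assign 24 (.op .sub (rdE 6 (.var 20) (.var 21) zE) (.const 1))) <|
     .seq (.assign 25 (rdE 8 (.var 20) (.var 21) (.var 24))) <|
     .seq (.write (adE 6 (.var 20) (.var 21) zE) (.var 24)) <|
     .seq (.write (adE 8 (.var 20) (.var 21) (.var 22)) (.var 25)) <|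
     .seq (.write (adE 9 (.var 20) (.var 21) (.var 25)) (.plus (.var 22) (.const 1))) <|
     .seq (.write (adE 8 (.var 20) (.var 21) (.var 24)) (.var 8)) <|
     .seq (.write (adE 9 (.var 20) (.var 21) (.var 8)) (.plus (.var 24) (.const 1))) <|
     .assign 22 (.var 24)) .nop

/-- Remove the vertex in variable `8` from the list of the pair in variables `20` and `21`. -/
def removeC : Cmd :=
  .seq (.assign 22 (.op .sub (rdE 9 (.var 20) (.var 21) (.var 8)) (.const 1))) <|
  .seq deactivateC <|
  .seq (.assign 23 (.op .sub (rdE 7 (.var 20) (.var 21) zE) (.const 1))) <|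
  .seq (.assign 25 (rdE 8 (.var 20) (.var 21) (.var 23))) <|
  .seq (.write (adE 7 (.var 20) (.var 21) zE) (.var 23)) <|
  .seq (.write (adE 8 (.var 20) (.var 21) (.var 22)) (.var 25)) <|
  .write (adE 9 (.var 20) (.var 21) (.var 25)) (.plus (.var 22) (.const 1))

/-- Store the pair of the values of two expressions, in increasing order, in variables `20` and
`21`. -/
def setPairC (e₁ e₂ : Expr) : Cmd :=
  .cond (.op .lt e₁ e₂) (.seq (.assign 20 e₁) (.assign 21 e₂))
    (.seq (.assign 20 e₂) (.assign 21 e₁))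

/-- Compared to `σ₀`, only the list of the pair `(x, y)` and variables from `22` on are changed,
and the list has length `len`, `a` active elements, the entries `L` and the positions `pos`. -/
structure LView {n : ℕ} (P : Par n) (σ₀ σ : State n) (x y len a : ℕ) (L pos : ℕ → ℕ) : Prop where
  var : ∀ i < 22, σ.var i = σ₀.var i
  out : σ.out = σ₀.out
  inp : ∀ i < P.D ^ 3, σ.mem i = σ₀.mem i
  oth : ∀ k i j l, i < P.D → j < P.D → l < P.D → (k < 6 ∨ 9 < k ∨ i ≠ x ∨ j ≠ y) →
    σ.mem (addr P.D k i j l) = σ₀.mem (addr P.D k i j l)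
  len : σ.mem (addr P.D 7 x y 0) = len
  act : σ.mem (addr P.D 6 x y 0) = a
  L : ∀ k < P.D, σ.mem (addr P.D 8 x y k) = L k
  pos : ∀ k < P.D, σ.mem (addr P.D 9 x y k) = pos k

section
variable {n : ℕ} {P : Par n} {M : Abs} {σ σ₀ : State n} {x y len a : ℕ} {L pos : ℕ → ℕ} {N : ℕ}

namespace LView

theorem self (P : Par n) (σ : State n) (x y : ℕ) : LView P σ σ x y (σ.mem (addr P.D 7 x y 0))
    (σ.mem (addr P.D 6 x y 0)) (fun k => σ.mem (addr P.D 8 x y k))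
    (fun k => σ.mem (addr P.D 9 x y k)) :=
  ⟨fun _ _ => rfl, rfl, fun _ _ => rfl, fun _ _ _ _ _ _ _ _ => rfl, rfl, rfl, fun _ _ => rfl,
    fun _ _ => rfl⟩

theorem setVar (h : LView P σ₀ σ x y len a L pos) {z v : ℕ} (hz : 22 ≤ z) :
    LView P σ₀ (σ.setVar z v) x y len a L pos :=
  ⟨fun i hi => (Function.update_of_ne (by omega) _ _).trans (h.var i hi), h.out, h.inp, h.oth,
    h.len, h.act, h.L, h.pos⟩

theorem write (h : LView P σ₀ σ x y len a L pos) (hx : x < P.D) (hy : y < P.D) {k l v : ℕ}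
    (hl : l < P.D) {len' a' : ℕ} {L' pos' : ℕ → ℕ}
    (hk : k = 6 ∧ l = 0 ∧ len' = len ∧ a' = v ∧ L' = L ∧ pos' = pos ∨
      k = 7 ∧ l = 0 ∧ len' = v ∧ a' = a ∧ L' = L ∧ pos' = pos ∨
      k = 8 ∧ len' = len ∧ a' = a ∧ L' = Function.update L l v ∧ pos' = pos ∨
      k = 9 ∧ len' = len ∧ a' = a ∧ L' = L ∧ pos' = Function.update pos l v) :
    LView P σ₀ (σ.setMem (addr P.D k x y l) v) x y len' a' L' pos' := by
  have hD := P.D_pos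
  have key : ∀ {k' i' j' l' : ℕ}, i' < P.D → j' < P.D → l' < P.D →
      (σ.setMem (addr P.D k x y l) v).mem (addr P.D k' i' j' l') =
      if k' = k ∧ i' = x ∧ j' = y ∧ l' = l then v else σ.mem (addr P.D k' i' j' l') :=
    fun h1 h2 h3 => mem_setMem_addr _ _ hx hy hl h1 h2 h3
  refine ⟨h.var, h.out, ?_, ?_, ?_, ?_, ?_, ?_⟩
  · intro i hi
    rw [← h.inp i hi]
    refine Function.update_of_ne ?_ _ _
    have := le_addr (D := P.D) (k := k) (i := x) (j := y) (l := l) (by omega)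
    omega
  · intro k' i j l' hi hj hl' hh
    rw [key hi hj hl', if_neg (by omega), h.oth k' i j l' hi hj hl' hh]
  · rw [key hx hy hD, h.len]; grind
  · rw [key hx hy hD, h.act]; grind
  · intro i hi
    rw [key hx hy hi, h.L i hi]
    rcases hk with ⟨rfl, -, -, -, rfl, rfl⟩ | ⟨rfl, -, -, -, rfl, rfl⟩ | ⟨rfl, -, -, rfl, rfl⟩ |
      ⟨rfl, -, -, rfl, rfl⟩ <;> simp [Function.update_apply]
  · intro i hi
    rw [key hx hy hi, h.pos i hi]
    rcases hk with ⟨rfl, -, -, -, rfl, rfl⟩ | ⟨rfl, -, -, -, rfl, rfl⟩ | ⟨rfl, -, -, rfl, rfl⟩ |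
      ⟨rfl, -, -, rfl, rfl⟩ <;> simp [Function.update_apply]

theorem tri_deactivate (h : LView P σ₀ σ x y len a L pos) (h5 : σ₀.var 5 = P.D)
    (h20 : σ₀.var 20 = x) (h21 : σ₀.var 21 = y) {v : ℕ} (h8 : σ₀.var 8 = v) (hx : x < P.D)
    (hy : y < P.D) (hv : v < P.D) {tot act : Finset ℕ} (hl : LOk len a L pos tot act)
    (hlen : len ≤ P.D) (htot : ∀ u ∈ tot, u < P.D) (hvt : v ∈ tot) (h22 : σ.var 22 = pos v - 1)
    {R : State n → Prop}
    (K : ∀ σ' L' pos' a', LView P σ₀ σ' x y len a' L' pos' → σ'.var 22 = pos' v - 1 →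
      LOk len a' L' pos' tot (act.erase v) → R σ') :
    Tri P.w deactivateC σ (deactivateC.cost N) R := by
  have hD := P.D_pos
  have g5 : σ.var 5 = P.D := (h.var 5 (by omega)).trans h5
  have g8 : σ.var 8 = v := (h.var 8 (by omega)).trans h8
  have g20 : σ.var 20 = x := (h.var 20 (by omega)).trans h20
  have g21 : σ.var 21 = y := (h.var 21 (by omega)).trans h21
  have e6 : (rdE 6 (.var 20) (.var 21) zE).eval P.w σ = a := by
    rw [eval_rdE g5 (by omega) (eval_var g20) (eval_var g21) eval_zE hx hy hD, h.act]
  have hlv := hl.val v hvt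
  have hle := hl.le
  refine Tri.cond ?_ ?_
  · intro hlt
    rw [eval_lt_ne (eval_var h22) e6] at hlt
    have hva : v ∈ act := (hl.mem_act hvt).2 (by omega)
    have hla := hl.idx (a - 1) (by omega)
    have hLD := htot _ hla.1
    refine Tri.seq (Tri.assign ?_)
    rw [eval_sub e6 (eval_const P.one_lt_W)]
    have s1 := h.setVar (z := 24) (v := a - 1) (by omega)
    have w22 : (σ.setVar 24 (a - 1)).var 22 = pos v - 1 := h22
    refine Tri.seq (Tri.assign ?_)
    have k20 : (σ.setVar 24 (a - 1)).var 20 = x := g20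
    have k21 : (σ.setVar 24 (a - 1)).var 21 = y := g21
    have k24 : (σ.setVar 24 (a - 1)).var 24 = a - 1 := by simp [State.setVar]
    rw [eval_rdE (σ := σ.setVar 24 (a - 1)) g5 (by omega) (eval_var k20) (eval_var k21)
      (eval_var k24) hx hy (by omega), s1.L _ (by omega)]
    have s2 := s1.setVar (z := 25) (v := L (a - 1)) (by omega)
    set σ₂ := (σ.setVar 24 (a - 1)).setVar 25 (L (a - 1)) with hσ₂
    have v5 : σ₂.var 5 = P.D := g5
    have v8 : σ₂.var 8 = v := g8
    have v20 : σ₂.var 20 = x := g20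
    have v21 : σ₂.var 21 = y := g21
    have v22 : σ₂.var 22 = pos v - 1 := h22
    have v24 : σ₂.var 24 = a - 1 := by simp [hσ₂, State.setVar]
    have v25 : σ₂.var 25 = L (a - 1) := by simp [hσ₂, State.setVar]
    clear_value σ₂
    refine Tri.seq (Tri.write ?_)
    rw [eval_adE v5 (by omega) (eval_var v20) (eval_var v21) eval_zE hx hy hD, eval_var v24]
    have s3 := s2.write hx hy (k := 6) (l := 0) (v := a - 1) hD
      (Or.inl ⟨rfl, rfl, rfl, rfl, rfl, rfl⟩)
    refine Tri.seq (Tri.write ?_)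
    rw [eval_adE (σ := σ₂.setMem _ _) v5 (by omega) (Ev.var v20 _ rfl) (Ev.var v21 _ rfl) (Ev.var v22 _ rfl)
      hx hy (by omega), eval_var (σ := σ₂.setMem _ _) v25]
    have s4 := s3.write hx hy (k := 8) (l := pos v - 1) (v := L (a - 1)) (by omega)
      (Or.inr (Or.inr (Or.inl ⟨rfl, rfl, rfl, rfl, rfl⟩)))
    refine Tri.seq (Tri.write ?_)
    rw [eval_adE (σ := (σ₂.setMem _ _).setMem _ _) v5 (by omega) (Ev.var v20 _ rfl) (Ev.var v21 _ rfl)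
      (Ev.var v25 _ rfl) hx hy hLD, eval_add (σ := (σ₂.setMem _ _).setMem _ _) (Ev.var v22 _ rfl)
      (eval_const P.one_lt_W) (P.lt_W' (by omega))]
    have s5 := s4.write hx hy (k := 9) (l := L (a - 1)) (v := pos v - 1 + 1) hLD
      (Or.inr (Or.inr (Or.inr ⟨rfl, rfl, rfl, rfl, rfl⟩)))
    refine Tri.seq (Tri.write ?_)
    rw [eval_adE (σ := ((σ₂.setMem _ _).setMem _ _).setMem _ _) v5 (by omega) (Ev.var v20 _ rfl)
      (Ev.var v21 _ rfl) (Ev.var v24 _ rfl) hx hy (by omega),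
      eval_var (σ := ((σ₂.setMem _ _).setMem _ _).setMem _ _) v8]
    have s6 := s5.write hx hy (k := 8) (l := a - 1) (v := v) (by omega)
      (Or.inr (Or.inr (Or.inl ⟨rfl, rfl, rfl, rfl, rfl⟩)))
    refine Tri.seq (Tri.write ?_)
    rw [eval_adE (σ := (((σ₂.setMem _ _).setMem _ _).setMem _ _).setMem _ _) v5 (by omega)
      (Ev.var v20 _ rfl) (Ev.var v21 _ rfl) (Ev.var v8 _ rfl) hx hy hv,
      eval_add (σ := (((σ₂.setMem _ _).setMem _ _).setMem _ _).setMem _ _) (Ev.var v24 _ rfl)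
      (eval_const P.one_lt_W) (P.lt_W' (by omega))]
    have s7 := s6.write hx hy (k := 9) (l := v) (v := a - 1 + 1) hv
      (Or.inr (Or.inr (Or.inr ⟨rfl, rfl, rfl, rfl, rfl⟩)))
    refine Tri.assign ?_
    rw [eval_var (σ := ((((σ₂.setMem _ _).setMem _ _).setMem _ _).setMem _ _).setMem _ _) v24]
    refine K _ _ _ _ (s7.setVar (by omega)) ?_ (hl.deactivate hva)
    simp [State.setVar]
  · intro hlt
    have hlt' := mt (eval_lt_ne (eval_var h22) e6).2 (not_not.2 hlt)
    have hva : v ∉ act := fun hh => by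
      have := (hl.mem_act hvt).1 hh
      omega
    refine Tri.nop (K _ _ _ _ h h22 ?_)
    rwa [Finset.erase_eq_of_notMem hva]

end LView

theorem LView.fr {L pos : ℕ → ℕ} (h : LView P σ₀ σ x y len a L pos) : Fr P 22 σ₀ σ := ⟨h.var, h.inp⟩

theorem LView.rep (h : LView P σ₀ σ x y len a L pos) (hr : Rep P M σ₀) (hx : x < P.D) (hy : y < P.D)
    {tot act : Finset ℕ} (hl : LOk len a L pos tot act) (ht : tot ⊆ Finset.range n) :
    Rep P { M with tot := upd2 M.tot x y tot, act := upd2 M.act x y act } σ ∧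
      tokOf P.D σ = tokOf P.D σ₀ := by
  have hn := P.n_le_D
  have hcard := Finset.card_le_card ht
  rw [Finset.card_range, hl.card_tot] at hcard
  refine hr.setList hx hy (fun i hi => h.var i (by omega)) h.out h.oth ?_ ht
  rw [h.len, h.act]
  refine hl.congr (fun i hi => h.L i (by omega)) fun v hv => h.pos v ?_
  have := Finset.mem_range.1 (ht hv)
  omega

/-- A change of lists that leaves reference counts, witnesses, and variables below `22` as they
are. -/
theorem Rep.tri_append (h : Rep P M σ) {v : ℕ} (h20 : σ.var 20 = x) (h21 : σ.var 21 = y)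
    (h8 : σ.var 8 = v) (hx : x < P.D) (hy : y < P.D) (hv : v < n) (hvt : v ∉ M.tot x y)
    {R : State n → Prop}
    (K : ∀ σ', Rep P { M with tot := upd2 M.tot x y (insert v (M.tot x y)) } σ' → Fr P 22 σ σ' →
      tokOf P.D σ' = tokOf P.D σ → R σ') :
    Tri P.w appendC σ (appendC.cost N) R := by
  have hD := P.D_pos
  have hn := P.n_le_D
  have hl := h.lst x hx y hy
  have hsub : insert v (M.tot x y) ⊆ Finset.range n :=
    Finset.insert_subset (Finset.mem_range.2 hv) (h.tot x hx y hy)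
  have hcard := Finset.card_le_card hsub
  rw [Finset.card_insert_of_notMem hvt, Finset.card_range, hl.card_tot] at hcard
  have s0 := LView.self P σ x y
  set len := σ.mem (addr P.D 7 x y 0) with hlen
  refine Tri.seq (Tri.assign ?_)
  rw [eval_rdE h.v5 (by omega) (eval_var h20) (eval_var h21) eval_zE hx hy hD, ← hlen]
  have s1 := s0.setVar (z := 22) (v := len) (by omega)
  set σ₁ := σ.setVar 22 len with hσ₁
  have v5 : σ₁.var 5 = P.D := h.v5
  have v8 : σ₁.var 8 = v := h8
  have v20 : σ₁.var 20 = x := h20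
  have v21 : σ₁.var 21 = y := h21
  have v22 : σ₁.var 22 = len := by simp [hσ₁, State.setVar]
  refine Tri.seq (Tri.write ?_)
  rw [eval_adE v5 (by omega) (eval_var v20) (eval_var v21) (eval_var v22) hx hy (by omega),
    eval_var v8]
  have s2 := s1.write hx hy (k := 8) (l := len) (v := v) (by omega)
    (Or.inr (Or.inr (Or.inl ⟨rfl, rfl, rfl, rfl, rfl⟩)))
  refine Tri.seq (Tri.write ?_)
  rw [eval_adE (σ := σ₁.setMem _ _) v5 (by omega) (Ev.var v20 _ rfl) (Ev.var v21 _ rfl) (Ev.var v8 _ rfl)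
    hx hy (by omega), eval_add (σ := σ₁.setMem _ _) (Ev.var v22 _ rfl) (eval_const P.one_lt_W)
    (P.lt_W' (by omega))]
  have s3 := s2.write hx hy (k := 9) (l := v) (v := len + 1) (by omega)
    (Or.inr (Or.inr (Or.inr ⟨rfl, rfl, rfl, rfl, rfl⟩)))
  refine Tri.write ?_
  rw [eval_adE (σ := (σ₁.setMem _ _).setMem _ _) v5 (by omega) (Ev.var v20 _ rfl) (Ev.var v21 _ rfl)
    eval_zE hx hy hD, eval_add (σ := (σ₁.setMem _ _).setMem _ _) (Ev.var v22 _ rfl)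
    (eval_const P.one_lt_W) (P.lt_W' (by omega))]
  have s4 := s3.write hx hy (k := 7) (l := 0) (v := len + 1) hD
    (Or.inr (Or.inl ⟨rfl, rfl, rfl, rfl, rfl, rfl⟩))
  obtain ⟨r, ht⟩ := s4.rep h hx hy (hl.append hvt) hsub
  refine K _ ?_ s4.fr ht
  have : upd2 M.act x y (M.act x y) = M.act := by
    funext i j; unfold upd2; split_ifs with hij
    · rw [hij.1, hij.2]
    · rfl
  rwa [this] at r

theorem Rep.tri_remove (h : Rep P M σ) {v : ℕ} (h20 : σ.var 20 = x) (h21 : σ.var 21 = y)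
    (h8 : σ.var 8 = v) (hx : x < P.D) (hy : y < P.D) (hvt : v ∈ M.tot x y)
    {R : State n → Prop}
    (K : ∀ σ', Rep P { M with tot := upd2 M.tot x y ((M.tot x y).erase v),
                              act := upd2 M.act x y ((M.act x y).erase v) } σ' → Fr P 22 σ σ' →
      tokOf P.D σ' = tokOf P.D σ → R σ') :
    Tri P.w removeC σ (removeC.cost N) R := by
  have hD := P.D_pos
  have hn := P.n_le_D
  have hl := h.lst x hx y hy
  have hsub := h.tot x hx y hy
  have hv := Finset.mem_range.1 (hsub hvt)
  have hcard := Finset.card_le_card hsub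
  rw [Finset.card_range, hl.card_tot] at hcard
  have s0 := LView.self P σ x y
  set len := σ.mem (addr P.D 7 x y 0) with hlen
  refine Tri.seq (Tri.assign ?_)
  rw [eval_sub (eval_rdE h.v5 (by omega) (eval_var h20) (eval_var h21) (eval_var h8) hx hy
    (by omega)) (eval_const P.one_lt_W)]
  have s1 := s0.setVar (z := 22) (v := σ.mem (addr P.D 9 x y v) - 1) (by omega)
  refine Tri.seq (s1.tri_deactivate h.v5 h20 h21 h8 hx hy (by omega) hl (by omega)
    (fun u hu => (Finset.mem_range.1 (hsub hu)).trans_le hn) hvt (by simp [State.setVar]) ?_)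
  intro σ₁ L pos a t1 h22 hl1
  have hlv := hl1.val v hvt
  have hlL := hl1.idx (len - 1) (by omega)
  have hLn := Finset.mem_range.1 (hsub hlL.1)
  have g5 : σ₁.var 5 = P.D := (t1.var 5 (by omega)).trans h.v5
  have g20 : σ₁.var 20 = x := (t1.var 20 (by omega)).trans h20
  have g21 : σ₁.var 21 = y := (t1.var 21 (by omega)).trans h21
  refine Tri.seq (Tri.assign ?_)
  rw [eval_sub (eval_rdE g5 (by omega) (eval_var g20) (eval_var g21) eval_zE hx hy hD)
    (eval_const P.one_lt_W), t1.len]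
  have t2 := t1.setVar (z := 23) (v := len - 1) (by omega)
  refine Tri.seq (Tri.assign ?_)
  have k20 : (σ₁.setVar 23 (len - 1)).var 20 = x := g20
  have k21 : (σ₁.setVar 23 (len - 1)).var 21 = y := g21
  have k23 : (σ₁.setVar 23 (len - 1)).var 23 = len - 1 := by simp [State.setVar]
  rw [eval_rdE (σ := σ₁.setVar 23 (len - 1)) g5 (by omega) (eval_var k20) (eval_var k21)
    (eval_var k23) hx hy (by omega), t2.L _ (by omega)]
  have t3 := t2.setVar (z := 25) (v := L (len - 1)) (by omega)
  have v22 : ((σ₁.setVar 23 (len - 1)).setVar 25 (L (len - 1))).var 22 = pos v - 1 := h22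
  set σ₂ := (σ₁.setVar 23 (len - 1)).setVar 25 (L (len - 1)) with hσ₂
  have v5 : σ₂.var 5 = P.D := g5
  have v20 : σ₂.var 20 = x := g20
  have v21 : σ₂.var 21 = y := g21
  have v23 : σ₂.var 23 = len - 1 := by simp [hσ₂, State.setVar]
  have v25 : σ₂.var 25 = L (len - 1) := by simp [hσ₂, State.setVar]
  clear_value σ₂
  refine Tri.seq (Tri.write ?_)
  rw [eval_adE v5 (by omega) (eval_var v20) (eval_var v21) eval_zE hx hy hD, eval_var v23]
  have t4 := t3.write hx hy (k := 7) (l := 0) (v := len - 1) hD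
    (Or.inr (Or.inl ⟨rfl, rfl, rfl, rfl, rfl, rfl⟩))
  refine Tri.seq (Tri.write ?_)
  rw [eval_adE (σ := σ₂.setMem _ _) v5 (by omega) (Ev.var v20 _ rfl) (Ev.var v21 _ rfl) (Ev.var v22 _ rfl)
    hx hy (by omega), eval_var (σ := σ₂.setMem _ _) v25]
  have t5 := t4.write hx hy (k := 8) (l := pos v - 1) (v := L (len - 1)) (by omega)
    (Or.inr (Or.inr (Or.inl ⟨rfl, rfl, rfl, rfl, rfl⟩)))
  refine Tri.write ?_
  rw [eval_adE (σ := (σ₂.setMem _ _).setMem _ _) v5 (by omega) (Ev.var v20 _ rfl) (Ev.var v21 _ rfl)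
    (Ev.var v25 _ rfl) hx hy (by omega), eval_add (σ := (σ₂.setMem _ _).setMem _ _) (Ev.var v22 _ rfl)
    (eval_const P.one_lt_W) (P.lt_W' (by omega))]
  have t6 := t5.write hx hy (k := 9) (l := L (len - 1)) (v := pos v - 1 + 1) (by omega)
    (Or.inr (Or.inr (Or.inr ⟨rfl, rfl, rfl, rfl, rfl⟩)))
  obtain ⟨r, ht⟩ := t6.rep h hx hy (hl1.remove_inactive hvt (by simp))
    ((Finset.erase_subset _ _).trans hsub)
  exact K _ r t6.fr ht

theorem tri_setPair {e₁ e₂ : Expr} {x y : ℕ} (h1 : e₁.eval P.w σ = x) (h2 : e₂.eval P.w σ = y)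
    (h1' : ∀ v, e₁.eval P.w (σ.setVar 20 v) = x) (h2' : ∀ v, e₂.eval P.w (σ.setVar 20 v) = y)
    {R : State n → Prop} (K : R ((σ.setVar 20 (min x y)).setVar 21 (max x y))) :
    Tri P.w (setPairC e₁ e₂) σ ((setPairC e₁ e₂).cost N) R := by
  refine Tri.cond ?_ ?_
  · intro h
    rw [eval_lt_ne h1 h2] at h
    refine Tri.seq (Tri.assign (Tri.assign ?_))
    rw [h1, h2']
    rwa [min_eq_left h.le, max_eq_right h.le] at K
  · intro h
    have h' := mt (eval_lt_ne h1 h2).2 (not_not.2 h)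
    refine Tri.seq (Tri.assign (Tri.assign ?_))
    rw [h2, h1']
    rwa [min_eq_right (not_lt.1 h'), max_eq_left (not_lt.1 h')] at K

end

/-! ### Abstract updates -/

/-- The pair of `a` and `b` in increasing order. -/
def pr (a b : ℕ) : ℕ × ℕ := (min a b, max a b)

/-- The candidates for witnesses of the pair `(x, y)`: common neighbours before `x` and `y`. Only
increasing pairs within a bucket have candidates. -/
def totOf (n s : ℕ) (st : ℕ → ℕ → ℕ) (x y : ℕ) : Finset ℕ :=
  if x ≤ y ∧ x / s = y / s then (Finset.range n).filter fun v => st v x ≠ 0 ∧ st v y ≠ 0 else ∅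

/-- The number of references to an edge other than those by witnesses. -/
def baseOf (s : ℕ) (st cen : ℕ → ℕ → ℕ) (v a : ℕ) : ℕ :=
  (if st v a = 1 ∨ st v a = 2 then 1 else 0) + if cen v (a / s) = a + 1 then 1 else 0

/-- Consistency of the abstract data. The states of an edge are: `0` absent, `1` and `2` explicitly
in the output, `3` represented by a center and witnesses. -/
structure Wf (n s : ℕ) (M : Abs) : Prop where
  lt : ∀ v a, M.st v a ≠ 0 → v < a ∧ a < n
  le : ∀ v a, M.st v a ≤ 3
  tot : M.tot = totOf n s M.st
  act : ∀ x y, M.act x y ⊆ M.tot x y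
  base : M.base = baseOf s M.st M.cen
  cen1 : ∀ v i a, M.cen v i = a + 1 → a / s = i ∧ M.st v a = 3
  cen0 : ∀ v a, M.cen v (a / s) = 0 → M.st v a ≠ 3
  la : ∀ x j, M.la x j < n

/-- The witness of `p` is an active candidate, and it exists if there is one. -/
def TokAt (M : Abs) (y : Tok) (p : ℕ × ℕ) : Prop :=
  (M.act p.1 p.2 = ∅ ∧ y p = 0) ∨ ∃ v ∈ M.act p.1 p.2, y p = v + 1

/-- The machine represents consistent data, with a witness for every pair that can have one. -/
structure Ok {n : ℕ} (P : Par n) (M : Abs) (σ : State n) : Prop where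
  rep : Rep P M σ
  wf : Wf n P.s M
  tok : ∀ p : ℕ × ℕ, p.1 < P.D → p.2 < P.D → TokAt M (tokOf P.D σ) p

/-- Starting from `c`, the first entry `B + j + 1` with `st v (B + j) = k`, if `c` is `0`. -/
def firstC (k : ℕ) (st : ℕ → ℕ → ℕ) (v B c : ℕ) : ℕ → ℕ
  | 0 => c
  | i + 1 => if firstC k st v B c i = 0 ∧ st v (B + i) = k then B + i + 1 else firstC k st v B c i

theorem firstC_eq_zero {k : ℕ} {st : ℕ → ℕ → ℕ} {v B c i : ℕ} :
    firstC k st v B c i = 0 ↔ c = 0 ∧ ∀ j < i, st v (B + j) ≠ k := by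
  induction i with
  | zero => simp [firstC]
  | succ i ih =>
    simp only [firstC, Nat.lt_succ_iff_lt_or_eq]
    grind

theorem firstC_eq_succ {k : ℕ} {st : ℕ → ℕ → ℕ} {v B c i d : ℕ}
    (h : firstC k st v B c i = d + 1) : c = d + 1 ∨ c = 0 ∧ ∃ j < i, d = B + j ∧ st v d = k := by
  induction i with
  | zero => exact Or.inl h
  | succ i ih =>
    simp only [firstC] at h
    split_ifs at h with h1
    · exact Or.inr ⟨(firstC_eq_zero.1 h1.1).1, i, by omega, by omega, by
        rw [show d = B + i by omega]; exact h1.2⟩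
    · rcases ih h with h2 | ⟨h2, j, hj, h3⟩
      · exact Or.inl h2
      · exact Or.inr ⟨h2, j, by omega, h3⟩

/-- The first `i` pairs of `a` with the elements of its bucket are changed from `f` to `g`. -/
noncomputable def ptot {α : Type*} (f g : ℕ → ℕ → α) (a s i x y : ℕ) : α :=
  open Classical in
  if ∃ b, b / s = a / s ∧ b % s < i ∧ (x, y) = pr a b then g x y else f x y

theorem pr_inj {a b b' : ℕ} (h : pr a b = pr a b') : b = b' := by
  simp only [pr, Prod.mk.injEq] at h
  omega

theorem bucket_div {s B j : ℕ} (hj : j < s) : (B * s + j) / s = B := by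
  rw [add_comm, Nat.add_mul_div_right _ _ (by omega), Nat.div_eq_of_lt hj, zero_add]

theorem bucket_mod {s B j : ℕ} (hj : j < s) : (B * s + j) % s = j := by
  rw [add_comm, Nat.add_mul_mod_self_right, Nat.mod_eq_of_lt hj]

theorem bucket_eq {s B b : ℕ} (h : b / s = B) : b = B * s + b % s := by
  rw [← h, mul_comm]; exact (Nat.div_add_mod b s).symm

section ptot
variable {α : Type*} {f g : ℕ → ℕ → α} {a s : ℕ}

theorem ptot_zero : ptot f g a s 0 = f := by
  funext x y; simp [ptot]

theorem ptot_at {i : ℕ} (hi : i < s) :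
    ptot f g a s i (min a (a / s * s + i)) (max a (a / s * s + i)) =
      f (min a (a / s * s + i)) (max a (a / s * s + i)) := by
  unfold ptot
  rw [if_neg]
  rintro ⟨b, -, h2, h3⟩
  have := pr_inj (show pr a (a / s * s + i) = pr a b from h3)
  rw [← this, bucket_mod hi] at h2
  omega

theorem ptot_succ {i : ℕ} (hi : i < s) : ptot f g a s (i + 1) =
    upd2 (ptot f g a s i) (min a (a / s * s + i)) (max a (a / s * s + i))
      (g (min a (a / s * s + i)) (max a (a / s * s + i))) := by
  funext x y
  by_cases hxy : x = min a (a / s * s + i) ∧ y = max a (a / s * s + i)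
  · obtain ⟨rfl, rfl⟩ := hxy
    rw [upd2_self, ptot, if_pos ⟨a / s * s + i, bucket_div hi, by rw [bucket_mod hi]; omega, rfl⟩]
  · simp only [upd2, hxy, if_false]
    unfold ptot
    have : (∃ b, b / s = a / s ∧ b % s < i + 1 ∧ (x, y) = pr a b) ↔
        ∃ b, b / s = a / s ∧ b % s < i ∧ (x, y) = pr a b := by
      constructor
      · rintro ⟨b, h1, h2, h3⟩
        refine ⟨b, h1, ?_, h3⟩
        by_contra hb
        have h4 : b % s = i := by omega
        have h5 := bucket_eq h1
        rw [h4] at h5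
        rw [h5] at h3
        exact hxy ⟨congrArg Prod.fst h3, congrArg Prod.snd h3⟩
      · rintro ⟨b, h1, h2, h3⟩
        exact ⟨b, h1, by omega, h3⟩
    split_ifs with h1 h2 h2
    · rfl
    · exact absurd (this.1 h1) h2
    · exact absurd (this.2 h2) h1
    · rfl

theorem ptot_full (hs : 0 < s) (h : ∀ x y, (∀ b, b / s = a / s → (x, y) ≠ pr a b) → f x y = g x y) :
    ptot f g a s s = g := by
  funext x y
  unfold ptot
  split_ifs with hb
  · rfl
  · refine h x y fun b hb1 hb2 => hb ⟨b, hb1, Nat.mod_lt _ hs, hb2⟩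

end ptot

theorem eq_pr_of {s a x y : ℕ} (h1 : x ≤ y) (h2 : x / s = y / s) (h3 : x = a ∨ y = a) :
    ∃ b, b / s = a / s ∧ (x, y) = pr a b := by
  rcases h3 with rfl | rfl
  · exact ⟨y, h2.symm, by simp [pr, h1]⟩
  · exact ⟨x, h2, by simp [pr, h1]⟩

/-- Record a deletion at the vertex `a` in slot `q` of the log; `bit` marks the lost witnesses. -/
def logAbs (s q a : ℕ) (bit : ℕ → ℕ) (M : Abs) : Abs :=
  { M with
    la := upd2 M.la (q / s) (q % s) a
    bt := upd2 M.bt (q / s) (q % s) fun j => if j < s then bit j else M.bt (q / s) (q % s) j }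

/-- Insert the edge `(v, a)`. -/
def insAbs (n s q v a : ℕ) (M : Abs) : Abs :=
  logAbs s q a (fun _ => 0)
    { M with
      st := upd2 M.st v a 1
      base := baseOf s (upd2 M.st v a 1) M.cen
      tot := totOf n s (upd2 M.st v a 1) }

/-- The centers after deletion of the edge `(v, a)`. -/
def delCen (s v a : ℕ) (M : Abs) : ℕ → ℕ → ℕ :=
  if M.cen v (a / s) = a + 1 then
    upd2 M.cen v (a / s) (firstC 3 (upd2 M.st v a 0) v (a / s * s) 0 s)
  else M.cen

/-- The witness of `a` and the `j`-th element of its bucket is lost by deletion of `(v, a)`. -/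
def Lost (s v a : ℕ) (M : Abs) (y : Tok) (j : ℕ) : Prop :=
  M.st v (a / s * s + j) ≠ 0 ∧ y (pr a (a / s * s + j)) = v + 1

instance (s v a : ℕ) (M : Abs) (y : Tok) (j : ℕ) : Decidable (Lost s v a M y j) :=
  inferInstanceAs (Decidable (_ ∧ _))

/-- The active candidates after deletion of the edge `(v, a)`. -/
def delAct (v a : ℕ) (M : Abs) (x y : ℕ) : Finset ℕ :=
  if x = a ∨ y = a then (M.act x y).erase v else M.act x y

/-- Delete the edge `(v, a)`, when the witnesses are `y`. -/
def delAbs (n s q v a : ℕ) (y : Tok) (M : Abs) : Abs :=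
  logAbs s q a (fun j => if Lost s v a M y j then 1 else 0)
    { M with
      st := upd2 M.st v a 0
      cen := delCen s v a M
      base := baseOf s (upd2 M.st v a 0) (delCen s v a M)
      tot := totOf n s (upd2 M.st v a 0)
      act := delAct v a M }

/-- The witnesses that are resampled at the deletion of `(v, a)`. -/
def delSam (s v a : ℕ) (y : Tok) (M : Abs) : List ((ℕ × ℕ) × Finset ℕ) :=
  catList (fun j => if Lost s v a M y j then
    [(pr a (a / s * s + j), delAct v a M (pr a (a / s * s + j)).1 (pr a (a / s * s + j)).2)]
    else []) 0 s

/-- The witnesses that are resampled because they were lost in the update logged in slot `r`. -/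
def slotSam (s r : ℕ) (M : Abs) : List ((ℕ × ℕ) × Finset ℕ) :=
  catList (fun j => if M.bt (r / s) (r % s) j ≠ 0 then
    [(pr (M.la (r / s) (r % s)) (M.la (r / s) (r % s) / s * s + j),
      M.act (pr (M.la (r / s) (r % s)) (M.la (r / s) (r % s) / s * s + j)).1
        (pr (M.la (r / s) (r % s)) (M.la (r / s) (r % s) / s * s + j)).2)] else []) 0 s

/-- Witnesses that were lost `2 ^ i` updates ago are resampled. -/
def schedSam (s T q : ℕ) (M : Abs) : List ((ℕ × ℕ) × Finset ℕ) :=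
  catList (fun i => slotSam s ((q + T - 2 ^ i) % T) M) 0 (Nat.clog 2 T)

/-- The pair all of whose candidates become active in step `q` of a background pass. -/
def flipPair (s q : ℕ) : ℕ × ℕ := pr (q / s) (q / s / s * s + q % s)

/-- The change of the state of an edge when it is scanned. -/
def bump (x : ℕ) : ℕ := if x = 1 then 2 else if x = 2 then 3 else x

/-- The states of edges after the first `j` elements of bucket `i` are scanned for `x`. -/
def scanSt (s x i j : ℕ) (st : ℕ → ℕ → ℕ) (v a : ℕ) : ℕ :=
  if v = x ∧ a / s = i ∧ a % s < j then bump (st v a) else st v a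

/-- Step `q` of a background pass. -/
def bgAbs (s q : ℕ) (M : Abs) : Abs :=
  let st' := scanSt s (q / s) (q % s) s M.st
  let cen' := upd2 M.cen (q / s) (q % s)
    (firstC 2 M.st (q / s) (q % s * s) (M.cen (q / s) (q % s)) s)
  { M with
    st := st'
    cen := cen'
    base := baseOf s st' cen'
    act := upd2 M.act (flipPair s q).1 (flipPair s q).2 (M.tot (flipPair s q).1 (flipPair s q).2) }

/-- The witness that is resampled in step `q` of a background pass. -/
def bgSam (s q : ℕ) (M : Abs) : List ((ℕ × ℕ) × Finset ℕ) :=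
  [(flipPair s q, M.tot (flipPair s q).1 (flipPair s q).2)]

section Wf
variable {n s : ℕ} {M : Abs}

theorem mem_totOf {st : ℕ → ℕ → ℕ} {x y v : ℕ} : v ∈ totOf n s st x y ↔
    v < n ∧ x ≤ y ∧ x / s = y / s ∧ st v x ≠ 0 ∧ st v y ≠ 0 := by
  unfold totOf
  split_ifs with h
  · simp [h]
  · simp only [Finset.notMem_empty, false_iff]; tauto

theorem Wf.mem_tot (h : Wf n s M) {x y v : ℕ} : v ∈ M.tot x y ↔
    x ≤ y ∧ x / s = y / s ∧ M.st v x ≠ 0 ∧ M.st v y ≠ 0 := by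
  rw [h.tot, mem_totOf]
  constructor
  · tauto
  · intro hh
    have := h.lt v x hh.2.2.1
    exact ⟨by omega, hh⟩

theorem Wf.tot_lt (h : Wf n s M) {x y v : ℕ} (hv : v ∈ M.tot x y) : v < x ∧ v < y ∧ x < n ∧ y < n := by
  obtain ⟨-, -, h1, h2⟩ := h.mem_tot.1 hv
  exact ⟨(h.lt _ _ h1).1, (h.lt _ _ h2).1, (h.lt _ _ h1).2, (h.lt _ _ h2).2⟩

theorem Wf.act_lt (h : Wf n s M) {x y v : ℕ} (hv : v ∈ M.act x y) : v < x ∧ v < y ∧ x < n ∧ y < n :=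
  h.tot_lt (h.act x y hv)

theorem baseOf_le (s : ℕ) (st cen : ℕ → ℕ → ℕ) (v a : ℕ) : baseOf s st cen v a ≤ 2 := by
  unfold baseOf; split_ifs <;> omega

theorem Wf.log (h : Wf n s M) {q a : ℕ} (ha : a < n) (bit : ℕ → ℕ) :
    Wf n s (logAbs s q a bit M) := by
  refine ⟨h.lt, h.le, h.tot, h.act, h.base, h.cen1, h.cen0, ?_⟩
  intro x j
  simp only [logAbs, upd2]
  split_ifs
  · exact ha
  · exact h.la x j

theorem Wf.insert (h : Wf n s M) {q v a : ℕ} (hva : v < a) (ha : a < n) (h0 : M.st v a = 0) :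
    Wf n s (insAbs n s q v a M) := by
  refine Wf.log (M := _) ?_ ha _
  refine ⟨?_, ?_, rfl, ?_, rfl, ?_, ?_, h.la⟩
  · intro v' a'
    have := h.lt v' a'
    simp only [upd2]
    split_ifs with hh
    · intro _; omega
    · exact this
  · intro v' a'
    have := h.le v' a'
    simp only [upd2]
    split_ifs <;> omega
  · intro x y u hu
    have h1 := h.mem_tot.1 (h.act x y hu)
    have h2 := h.act_lt hu
    refine mem_totOf.2 ⟨by omega, h1.1, h1.2.1, ?_, ?_⟩
    · simp only [upd2]; split_ifs; exacts [one_ne_zero, h1.2.2.1]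
    · simp only [upd2]; split_ifs; exacts [one_ne_zero, h1.2.2.2]
  · intro u i c hc
    obtain ⟨h1, h2⟩ := h.cen1 u i c hc
    refine ⟨h1, ?_⟩
    simp only [upd2]
    rw [if_neg]
    · exact h2
    · rintro ⟨rfl, rfl⟩; omega
  · intro u c hc
    have := h.cen0 u c hc
    simp only [upd2]
    split_ifs
    · omega
    · exact this

theorem Wf.delete (h : Wf n s M) (hs : 0 < s) {q v a : ℕ} (y : Tok) (ha : a < n) :
    Wf n s (delAbs n s q v a y M) := by
  refine Wf.log (M := _) ?_ ha _
  refine ⟨?_, ?_, rfl, ?_, rfl, ?_, ?_, h.la⟩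
  · intro v' a'
    have := h.lt v' a'
    simp only [upd2]
    split_ifs with hh
    · intro h; exact absurd rfl h
    · exact this
  · intro v' a'
    have := h.le v' a'
    simp only [upd2]
    split_ifs <;> omega
  · intro x y u hu
    have hu' : u ∈ M.act x y := by
      simp only [delAct] at hu
      split_ifs at hu
      · exact Finset.mem_of_mem_erase hu
      · exact hu
    have h1 := h.mem_tot.1 (h.act x y hu')
    have h2 := h.act_lt hu'
    have h3 : ∀ z, z = x ∨ z = y → ¬ (u = v ∧ z = a) := by
      rintro z hz ⟨rfl, rfl⟩
      simp only [delAct] at hu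
      rw [if_pos (by tauto)] at hu
      simp at hu
    refine mem_totOf.2 ⟨by omega, h1.1, h1.2.1, ?_, ?_⟩
    · simp only [upd2]; rw [if_neg (h3 x (Or.inl rfl))]; exact h1.2.2.1
    · simp only [upd2]; rw [if_neg (h3 y (Or.inr rfl))]; exact h1.2.2.2
  · intro u i c hc
    have key : M.cen u i = c + 1 → ¬ (u = v ∧ c = a) →
        c / s = i ∧ upd2 M.st v a 0 u c = 3 := by
      intro hc hne
      obtain ⟨h1, h2⟩ := h.cen1 u i c hc
      simp only [upd2, hne, if_false]
      exact ⟨h1, h2⟩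
    simp only [delCen] at hc
    split_ifs at hc with h1
    · simp only [upd2] at hc
      split_ifs at hc with h2
      · rcases firstC_eq_succ hc with h3 | ⟨-, j, hj, rfl, h3⟩
        · omega
        · rw [h2.1, h2.2]
          exact ⟨bucket_div hj, h3⟩
      · refine key hc ?_
        rintro ⟨rfl, rfl⟩
        exact h2 ⟨rfl, (h.cen1 _ _ _ hc).1.symm⟩
    · refine key hc ?_
      rintro ⟨rfl, rfl⟩
      have h2 := h.cen1 _ _ _ hc
      rw [← h2.1] at hc
      exact h1 hc
  · intro u c hc
    simp only [delCen] at hc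
    split_ifs at hc with h1
    · simp only [upd2] at hc
      split_ifs at hc with h2
      · have h3 := (firstC_eq_zero.1 hc).2 (c % s) (Nat.mod_lt _ hs)
        rw [← bucket_eq h2.2] at h3
        simp only [h2.1]
        exact h3
      · have := h.cen0 u c hc
        simp only [upd2]
        split_ifs
        · omega
        · exact this
    · have := h.cen0 u c hc
      simp only [upd2]
      split_ifs
      · omega
      · exact this

theorem bump_eq_zero {x : ℕ} : bump x = 0 ↔ x = 0 := by
  unfold bump; grind

theorem scanSt_ne_zero {x i j v a : ℕ} {st : ℕ → ℕ → ℕ} :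
    scanSt s x i j st v a ≠ 0 ↔ st v a ≠ 0 := by
  unfold scanSt; split_ifs
  · exact not_congr bump_eq_zero
  · rfl

theorem totOf_scanSt {x i j : ℕ} {st : ℕ → ℕ → ℕ} :
    totOf n s (scanSt s x i j st) = totOf n s st := by
  funext a b
  ext v
  simp only [mem_totOf, scanSt_ne_zero]

theorem Wf.bg (h : Wf n s M) (hs : 0 < s) (q : ℕ) : Wf n s (bgAbs s q M) := by
  refine ⟨?_, ?_, ?_, ?_, rfl, ?_, ?_, h.la⟩
  · intro v a hv
    exact h.lt v a (scanSt_ne_zero.1 hv)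
  · intro v a
    have := h.le v a
    change scanSt s (q / s) (q % s) s M.st v a ≤ 3
    unfold scanSt bump
    split_ifs <;> omega
  · simp only [bgAbs, totOf_scanSt]
    exact h.tot
  · intro x y
    simp only [bgAbs, upd2]
    split_ifs with hh
    · rw [hh.1, hh.2]
    · exact h.act x y
  · intro v i a hc
    have key : M.cen v i = a + 1 → a / s = i ∧ scanSt s (q / s) (q % s) s M.st v a = 3 := by
      intro hc
      obtain ⟨h1, h2⟩ := h.cen1 v i a hc
      refine ⟨h1, ?_⟩
      simp [scanSt, bump, h2]
    simp only [bgAbs, upd2] at hc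
    split_ifs at hc with hh
    · rcases firstC_eq_succ hc with h3 | ⟨-, j, hj, rfl, h3⟩
      · rw [← hh.1, ← hh.2] at h3; exact key h3
      · rw [hh.1, hh.2]
        refine ⟨bucket_div hj, ?_⟩
        simp [bgAbs, scanSt, bucket_div hj, Nat.mod_lt _ hs, h3, bump]
    · exact key hc
  · intro v a hc
    simp only [bgAbs, upd2] at hc
    simp only [bgAbs, scanSt]
    split_ifs at hc with hh
    · obtain ⟨h1, h2⟩ := firstC_eq_zero.1 hc
      have h3 := h2 (a % s) (Nat.mod_lt _ hs)
      rw [← bucket_eq hh.2, ← hh.1] at h3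
      have h4 := h.cen0 v a (by rw [hh.1, hh.2]; exact h1)
      rw [if_pos ⟨hh.1, hh.2, Nat.mod_lt _ hs⟩]
      unfold bump
      split_ifs <;> omega
    · rw [if_neg (by tauto)]
      exact h.cen0 v a hc

end Wf

/-! ### Programs for updates -/

/-- Count the variable `j` from `0` to the value of `e`. -/
def forC (j : ℕ) (e : Expr) (body : Cmd) : Cmd := .seq (.assign j zE) (forLoop j e body)

/-- Element number `var j` of the bucket of the value of `e`. -/
def buE (e : Expr) : Expr := .plus (.times (.op .div e (.var 4)) (.var 4)) (.var 14)

/-- The first coordinate of the slot with number `e`. -/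
def dE (e : Expr) : Expr := .op .div e (.var 4)

/-- The second coordinate of the slot with number `e`. -/
def mE (e : Expr) : Expr := .op .mod e (.var 4)

/-- Clear the mark number `var 14` in the current slot of the log, and add the vertex in variable
`8` to the candidates for the pair of the vertex in variable `9` and element number `var 14` of its
bucket, if it is adjacent to that element. -/
def insBodyC : Cmd :=
  .seq (.assign 15 (buE (.var 9))) <|
  .seq (.write (adE 11 (dE (.var 7)) (mE (.var 7)) (.var 14)) zE) <|
  .cond (rdE 1 (.var 8) (.var 15) zE) (.seq (setPairC (.var 9) (.var 15)) appendC) .nop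

/-- Insert the edge between the vertices in variables `8` and `9`. -/
def insC : Cmd :=
  .seq (.write (adE 1 (.var 8) (.var 9) zE) (.const 1)) <|
  .seq (incC (.var 8) (.var 9)) <|
  .seq (forC 14 (.var 4) insBodyC) <|
  .write (adE 10 (dE (.var 7)) (mE (.var 7)) zE) (.var 9)

/-- Remove the candidate in variable `8` for the pair of the vertex in variable `9` and an element
of its bucket. -/
def delBodyC : Cmd :=
  .seq (.assign 15 (buE (.var 9))) <|
  .seq (.write (adE 11 (dE (.var 7)) (mE (.var 7)) (.var 14)) zE) <|
  .cond (rdE 1 (.var 8) (.var 15) zE)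
    (.seq (setPairC (.var 9) (.var 15)) <| .seq removeC <|
      .cond (.op .eq (rdE 5 (.var 20) (.var 21) zE) (.plus (.var 8) (.const 1)))
        (.seq (.write (adE 11 (dE (.var 7)) (mE (.var 7)) (.var 14)) (.const 1)) resampleC) .nop)
    .nop

/-- If the vertex in variable `8` has no center in the bucket and the edge between it and the
vertex in variable `15` has state `3`, then make the latter its center. -/
def fixBodyC : Cmd :=
  .seq (.assign 15 (buE (.var 9))) <|
  .cond (rdE 4 (.var 8) (dE (.var 9)) zE) .nop <|
  .cond (.op .eq (rdE 1 (.var 8) (.var 15) zE) (.const 3))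
    (.seq (.write (adE 4 (.var 8) (dE (.var 9)) zE) (.plus (.var 15) (.const 1)))
      (incC (.var 8) (.var 15))) .nop

/-- Remove the edge between the vertices in variables `8` and `9` itself. -/
def delTailC : Cmd :=
  .cond (.op .eq (rdE 1 (.var 8) (.var 9) zE) (.const 3))
    (.seq (.write (adE 1 (.var 8) (.var 9) zE) zE) <|
     .cond (.op .eq (rdE 4 (.var 8) (dE (.var 9)) zE) (.plus (.var 9) (.const 1)))
      (.seq (.write (adE 4 (.var 8) (dE (.var 9)) zE) zE) <|
       .seq (decC (.var 8) (.var 9)) (forC 14 (.var 4) fixBodyC)) .nop)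
    (.seq (.write (adE 1 (.var 8) (.var 9) zE) zE) (decC (.var 8) (.var 9)))

/-- Delete the edge between the vertices in variables `8` and `9`. -/
def delC : Cmd :=
  .seq (forC 14 (.var 4) delBodyC) <|
  .seq (.write (adE 10 (dE (.var 7)) (mE (.var 7)) zE) (.var 9)) delTailC

section
variable {n : ℕ} {P : Par n} {M : Abs} {σ : State n} {N : ℕ}

theorem ExecS.forC {D w j : ℕ} {e : Expr} {body : Cmd} {m : ℕ} {l} {I : ℕ → State n → Prop}
    (hm : m < 2 ^ w) (hmN : m ≤ N)
    (hI : ∀ i ≤ m, ∀ s, I i s → s.var j = i ∧ e.eval w s = m)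
    (hbody : ∀ i < m, ∀ s, I i s → ExecS D w body s (body.cost N) (l i) fun s' =>
      s'.var j = i ∧ I (i + 1) (s'.setVar j (i + 1)))
    (hs : I 0 (σ.setVar j 0)) :
    ExecS D w (forC j e body) σ ((forC j e body).cost N) (catList l 0 m) (I m) := by
  refine ExecS.seq_nil (ExecS.of_tri (Tri.assign ⟨rfl, ?_⟩))
  rw [show zE.eval w σ = 0 from Nat.zero_mod _]
  exact ExecS.forLoop hm hmN hI hbody hs

theorem catList_nil {α : Type*} (i m : ℕ) : catList (fun _ => ([] : List α)) i m = [] := by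
  induction m generalizing i with
  | zero => rfl
  | succ m ih => simp [catList, ih]

theorem Par.bucket_lt (P : Par n) {a j : ℕ} (ha : a / P.s < P.s) (hj : j < P.s) :
    a / P.s * P.s + j < P.D := by
  unfold Par.D
  nlinarith

theorem Par.div_lt_s (P : Par n) {a : ℕ} (ha : a < n) : a / P.s < P.s :=
  Nat.div_lt_of_lt_mul (lt_of_lt_of_le ha P.n_le)

theorem Par.div_lt (P : Par n) {a : ℕ} (ha : a < n) : a / P.s < P.D :=
  (P.div_lt_s ha).trans_le P.s_le_D

theorem Par.slot_div (P : Par n) {q : ℕ} (hq : q < P.T) : q / P.s < n :=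
  Nat.div_lt_of_lt_mul (by rw [mul_comm]; exact hq)

theorem Par.slot_mod (P : Par n) (q : ℕ) : q % P.s < P.s := Nat.mod_lt _ P.s_pos

theorem Ev.dE {e : Expr} {a : ℕ} (h4 : σ.var 4 = P.s) (h : Ev P σ e a) :
    Ev P σ (dE e) (a / P.s) := fun σ' h' =>
  eval_div (h σ' h') ((congrFun h' 4).trans h4)

theorem Ev.mE {e : Expr} {a : ℕ} (h4 : σ.var 4 = P.s) (h : Ev P σ e a) :
    Ev P σ (mE e) (a % P.s) := fun σ' h' =>
  eval_mod (h σ' h') ((congrFun h' 4).trans h4)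

theorem Ev.buE {e : Expr} {a j : ℕ} (h4 : σ.var 4 = P.s) (h : Ev P σ e a) (hj : σ.var 14 = j)
    (ha : a / P.s < P.s) (hjs : j < P.s) : Ev P σ (buE e) (a / P.s * P.s + j) := fun σ' h' => by
  have := P.bucket_lt ha hjs
  exact eval_add (eval_mul (eval_div (h σ' h') ((congrFun h' 4).trans h4))
    ((congrFun h' 4).trans h4) (P.lt_W' (by omega))) ((congrFun h' 14).trans hj)
    (P.lt_W' (by omega))

theorem Ev.of_eq {τ : State n} {e : Expr} {a : ℕ} (h : Ev P σ e a) (hτ : τ.var = σ.var) :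
    Ev P τ e a := fun σ' h' => h σ' (h'.trans hτ)

theorem Fr.var {k : ℕ} {σ σ' : State n} (h : Fr P k σ σ') {x v : ℕ} (hx : x < k)
    (hv : σ.var x = v) : σ'.var x = v := (h.1 x hx).trans hv

/-- Resampling restores the validity of the witness table at one pair. -/
theorem Rep.resample (h : Rep P M σ) {x y : ℕ} (h20 : σ.var 20 = x) (h21 : σ.var 21 = y)
    (hx : x < P.D) (hy : y < P.D)
    (ht : tokOf P.D σ (x, y) = 0 ∨ tokOf P.D σ (x, y) - 1 < x ∧ tokOf P.D σ (x, y) - 1 < y ∧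
      x < n ∧ y < n)
    (hA : ∀ v ∈ M.act x y, v < x ∧ v < y ∧ x < n ∧ y < n) (hb : ∀ v a, M.base v a ≤ 4)
    (htok : ∀ p : ℕ × ℕ, p.1 < P.D → p.2 < P.D → p ≠ (x, y) → TokAt M (tokOf P.D σ) p)
    {R : State n → Prop}
    (K : ∀ σ', Rep P M σ' → Fr P 22 σ σ' → (∀ p ≠ (x, y), tokOf P.D σ' p = tokOf P.D σ p) →
      (∀ p : ℕ × ℕ, p.1 < P.D → p.2 < P.D → TokAt M (tokOf P.D σ') p) → R σ') :
    ExecS P.D P.w resampleC σ (resampleC.cost N) [((x, y), M.act x y)] R := by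
  refine h.execS_resample h20 h21 hx hy ht hA hb fun σ' r f t1 t2 => K σ' r f t1 ?_
  intro p hp1 hp2
  by_cases hp : p = (x, y)
  · subst hp; exact t2
  · have := htok p hp1 hp2 hp
    unfold TokAt at this ⊢
    rwa [t1 p hp]

theorem Wf.base_le (h : Wf n P.s M) (v a : ℕ) : M.base v a ≤ 2 := by
  rw [h.base]; exact baseOf_le _ _ _ _ _

theorem totOf_ins_of_ne {s v a c : ℕ} {st : ℕ → ℕ → ℕ} {x y : ℕ}
    (h : ∀ b, b / s = a / s → (x, y) ≠ pr a b) :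
    totOf n s (upd2 st v a c) x y = totOf n s st x y := by
  ext u
  rw [mem_totOf, mem_totOf]
  by_cases hxy : x ≤ y ∧ x / s = y / s
  · have hx : x ≠ a := fun hh => by
      obtain ⟨b, hb, hb'⟩ := eq_pr_of (a := a) hxy.1 hxy.2 (Or.inl hh)
      exact h b hb hb'
    have hy : y ≠ a := fun hh => by
      obtain ⟨b, hb, hb'⟩ := eq_pr_of (a := a) hxy.1 hxy.2 (Or.inr hh)
      exact h b hb hb'
    simp [upd2, hx, hy]
  · tauto

theorem min_max_div {s a b : ℕ} (h : b / s = a / s) : min a b / s = max a b / s := by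
  rcases le_total a b with hab | hab <;> simp [hab, h]

/-- Candidates for the pair of `a` and `b` after a change of the state of `(v, a)`. -/
theorem mem_totOf_pr {s : ℕ} {st : ℕ → ℕ → ℕ} {a b u : ℕ} (hb : b / s = a / s) :
    u ∈ totOf n s st (min a b) (max a b) ↔ u < n ∧ st u a ≠ 0 ∧ st u b ≠ 0 := by
  rw [mem_totOf]
  have h1 : min a b ≤ max a b := min_le_max
  have h2 := min_max_div hb
  rcases le_total a b with hab | hab <;> simp [hab, hb] <;> tauto

theorem Ok.of_rep {M' : Abs} {σ' : State n} (h : Ok P M σ) (r : Rep P M' σ') (hw : Wf n P.s M')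
    (hact : M'.act = M.act) (ht : tokOf P.D σ' = tokOf P.D σ) : Ok P M' σ' := by
  refine ⟨r, hw, fun p h1 h2 => ?_⟩
  have := h.tok p h1 h2
  unfold TokAt at this ⊢
  rwa [hact, ht]

/-- Abstract data in the middle of an insertion. -/
noncomputable def insMid (P : Par n) (q v a i : ℕ) (M : Abs) : Abs :=
  { M with
    st := upd2 M.st v a 1
    base := upd2 M.base v a (M.base v a + 1)
    tot := ptot M.tot (totOf n P.s (upd2 M.st v a 1)) a P.s i
    bt := upd2 M.bt (q / P.s) (q % P.s) fun j => if j < i then 0 else M.bt (q / P.s) (q % P.s) j }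

theorem upd2_upd2 {α : Type*} (f : ℕ → ℕ → α) (i j : ℕ) (u v : α) :
    upd2 (upd2 f i j u) i j v = upd2 f i j v := by
  funext x y; unfold upd2; split_ifs <;> rfl

theorem upd2_eq_self {α : Type*} (f : ℕ → ℕ → α) (i j : ℕ) : upd2 f i j (f i j) = f := by
  funext x y; unfold upd2; split_ifs with h
  · rw [h.1, h.2]
  · rfl

theorem update_lt_succ {i v : ℕ} {f g : ℕ → ℕ} (hv : f i = v) :
    Function.update (fun j => if j < i then f j else g j) i v =
      fun j => if j < i + 1 then f j else g j := by
  funext j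
  by_cases h : j = i
  · subst h; simp [hv]
  · rw [Function.update_of_ne h]
    split_ifs <;> first | rfl | omega

/-- One iteration of the loop over the bucket of `a` in the insertion of the edge `(v, a)`. -/
theorem insMid_step (hwf : Wf n P.s M) {q v a i : ℕ} (hva : v < a) (ha : a < n)
    (h0 : M.st v a = 0) (hi : i < P.s)
    (τ : State n) (r : Rep P (insMid P q v a i M) τ) (h7 : τ.var 7 = q) (hq : q < P.T)
    (h8 : τ.var 8 = v) (h9 : τ.var 9 = a) (h14 : τ.var 14 = i) {R : State n → Prop}
    (K : ∀ τ', Rep P (insMid P q v a (i + 1) M) τ' → Fr P 15 τ τ' →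
      tokOf P.D τ' = tokOf P.D τ → R τ') :
    Tri P.w insBodyC τ (insBodyC.cost N) R := by
  have hD := P.D_pos
  have hn := P.n_le_D
  have hs := P.s_le_D
  have hb := P.bucket_lt (P.div_lt_s ha) hi
  have hq1 := P.slot_div hq
  have hq2 := P.slot_mod q
  have hbd : (a / P.s * P.s + i) / P.s = a / P.s := bucket_div hi
  set b := a / P.s * P.s + i with hbdef
  refine Tri.seq (Tri.assign ?_)
  rw [(Ev.buE r.v4 (Ev.var h9) h14 (P.div_lt_s ha) hi).self]
  have r1 : Rep P (insMid P q v a i M) (τ.setVar 15 b) := r.setVar (by omega)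
  have f1 : Fr P 15 τ (τ.setVar 15 b) := (Fr.refl P 15 τ).of_setVar (by omega)
  have v15 : (τ.setVar 15 b).var 15 = b := by simp [State.setVar]
  have t1 : tokOf P.D (τ.setVar 15 b) = tokOf P.D τ := rfl
  rw [← hbdef]
  set τ₁ := τ.setVar 15 b
  clear_value τ₁
  have w7 : Ev P τ₁ (.var 7) q := Ev.var (f1.var (by omega) h7)
  have w8 : Ev P τ₁ (.var 8) v := Ev.var (f1.var (by omega) h8)
  have w9 : Ev P τ₁ (.var 9) a := Ev.var (f1.var (by omega) h9)
  have w15 : Ev P τ₁ (.var 15) b := Ev.var v15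
  refine Tri.seq (Tri.write ?_)
  rw [eval_adE r1.v5 (by omega) (w7.dE r1.v4).self (w7.mE r1.v4).self
    (eval_var (f1.var (by omega) h14)) (by omega) (by omega) (by omega), eval_zE]
  have r2 := r1.setMem (k := 11) (i := q / P.s) (j := q % P.s) (l := i) (v := 0) (by omega)
    (by omega) (by omega) (Or.inr (Or.inr (Or.inr ⟨rfl, rfl⟩)))
  have f2 : Fr P 15 τ (τ₁.setMem (addr P.D 11 (q / P.s) (q % P.s) i) 0) := f1.setMem (by omega)
  have t2 := tokOf_setMem_of_ne (P := P) (σ := τ₁) (k := 11) (i := q / P.s) (j := q % P.s) (l := i)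
    (v := 0) (by omega) (by omega) (by omega) (by omega)
  rw [t1] at t2
  have hvar : (τ₁.setMem (addr P.D 11 (q / P.s) (q % P.s) i) 0).var = τ₁.var := rfl
  set τ₂ := τ₁.setMem (addr P.D 11 (q / P.s) (q % P.s) i) 0
  clear_value τ₂
  have e1 : (rdE 1 (.var 8) (.var 15) zE).eval P.w τ₂ = upd2 M.st v a 1 v b := by
    rw [eval_rdE r2.v5 (by omega) (w8 _ hvar) (w15 _ hvar) eval_zE (by omega) hb hD,
      r2.st _ (by omega) _ hb]
    rfl
  have hbt : ∀ M' : Abs, M'.bt = (insMid P q v a i M).bt →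
      upd2 M'.bt (q / P.s) (q % P.s) (Function.update (M'.bt (q / P.s) (q % P.s)) i 0) =
      (insMid P q v a (i + 1) M).bt := by
    intro M' hM'
    rw [hM']
    simp only [insMid, upd2_self, upd2_upd2]
    rw [update_lt_succ (f := fun _ => 0) rfl]
  have htot0 : (insMid P q v a i M).tot (min a b) (max a b) = totOf n P.s M.st (min a b) (max a b) := by
    simp only [insMid]
    rw [ptot_at hi, hwf.tot]
  have htot1 : (insMid P q v a (i + 1) M).tot = upd2 (insMid P q v a i M).tot (min a b) (max a b)
      (totOf n P.s (upd2 M.st v a 1) (min a b) (max a b)) := by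
    simp only [insMid]
    rw [ptot_succ hi]
  refine Tri.cond ?_ ?_ <;> rw [e1] <;> intro hst
  · have hbn : v < b ∧ b < n := by
      simp only [upd2] at hst
      split_ifs at hst with hh
      · omega
      · exact hwf.lt v b hst
    refine Tri.seq (tri_setPair (x := a) (y := b) (w9 _ hvar) (w15 _ hvar) (fun u => ?_)
      (fun u => ?_) ?_)
    · exact (congrFun hvar 9).trans w9.self
    · exact (congrFun hvar 15).trans w15.self
    · set τ₃ := (τ₂.setVar 20 (min a b)).setVar 21 (max a b) with hτ₃
      have r3 : Rep P _ τ₃ := (r2.setVar (x := 20) (v := min a b) (by omega)).setVar (x := 21)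
        (v := max a b) (by omega)
      have hvt : v ∉ (insMid P q v a i M).tot (min a b) (max a b) := by
        rw [htot0, mem_totOf_pr hbd]
        tauto
      refine r3.tri_append (x := min a b) (y := max a b) (v := v) (by simp [hτ₃, State.setVar])
        (by simp [hτ₃, State.setVar]) ((congrFun hvar 8).trans w8.self) (by omega) (by omega)
        (by omega) hvt fun τ₄ r4 f4 t4 => ?_
      refine K τ₄ ?_ ?_ (t4.trans t2)
      · have : insert v ((insMid P q v a i M).tot (min a b) (max a b)) =
            totOf n P.s (upd2 M.st v a 1) (min a b) (max a b) := by
          rw [htot0]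
          ext u
          rw [Finset.mem_insert, mem_totOf_pr hbd, mem_totOf_pr hbd]
          have := hwf.lt v a
          simp only [upd2] at hst ⊢
          grind
        rw [this, ← htot1, hbt _ rfl] at r4
        exact r4
      · exact (f2.trans (((Fr.refl P 15 τ₂).of_setVar (by omega)).of_setVar (by omega))).trans
          (f4.mono (by omega))
  · refine Tri.nop (K τ₂ ?_ f2 t2)
    have : (insMid P q v a i M).tot (min a b) (max a b) =
        totOf n P.s (upd2 M.st v a 1) (min a b) (max a b) := by
      rw [htot0]
      ext u
      rw [mem_totOf_pr hbd, mem_totOf_pr hbd]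
      simp only [upd2] at hst ⊢
      grind
    rw [← this, upd2_eq_self] at htot1
    rw [hbt _ rfl] at r2
    have h2 : insMid P q v a (i + 1) M =
        { insMid P q v a i M with
          tot := (insMid P q v a (i + 1) M).tot
          bt := (insMid P q v a (i + 1) M).bt } := rfl
    rw [h2, htot1]
    exact r2

end

section
variable {n : ℕ} {P : Par n} {M : Abs} {σ : State n} {N : ℕ}

theorem tokOf_of_lt {D x y : ℕ} (hx : x < D) (hy : y < D) :
    tokOf D σ (x, y) = σ.mem (addr D 5 x y 0) := by
  simp [tokOf, hx, hy]

theorem insMid_zero (q v a : ℕ) : insMid P q v a 0 M =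
    { M with st := upd2 M.st v a 1, base := upd2 M.base v a (M.base v a + 1) } := by
  simp only [insMid, ptot_zero, Nat.not_lt_zero, if_false]
  rw [upd2_eq_self]

theorem insMid_full (hwf : Wf n P.s M) {q v a : ℕ} (h0 : M.st v a = 0) :
    { insMid P q v a P.s M with la := upd2 M.la (q / P.s) (q % P.s) a } = insAbs n P.s q v a M := by
  have h1 : ptot M.tot (totOf n P.s (upd2 M.st v a 1)) a P.s P.s =
      totOf n P.s (upd2 M.st v a 1) := ptot_full P.s_pos fun x y hxy => by
    rw [hwf.tot, totOf_ins_of_ne hxy]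
  have h2 : upd2 M.base v a (M.base v a + 1) = baseOf P.s (upd2 M.st v a 1) M.cen := by
    rw [hwf.base]
    funext u c
    have := hwf.cen1 v (a / P.s) a
    simp only [upd2, baseOf]
    grind
  simp only [insMid, insAbs, logAbs, h1, h2]

theorem Ok.insert (h : Ok P M σ) {q v a : ℕ} (hva : v < a) (ha : a < n) (h0 : M.st v a = 0)
    (h7 : σ.var 7 = q) (hq : q < P.T) (h8 : σ.var 8 = v) (h9 : σ.var 9 = a) (hN : P.s ≤ N) :
    ExecS P.D P.w insC σ (insC.cost N) [] fun σ' => Ok P (insAbs n P.s q v a M) σ' ∧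
      Fr P 14 σ σ' := by
  have hD := P.D_pos
  have hn := P.n_le_D
  have hs := P.s_le_D
  have r0 := h.rep
  have hq1 := P.slot_div hq
  have hq2 := P.slot_mod q
  refine ExecS.seq_nil (ExecS.of_tri (Tri.write ?_))
  rw [eval_adE r0.v5 (by omega) (eval_var h8) (eval_var h9) eval_zE (by omega) (by omega) hD,
    eval_const P.one_lt_W]
  have r1 := r0.setMem (k := 1) (i := v) (j := a) (l := 0) (v := 1) (by omega) (by omega) hD
    (Or.inl ⟨rfl, rfl, rfl⟩)
  have f1 : Fr P 14 σ (σ.setMem (addr P.D 1 v a 0) 1) := (Fr.refl P 14 σ).setMem (by omega)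
  have t1 := tokOf_setMem_of_ne (P := P) (σ := σ) (k := 1) (i := v) (j := a) (l := 0) (v := 1)
    (by omega) (by omega) (by omega) hD
  set σ₁ := σ.setMem (addr P.D 1 v a 0) 1
  refine ⟨t1, ExecS.seq_nil (ExecS.of_tri (r1.tri_inc (Ev.var (f1.var (by omega) h8))
    (Ev.var (f1.var (by omega) h9)) hva ha ((h.wf.base_le v a).trans (by omega))
    fun σ₂ r2 w2 f2 t2 _ => ⟨t2, ?_⟩))⟩
  refine ExecS.seq' (l₁ := []) ((ExecS.forC (m := P.s) (l := fun _ => []) (P.lt_W' (by omega)) hN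
    (I := fun i τ => Rep P (insMid P q v a i M) τ ∧ Fr P 14 σ τ ∧ τ.var 14 = i ∧
      tokOf P.D τ = tokOf P.D σ) ?_ ?_ ?_).imp ?_ |> fun hh => by rwa [catList_nil] at hh)
  · rintro i - τ ⟨r, -, h14, -⟩
    exact ⟨h14, r.v4⟩
  · rintro i hi τ ⟨r, f, h14, t⟩
    refine ExecS.of_tri (insMid_step h.wf hva ha h0 hi τ r (f.var (by omega) h7) hq
      (f.var (by omega) h8) (f.var (by omega) h9) h14 fun τ' r' f' t' =>
      ⟨t', f'.var (by omega) h14, r'.setVar (by omega), ?_, by simp [State.setVar], ?_⟩)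
    · exact (f.trans (f'.mono (by omega))).of_setVar (by omega)
    · exact t'.trans t
  · refine ⟨?_, (f1.trans (f2 14)).of_setVar (by omega), by simp [State.setVar], t2.trans t1⟩
    rw [insMid_zero]
    exact r2.setVar (by omega)
  · rintro τ ⟨r, f, -, t⟩
    refine ExecS.of_tri (Tri.write ?_)
    have h7' := Ev.var (P := P) (f.var (by omega) h7)
    rw [eval_adE r.v5 (by omega) (h7'.dE r.v4).self (h7'.mE r.v4).self eval_zE (by omega)
      (by omega) hD, eval_var (f.var (by omega) h9)]
    have r' := r.setMem (k := 10) (i := q / P.s) (j := q % P.s) (l := 0) (v := a) (by omega)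
      (by omega) hD (Or.inr (Or.inr (Or.inl ⟨rfl, rfl, rfl⟩)))
    have t' := tokOf_setMem_of_ne (P := P) (σ := τ) (k := 10) (i := q / P.s) (j := q % P.s) (l := 0)
      (v := a) (by omega) (by omega) (by omega) hD
    refine ⟨t', h.of_rep ?_ (h.wf.insert hva ha h0) rfl (t'.trans t), f.setMem (by omega)⟩
    rw [← insMid_full h.wf h0]
    exact r'

/-- Abstract data in the middle of the removal of candidates. -/
noncomputable def delMid (P : Par n) (q v a : ℕ) (y : Tok) (i : ℕ) (M : Abs) : Abs :=
  { M with
    tot := ptot M.tot (totOf n P.s (upd2 M.st v a 0)) a P.s i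
    act := ptot M.act (delAct v a M) a P.s i
    bt := upd2 M.bt (q / P.s) (q % P.s) fun j =>
      if j < i then (if Lost P.s v a M y j then 1 else 0) else M.bt (q / P.s) (q % P.s) j }

theorem delAct_pr (v a b : ℕ) (M : Abs) : delAct v a M (min a b) (max a b) =
    (M.act (min a b) (max a b)).erase v := by
  unfold delAct
  rw [if_pos]
  rcases le_total a b with h | h <;> simp [h]

theorem delAct_subset (v a : ℕ) (M : Abs) (x y : ℕ) : delAct v a M x y ⊆ M.act x y := by
  unfold delAct; split_ifs
  · exact Finset.erase_subset _ _
  · rfl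

theorem delMid_act_subset (q v a : ℕ) (y : Tok) (i : ℕ) (x z : ℕ) :
    (delMid P q v a y i M).act x z ⊆ M.act x z := by
  simp only [delMid, ptot]
  split_ifs
  · exact delAct_subset _ _ _ _ _
  · rfl

/-- One iteration of the loop over the bucket of `a` in the deletion of the edge `(v, a)`. The loop
can resample a witness only after the pair has lost it, since its candidates are changed at that
time. -/
theorem delMid_step (hwf : Wf n P.s M) {q v a i : ℕ} {y : Tok} (hva : v < a) (ha : a < n)
    (h0 : M.st v a ≠ 0) (hi : i < P.s)
    (τ : State n) (r : Rep P (delMid P q v a y i M) τ) (h7 : τ.var 7 = q) (hq : q < P.T)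
    (h8 : τ.var 8 = v) (h9 : τ.var 9 = a) (h14 : τ.var 14 = i)
    (hy : tokOf P.D τ (pr a (a / P.s * P.s + i)) = y (pr a (a / P.s * P.s + i)))
    (ht : ∀ p : ℕ × ℕ, p.1 < P.D → p.2 < P.D → TokAt (delMid P q v a y i M) (tokOf P.D τ) p)
    {R : State n → Prop}
    (K : ∀ τ', Rep P (delMid P q v a y (i + 1) M) τ' → Fr P 15 τ τ' →
      (∀ p ≠ pr a (a / P.s * P.s + i), tokOf P.D τ' p = tokOf P.D τ p) →
      (∀ p : ℕ × ℕ, p.1 < P.D → p.2 < P.D →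
        TokAt (delMid P q v a y (i + 1) M) (tokOf P.D τ') p) → R τ') :
    ExecS P.D P.w delBodyC τ (delBodyC.cost N) (if Lost P.s v a M y i then
      [(pr a (a / P.s * P.s + i), delAct v a M (pr a (a / P.s * P.s + i)).1
        (pr a (a / P.s * P.s + i)).2)] else []) R := by
  have hD := P.D_pos
  have hn := P.n_le_D
  have hs := P.s_le_D
  have hb := P.bucket_lt (P.div_lt_s ha) hi
  have hq1 := P.slot_div hq
  have hq2 := P.slot_mod q
  have hbd : (a / P.s * P.s + i) / P.s = a / P.s := bucket_div hi
  have hL : Lost P.s v a M y i ↔ M.st v (a / P.s * P.s + i) ≠ 0 ∧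
    y (pr a (a / P.s * P.s + i)) = v + 1 := Iff.rfl
  have htot0 : (delMid P q v a y i M).tot (min a (a / P.s * P.s + i)) (max a (a / P.s * P.s + i)) =
      totOf n P.s M.st (min a (a / P.s * P.s + i)) (max a (a / P.s * P.s + i)) := by
    simp only [delMid]
    rw [ptot_at hi, hwf.tot]
  have hact0 : (delMid P q v a y i M).act (min a (a / P.s * P.s + i)) (max a (a / P.s * P.s + i)) =
      M.act (min a (a / P.s * P.s + i)) (max a (a / P.s * P.s + i)) := by
    simp only [delMid]
    rw [ptot_at hi]
  have htot1 : (delMid P q v a y (i + 1) M).tot =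
      upd2 (delMid P q v a y i M).tot (min a (a / P.s * P.s + i)) (max a (a / P.s * P.s + i))
      (totOf n P.s (upd2 M.st v a 0) (min a (a / P.s * P.s + i)) (max a (a / P.s * P.s + i))) := by
    simp only [delMid]
    rw [ptot_succ hi]
  have hact1 : (delMid P q v a y (i + 1) M).act =
      upd2 (delMid P q v a y i M).act (min a (a / P.s * P.s + i)) (max a (a / P.s * P.s + i))
      ((M.act (min a (a / P.s * P.s + i)) (max a (a / P.s * P.s + i))).erase v) := by
    simp only [delMid]
    rw [ptot_succ hi, delAct_pr]
  have hlost1 : ∀ M' : Abs, M'.bt = (delMid P q v a y i M).bt → ∀ c,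
      (if Lost P.s v a M y i then 1 else 0) = c →
      upd2 M'.bt (q / P.s) (q % P.s) (Function.update (M'.bt (q / P.s) (q % P.s)) i c) =
      (delMid P q v a y (i + 1) M).bt := by
    intro M' hM' c hc
    rw [hM']
    simp only [delMid, upd2_self, upd2_upd2]
    rw [update_lt_succ (f := fun j => if Lost P.s v a M y j then 1 else 0) hc]
  have hmid : delMid P q v a y (i + 1) M =
      { delMid P q v a y i M with
        tot := (delMid P q v a y (i + 1) M).tot
        act := (delMid P q v a y (i + 1) M).act
        bt := (delMid P q v a y (i + 1) M).bt } := rfl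
  refine ExecS.seq_nil (ExecS.of_tri (Tri.assign ⟨rfl, ?_⟩))
  rw [(Ev.buE r.v4 (Ev.var h9) h14 (P.div_lt_s ha) hi).self]
  set b := a / P.s * P.s + i with hbdef
  clear_value b
  have hpr : pr a b = (min a b, max a b) := rfl
  have r1 : Rep P (delMid P q v a y i M) (τ.setVar 15 b) := r.setVar (by omega)
  have f1 : Fr P 15 τ (τ.setVar 15 b) := (Fr.refl P 15 τ).of_setVar (by omega)
  have v15 : (τ.setVar 15 b).var 15 = b := by simp [State.setVar]
  have t1 : tokOf P.D (τ.setVar 15 b) = tokOf P.D τ := rfl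
  set τ₁ := τ.setVar 15 b
  clear_value τ₁
  have w7 : Ev P τ₁ (.var 7) q := Ev.var (f1.var (by omega) h7)
  have w8 : Ev P τ₁ (.var 8) v := Ev.var (f1.var (by omega) h8)
  have w9 : Ev P τ₁ (.var 9) a := Ev.var (f1.var (by omega) h9)
  have w15 : Ev P τ₁ (.var 15) b := Ev.var v15
  have w14 : Ev P τ₁ (.var 14) i := Ev.var (f1.var (by omega) h14)
  refine ExecS.seq_nil (ExecS.of_tri (Tri.write ?_))
  rw [eval_adE r1.v5 (by omega) (w7.dE r1.v4).self (w7.mE r1.v4).self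
    w14.self (by omega) (by omega) (by omega), eval_zE]
  have r2 := r1.setMem (k := 11) (i := q / P.s) (j := q % P.s) (l := i) (v := 0) (by omega)
    (by omega) (by omega) (Or.inr (Or.inr (Or.inr ⟨rfl, rfl⟩)))
  have f2 : Fr P 15 τ (τ₁.setMem (addr P.D 11 (q / P.s) (q % P.s) i) 0) := f1.setMem (by omega)
  have t2 := tokOf_setMem_of_ne (P := P) (σ := τ₁) (k := 11) (i := q / P.s) (j := q % P.s) (l := i)
    (v := 0) (by omega) (by omega) (by omega) (by omega)
  refine ⟨t2, ?_⟩
  rw [t1] at t2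
  have hvar : (τ₁.setMem (addr P.D 11 (q / P.s) (q % P.s) i) 0).var = τ₁.var := rfl
  set τ₂ := τ₁.setMem (addr P.D 11 (q / P.s) (q % P.s) i) 0
  clear_value τ₂
  have e1 : (rdE 1 (.var 8) (.var 15) zE).eval P.w τ₂ = M.st v b := by
    rw [eval_rdE r2.v5 (by omega) (w8 _ hvar) (w15 _ hvar) eval_zE (by omega) hb hD,
      r2.st _ (by omega) _ hb]
    rfl
  refine ExecS.cond ?_ ?_ <;> rw [e1] <;> intro hst
  · obtain ⟨hvb, hbn⟩ := hwf.lt v b hst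
    refine ExecS.seq_nil (ExecS.of_tri (tri_setPair (x := a) (y := b) (w9 _ hvar) (w15 _ hvar)
      (fun u => ?_) (fun u => ?_) ⟨rfl, ?_⟩))
    · exact (congrFun hvar 9).trans w9.self
    · exact (congrFun hvar 15).trans w15.self
    set τ₃ := (τ₂.setVar 20 (min a b)).setVar 21 (max a b) with hτ₃
    have r3 : Rep P _ τ₃ := (r2.setVar (x := 20) (v := min a b) (by omega)).setVar (x := 21)
      (v := max a b) (by omega)
    have hvt : v ∈ (delMid P q v a y i M).tot (min a b) (max a b) := by
      rw [htot0, mem_totOf_pr hbd]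
      exact ⟨by omega, h0, hst⟩
    have v20 : τ₃.var 20 = min a b := by simp [hτ₃, State.setVar]
    have v21 : τ₃.var 21 = max a b := by simp [hτ₃, State.setVar]
    have f3 : Fr P 15 τ τ₃ :=
      f2.trans (((Fr.refl P 15 τ₂).of_setVar (by omega)).of_setVar (by omega))
    have t3 : tokOf P.D τ₃ = tokOf P.D τ := t2
    have x7 : τ₃.var 7 = q := (congrFun hvar 7).trans w7.self
    have x8 : τ₃.var 8 = v := (congrFun hvar 8).trans w8.self
    have x14 : τ₃.var 14 = i := (congrFun hvar 14).trans w14.self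
    clear_value τ₃
    refine ExecS.seq_nil (ExecS.of_tri (r3.tri_remove v20 v21 x8 (by omega) (by omega) hvt
      fun τ₄ r4 f4 t4 => ⟨t4, ?_⟩))
    rw [t3] at t4
    have htot2 : ((delMid P q v a y i M).tot (min a b) (max a b)).erase v =
        totOf n P.s (upd2 M.st v a 0) (min a b) (max a b) := by
      rw [htot0]
      ext u
      rw [Finset.mem_erase, mem_totOf_pr hbd, mem_totOf_pr hbd]
      simp only [upd2]
      grind
    have r4' : Rep P { delMid P q v a y (i + 1) M with
        bt := upd2 (delMid P q v a y i M).bt (q / P.s) (q % P.s)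
          (Function.update ((delMid P q v a y i M).bt (q / P.s) (q % P.s)) i 0) } τ₄ := by
      have h3 : ((delMid P q v a y i M).act (min a b) (max a b)).erase v =
          (M.act (min a b) (max a b)).erase v := by rw [hact0]
      rw [hmid, htot1, ← htot2, hact1, ← h3]
      exact r4
    have f4' : Fr P 15 τ τ₄ := f3.trans (f4.mono (by omega))
    have g20 := f4.var (by omega) v20
    have g21 := f4.var (by omega) v21
    have e5 : (rdE 5 (.var 20) (.var 21) zE).eval P.w τ₄ = y (pr a b) := by
      rw [eval_rdE r4.v5 (by omega) (eval_var g20) (eval_var g21) eval_zE (by omega) (by omega) hD,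
        ← hy, ← t4, hpr, tokOf_of_lt (by omega) (by omega)]
    have e6 : (Expr.plus (.var 8) (.const 1)).eval P.w τ₄ = v + 1 :=
      eval_add (eval_var (f4.var (by omega) x8)) (eval_const P.one_lt_W) (P.lt_W' (by omega))
    have hpa : (M.act (min a b) (max a b)).erase v = (delMid P q v a y (i + 1) M).act (min a b)
      (max a b) := by rw [hact1, upd2_self]
    have hother : ∀ p : ℕ × ℕ, p.1 < P.D → p.2 < P.D → p ≠ pr a b →
        TokAt (delMid P q v a y (i + 1) M) (tokOf P.D τ) p := by
      intro p h1 h2 hp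
      have := ht p h1 h2
      unfold TokAt at this ⊢
      have h3 : (delMid P q v a y (i + 1) M).act p.1 p.2 = (delMid P q v a y i M).act p.1 p.2 := by
        rw [hact1]
        unfold upd2
        rw [if_neg]
        rintro ⟨h3, h4⟩
        exact hp (Prod.ext h3 h4)
      rwa [h3]
    refine ExecS.cond ?_ ?_
    · intro hc
      rw [eval_eq_ne e5 e6] at hc
      have hlost : Lost P.s v a M y i := hL.2 ⟨hst, hc⟩
      rw [if_pos hlost]
      have h7' := Ev.var (P := P) (f4.var (by omega) x7)
      refine ExecS.seq_nil (ExecS.of_tri (Tri.write ?_))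
      rw [eval_adE r4.v5 (by omega) (h7'.dE r4.v4).self (h7'.mE r4.v4).self
        (eval_var (f4.var (by omega) x14)) (by omega) (by omega) (by omega),
        eval_const P.one_lt_W]
      have r5 := r4'.setMem (k := 11) (i := q / P.s) (j := q % P.s) (l := i) (v := 1) (by omega)
        (by omega) (by omega) (Or.inr (Or.inr (Or.inr ⟨rfl, rfl⟩)))
      have t5 := tokOf_setMem_of_ne (P := P) (σ := τ₄) (k := 11) (i := q / P.s) (j := q % P.s)
        (l := i) (v := 1) (by omega) (by omega) (by omega) (by omega)
      refine ⟨t5, ?_⟩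
      rw [t4] at t5
      have f5 : Fr P 15 τ (τ₄.setMem (addr P.D 11 (q / P.s) (q % P.s) i) 1) := f4'.setMem (by omega)
      simp only [upd2_self, upd2_upd2, Function.update_idem] at r5
      have hb' := hlost1 (delMid P q v a y i M) rfl 1 (if_pos hlost)
      rw [hb'] at r5
      have hty : tokOf P.D τ (min a b, max a b) = v + 1 := hy.trans hc
      rw [show delAct v a M (pr a b).1 (pr a b).2 = (delMid P q v a y (i + 1) M).act (min a b)
        (max a b) from (delAct_pr v a b M).trans hpa, hpr]
      refine Rep.resample (M := delMid P q v a y (i + 1) M) r5 g20 g21 (by omega) (by omega) ?_ ?_ ?_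
        ?_ ?_
      · rw [t5, hty]
        exact Or.inr (by omega)
      · intro u hu
        exact hwf.act_lt (delMid_act_subset _ _ _ _ _ _ _ hu)
      · intro u c
        exact (hwf.base_le u c).trans (by omega)
      · intro p h1 h2 hp
        rw [t5]
        exact hother p h1 h2 hp
      · intro τ' r' f' t' ht'
        refine K τ' r' (f5.trans (f'.mono (by omega))) (fun p hp => ?_) ht'
        rw [t' p hp, t5]
    · intro hc
      have hc' := mt (eval_eq_ne e5 e6).2 (not_not.2 hc)
      have hlost : ¬ Lost P.s v a M y i := fun hh => hc' (hL.1 hh).2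
      rw [if_neg hlost]
      have hb' := hlost1 (delMid P q v a y i M) rfl 0 (if_neg hlost)
      rw [hb'] at r4'
      refine ExecS.of_tri (Tri.nop ⟨rfl, K τ₄ r4' f4' (fun p _ => by rw [t4]) ?_⟩)
      intro p h1 h2
      rw [t4]
      by_cases hp : p = pr a b
      · subst hp
        have h3 := ht _ h1 h2
        unfold TokAt at h3 ⊢
        rw [hpr] at h3 ⊢
        simp only at h3 ⊢
        rw [hact0] at h3
        rw [← hpa]
        rcases h3 with ⟨h3, h4⟩ | ⟨u, h3, h4⟩
        · exact Or.inl ⟨by simp [h3], h4⟩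
        · refine Or.inr ⟨u, Finset.mem_erase.2 ⟨?_, h3⟩, h4⟩
          rintro rfl
          exact hc' (hy.symm.trans h4)
      · exact hother p h1 h2 hp
  · have hlost : ¬ Lost P.s v a M y i := fun hh => (hL.1 hh).1 hst
    rw [if_neg hlost]
    have hb' := hlost1 (delMid P q v a y i M) rfl 0 (if_neg hlost)
    have hnot : v ∉ M.tot (min a b) (max a b) := by
      rw [hwf.tot, mem_totOf_pr hbd]
      tauto
    have htot2 : (delMid P q v a y i M).tot (min a b) (max a b) =
        totOf n P.s (upd2 M.st v a 0) (min a b) (max a b) := by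
      rw [htot0]
      ext u
      rw [mem_totOf_pr hbd, mem_totOf_pr hbd]
      simp only [upd2]
      grind
    have h3 : (M.act (min a b) (max a b)).erase v =
        (delMid P q v a y i M).act (min a b) (max a b) := by
      rw [hact0, Finset.erase_eq_of_notMem fun hh => hnot (hwf.act _ _ hh)]
    rw [← htot2, upd2_eq_self] at htot1
    rw [h3, upd2_eq_self] at hact1
    have hrep : Rep P (delMid P q v a y (i + 1) M) τ₂ := by
      rw [hmid, htot1, hact1, ← hb']
      exact r2
    refine ExecS.of_tri (Tri.nop ⟨rfl, K τ₂ hrep f2 (fun p _ => by rw [t2]) ?_⟩)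
    intro p h1 h2
    have := ht p h1 h2
    unfold TokAt at this ⊢
    rwa [hact1, t2]

end

section
variable {n : ℕ} {P : Par n} {M : Abs} {σ : State n} {N : ℕ}

/-- One iteration of the search for a new center of `v` in the bucket of `a`. -/
theorem fix_step {v a i : ℕ} {st cen : ℕ → ℕ → ℕ} (hlt : ∀ v a, st v a ≠ 0 → v < a ∧ a < n)
    (hva : v < a) (ha : a < n) (hi : i < P.s) (τ : State n)
    (r : Rep P { M with
      st := st
      cen := upd2 cen v (a / P.s) (firstC 3 st v (a / P.s * P.s) 0 i)
      base := baseOf P.s st (upd2 cen v (a / P.s) (firstC 3 st v (a / P.s * P.s) 0 i)) } τ)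
    (h8 : τ.var 8 = v) (h9 : τ.var 9 = a) (h14 : τ.var 14 = i) {R : State n → Prop}
    (K : ∀ τ', Rep P { M with
        st := st
        cen := upd2 cen v (a / P.s) (firstC 3 st v (a / P.s * P.s) 0 (i + 1))
        base := baseOf P.s st (upd2 cen v (a / P.s) (firstC 3 st v (a / P.s * P.s) 0 (i + 1))) }
        τ' → Fr P 15 τ τ' → tokOf P.D τ' = tokOf P.D τ → R τ') :
    Tri P.w fixBodyC τ (fixBodyC.cost N) R := by
  have hD := P.D_pos
  have hn := P.n_le_D
  have hb := P.bucket_lt (P.div_lt_s ha) hi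
  have hB := P.div_lt ha
  have hbd : (a / P.s * P.s + i) / P.s = a / P.s := bucket_div hi
  set b := a / P.s * P.s + i with hbdef
  have hsucc : firstC 3 st v (a / P.s * P.s) 0 (i + 1) =
    if firstC 3 st v (a / P.s * P.s) 0 i = 0 ∧ st v b = 3 then b + 1 else
      firstC 3 st v (a / P.s * P.s) 0 i := rfl
  refine Tri.seq (Tri.assign ?_)
  rw [(Ev.buE r.v4 (Ev.var h9) h14 (P.div_lt_s ha) hi).self, ← hbdef]
  have r1 := r.setVar (x := 15) (v := b) (by omega)
  have f1 : Fr P 15 τ (τ.setVar 15 b) := (Fr.refl P 15 τ).of_setVar (by omega)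
  have v15 : (τ.setVar 15 b).var 15 = b := by simp [State.setVar]
  have t1 : tokOf P.D (τ.setVar 15 b) = tokOf P.D τ := rfl
  set τ₁ := τ.setVar 15 b
  clear_value τ₁
  have w8 : Ev P τ₁ (.var 8) v := Ev.var (f1.var (by omega) h8)
  have w9 : Ev P τ₁ (.var 9) a := Ev.var (f1.var (by omega) h9)
  have w15 : Ev P τ₁ (.var 15) b := Ev.var v15
  have e1 : (rdE 4 (.var 8) (dE (.var 9)) zE).eval P.w τ₁ =
      firstC 3 st v (a / P.s * P.s) 0 i := by
    rw [eval_rdE r1.v5 (by omega) w8.self (w9.dE r1.v4).self eval_zE (by omega) (by omega) hD,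
      r1.cen _ (by omega) _ (by omega)]
    exact upd2_self _ _ _ _
  refine Tri.cond ?_ ?_ <;> rw [e1] <;> intro hc
  · rw [if_neg (by tauto)] at hsucc
    rw [hsucc] at K
    exact Tri.nop (K τ₁ r1 f1 t1)
  have e2 : (rdE 1 (.var 8) (.var 15) zE).eval P.w τ₁ = st v b := by
    rw [eval_rdE r1.v5 (by omega) w8.self w15.self eval_zE (by omega) hb hD,
      r1.st _ (by omega) _ hb]
  refine Tri.cond ?_ ?_ <;> intro hc2
  · rw [eval_eq_ne e2 (eval_const (P.lt_W' (by omega)))] at hc2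
    obtain ⟨hvb, hbn⟩ := hlt v b (by omega)
    rw [if_pos ⟨hc, hc2⟩] at hsucc
    rw [hsucc] at K
    refine Tri.seq (Tri.write ?_)
    rw [eval_adE r1.v5 (by omega) w8.self (w9.dE r1.v4).self eval_zE (by omega) (by omega) hD,
      eval_add w15.self (eval_const P.one_lt_W) (P.lt_W' (by omega))]
    have r2 := r1.setMem (k := 4) (i := v) (j := a / P.s) (l := 0) (v := b + 1) (by omega)
      (by omega) hD (Or.inr (Or.inl ⟨rfl, rfl, rfl⟩))
    have f2 : Fr P 15 τ (τ₁.setMem (addr P.D 4 v (a / P.s) 0) (b + 1)) := f1.setMem (by omega)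
    have t2 := tokOf_setMem_of_ne (P := P) (σ := τ₁) (k := 4) (i := v) (j := a / P.s) (l := 0)
      (v := b + 1) (by omega) (by omega) (by omega) hD
    refine r2.tri_inc (fun σ' h' => w8 σ' h') (fun σ' h' => w15 σ' h') hvb hbn
      ((baseOf_le _ _ _ _ _).trans (by omega)) fun τ₃ r3 _ f3 t3 _ => ?_
    refine K τ₃ (r3.of_base_eq ?_ ?_) (f2.trans (f3 15)) (t3.trans (t2.trans t1))
    · intro u c
      simp only [upd2, baseOf, hc]
      clear_value b
      grind
    · simp only [upd2_upd2]
  · have hc2' := mt (eval_eq_ne e2 (eval_const (P.lt_W' (by omega)))).2 (not_not.2 hc2)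
    rw [if_neg (by tauto)] at hsucc
    rw [hsucc] at K
    exact Tri.nop (K τ₁ r1 f1 t1)

theorem Rep.delTail (r : Rep P M σ) (hlt : ∀ v a, M.st v a ≠ 0 → v < a ∧ a < n)
    (hle : ∀ v a, M.st v a ≤ 3)
    (hbase : M.base = baseOf P.s M.st M.cen)
    (hcen : ∀ v i a, M.cen v i = a + 1 → a / P.s = i ∧ M.st v a = 3) {v a : ℕ}
    (h0 : M.st v a ≠ 0) (h8 : σ.var 8 = v) (h9 : σ.var 9 = a) (hN : P.s ≤ N)
    {R : State n → Prop}
    (K : ∀ σ', Rep P { M with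
        st := upd2 M.st v a 0
        cen := delCen P.s v a M
        base := baseOf P.s (upd2 M.st v a 0) (delCen P.s v a M) } σ' → Fr P 14 σ σ' →
        tokOf P.D σ' = tokOf P.D σ → R σ') :
    ExecS P.D P.w delTailC σ (delTailC.cost N) [] R := by
  have hD := P.D_pos
  have hn := P.n_le_D
  have hs := P.s_le_D
  obtain ⟨hva, ha⟩ := hlt v a h0
  have hB := P.div_lt ha
  have h3 := hle v a
  have w8 : Ev P σ (.var 8) v := Ev.var h8
  have w9 : Ev P σ (.var 9) a := Ev.var h9
  have e1 : (rdE 1 (.var 8) (.var 9) zE).eval P.w σ = M.st v a := by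
    rw [eval_rdE r.v5 (by omega) w8.self w9.self eval_zE (by omega) (by omega) hD,
      r.st _ (by omega) _ (by omega)]
  have r1 := r.setMem (k := 1) (i := v) (j := a) (l := 0) (v := 0) (by omega) (by omega) hD
    (Or.inl ⟨rfl, rfl, rfl⟩)
  have f1 : Fr P 14 σ (σ.setMem (addr P.D 1 v a 0) 0) := (Fr.refl P 14 σ).setMem (by omega)
  have t1 := tokOf_setMem_of_ne (P := P) (σ := σ) (k := 1) (i := v) (j := a) (l := 0) (v := 0)
    (by omega) (by omega) (by omega) hD
  have ea : (adE 1 (.var 8) (.var 9) zE).eval P.w σ = addr P.D 1 v a 0 :=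
    eval_adE r.v5 (by omega) w8.self w9.self eval_zE (by omega) (by omega) hD
  have w8' : Ev P (σ.setMem (addr P.D 1 v a 0) 0) (.var 8) v := w8
  have w9' : Ev P (σ.setMem (addr P.D 1 v a 0) 0) (.var 9) a := w9
  have hb0 : M.base v a = baseOf P.s M.st M.cen v a := by rw [hbase]
  have hca := hcen v (a / P.s) a
  refine ExecS.cond ?_ ?_ <;> intro hc
  · rw [eval_eq_ne e1 (eval_const (P.lt_W' (by omega)))] at hc
    refine ExecS.seq_nil (ExecS.of_tri (Tri.write ?_))
    rw [ea, eval_zE]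
    refine ⟨t1, ?_⟩
    set σ₁ := σ.setMem (addr P.D 1 v a 0) 0
    clear_value σ₁
    have e2 : (rdE 4 (.var 8) (dE (.var 9)) zE).eval P.w σ₁ = M.cen v (a / P.s) := by
      rw [eval_rdE r1.v5 (by omega) w8'.self (w9'.dE r1.v4).self eval_zE (by omega) (by omega) hD,
        r1.cen _ (by omega) _ (by omega)]
    have e3 : (Expr.plus (.var 9) (.const 1)).eval P.w σ₁ = a + 1 :=
      eval_add w9'.self (eval_const P.one_lt_W) (P.lt_W' (by omega))
    refine ExecS.cond ?_ ?_ <;> intro hc2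
    · rw [eval_eq_ne e2 e3] at hc2
      simp only [delCen, if_pos hc2] at K
      refine ExecS.seq_nil (ExecS.of_tri (Tri.write ?_))
      rw [eval_adE r1.v5 (by omega) w8'.self (w9'.dE r1.v4).self eval_zE (by omega) (by omega) hD,
        eval_zE]
      have r2 := r1.setMem (k := 4) (i := v) (j := a / P.s) (l := 0) (v := 0) (by omega)
        (by omega) hD (Or.inr (Or.inl ⟨rfl, rfl, rfl⟩))
      have f2 : Fr P 14 σ (σ₁.setMem (addr P.D 4 v (a / P.s) 0) 0) := f1.setMem (by omega)
      have t2 := tokOf_setMem_of_ne (P := P) (σ := σ₁) (k := 4) (i := v) (j := a / P.s) (l := 0)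
        (v := 0) (by omega) (by omega) (by omega) hD
      refine ⟨t2, ExecS.seq_nil (ExecS.of_tri (r2.tri_dec (fun σ' h' => w8' σ' h')
        (fun σ' h' => w9' σ' h') hva ha ?_ fun σ₃ r3 _ f3 t3 _ => ⟨t3, ?_⟩))⟩
      · change 1 ≤ M.base v a
        rw [hb0]
        simp [baseOf, hc2]
      have f3' := f2.trans (f3 14)
      have t3' := t3.trans (t2.trans t1)
      have hl : catList (fun _ => ([] : List ((ℕ × ℕ) × Finset ℕ))) 0 P.s = [] := catList_nil _ _
      rw [← hl]
      refine (ExecS.forC (m := P.s) (l := fun _ => []) (P.lt_W' (by omega)) hN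
        (I := fun i τ => Rep P { M with
          st := upd2 M.st v a 0
          cen := upd2 M.cen v (a / P.s) (firstC 3 (upd2 M.st v a 0) v (a / P.s * P.s) 0 i)
          base := baseOf P.s (upd2 M.st v a 0)
            (upd2 M.cen v (a / P.s) (firstC 3 (upd2 M.st v a 0) v (a / P.s * P.s) 0 i)) } τ ∧
          Fr P 14 σ τ ∧ τ.var 14 = i ∧ tokOf P.D τ = tokOf P.D σ) ?_ ?_ ?_).imp ?_
      · rintro i - τ ⟨r, -, h14, -⟩
        exact ⟨h14, r.v4⟩
      · rintro i hi τ ⟨r, f, h14, t⟩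
        refine ExecS.of_tri (fix_step ?_ hva ha hi τ r (f.var (by omega) h8) (f.var (by omega) h9)
          h14 fun τ' r' f' t' => ⟨t', f'.var (by omega) h14, r'.setVar (by omega), ?_,
          by simp [State.setVar], ?_⟩)
        · intro u c hu
          refine hlt u c ?_
          simp only [upd2] at hu
          split_ifs at hu
          · exact absurd rfl hu
          · exact hu
        · exact (f.trans (f'.mono (by omega))).of_setVar (by omega)
        · exact t'.trans t
      · refine ⟨?_, f3'.of_setVar (by omega), by simp [State.setVar], t3'⟩
        refine Rep.setVar (r3.of_base_eq ?_ ?_) (by omega)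
        · intro u c
          simp only [upd2, baseOf, firstC, hbase]
          grind
        · rfl
      · rintro τ ⟨r, f, -, t⟩
        exact K τ r f t
    · have hc2' := mt (eval_eq_ne e2 e3).2 (not_not.2 hc2)
      simp only [delCen, if_neg hc2'] at K
      refine ExecS.of_tri (Tri.nop ⟨rfl, K _ (r1.of_base_eq ?_ rfl) f1 t1⟩)
      intro u c
      simp only [upd2, baseOf, hbase]
      grind
  · have hc' := mt (eval_eq_ne e1 (eval_const (P.lt_W' (by omega)))).2 (not_not.2 hc)
    have hc2 : M.cen v (a / P.s) ≠ a + 1 := fun hh => hc' (hca hh).2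
    simp only [delCen, if_neg hc2] at K
    refine ExecS.seq_nil (ExecS.of_tri (Tri.write ?_))
    rw [ea, eval_zE]
    refine ⟨t1, ExecS.of_tri (r1.tri_dec w8' w9' hva ha ?_ fun σ₃ r3 _ f3 t3 _ =>
      ⟨t3, K _ (r3.of_base_eq ?_ rfl) (f1.trans (f3 14)) (t3.trans t1)⟩)⟩
    · change 1 ≤ M.base v a
      rw [hb0]
      simp only [baseOf]
      rw [if_pos (by omega)]
      omega
    · intro u c
      have hst : M.st v a = 1 ∨ M.st v a = 2 := by omega
      simp only [upd2, baseOf, hbase]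
      grind

theorem delMid_zero (q v a : ℕ) (y : Tok) : delMid P q v a y 0 M = M := by
  simp only [delMid, ptot_zero, Nat.not_lt_zero, if_false]
  rw [upd2_eq_self]

theorem delMid_full_tot (hwf : Wf n P.s M) (q v a : ℕ) (y : Tok) :
    (delMid P q v a y P.s M).tot = totOf n P.s (upd2 M.st v a 0) :=
  ptot_full P.s_pos fun x y hxy => by rw [hwf.tot, totOf_ins_of_ne hxy]

theorem delMid_full_act (hwf : Wf n P.s M) (q v a : ℕ) (y : Tok) :
    (delMid P q v a y P.s M).act = delAct v a M :=
  ptot_full P.s_pos fun x y hxy => by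
    unfold delAct
    split_ifs with h
    · rw [Finset.erase_eq_of_notMem]
      intro hv
      obtain ⟨h1, h2, -⟩ := hwf.mem_tot.1 (hwf.act _ _ hv)
      obtain ⟨b, hb, hb'⟩ := eq_pr_of h1 h2 h
      exact hxy b hb hb'
    · rfl

theorem Ok.delete (h : Ok P M σ) {q v a : ℕ} (h0 : M.st v a ≠ 0)
    (h7 : σ.var 7 = q) (hq : q < P.T) (h8 : σ.var 8 = v) (h9 : σ.var 9 = a) (hN : P.s ≤ N) :
    ExecS P.D P.w delC σ (delC.cost N) (delSam P.s v a (tokOf P.D σ) M) fun σ' =>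
      Ok P (delAbs n P.s q v a (tokOf P.D σ) M) σ' ∧ Fr P 14 σ σ' := by
  have hD := P.D_pos
  have hn := P.n_le_D
  have hs := P.s_le_D
  obtain ⟨hva, ha⟩ := h.wf.lt v a h0
  have hq1 := P.slot_div hq
  have hq2 := P.slot_mod q
  set y := tokOf P.D σ with hy
  rw [← List.append_nil (delSam _ _ _ _ _)]
  refine ExecS.seq ((ExecS.forC (m := P.s) (P.lt_W' (by omega)) hN
    (I := fun i τ => Rep P (delMid P q v a y i M) τ ∧ Fr P 14 σ τ ∧ τ.var 14 = i ∧
      (∀ p : ℕ × ℕ, p.1 < P.D → p.2 < P.D → TokAt (delMid P q v a y i M) (tokOf P.D τ) p) ∧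
      ∀ j, i ≤ j → j < P.s →
        tokOf P.D τ (pr a (a / P.s * P.s + j)) = y (pr a (a / P.s * P.s + j))) ?_ ?_ ?_).imp ?_)
  · rintro i - τ ⟨r, -, h14, -⟩
    exact ⟨h14, r.v4⟩
  · rintro i hi τ ⟨r, f, h14, t, ty⟩
    refine delMid_step h.wf hva ha h0 hi τ r (f.var (by omega) h7) hq
      (f.var (by omega) h8) (f.var (by omega) h9) h14 (ty i le_rfl hi) t fun τ' r' f' t' t'' =>
      ⟨f'.var (by omega) h14, r'.setVar (by omega), ?_, by simp [State.setVar], t'', ?_⟩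
    · exact (f.trans (f'.mono (by omega))).of_setVar (by omega)
    · intro j hij hj
      change tokOf P.D τ' _ = _
      rw [t', ty j (by omega) hj]
      intro hh
      have := pr_inj hh
      omega
  · refine ⟨?_, (Fr.refl _ _ _).of_setVar (by omega), by simp [State.setVar], ?_, ?_⟩
    · rw [delMid_zero]; exact h.rep.setVar (by omega)
    · rw [delMid_zero]; exact h.tok
    · intro j _ _; rfl
  · rintro τ ⟨r, f, -, t, -⟩
    refine ExecS.seq_nil (ExecS.of_tri (Tri.write ?_))
    have h7' := Ev.var (P := P) (f.var (by omega) h7)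
    rw [eval_adE r.v5 (by omega) (h7'.dE r.v4).self (h7'.mE r.v4).self eval_zE (by omega)
      (by omega) hD, eval_var (f.var (by omega) h9)]
    have r' := r.setMem (k := 10) (i := q / P.s) (j := q % P.s) (l := 0) (v := a) (by omega)
      (by omega) hD (Or.inr (Or.inr (Or.inl ⟨rfl, rfl, rfl⟩)))
    have t' := tokOf_setMem_of_ne (P := P) (σ := τ) (k := 10) (i := q / P.s) (j := q % P.s) (l := 0)
      (v := a) (by omega) (by omega) (by omega) hD
    have f' : Fr P 14 σ (τ.setMem (addr P.D 10 (q / P.s) (q % P.s) 0) a) := f.setMem (by omega)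
    refine ⟨t', r'.delTail h.wf.lt h.wf.le h.wf.base h.wf.cen1 h0 (f'.var (by omega) h8)
      (f'.var (by omega) h9) hN fun σ' r2 f2 t2 => ⟨⟨?_, h.wf.delete P.s_pos _ ha, ?_⟩,
      f'.trans f2⟩⟩
    · have e : delAbs n P.s q v a y M = { delMid P q v a y P.s M with
          la := upd2 M.la (q / P.s) (q % P.s) a
          tot := totOf n P.s (upd2 M.st v a 0)
          act := delAct v a M
          st := upd2 M.st v a 0
          cen := delCen P.s v a M
          base := baseOf P.s (upd2 M.st v a 0) (delCen P.s v a M) } := rfl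
      rw [e, ← delMid_full_tot h.wf q v a y, ← delMid_full_act h.wf q v a y]
      exact r2
    · intro p h1 h2
      have := t p h1 h2
      unfold TokAt at this ⊢
      rw [t2, t']
      rw [delMid_full_act h.wf] at this
      exact this

end

/-! ### Programs for scheduled resampling and for background passes -/

/-- Resample the witness of the pair number `var 14` in the slot with number `var 17` of the log,
if it is marked. -/
def slotBodyC : Cmd :=
  .cond (rdE 11 (dE (.var 17)) (mE (.var 17)) (.var 14))
    (.seq (.assign 15 (buE (.var 18))) <| .seq (setPairC (.var 18) (.var 15)) resampleC) .nop

/-- Resample the witnesses marked in the slot `var 16` updates ago. -/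
def schedBodyC : Cmd :=
  .seq (.assign 17 (.op .mod (.op .sub (.plus (.var 7) (.var 6)) (.var 16)) (.var 6))) <|
  .seq (.assign 18 (rdE 10 (dE (.var 17)) (mE (.var 17)) zE)) <|
  .seq (forC 14 (.var 4) slotBodyC) (.assign 16 (.times (.var 16) (.const 2)))

/-- Resample the witnesses that were lost `2 ^ i` updates ago, for all `i`. -/
def schedC : Cmd :=
  .seq (.assign 16 (.const 1)) (.loop (.op .lt (.var 16) (.var 6)) schedBodyC)

/-- Scan the edge between the vertex in variable `19` and element number `var 14` of a bucket. -/
def scanBodyC : Cmd :=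
  .seq (.assign 15 (.plus (.times (mE (.var 7)) (.var 4)) (.var 14))) <|
  .cond (.op .eq (rdE 1 (.var 19) (.var 15) zE) (.const 1))
    (.write (adE 1 (.var 19) (.var 15) zE) (.const 2)) <|
  .cond (.op .eq (rdE 1 (.var 19) (.var 15) zE) (.const 2))
    (.seq (.write (adE 1 (.var 19) (.var 15) zE) (.const 3)) <|
     .seq (.cond (rdE 4 (.var 19) (mE (.var 7)) zE) .nop
      (.seq (.write (adE 4 (.var 19) (mE (.var 7)) zE) (.plus (.var 15) (.const 1)))
        (incC (.var 19) (.var 15))))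
      (decC (.var 19) (.var 15))) .nop

/-- One step of a background pass. -/
def bgC : Cmd :=
  .seq (.assign 19 (dE (.var 7))) <|
  .seq (.assign 15 (.plus (.times (dE (.var 19)) (.var 4)) (mE (.var 7)))) <|
  .seq (setPairC (.var 19) (.var 15)) <|
  .seq (.write (adE 6 (.var 20) (.var 21) zE) (rdE 7 (.var 20) (.var 21) zE)) <|
  .seq resampleC <|
  .seq (forC 14 (.var 4) scanBodyC) <|
  .assign 7 (.op .mod (.plus (.var 7) (.const 1)) (.var 6))

section
variable {n : ℕ} {P : Par n} {M : Abs} {σ : State n} {N : ℕ}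

theorem TokAt.tok_lt (h : Wf n P.s M) {y : Tok} {p : ℕ × ℕ} (hp : TokAt M y p) :
    y p = 0 ∨ y p - 1 < p.1 ∧ y p - 1 < p.2 ∧ p.1 < n ∧ p.2 < n := by
  rcases hp with ⟨-, h0⟩ | ⟨v, hv, hy⟩
  · exact Or.inl h0
  · have := h.act_lt hv
    rw [hy]
    exact Or.inr this

theorem Ok.resample (h : Ok P M σ) {x y : ℕ} (h20 : σ.var 20 = x) (h21 : σ.var 21 = y)
    (hx : x < P.D) (hy : y < P.D) {R : State n → Prop}
    (K : ∀ σ', Ok P M σ' → Fr P 22 σ σ' → R σ') :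
    ExecS P.D P.w resampleC σ (resampleC.cost N) [((x, y), M.act x y)] R :=
  h.rep.resample h20 h21 hx hy ((h.tok (x, y) hx hy).tok_lt h.wf) (fun _ => h.wf.act_lt)
    (fun v a => (h.wf.base_le v a).trans (by omega)) (fun p h1 h2 _ => h.tok p h1 h2)
    fun σ' r f _ t => K σ' ⟨r, h.wf, t⟩ f

theorem Ok.slot (h : Ok P M σ) {r c i : ℕ} (hr : r < P.T) (hi : i < P.s) (h17 : σ.var 17 = r)
    (h18 : σ.var 18 = c) (h14 : σ.var 14 = i) (hc : c < n) {R : State n → Prop}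
    (K : ∀ σ', Ok P M σ' → Fr P 15 σ σ' → (∀ z, z = 16 ∨ z = 17 ∨ z = 18 → σ'.var z = σ.var z) →
      R σ') :
    ExecS P.D P.w slotBodyC σ (slotBodyC.cost N) (if M.bt (r / P.s) (r % P.s) i ≠ 0 then
      [(pr c (c / P.s * P.s + i), M.act (pr c (c / P.s * P.s + i)).1
        (pr c (c / P.s * P.s + i)).2)] else []) R := by
  have hD := P.D_pos
  have hn := P.n_le_D
  have hs := P.s_le_D
  have hr1 := P.slot_div hr
  have hr2 := P.slot_mod r
  have hb := P.bucket_lt (P.div_lt_s hc) hi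
  have w17 : Ev P σ (.var 17) r := Ev.var h17
  have e1 : (rdE 11 (dE (.var 17)) (mE (.var 17)) (.var 14)).eval P.w σ =
      M.bt (r / P.s) (r % P.s) i := by
    rw [eval_rdE h.rep.v5 (by omega) (w17.dE h.rep.v4).self (w17.mE h.rep.v4).self (eval_var h14)
      (by omega) (by omega) (by omega), h.rep.bt _ (by omega) _ (by omega) _ (by omega)]
  refine ExecS.cond ?_ ?_ <;> rw [e1] <;> intro hc1
  · rw [if_pos hc1]
    refine ExecS.seq_nil (ExecS.of_tri (Tri.assign ⟨rfl, ?_⟩))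
    rw [(Ev.buE h.rep.v4 (Ev.var h18) h14 (P.div_lt_s hc) hi).self]
    set b := c / P.s * P.s + i
    clear_value b
    have k15 : (σ.setVar 15 b).var 15 = b := by simp [State.setVar]
    have k18 : (σ.setVar 15 b).var 18 = c := h18
    refine ExecS.seq_nil (ExecS.of_tri (tri_setPair (x := c) (y := b) (eval_var k18) (eval_var k15)
      (fun u => k18) (fun u => k15) ⟨rfl, ?_⟩))
    have h3 : Ok P M (((σ.setVar 15 b).setVar 20 (min c b)).setVar 21 (max c b)) :=
      ⟨((h.rep.setVar (by omega)).setVar (by omega)).setVar (by omega), h.wf, h.tok⟩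
    refine h3.resample (x := min c b) (y := max c b) (by simp [State.setVar])
      (by simp [State.setVar]) (by omega) (by omega) fun σ' ok f => K σ' ok ?_ ?_
    · exact ((((Fr.refl P 15 σ).of_setVar (by omega)).of_setVar (by omega)).of_setVar
        (by omega)).trans (f.mono (by omega))
    · intro z hz
      rw [f.1 z (by omega)]
      rcases hz with rfl | rfl | rfl <;> rfl
  · rw [if_neg (by tauto)]
    exact ExecS.of_tri (Tri.nop ⟨rfl, K σ h (Fr.refl _ _ _) fun _ _ => rfl⟩)

theorem Par.T_pos (P : Par n) (hn : 0 < n) : 0 < P.T := Nat.mul_pos hn P.s_pos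

theorem Par.T_le' (P : Par n) : 4 * P.T ≤ 64 * P.D * P.D := by
  have := P.T_le
  rw [mul_assoc]
  omega

theorem Ok.sched (h : Ok P M σ) {q : ℕ} (h7 : σ.var 7 = q) (hq : q < P.T) (hN : P.s ≤ N) :
    ExecS P.D P.w schedC σ (1 + 1 + (Nat.clog 2 P.T * (1 + schedBodyC.cost N) + 1))
      (schedSam P.s P.T q M) fun σ' => Ok P M σ' ∧ Fr P 14 σ σ' := by
  have hD := P.D_pos
  have hn := P.n_le_D
  have hs := P.s_le_D
  have hT := P.T_le'
  have hlog : ∀ i, i < Nat.clog 2 P.T ↔ 2 ^ i < P.T := fun i => Nat.lt_clog_iff_pow_lt one_lt_two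
  refine ExecS.seq' (l₁ := []) (b₁ := 1) (ExecS.of_tri (Tri.assign (N := N) ⟨rfl, ?_⟩))
  rw [eval_const P.one_lt_W]
  refine (ExecS.loop_aux (M := Nat.clog 2 P.T) (b := schedBodyC.cost N)
    (I := fun i τ => Ok P M τ ∧ Fr P 14 σ τ ∧ τ.var 16 = 2 ^ i) ?_ ?_ _ 0 (by omega) _ ?_).imp ?_
  · rintro i - τ ⟨ok, -, h16⟩
    rw [eval_lt_ne (eval_var h16) (eval_var ok.rep.v6), hlog]
  · rintro i hi τ ⟨ok, f, h16⟩
    rw [hlog] at hi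
    have hrT : (q + P.T - 2 ^ i) % P.T < P.T := Nat.mod_lt _ (by omega)
    refine ExecS.seq_nil (ExecS.of_tri (Tri.assign ⟨rfl, ?_⟩))
    rw [eval_mod (eval_sub (eval_add (eval_var (f.var (by omega) h7)) (eval_var ok.rep.v6)
      (P.lt_W (by omega))) (eval_var h16)) (eval_var ok.rep.v6)]
    set r := (q + P.T - 2 ^ i) % P.T with hr
    clear_value r
    have hr1 := P.slot_div hrT
    have hr2 := P.slot_mod r
    have r1 : Rep P M (τ.setVar 17 r) := ok.rep.setVar (by omega)
    have w17 : Ev P (τ.setVar 17 r) (.var 17) r := Ev.var (by simp [State.setVar])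
    refine ExecS.seq_nil (ExecS.of_tri (Tri.assign ⟨rfl, ?_⟩))
    rw [eval_rdE r1.v5 (by omega) (w17.dE r1.v4).self (w17.mE r1.v4).self eval_zE (by omega)
      (by omega) hD, r1.la _ (by omega) _ (by omega)]
    have hc := ok.wf.la (r / P.s) (r % P.s)
    unfold slotSam
    set c := M.la (r / P.s) (r % P.s)
    rw [← List.append_nil (catList _ _ _)]
    have f2 : Fr P 14 σ ((τ.setVar 17 r).setVar 18 c) := (f.of_setVar (by omega)).of_setVar (by omega)
    have ok2 : Ok P M ((τ.setVar 17 r).setVar 18 c) := ⟨r1.setVar (by omega), ok.wf, ok.tok⟩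
    have x17 : ((τ.setVar 17 r).setVar 18 c).var 17 = r := by simp [State.setVar]
    have x18 : ((τ.setVar 17 r).setVar 18 c).var 18 = c := by simp [State.setVar]
    have x16 : ((τ.setVar 17 r).setVar 18 c).var 16 = 2 ^ i := h16
    set τ₂ := (τ.setVar 17 r).setVar 18 c
    clear_value τ₂
    refine ExecS.seq ((ExecS.forC (m := P.s) (P.lt_W' (by omega)) hN
      (I := fun j τ => Ok P M τ ∧ Fr P 14 σ τ ∧ τ.var 14 = j ∧ τ.var 16 = 2 ^ i ∧ τ.var 17 = r ∧
        τ.var 18 = c) ?_ ?_ ?_).imp ?_)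
    · rintro j - τ ⟨ok, -, h14, -⟩
      exact ⟨h14, ok.rep.v4⟩
    · rintro j hj τ ⟨ok, f, h14, h16, h17, h18⟩
      refine ok.slot hrT hj h17 h18 h14 hc fun τ' ok' f' hv => ⟨f'.var (by omega) h14,
        ⟨ok'.rep.setVar (by omega), ok'.wf, ok'.tok⟩,
        (f.trans (f'.mono (by omega))).of_setVar (by omega), by simp [State.setVar],
        (hv 16 (by omega)).trans h16, (hv 17 (by omega)).trans h17, (hv 18 (by omega)).trans h18⟩
    · exact ⟨⟨ok2.rep.setVar (by omega), ok2.wf, ok2.tok⟩, f2.of_setVar (by omega),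
        by simp [State.setVar], x16, x17, x18⟩
    · rintro τ ⟨ok, f, -, h16, -⟩
      refine ExecS.of_tri (Tri.assign ?_)
      rw [eval_mul (eval_var h16) (eval_const (P.lt_W' (by omega))) (P.lt_W (by omega)), ← pow_succ]
      exact ⟨rfl, ⟨ok.rep.setVar (by omega), ok.wf, ok.tok⟩, f.of_setVar (by omega),
        by simp [State.setVar]⟩
  · exact ⟨⟨h.rep.setVar (by omega), h.wf, h.tok⟩, (Fr.refl _ _ _).of_setVar (by omega),
      by simp [State.setVar]⟩
  · rintro τ ⟨ok, f, -⟩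
    exact ⟨ok, f⟩

theorem scanSt_zero {s x i : ℕ} {st : ℕ → ℕ → ℕ} : scanSt s x i 0 st = st := by
  funext v a; simp [scanSt]

theorem scanSt_at {s x i j : ℕ} {st : ℕ → ℕ → ℕ} (hj : j < s) :
    scanSt s x i j st x (i * s + j) = st x (i * s + j) := by
  unfold scanSt
  rw [if_neg]
  rw [bucket_mod hj]
  omega

theorem scanSt_succ {s x i j : ℕ} {st : ℕ → ℕ → ℕ} (hj : j < s) :
    scanSt s x i (j + 1) st = upd2 (scanSt s x i j st) x (i * s + j) (bump (st x (i * s + j))) := by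
  funext v a
  by_cases h : v = x ∧ a = i * s + j
  · obtain ⟨rfl, rfl⟩ := h
    rw [upd2_self]
    unfold scanSt
    rw [if_pos ⟨rfl, bucket_div hj, by rw [bucket_mod hj]; omega⟩]
  · simp only [upd2, h, if_false]
    unfold scanSt
    by_cases h2 : v = x ∧ a / s = i ∧ a % s < j
    · rw [if_pos h2, if_pos ⟨h2.1, h2.2.1, by omega⟩]
    · rw [if_neg h2, if_neg]
      rintro ⟨h3, h4, h5⟩
      have := bucket_eq h4
      have h6 : a % s = j := by
        by_contra h6
        exact h2 ⟨h3, h4, by omega⟩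
      rw [h6] at this
      exact h ⟨h3, this⟩

/-- Abstract data in the middle of a step of a background pass. -/
def bgMid (s x i j : ℕ) (M : Abs) : Abs :=
  { M with
    st := scanSt s x i j M.st
    cen := upd2 M.cen x i (firstC 2 M.st x (i * s) (M.cen x i) j)
    base := baseOf s (scanSt s x i j M.st)
      (upd2 M.cen x i (firstC 2 M.st x (i * s) (M.cen x i) j)) }

/-- One iteration of the scan of a bucket by a background pass. -/
theorem scan_step {x q j : ℕ} (hlt : ∀ v a, M.st v a ≠ 0 → v < a ∧ a < n)
    (hcen : ∀ v i a, M.cen v i = a + 1 → a / P.s = i ∧ M.st v a = 3)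
    (hx : x < P.D) (hj : j < P.s) (τ : State n)
    (r : Rep P (bgMid P.s x (q % P.s) j M) τ) (h7 : τ.var 7 = q) (h19 : τ.var 19 = x)
    (h14 : τ.var 14 = j) {R : State n → Prop}
    (K : ∀ τ', Rep P (bgMid P.s x (q % P.s) (j + 1) M) τ' → Fr P 15 τ τ' → τ'.var 19 = x →
      tokOf P.D τ' = tokOf P.D τ → R τ') :
    Tri P.w scanBodyC τ (scanBodyC.cost N) R := by
  have hD := P.D_pos
  have hs := P.s_le_D
  have hq2 := P.slot_mod q
  have hb : q % P.s * P.s + j < P.D := by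
    unfold Par.D
    nlinarith
  have hsucc : firstC 2 M.st x (q % P.s * P.s) (M.cen x (q % P.s)) (j + 1) =
    if firstC 2 M.st x (q % P.s * P.s) (M.cen x (q % P.s)) j = 0 ∧
      M.st x (q % P.s * P.s + j) = 2 then q % P.s * P.s + j + 1 else
      firstC 2 M.st x (q % P.s * P.s) (M.cen x (q % P.s)) j := rfl
  have hst1 := scanSt_succ (x := x) (i := q % P.s) (st := M.st) hj
  have hst0 := scanSt_at (x := x) (i := q % P.s) (st := M.st) hj
  have hbd : (q % P.s * P.s + j) / P.s = q % P.s := bucket_div hj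
  have hne : M.st x (q % P.s * P.s + j) = 2 →
      firstC 2 M.st x (q % P.s * P.s) (M.cen x (q % P.s)) j ≠ q % P.s * P.s + j + 1 := by
    intro h2 hh
    rcases firstC_eq_succ hh with h3 | ⟨-, j', hj', h3, -⟩
    · have := (hcen _ _ _ h3).2
      omega
    · omega
  refine Tri.seq (Tri.assign ?_)
  have w7' : Ev P τ (.var 7) q := Ev.var h7
  rw [eval_add (eval_mul (w7'.mE r.v4).self (eval_var r.v4) (P.lt_W' (by omega)))
    (eval_var h14) (P.lt_W' (by omega))]
  unfold bgMid at r K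
  set b := q % P.s * P.s + j with hbdef
  set C := firstC 2 M.st x (q % P.s * P.s) (M.cen x (q % P.s)) j
  set C' := firstC 2 M.st x (q % P.s * P.s) (M.cen x (q % P.s)) (j + 1)
  set S := scanSt P.s x (q % P.s) j M.st
  set S' := scanSt P.s x (q % P.s) (j + 1) M.st
  clear_value C C' S S'
  have r1 := r.setVar (x := 15) (v := b) (by omega)
  have f1 : Fr P 15 τ (τ.setVar 15 b) := (Fr.refl P 15 τ).of_setVar (by omega)
  have v15 : (τ.setVar 15 b).var 15 = b := by simp [State.setVar]
  have v19 : (τ.setVar 15 b).var 19 = x := h19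
  have t1 : tokOf P.D (τ.setVar 15 b) = tokOf P.D τ := rfl
  set τ₁ := τ.setVar 15 b
  clear_value τ₁
  have w7 : Ev P τ₁ (.var 7) q := Ev.var (f1.var (by omega) h7)
  have w19 : Ev P τ₁ (.var 19) x := Ev.var v19
  have w15 : Ev P τ₁ (.var 15) b := Ev.var v15
  have e1 : (rdE 1 (.var 19) (.var 15) zE).eval P.w τ₁ = M.st x b := by
    rw [eval_rdE r1.v5 (by omega) w19.self w15.self eval_zE hx hb hD, r1.st _ hx _ hb, ← hst0]
  have ea : (adE 1 (.var 19) (.var 15) zE).eval P.w τ₁ = addr P.D 1 x b 0 :=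
    eval_adE r1.v5 (by omega) w19.self w15.self eval_zE hx hb hD
  have r2 : ∀ u, Rep P _ (τ₁.setMem (addr P.D 1 x b 0) u) := fun u =>
    r1.setMem (k := 1) (i := x) (j := b) (l := 0) (v := u) hx hb hD (Or.inl ⟨rfl, rfl, rfl⟩)
  have f2 : ∀ u, Fr P 15 τ (τ₁.setMem (addr P.D 1 x b 0) u) := fun u => f1.setMem (by omega)
  have t2 : ∀ u, tokOf P.D (τ₁.setMem (addr P.D 1 x b 0) u) = tokOf P.D τ := fun u =>
    (tokOf_setMem_of_ne (P := P) (by omega) hx hb hD).trans t1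
  refine Tri.cond ?_ ?_ <;> intro hc
  · rw [eval_eq_ne e1 (eval_const P.one_lt_W)] at hc
    rw [if_neg (by omega)] at hsucc
    refine Tri.write ?_
    rw [ea, eval_const (P.lt_W' (by omega))]
    refine K _ ((r2 2).of_base_eq ?_ ?_) (f2 2) v19 (t2 2)
    · intro u c
      simp only [hst1, hsucc, upd2, baseOf, bump, hc]
      clear_value b
      grind
    · simp only [hst1, hsucc, hc]
      rfl
  have hc' := mt (eval_eq_ne e1 (eval_const P.one_lt_W)).2 (not_not.2 hc)
  refine Tri.cond ?_ ?_ <;> intro hc2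
  · rw [eval_eq_ne e1 (eval_const (P.lt_W' (by omega)))] at hc2
    obtain ⟨hxb, hbn⟩ := hlt x b (by omega)
    have hne' := hne hc2
    refine Tri.seq (Tri.write ?_)
    rw [ea, eval_const (P.lt_W' (by omega))]
    have w7' : Ev P (τ₁.setMem (addr P.D 1 x b 0) 3) (.var 7) q := w7
    have w19' : Ev P (τ₁.setMem (addr P.D 1 x b 0) 3) (.var 19) x := w19
    have w15' : Ev P (τ₁.setMem (addr P.D 1 x b 0) 3) (.var 15) b := w15
    have r3 := r2 3
    have f3 := f2 3
    have t3 := t2 3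
    have v19' : (τ₁.setMem (addr P.D 1 x b 0) 3).var 19 = x := v19
    set τ₃ := τ₁.setMem (addr P.D 1 x b 0) 3
    clear_value τ₃
    have e4 : (rdE 4 (.var 19) (mE (.var 7)) zE).eval P.w τ₃ = C := by
      rw [eval_rdE r3.v5 (by omega) w19'.self (w7'.mE r3.v4).self eval_zE hx (by omega) hD,
        r3.cen _ hx _ (by omega)]
      exact upd2_self _ _ _ _
    refine Tri.seq (Tri.cond ?_ ?_) <;> rw [e4] <;> intro hC
    · rw [if_neg (by omega)] at hsucc
      refine Tri.nop (r3.tri_dec w19' w15' hxb hbn ?_ fun τ₄ r4 w4 f4 t4 _ =>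
        K _ (r4.of_base_eq ?_ ?_) (f3.trans (f4 15)) ((congrFun w4 19).trans v19') (t4.trans t3))
      · simp only [baseOf, hst0, hc2]
        simp
      · intro u c
        simp only [hst1, hsucc, upd2, baseOf, bump, hc2]
        clear_value b
        grind
      · simp only [hst1, hsucc, hc2]
        rfl
    · rw [if_pos ⟨hC, hc2⟩] at hsucc
      refine Tri.seq (Tri.write ?_)
      rw [eval_adE r3.v5 (by omega) w19'.self (w7'.mE r3.v4).self eval_zE hx (by omega) hD,
        eval_add w15'.self (eval_const P.one_lt_W) (P.lt_W' (by omega))]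
      have r4 := r3.setMem (k := 4) (i := x) (j := q % P.s) (l := 0) (v := b + 1) hx (by omega) hD
        (Or.inr (Or.inl ⟨rfl, rfl, rfl⟩))
      have f4 : Fr P 15 τ (τ₃.setMem (addr P.D 4 x (q % P.s) 0) (b + 1)) := f3.setMem (by omega)
      have t4 := (tokOf_setMem_of_ne (P := P) (σ := τ₃) (k := 4) (i := x) (j := q % P.s) (l := 0)
        (v := b + 1) (by omega) hx (by omega) hD).trans t3
      have w19'' : Ev P (τ₃.setMem (addr P.D 4 x (q % P.s) 0) (b + 1)) (.var 19) x := w19'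
      have w15'' : Ev P (τ₃.setMem (addr P.D 4 x (q % P.s) 0) (b + 1)) (.var 15) b := w15'
      have v19'' : (τ₃.setMem (addr P.D 4 x (q % P.s) 0) (b + 1)).var 19 = x := v19'
      set τ₄ := τ₃.setMem (addr P.D 4 x (q % P.s) 0) (b + 1)
      clear_value τ₄
      refine r4.tri_inc w19'' w15'' hxb hbn ((baseOf_le _ _ _ _ _).trans (by omega))
        fun τ₅ r5 w5 f5 t5 _ => ?_
      refine r5.tri_dec (w19''.of_eq w5) (w15''.of_eq w5) hxb hbn ?_ fun τ₆ r6 w6 f6 t6 _ =>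
        K _ (r6.of_base_eq ?_ ?_) (f4.trans ((f5 15).trans (f6 15)))
          ((congrFun (w6.trans w5) 19).trans v19'') (t6.trans (t5.trans t4))
      · simp only [upd2_self]
        omega
      · intro u c
        simp only [hst1, hsucc, upd2, baseOf, bump, hc2, hC]
        clear_value b
        grind
      · simp only [hst1, hsucc, hc2, upd2_upd2]
        rfl
  · have hc2' := mt (eval_eq_ne e1 (eval_const (P.lt_W' (by omega)))).2 (not_not.2 hc2)
    rw [if_neg (by omega)] at hsucc
    have hS : S' = S := by
      rw [hst1]
      unfold bump
      rw [if_neg hc', if_neg hc2', ← hst0, upd2_eq_self]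
    rw [hS, hsucc] at K
    exact Tri.nop (K _ r1 f1 v19 t1)

end

/-- The update program: change the edge between the vertices in variables `1` and `2`, resample
witnesses according to the schedule, and make one step of a background pass. -/
def updC : Cmd :=
  .seq (.cond (.op .lt (.var 1) (.var 2)) (.seq (.assign 8 (.var 1)) (.assign 9 (.var 2)))
    (.seq (.assign 8 (.var 2)) (.assign 9 (.var 1)))) <|
  .seq (.cond (.var 0) insC delC) <| .seq schedC bgC

/-- The change of the edge `(v, a)`. -/
def usrAbs (n s q v a : ℕ) (y : Tok) (M : Abs) : Abs :=
  if M.st v a = 0 then insAbs n s q v a M else delAbs n s q v a y M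

/-- The witnesses that are resampled because they are lost by the change of the edge `(v, a)`. -/
def usrSam (s v a : ℕ) (y : Tok) (M : Abs) : List ((ℕ × ℕ) × Finset ℕ) :=
  if M.st v a = 0 then [] else delSam s v a y M

/-- The effect of the update program. -/
def updAbs (n s q v a : ℕ) (y : Tok) (M : Abs) : Abs := bgAbs s q (usrAbs n s q v a y M)

/-- The witnesses that the update program resamples. -/
def updSam (n s T q v a : ℕ) (y : Tok) (M : Abs) : List ((ℕ × ℕ) × Finset ℕ) :=
  usrSam s v a y M ++ (schedSam s T q (usrAbs n s q v a y M) ++ bgSam s q (usrAbs n s q v a y M))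

/-- A bound for the running time of the update program. -/
def updCost (N L : ℕ) : ℕ :=
  1 + 7 + (1 + (Cmd.cond (.var 0) insC delC).cost N +
    (1 + (1 + 1 + (L * (1 + schedBodyC.cost N) + 1)) + bgC.cost N))

section
variable {n : ℕ} {P : Par n} {M : Abs} {σ : State n} {N : ℕ}

/-- One step of a background pass: the pair of the slot gets all its candidates activated and its
witness resampled, and one bucket of one vertex is scanned. -/
theorem Ok.bg (h : Ok P M σ) {q : ℕ} (h7 : σ.var 7 = q) (hq : q < P.T) (hN : P.s ≤ N) :
    ExecS P.D P.w bgC σ (bgC.cost N) (bgSam P.s q M) fun σ' => Ok P (bgAbs P.s q M) σ' ∧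
      σ'.var 7 = (q + 1) % P.T ∧ ∀ y < 14, y ≠ 7 → σ'.var y = σ.var y := by
  have hD := P.D_pos
  have hn := P.n_le_D
  have hs := P.s_le_D
  have hT := P.T_le'
  have hq1 := P.slot_div hq
  have hq2 := P.slot_mod q
  have r0 := h.rep
  refine ExecS.seq_nil (ExecS.of_tri (Tri.assign ⟨rfl, ?_⟩))
  rw [((Ev.var h7).dE r0.v4).self]
  have hb := P.bucket_lt (P.div_lt_s hq1) hq2
  have w19 : Ev P (σ.setVar 19 (q / P.s)) (.var 19) (q / P.s) := Ev.var (by simp [State.setVar])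
  have w7 : Ev P (σ.setVar 19 (q / P.s)) (.var 7) q := Ev.var h7
  have r1 : Rep P M (σ.setVar 19 (q / P.s)) := r0.setVar (by omega)
  have hx1 := P.div_lt hq1
  refine ExecS.seq_nil (ExecS.of_tri (Tri.assign ⟨rfl, ?_⟩))
  rw [eval_add (eval_mul (w19.dE r1.v4).self (eval_var r1.v4) (P.lt_W' (by omega)))
    (w7.mE r1.v4).self (P.lt_W' (by omega))]
  have hfp : flipPair P.s q = pr (q / P.s) (q / P.s / P.s * P.s + q % P.s) := rfl
  unfold bgSam
  have hbg : ∀ M' : Abs, M' = { M with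
        act := upd2 M.act (flipPair P.s q).1 (flipPair P.s q).2
          (M.tot (flipPair P.s q).1 (flipPair P.s q).2) } →
      bgMid P.s (q / P.s) (q % P.s) P.s M' = bgAbs P.s q M := by rintro _ rfl; rfl
  set x := q / P.s
  set b := x / P.s * P.s + q % P.s
  clear_value b
  have k19 : ((σ.setVar 19 x).setVar 15 b).var 19 = x := by simp [State.setVar]
  have k15 : ((σ.setVar 19 x).setVar 15 b).var 15 = b := by simp [State.setVar]
  refine ExecS.seq_nil (ExecS.of_tri (tri_setPair (x := x) (y := b) (eval_var k19) (eval_var k15)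
    (fun u => k19) (fun u => k15) ⟨rfl, ?_⟩))
  rw [hfp] at hbg ⊢
  simp only [pr] at hbg ⊢
  set σ₃ := (((σ.setVar 19 x).setVar 15 b).setVar 20 (min x b)).setVar 21 (max x b) with hσ₃
  have r3 : Rep P M σ₃ := (((r1.setVar (by omega)).setVar (by omega)).setVar (by omega))
  have f3 : Fr P 14 σ σ₃ := ((((Fr.refl P 14 σ).of_setVar (by omega)).of_setVar
    (by omega)).of_setVar (by omega)).of_setVar (by omega)
  have v20 : σ₃.var 20 = min x b := by simp [hσ₃, State.setVar]
  have v21 : σ₃.var 21 = max x b := by simp [hσ₃, State.setVar]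
  have v19 : σ₃.var 19 = x := by simp [hσ₃, State.setVar]
  have t3 : tokOf P.D σ₃ = tokOf P.D σ := rfl
  clear_value σ₃
  have hu : min x b < P.D := by omega
  have hv : max x b < P.D := by omega
  have hwf := h.wf
  have htok := h.tok
  set u := min x b
  set v := max x b
  clear_value u v
  refine ExecS.seq_nil (ExecS.of_tri (Tri.write ?_))
  have hl := r3.lst u hu v hv
  rw [eval_adE r3.v5 (by omega) (eval_var v20) (eval_var v21) eval_zE hu hv hD,
    eval_rdE r3.v5 (by omega) (eval_var v20) (eval_var v21) eval_zE hu hv hD]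
  obtain ⟨r4, t4⟩ := ((LView.self P σ₃ u v).write hu hv (k := 6) (l := 0)
    (v := σ₃.mem (addr P.D 7 u v 0)) hD (Or.inl ⟨rfl, rfl, rfl, rfl, rfl, rfl⟩)).rep r3 hu hv
    hl.activate (r3.tot u hu v hv)
  rw [upd2_eq_self] at r4
  have f4 : Fr P 14 σ (σ₃.setMem (addr P.D 6 u v 0) (σ₃.mem (addr P.D 7 u v 0))) :=
    f3.setMem (by omega)
  have x20 : (σ₃.setMem (addr P.D 6 u v 0) (σ₃.mem (addr P.D 7 u v 0))).var 20 = u := v20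
  have x21 : (σ₃.setMem (addr P.D 6 u v 0) (σ₃.mem (addr P.D 7 u v 0))).var 21 = v := v21
  have x19 : (σ₃.setMem (addr P.D 6 u v 0) (σ₃.mem (addr P.D 7 u v 0))).var 19 = x := v19
  refine ⟨t4, ?_⟩
  have t5 := t4.trans t3
  set σ₄ := σ₃.setMem (addr P.D 6 u v 0) (σ₃.mem (addr P.D 7 u v 0))
  clear_value σ₄
  rw [← List.append_nil [((u, v), M.tot u v)]]
  have hact : (upd2 M.act u v (M.tot u v)) u v = M.tot u v := upd2_self _ _ _ _
  rw [← hact]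
  refine ExecS.seq (r4.resample x20 x21 hu hv ?_ ?_ ?_ ?_ fun σ₅ r5 f5 _ t5 => ?_)
  · rw [t5]
    exact (htok (u, v) hu hv).tok_lt hwf
  · intro c hc
    simp only [upd2_self] at hc
    exact hwf.tot_lt hc
  · exact fun u c => (hwf.base_le u c).trans (by omega)
  · intro p h1 h2 hp
    have := htok p h1 h2
    unfold TokAt at this ⊢
    rw [t5]
    simp only [upd2]
    rw [if_neg]
    · exact this
    · rintro ⟨h3, h4⟩
      exact hp (Prod.ext h3 h4)
  have f5' : Fr P 14 σ σ₅ := f4.trans (f5.mono (by omega))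
  have y19 : σ₅.var 19 = x := (f5.1 19 (by omega)).trans x19
  have hl0 : catList (fun _ => ([] : List ((ℕ × ℕ) × Finset ℕ))) 0 P.s = [] := catList_nil _ _
  set M₁ : Abs := { M with act := upd2 M.act u v (M.tot u v) } with hM₁
  rw [← hl0, ← List.append_nil (catList _ _ _)]
  refine ExecS.seq ((ExecS.forC (m := P.s) (l := fun _ => []) (P.lt_W' (by omega)) hN
    (I := fun i τ => Rep P (bgMid P.s x (q % P.s) i M₁) τ ∧ Fr P 14 σ τ ∧ τ.var 14 = i ∧
      τ.var 19 = x ∧ tokOf P.D τ = tokOf P.D σ₅) ?_ ?_ ?_).imp ?_)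
  · rintro i - τ ⟨r, -, h14, -⟩
    exact ⟨h14, r.v4⟩
  · rintro i hi τ ⟨r, f, h14, h19, t⟩
    exact ExecS.of_tri (scan_step (M := M₁) hwf.lt hwf.cen1 (by omega) hi τ r (f.var (by omega) h7) h19 h14
      fun τ' r' f' h19' t' => ⟨t', f'.var (by omega) h14, r'.setVar (by omega),
        (f.trans (f'.mono (by omega))).of_setVar (by omega), by simp [State.setVar], h19',
        t'.trans t⟩)
  · refine ⟨?_, f5'.of_setVar (by omega), by simp [State.setVar], y19, rfl⟩
    refine Rep.setVar (r5.of_base_eq ?_ ?_) (by omega)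
    · intro c d
      simp only [bgMid, scanSt_zero, firstC, hM₁]
      rw [hwf.base, upd2_eq_self]
    · simp only [bgMid, scanSt_zero, firstC, hM₁]
      rw [upd2_eq_self]
  · rintro τ ⟨r, f, -, -, t⟩
    refine ExecS.of_tri (Tri.assign ?_)
    rw [eval_mod (eval_add (eval_var (f.var (by omega) h7)) (eval_const P.one_lt_W)
      (P.lt_W (by omega))) (eval_var r.v6)]
    rw [hbg _ rfl] at r
    refine ⟨rfl, ⟨r.setVar (by omega), hwf.bg P.s_pos q, ?_⟩, by simp [State.setVar], ?_⟩
    · intro p h1 h2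
      change TokAt _ (tokOf P.D τ) p
      rw [t]
      have h6 : (bgAbs P.s q M).act = M₁.act := by rw [← hbg _ rfl]; rfl
      have := t5 p h1 h2
      unfold TokAt at this ⊢
      rwa [h6]
    · intro z hz hz7
      refine (Function.update_of_ne hz7 _ _).trans (f.1 z hz)

theorem Rep.setVar_lt (h : Rep P M σ) {x v : ℕ} (hx : x < 3) : Rep P M (σ.setVar x v) := by
  have hv : ∀ y, 3 ≤ y → (σ.setVar x v).var y = σ.var y := fun y hy =>
    Function.update_of_ne (by omega) _ _
  exact ⟨(hv 3 (by omega)).trans h.v3, (hv 4 (by omega)).trans h.v4, (hv 5 (by omega)).trans h.v5,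
    (hv 6 (by omega)).trans h.v6, h.st, h.rc, h.cen, h.lst, h.tot, h.la, h.bt, h.out⟩

theorem Ok.setVar (h : Ok P M σ) {x v : ℕ} (hx : 7 ≤ x) : Ok P M (σ.setVar x v) :=
  ⟨h.rep.setVar hx, h.wf, h.tok⟩

theorem Ok.setVar_lt (h : Ok P M σ) {x v : ℕ} (hx : x < 3) : Ok P M (σ.setVar x v) :=
  ⟨h.rep.setVar_lt hx, h.wf, h.tok⟩

theorem Ok.usr (h : Ok P M σ) {q v a : ℕ} (h7 : σ.var 7 = q) (hq : q < P.T) (hva : v < a)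
    (ha : a < n) (h0 : σ.var 0 = if M.st v a = 0 then 1 else 0) (h8 : σ.var 8 = v)
    (h9 : σ.var 9 = a) (hN : P.s ≤ N) :
    ExecS P.D P.w (.cond (.var 0) insC delC) σ ((Cmd.cond (.var 0) insC delC).cost N)
      (usrSam P.s v a (tokOf P.D σ) M)
      fun σ' => Ok P (usrAbs n P.s q v a (tokOf P.D σ) M) σ' ∧ Fr P 14 σ σ' := by
  unfold usrSam usrAbs
  refine ExecS.cond ?_ ?_ <;> intro hc
  · have hst : M.st v a = 0 := by
      by_contra hh
      rw [if_neg hh] at h0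
      exact hc h0
    rw [if_pos hst, if_pos hst]
    exact h.insert hva ha hst h7 hq h8 h9 hN
  · have hst : M.st v a ≠ 0 := by
      intro hh
      rw [if_pos hh] at h0
      exact one_ne_zero (h0.symm.trans hc)
    rw [if_neg hst, if_neg hst]
    exact h.delete hst h7 hq h8 h9 hN

theorem Ok.upd (h : Ok P M σ) {q u c : ℕ} (h7 : σ.var 7 = q) (hq : q < P.T) (huc : u ≠ c)
    (hu : u < n) (hc : c < n) (h0 : σ.var 0 = if M.st (min u c) (max u c) = 0 then 1 else 0)
    (h1 : σ.var 1 = u) (h2 : σ.var 2 = c) (hN : P.s ≤ N) :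
    ExecS P.D P.w updC σ (updCost N (Nat.clog 2 P.T))
      (updSam n P.s P.T q (min u c) (max u c) (tokOf P.D σ) M)
      fun σ' => Ok P (updAbs n P.s q (min u c) (max u c) (tokOf P.D σ) M) σ' ∧
        σ'.var 7 = (q + 1) % P.T := by
  have key : Tri P.w (.cond (.op .lt (.var 1) (.var 2)) (.seq (.assign 8 (.var 1))
      (.assign 9 (.var 2))) (.seq (.assign 8 (.var 2)) (.assign 9 (.var 1)))) σ
      (Cmd.cost N (.cond (.op .lt (.var 1) (.var 2)) (.seq (.assign 8 (.var 1))
      (.assign 9 (.var 2))) (.seq (.assign 8 (.var 2)) (.assign 9 (.var 1)))))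
      fun σ' => tokOf P.D σ' = tokOf P.D σ ∧ tokOf P.D σ' = tokOf P.D σ ∧ Ok P M σ' ∧ σ'.var 8 = min u c ∧
        σ'.var 9 = max u c ∧ Fr P 8 σ σ' := by
    refine Tri.cond ?_ ?_
    · intro hlt
      rw [eval_lt_ne (eval_var h1) (eval_var h2)] at hlt
      refine Tri.seq (Tri.assign (Tri.assign ⟨rfl, rfl, (h.setVar (by omega)).setVar (by omega), ?_, ?_,
        ((Fr.refl P 8 σ).of_setVar (by omega)).of_setVar (by omega)⟩))
      · simpa [State.setVar, Expr.eval, min_eq_left hlt.le] using h1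
      · simpa [State.setVar, Expr.eval, max_eq_right hlt.le] using h2
    · intro hlt
      have hlt' := mt (eval_lt_ne (eval_var h1) (eval_var h2)).2 (not_not.2 hlt)
      refine Tri.seq (Tri.assign (Tri.assign ⟨rfl, rfl, (h.setVar (by omega)).setVar (by omega), ?_, ?_,
        ((Fr.refl P 8 σ).of_setVar (by omega)).of_setVar (by omega)⟩))
      · simpa [State.setVar, Expr.eval, min_eq_right (not_lt.1 hlt')] using h2
      · simpa [State.setVar, Expr.eval, max_eq_left (not_lt.1 hlt')] using h1
  refine (ExecS.seq' (l₁ := []) (b₂ := 1 + (Cmd.cond (.var 0) insC delC).cost N +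
    (1 + (1 + 1 + (Nat.clog 2 P.T * (1 + schedBodyC.cost N) + 1)) + bgC.cost N))
    ((ExecS.of_tri key).imp ?_)).mono ?_
  · rintro σ₁ ⟨t1, ok1, h8, h9, f1⟩
    have hmm : min u c < max u c := by omega
    rw [← t1]
    refine ExecS.seq' ((ok1.usr (f1.var (by omega) h7) hq hmm (by omega)
      (f1.var (by omega) h0) h8 h9 hN).imp ?_)
    rintro σ₂ ⟨ok2, f2⟩
    have h7' := f2.var (by omega) (f1.var (by omega) h7)
    refine ExecS.seq' ((ok2.sched h7' hq hN).imp ?_)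
    rintro σ₃ ⟨ok3, f3⟩
    exact (ok3.bg (f3.var (by omega) h7') hq hN).imp fun σ' hh => ⟨hh.1, hh.2.1⟩
  · simp only [updCost, Cmd.cost]
    omega

end

/-! ### The program for preprocessing -/

/-- Read one entry of the adjacency matrix, and insert the edge if it is there. -/
def prepBodyC : Cmd :=
  .cond (.op .lt (.var 8) (.var 9))
    (.cond (.read (.plus (.times (.var 8) (.var 3)) (.var 9)))
      (.seq insC (.assign 11 (.plus (.var 11) (.const 1)))) .nop) .nop

/-- The preprocessing program: compute the parameters, insert the edges of the initial graph and
count them in variable `11`, and make two background passes if there are many. -/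
def prepC : Cmd :=
  .seq (.assign 3 (.var 0)) <|
  .seq (.loop (.op .lt (.times (.var 4) (.var 4)) (.var 3))
    (.assign 4 (.plus (.var 4) (.const 1)))) <|
  .seq (.assign 5 (.times (.var 4) (.var 4))) <|
  .seq (.assign 6 (.times (.var 3) (.var 4))) <|
  .seq (forC 8 (.var 3) (forC 9 (.var 3) prepBodyC)) <|
  .cond (.op .lt (.times (.var 5) (.var 4)) (.var 11))
    (forC 12 (.times (.var 6) (.const 2)) bgC) .nop

/-- The natural numbers `v` and `a` are adjacent vertices of `G`. -/
def AdjN {n : ℕ} (G : SimpleGraph (Fin n)) (v a : ℕ) : Prop :=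
  ∃ (hv : v < n) (ha : a < n), G.Adj ⟨v, hv⟩ ⟨a, ha⟩

open Classical in
/-- The states of edges when the entries before `(v, a)` of the adjacency matrix were read. -/
noncomputable def fillSt {n : ℕ} (G : SimpleGraph (Fin n)) (v a : ℕ) (u c : ℕ) : ℕ :=
  if u < c ∧ AdjN G u c ∧ (u < v ∨ u = v ∧ c < a) then 1 else 0

open Classical in
/-- The edges among the entries before `(v, a)` of the adjacency matrix. -/
noncomputable def fillSet {n : ℕ} (G : SimpleGraph (Fin n)) (v a : ℕ) : Finset (ℕ × ℕ) :=
  (Finset.range n ×ˢ Finset.range n).filter fun p =>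
    p.1 < p.2 ∧ AdjN G p.1 p.2 ∧ (p.1 < v ∨ p.1 = v ∧ p.2 < a)

/-- The number of edges of `G`. -/
noncomputable def numE {n : ℕ} (G : SimpleGraph (Fin n)) : ℕ := (fillSet G n 0).card

/-- The data hold edges of states `st` that are not yet represented otherwise. -/
structure Fresh (n s : ℕ) (st : ℕ → ℕ → ℕ) (M : Abs) : Prop where
  wf : Wf n s M
  st : M.st = st
  cen : ∀ v i, M.cen v i = 0
  act : ∀ x y, M.act x y = ∅
  bt : ∀ x j i, M.bt x j i = 0

/-- The first `i` steps of background passes. -/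
def bgIter (s T : ℕ) (M : Abs) : ℕ → Abs
  | 0 => M
  | i + 1 => bgAbs s (i % T) (bgIter s T M i)

/-- The data before any edge is inserted. -/
def zeroAbs : Abs := ⟨fun _ _ => 0, fun _ _ => 0, fun _ _ => 0, fun _ _ => ∅, fun _ _ => ∅,
  fun _ _ => 0, fun _ _ _ => 0⟩

theorem State.setVar_var_ne {n : ℕ} {σ : State n} {x y v : ℕ} (h : y ≠ x) :
    (σ.setVar x v).var y = σ.var y := Function.update_of_ne h _ _

/-- The command `c` halts within `b` steps in a state that satisfies `R`. -/
def ExecW (w : ℕ) {n : ℕ} (c : Cmd) (s : State n) (b : ℕ) (R : State n → Prop) : Prop :=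
  ∃ μ, Exec w c s b μ ∧ ∀ s' ∈ μ.support, R s'

theorem ExecS.weak {D w n b : ℕ} {c : Cmd} {s : State n} {l} {R : State n → Prop}
    (h : ExecS D w c s b l R) : ExecW w c s b R := by
  obtain ⟨μ, h1, h2, -⟩ := h
  exact ⟨μ, h1, h2⟩

theorem ExecW.seq {w n N : ℕ} {p q : Cmd} {s : State n} {R : State n → Prop}
    (hp : ExecW w p s (p.cost N) fun s' => ExecW w q s' (q.cost N) R) :
    ExecW w (.seq p q) s ((Cmd.seq p q).cost N) R := by
  classical
  obtain ⟨μ, h1, h2⟩ := hp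
  choose! ν hν using h2
  refine ⟨μ.bind ν, h1.seq fun s' hs' => (hν s' hs').1, fun s' hs' => ?_⟩
  obtain ⟨s₁, hs₁, hs₂⟩ := (PMF.mem_support_bind_iff _ _ _).1 hs'
  exact (hν s₁ hs₁).2 s' hs₂

theorem ExecW.imp {w n b : ℕ} {c : Cmd} {s : State n} {R R' : State n → Prop}
    (h : ExecW w c s b R) (hR : ∀ s', R s' → R' s') : ExecW w c s b R' := by
  obtain ⟨μ, h1, h2⟩ := h
  exact ⟨μ, h1, fun s' hs' => hR _ (h2 s' hs')⟩

section
variable {n : ℕ} {P : Par n} {M : Abs} {σ : State n} {N : ℕ} {G : SimpleGraph (Fin n)}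

theorem zeroAbs_fresh {s : ℕ} (hn : 0 < n) : Fresh n s (fun _ _ => 0) zeroAbs := by
  refine ⟨⟨?_, ?_, ?_, ?_, ?_, ?_, ?_, ?_⟩, rfl, fun _ _ => rfl, fun _ _ => rfl, fun _ _ _ => rfl⟩
  · intro v a h; exact absurd rfl h
  · intro v a; exact Nat.zero_le _
  · funext x y
    simp [totOf, zeroAbs]
  · intro x y; exact subset_rfl
  · funext v a
    simp [baseOf, zeroAbs]
  · intro v i a h
    simp [zeroAbs] at h
  · intro v a _
    simp [zeroAbs]
  · intro x j; exact hn

theorem Fresh.insert {s : ℕ} {st : ℕ → ℕ → ℕ} (h : Fresh n s st M) {v a : ℕ} (hva : v < a)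
    (ha : a < n) (h0 : M.st v a = 0) : Fresh n s (upd2 st v a 1) (insAbs n s 0 v a M) := by
  refine ⟨h.wf.insert hva ha h0, ?_, h.cen, h.act, ?_⟩
  · rw [← h.st]; rfl
  · intro x j i
    simp only [insAbs, logAbs, upd2]
    split_ifs
    · dsimp only
      split_ifs
      exacts [rfl, h.bt _ _ i]
    · exact h.bt x j i

theorem zeroAbs_rep (hn : 0 < n) (h3 : σ.var 3 = n) (h4 : σ.var 4 = P.s) (h5 : σ.var 5 = P.D)
    (h6 : σ.var 6 = P.T) (hm : ∀ i, P.D ^ 3 ≤ i → σ.mem i = 0) (ho : σ.out = ⊥) :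
    Ok P zeroAbs σ := by
  have hm' : ∀ k i j l, 1 ≤ k → σ.mem (addr P.D k i j l) = 0 := fun k i j l hk => hm _ (le_addr hk)
  have ht : ∀ p, tokOf P.D σ p = 0 := by
    intro p
    unfold tokOf
    split_ifs
    · exact hm' _ _ _ _ (by omega)
    · rfl
  have hc : ∀ v a, tokCount P.D (tokOf P.D σ) v a = 0 := by
    intro v a
    simp [tokCount, ht, tokRef]
  refine ⟨⟨h3, h4, h5, h6, ?_, ?_, ?_, ?_, ?_, ?_, ?_, ?_⟩, (zeroAbs_fresh hn).wf, ?_⟩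
  · intro v _ a _; exact hm' _ _ _ _ (by omega)
  · intro v _ a _; rw [hc]; exact hm' _ _ _ _ (by omega)
  · intro v _ a _; exact hm' _ _ _ _ (by omega)
  · intro x _ y _
    rw [hm' _ _ _ _ (by omega), hm' _ _ _ _ (by omega)]
    exact ⟨subset_rfl, le_rfl, fun i hi => absurd hi (by omega),
      fun v hv => absurd hv (Finset.notMem_empty v)⟩
  · intro x _ y _; exact Finset.empty_subset _
  · intro x _ y _; exact hm' _ _ _ _ (by omega)
  · intro x _ y _ z _; exact hm' _ _ _ _ (by omega)
  · intro u v
    rw [hc, ho]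
    simp [zeroAbs]
  · intro p _ _
    exact Or.inl ⟨rfl, ht p⟩

/-- The edges read so far have been inserted. -/
def Filled (P : Par n) (G : SimpleGraph (Fin n)) (v a : ℕ) (τ : State n) : Prop :=
  ∃ M, Ok P M τ ∧ Fresh n P.s (fillSt G v a) M ∧ τ.var 7 = 0 ∧ τ.var 11 = (fillSet G v a).card ∧
    ∀ v < n, ∀ a < n, τ.mem (v * n + a) ≠ 0 ↔ AdjN G v a

theorem fillSet_le (v a : ℕ) : (fillSet G v a).card ≤ n * n := by
  classical
  unfold fillSet
  refine (Finset.card_filter_le _ _).trans ?_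
  rw [Finset.card_product, Finset.card_range]

theorem Filled.setVar {v a z u : ℕ} {τ : State n} (h : Filled P G v a τ) (hz : 8 ≤ z) (hz' : z ≠ 11) :
    Filled P G v a (τ.setVar z u) := by
  obtain ⟨M, h1, h2, h3, h4, h5⟩ := h
  exact ⟨M, h1.setVar (by omega), h2, (State.setVar_var_ne (by omega)).trans h3,
    (State.setVar_var_ne (by omega)).trans h4, h5⟩

theorem Filled.next_row {v : ℕ} {τ : State n} (h : Filled P G v n τ) : Filled P G (v + 1) 0 τ := by
  obtain ⟨M, h1, h2, h3, h4, h5⟩ := h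
  have e : ∀ u c, u < c ∧ AdjN G u c ∧ (u < v ∨ u = v ∧ c < n) ↔
      u < c ∧ AdjN G u c ∧ (u < v + 1 ∨ u = v + 1 ∧ c < 0) := by
    intro u c
    constructor
    · rintro ⟨h1, h2, h3⟩; exact ⟨h1, h2, by omega⟩
    · rintro ⟨h1, h2, h3⟩
      have := h2.2.1
      exact ⟨h1, h2, by omega⟩
  have e1 : fillSt G v n = fillSt G (v + 1) 0 := by
    funext u c; unfold fillSt; congr 1; exact propext (e u c)
  have e2 : fillSet G v n = fillSet G (v + 1) 0 := by
    ext p; simp only [fillSet, Finset.mem_filter, e]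
  exact ⟨M, h1, e1 ▸ h2, h3, e2 ▸ h4, h5⟩

theorem mul_add_lt_cube {v a : ℕ} (hv : v < n) (ha : a < n) (P : Par n) : v * n + a < P.D ^ 3 := by
  have h1 := P.n_le_D
  have h2 : v * n + a < n * n := by nlinarith
  have h3 : n * n ≤ P.D * P.D := Nat.mul_le_mul h1 h1
  have h4 : P.D * P.D * 1 ≤ P.D * P.D * P.D := Nat.mul_le_mul_left _ P.D_pos
  calc v * n + a < P.D * P.D * P.D := by omega
    _ = _ := by ring

theorem Filled.step {v a : ℕ} {τ : State n} (h : Filled P G v a τ) (hv : v < n) (ha : a < n)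
    (h8 : τ.var 8 = v) (h9 : τ.var 9 = a) (hN : P.s ≤ N) :
    ExecS P.D P.w prepBodyC τ (prepBodyC.cost N) [] fun τ' =>
      Filled P G v (a + 1) τ' ∧ τ'.var 8 = v ∧ τ'.var 9 = a := by
  classical
  obtain ⟨M, h1, h2, h3, h4, h5⟩ := h
  have hD := P.D_pos
  have hn := P.n_le_D
  have hT : 0 < P.T := P.T_pos (by omega)
  have hle := fillSet_le (G := G) v a
  have hnn : n * n ≤ P.D * P.D := Nat.mul_le_mul hn hn
  have hvn : v * n ≤ n * n := Nat.mul_le_mul_right _ hv.le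
  have hskip : ¬ (v < a ∧ AdjN G v a) → Filled P G v (a + 1) τ := by
    intro hh
    have e : ∀ u c, u < c ∧ AdjN G u c ∧ (u < v ∨ u = v ∧ c < a) ↔
        u < c ∧ AdjN G u c ∧ (u < v ∨ u = v ∧ c < a + 1) := by
      intro u c
      constructor
      · rintro ⟨h1, h2, h3⟩; exact ⟨h1, h2, by omega⟩
      · rintro ⟨g1, g2, g3⟩
        refine ⟨g1, g2, ?_⟩
        by_contra g4
        have g5 : u = v := by omega
        have g6 : c = a := by omega
        exact hh ⟨g5 ▸ g6 ▸ g1, g5 ▸ g6 ▸ g2⟩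
    have e1 : fillSt G v a = fillSt G v (a + 1) := by
      funext u c; unfold fillSt; congr 1; exact propext (e u c)
    have e2 : fillSet G v a = fillSet G v (a + 1) := by
      ext p; simp only [fillSet, Finset.mem_filter, e]
    exact ⟨M, h1, e1 ▸ h2, h3, e2 ▸ h4, h5⟩
  refine ExecS.cond ?_ ?_ <;> intro hc
  · rw [eval_lt_ne (eval_var h8) (eval_var h9)] at hc
    have e1 : (Expr.read (.plus (.times (.var 8) (.var 3)) (.var 9))).eval P.w τ =
        τ.mem (v * n + a) := by
      have : (Expr.plus (.times (.var 8) (.var 3)) (.var 9)).eval P.w τ = v * n + a :=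
        eval_add (eval_mul (eval_var h8) (eval_var h1.rep.v3) (P.lt_W (by rw [mul_assoc]; omega)))
          (eval_var h9) (P.lt_W (by rw [mul_assoc]; nlinarith))
      rw [Expr.eval, this]
    refine ExecS.cond ?_ ?_ <;> rw [e1] <;> intro hc2
    · rw [h5 v hv a ha] at hc2
      have h0 : M.st v a = 0 := by
        rw [h2.st]
        unfold fillSt
        rw [if_neg (by omega)]
      refine ExecS.seq_nil ((h1.insert hc ha h0 h3 hT h8 h9 hN).imp ?_)
      rintro τ' ⟨ok, f⟩
      refine ExecS.of_tri (Tri.assign ?_)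
      have h11 := f.var (by omega) h4
      rw [eval_add (eval_var h11) (eval_const P.one_lt_W) (P.lt_W (by
        have : 1 * 1 ≤ P.D * P.D := Nat.mul_le_mul hD hD
        rw [mul_assoc]; omega))]
      have e1 : upd2 (fillSt G v a) v a 1 = fillSt G v (a + 1) := by
        funext u c
        simp only [fillSt, upd2]
        by_cases huc : u = v ∧ c = a
        · obtain ⟨rfl, rfl⟩ := huc
          simp [hc, hc2]
        · rw [if_neg huc]
          congr 1
          simp only [eq_iff_iff]
          refine and_congr_right fun _ => and_congr_right fun _ => ?_
          omega
      have e2 : (fillSet G v (a + 1)).card = (fillSet G v a).card + 1 := by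
        have : fillSet G v (a + 1) = insert (v, a) (fillSet G v a) := by
          ext ⟨u, c⟩
          simp only [fillSet, Finset.mem_insert, Finset.mem_filter, Finset.mem_product,
            Finset.mem_range, Prod.mk.injEq]
          constructor
          · rintro ⟨h6, h7, h8, h9⟩
            by_cases hh : u = v ∧ c = a
            · exact Or.inl hh
            · exact Or.inr ⟨h6, h7, h8, by omega⟩
          · rintro (⟨rfl, rfl⟩ | ⟨h6, h7, h8, h9⟩)
            · exact ⟨⟨hv, ha⟩, hc, hc2, by omega⟩
            · exact ⟨h6, h7, h8, by omega⟩
        rw [this, Finset.card_insert_of_notMem]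
        simp [fillSet]
      have := h2.insert hc ha h0
      rw [e1] at this
      refine ⟨rfl, ⟨_, ok.setVar (by omega), this, ?_, ?_, ?_⟩, ?_, ?_⟩
      · exact f.var (by omega) h3
      · rw [e2]; simp [State.setVar]
      · intro v' hv' a' ha'
        rw [← h5 v' hv' a' ha', ← f.2 _ (mul_add_lt_cube hv' ha' P)]
        rfl
      · exact f.var (by omega) h8
      · exact f.var (by omega) h9
    · exact ExecS.of_tri (Tri.nop ⟨rfl, hskip fun hh => (h5 v hv a ha).2 hh.2 hc2, h8, h9⟩)
  · have hc' := mt (eval_lt_ne (eval_var h8) (eval_var h9)).2 (not_not.2 hc)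
    exact ExecS.of_tri (Tri.nop ⟨rfl, hskip fun hh => hc' hh.1, h8, h9⟩)

theorem Filled.fill {τ : State n} (h : Filled P G 0 0 τ) (hN : P.s ≤ N) (hnN : n ≤ N) :
    ExecS P.D P.w (forC 8 (.var 3) (forC 9 (.var 3) prepBodyC)) τ
      ((forC 8 (.var 3) (forC 9 (.var 3) prepBodyC)).cost N) [] fun τ' => Filled P G n 0 τ' := by
  have hn := P.n_le_D
  have hl0 : ∀ m, catList (fun _ => ([] : List ((ℕ × ℕ) × Finset ℕ))) 0 m = [] :=
    fun m => catList_nil _ _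
  have h3 : ∀ {v a : ℕ} {τ : State n}, Filled P G v a τ → (Expr.var 3).eval P.w τ = n := by
    rintro v a τ ⟨M, h1, -⟩
    exact h1.rep.v3
  rw [← hl0 n]
  refine (ExecS.forC (m := n) (l := fun _ => []) (P.lt_W' (by omega)) hnN
    (I := fun v τ => Filled P G v 0 τ ∧ τ.var 8 = v) ?_ ?_ ?_).imp fun τ h => h.1
  · rintro v - τ ⟨h, h8⟩
    exact ⟨h8, h3 h⟩
  · rintro v hv τ ⟨h, h8⟩
    rw [← hl0 n]
    refine (ExecS.forC (m := n) (l := fun _ => []) (P.lt_W' (by omega)) hnN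
      (I := fun a τ => Filled P G v a τ ∧ τ.var 8 = v ∧ τ.var 9 = a) ?_ ?_ ?_).imp ?_
    · rintro a - τ ⟨h, -, h9⟩
      exact ⟨h9, h3 h⟩
    · rintro a ha τ ⟨h, h8, h9⟩
      exact (h.step hv ha h8 h9 hN).imp fun τ' hh => ⟨hh.2.2, hh.1.setVar (by omega) (by omega),
        (State.setVar_var_ne (by omega)).trans hh.2.1, by simp [State.setVar]⟩
    · exact ⟨h.setVar (by omega) (by omega), (State.setVar_var_ne (by omega)).trans h8,
        by simp [State.setVar]⟩
    · rintro τ ⟨h, h8, -⟩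
      exact ⟨h8, h.next_row.setVar (by omega) (by omega), by simp [State.setVar]⟩
  · exact ⟨h.setVar (by omega) (by omega), by simp [State.setVar]⟩

/-- The outcome of preprocessing. -/
def Prepared (P : Par n) (G : SimpleGraph (Fin n)) (τ : State n) : Prop :=
  ∃ M, Fresh n P.s (fillSt G n 0) M ∧ τ.var 7 = 0 ∧
    Ok P (if P.D * P.s < numE G then bgIter P.s P.T M (2 * P.T) else M) τ

theorem Filled.passes {τ : State n} (hn0 : 0 < n) (h : Filled P G n 0 τ) (hN : P.s ≤ N)
    (hTN : 2 * P.T ≤ N) :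
    ExecW P.w (.cond (.op .lt (.times (.var 5) (.var 4)) (.var 11))
      (forC 12 (.times (.var 6) (.const 2)) bgC) .nop) τ
      ((Cmd.cond (.op .lt (.times (.var 5) (.var 4)) (.var 11))
      (forC 12 (.times (.var 6) (.const 2)) bgC) .nop).cost N) (Prepared P G) := by
  obtain ⟨M, h1, h2, h3, h4, h5⟩ := h
  have hD := P.D_pos
  have hT := P.T_le'
  have hT0 := P.T_pos hn0
  have hs : P.D * P.s ≤ 64 * P.D * P.D :=
    calc P.D * P.s ≤ P.D * P.D := Nat.mul_le_mul_left _ P.s_le_D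
      _ ≤ 64 * P.D * P.D := by nlinarith
  have e1 : (Expr.times (.var 5) (.var 4)).eval P.w τ = P.D * P.s :=
    eval_mul (eval_var h1.rep.v5) (eval_var h1.rep.v4) (P.lt_W hs)
  by_cases hc : P.D * P.s < numE G
  · refine (ExecS.cond (D := P.D) (fun _ => ((ExecS.forC (m := 2 * P.T)
      (l := fun i => bgSam P.s (i % P.T) (bgIter P.s P.T M i)) (P.lt_W (by omega)) hTN
      (I := fun i τ => Ok P (bgIter P.s P.T M i) τ ∧ τ.var 7 = i % P.T ∧ τ.var 12 = i) ?_ ?_ ?_).imp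
      ?_)) fun h0 => absurd h0 ((eval_lt_ne e1 (eval_var h4)).2 hc)).weak
    · rintro i - τ ⟨ok, -, h12⟩
      refine ⟨h12, ?_⟩
      rw [eval_mul (eval_var ok.rep.v6) (eval_const (P.lt_W' (by omega))) (P.lt_W (by omega)),
        mul_comm]
    · rintro i hi τ ⟨ok, h7, h12⟩
      refine (ok.bg h7 (Nat.mod_lt _ hT0) hN).imp ?_
      rintro τ' ⟨ok', h7', hv⟩
      refine ⟨(hv 12 (by omega) (by omega)).trans h12, ok'.setVar (by omega),
        (State.setVar_var_ne (by omega)).trans (h7'.trans ?_), by simp [State.setVar]⟩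
      simp
    · exact ⟨h1.setVar (by omega), (State.setVar_var_ne (by omega)).trans (by simpa using h3),
        by simp [State.setVar]⟩
    · rintro τ ⟨ok, h7, -⟩
      refine ⟨M, h2, h7.trans (by simp), ?_⟩
      rw [if_pos hc]
      exact ok
  · refine (ExecS.cond (D := P.D) (fun h0 => absurd ((eval_lt_ne e1 (eval_var h4)).1 h0) hc) fun _ =>
      ExecS.of_tri (Tri.nop ⟨rfl, M, h2, h3, ?_⟩)).weak
    rw [if_neg hc]
    exact h1

/-- The word length on `n` vertices is `16` times the number of bits of `n`, and the size of
buckets is the square root of `n`, rounded up. -/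
def Par.std (hn : 0 < n) : Par n where
  s := Nat.sqrt (n - 1) + 1
  w := 16 * Nat.size n
  s_pos := Nat.succ_pos _
  n_le := by
    have := Nat.lt_succ_sqrt (n - 1)
    simp only [Nat.succ_eq_add_one] at this
    omega
  s_le := by
    have h1 := Nat.sqrt_le (n - 1)
    have h2 : Nat.sqrt (n - 1) ≤ Nat.sqrt (n - 1) * Nat.sqrt (n - 1) := Nat.le_mul_self _
    have h3 : (Nat.sqrt (n - 1) + 1) * (Nat.sqrt (n - 1) + 1) =
      Nat.sqrt (n - 1) * Nat.sqrt (n - 1) + 2 * Nat.sqrt (n - 1) + 1 := by ring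
    omega
  w_ge := by
    have h1 := Nat.sqrt_le (n - 1)
    have h2 : Nat.sqrt (n - 1) ≤ Nat.sqrt (n - 1) * Nat.sqrt (n - 1) := Nat.le_mul_self _
    have h3 : (Nat.sqrt (n - 1) + 1) * (Nat.sqrt (n - 1) + 1) =
      Nat.sqrt (n - 1) * Nat.sqrt (n - 1) + 2 * Nat.sqrt (n - 1) + 1 := by ring
    have h4 : (Nat.sqrt (n - 1) + 1) * (Nat.sqrt (n - 1) + 1) ≤ 4 * n := by omega
    have h5 := Nat.lt_size_self n
    have h6 : 1 ≤ Nat.size n := Nat.size_pos.2 hn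
    calc 64 * ((Nat.sqrt (n - 1) + 1) * (Nat.sqrt (n - 1) + 1)) ^ 3
        ≤ 64 * (4 * n) ^ 3 := by gcongr
      _ = 2 ^ 12 * n ^ 3 := by ring
      _ < 2 ^ 12 * (2 ^ Nat.size n) ^ 3 := by gcongr
      _ = 2 ^ (12 + Nat.size n * 3) := by rw [pow_add, pow_mul]
      _ ≤ 2 ^ (16 * Nat.size n) := Nat.pow_le_pow_right (by omega) (by omega)

theorem prep_exec (hn : 0 < n) (G : SimpleGraph (Fin n)) (hN : 2 * (Par.std hn).T ≤ N) :
    ExecW (Par.std hn).w prepC (initState G) (prepC.cost N) (Prepared (Par.std hn) G) := by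
  set P := Par.std hn with hP
  have hD := P.D_pos
  have hnD := P.n_le_D
  have hs := P.s_le_D
  have hT := P.T_le'
  have hsT : P.s ≤ P.T := Nat.le_mul_of_pos_left _ hn
  have hnT : n ≤ P.T := Nat.le_mul_of_pos_right _ P.s_pos
  -- the square root is found by trying all values
  have hsq : ∀ i, i < P.s ↔ i * i < n := by
    intro i
    have h1 : P.s = Nat.sqrt (n - 1) + 1 := rfl
    rw [h1, Nat.lt_succ_iff, Nat.le_sqrt]
    omega
  have key : ExecS P.D P.w (.loop (.op .lt (.times (.var 4) (.var 4)) (.var 3))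
      (.assign 4 (.plus (.var 4) (.const 1)))) ((initState G).setVar 3 n)
      ((Cmd.loop (.op .lt (.times (.var 4) (.var 4)) (.var 3))
      (.assign 4 (.plus (.var 4) (.const 1)))).cost N) [] fun τ => τ.mem = (initState G).mem ∧
        τ.out = ⊥ ∧ τ.var 3 = n ∧ τ.var 4 = P.s ∧ ∀ y ≥ 5, τ.var y = 0 := by
    rw [← catList_nil 0 P.s]
    refine ((ExecS.loop_aux (M := P.s) (l := fun _ => []) (I := fun i τ =>
      τ.mem = (initState G).mem ∧ τ.out = ⊥ ∧ τ.var 3 = n ∧ τ.var 4 = i ∧ ∀ y ≥ 5, τ.var y = 0)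
      (b := 1) ?_ ?_ P.s 0 (by omega) _ ?_).mono ?_)
    · rintro i hi τ ⟨-, -, h3, h4, -⟩
      rw [eval_lt_ne (eval_mul (eval_var h4) (eval_var h4) (P.lt_W' ?_)) (eval_var h3), hsq]
      calc i * i ≤ P.s * P.s := Nat.mul_le_mul hi hi
        _ ≤ 64 * P.D := by unfold Par.D; omega
    · rintro i hi τ ⟨h1, h2, h3, h4, h5⟩
      refine ExecS.of_tri (Tri.assign (N := 0) ?_)
      rw [eval_add (eval_var h4) (eval_const P.one_lt_W) (P.lt_W' (by omega))]
      refine ⟨rfl, h1, h2, h3, by simp [State.setVar], fun y hy => ?_⟩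
      exact (State.setVar_var_ne (by omega)).trans (h5 y hy)
    · refine ⟨rfl, rfl, by simp [State.setVar], ?_, ?_⟩
      · simp [State.setVar, initState]
      · intro y hy
        have h1 : y ≠ 3 := by omega
        have h2 : y ≠ 0 := by omega
        simp [State.setVar, initState, h1, h2]
    · simp only [Cmd.cost]
      gcongr
      omega
  have main : ∀ τ : State n, (τ.mem = (initState G).mem ∧ τ.out = ⊥ ∧ τ.var 3 = n ∧
      τ.var 4 = P.s ∧ ∀ y ≥ 5, τ.var y = 0) →
      Filled P G 0 0 ((τ.setVar 5 P.D).setVar 6 P.T) := by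
    rintro τ ⟨h1, h2, h3, h4, h5⟩
    refine ⟨zeroAbs, zeroAbs_rep hn h3 h4 (by simp [State.setVar]) (by simp [State.setVar]) ?_ h2, ?_,
      ?_, ?_, ?_⟩
    · intro i hi
      change τ.mem i = 0
      rw [h1]
      simp only [initState]
      rw [if_neg]
      rintro ⟨u, v, rfl, -⟩
      have := mul_add_lt_cube u.2 v.2 P
      omega
    · have : fillSt G 0 0 = fun _ _ => 0 := by
        funext u c
        simp [fillSt]
      rw [this]
      exact zeroAbs_fresh hn
    · exact h5 7 (by omega)
    · have : fillSet G 0 0 = ∅ := by simp [fillSet]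
      rw [this]
      exact h5 11 (by omega)
    · intro v hv a ha
      change τ.mem _ ≠ 0 ↔ _
      rw [h1]
      simp only [initState]
      constructor
      · intro hne
        by_contra hna
        rw [if_neg] at hne
        · exact hne rfl
        · rintro ⟨u, c, h6, h7⟩
          have h8 : (u : ℕ) = v := by
            have e1 : (v * n + a) / n = v := by
              rw [add_comm, Nat.add_mul_div_right _ _ hn, Nat.div_eq_of_lt ha, zero_add]
            have e2 : ((u : ℕ) * n + c) / n = u := by
              rw [add_comm, Nat.add_mul_div_right _ _ hn, Nat.div_eq_of_lt c.2, zero_add]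
            rw [← e1, h6, e2]
          have h9 : (c : ℕ) = a := by
            rw [h8] at h6
            omega
          subst h8 h9
          exact hna ⟨u.2, c.2, h7⟩
      · rintro ⟨hv, ha, h6⟩
        rw [if_pos ⟨⟨v, hv⟩, ⟨a, ha⟩, rfl, h6⟩]
        exact one_ne_zero
  refine ExecW.seq ((ExecS.of_tri (D := P.D) (Tri.assign ⟨rfl, ?_⟩)).weak)
  refine ExecW.seq (key.imp fun τ h => ?_).weak
  have e5 : (Expr.times (.var 4) (.var 4)).eval P.w τ = P.D :=
    eval_mul (eval_var h.2.2.2.1) (eval_var h.2.2.2.1) (P.lt_W' (by unfold Par.D; omega))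
  refine ExecW.seq ((ExecS.of_tri (D := P.D) (Tri.assign ⟨rfl, ?_⟩)).weak)
  rw [e5]
  have e6 : (Expr.times (.var 3) (.var 4)).eval P.w (τ.setVar 5 P.D) = P.T :=
    eval_mul (eval_var h.2.2.1) (eval_var h.2.2.2.1) (P.lt_W (by unfold Par.T at hT; omega))
  refine ExecW.seq ((ExecS.of_tri (D := P.D) (Tri.assign ⟨rfl, ?_⟩)).weak)
  rw [e6]
  exact ExecW.seq (((main τ h).fill (by omega) (by omega)).imp fun τ' h' =>
    h'.passes hn (by omega) hN).weak

end

/-! ### Edges as increasing pairs -/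

/-- The edges of a graph as increasing pairs of natural numbers. -/
noncomputable def edgesN {n : ℕ} (G : SimpleGraph (Fin n)) : Finset (ℕ × ℕ) := fillSet G n 0

section
variable {n : ℕ} {G H : SimpleGraph (Fin n)}

theorem mem_edgesN {u c : ℕ} : (u, c) ∈ edgesN G ↔ u < c ∧ AdjN G u c := by
  simp only [edgesN, fillSet, Finset.mem_filter, Finset.mem_product, Finset.mem_range]
  constructor
  · tauto
  · rintro ⟨h1, h2⟩
    obtain ⟨h3, h4, -⟩ := id h2
    exact ⟨⟨h3, h4⟩, h1, h2, Or.inl h3⟩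

theorem ncard_edgeSet (G : SimpleGraph (Fin n)) : G.edgeSet.ncard = (edgesN G).card := by
  have key : (fun e : Sym2 (Fin n) => ((e.inf : ℕ), (e.sup : ℕ))) '' G.edgeSet = ↑(edgesN G) := by
    ext ⟨u, c⟩
    simp only [Set.mem_image, Finset.mem_coe, mem_edgesN]
    constructor
    · rintro ⟨e, he, h⟩
      induction e with
      | _ x y =>
        rw [SimpleGraph.mem_edgeSet] at he
        have hne := he.ne
        simp only [Sym2.inf_mk, Sym2.sup_mk, Prod.mk.injEq] at h
        rcases lt_or_gt_of_ne hne with hlt | hlt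
        · rw [inf_eq_left.2 hlt.le, sup_eq_right.2 hlt.le] at h
          obtain ⟨rfl, rfl⟩ := h
          exact ⟨hlt, x.2, y.2, he⟩
        · rw [inf_eq_right.2 hlt.le, sup_eq_left.2 hlt.le] at h
          obtain ⟨rfl, rfl⟩ := h
          exact ⟨hlt, y.2, x.2, he.symm⟩
    · rintro ⟨hlt, hu, hc, h⟩
      refine ⟨s(⟨u, hu⟩, ⟨c, hc⟩), h, ?_⟩
      have hlt' : (⟨u, hu⟩ : Fin n) ≤ ⟨c, hc⟩ := hlt.le
      simp [inf_eq_left.2 hlt', sup_eq_right.2 hlt']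
  rw [← Set.ncard_coe_finset, ← key, Set.ncard_image_of_injective]
  intro e e' h
  simp only [Prod.mk.injEq, Fin.val_inj] at h
  exact Sym2.inf_eq_inf_and_sup_eq_sup.1 h

/-- The number of changed edges is twice the number of inserted edges, up to the change of the
total number of edges. -/
theorem ncard_symmDiff_add (G H : SimpleGraph (Fin n)) :
    (symmDiff G H).edgeSet.ncard + (edgesN G).card =
      (edgesN H).card + 2 * (edgesN G \ edgesN H).card := by
  have h1 : edgesN (symmDiff G H) = (edgesN G \ edgesN H) ∪ (edgesN H \ edgesN G) := by
    ext ⟨u, c⟩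
    simp only [mem_edgesN, Finset.mem_union, Finset.mem_sdiff, AdjN, symmDiff_def,
      SimpleGraph.sup_adj, SimpleGraph.sdiff_adj]
    constructor
    · rintro ⟨h, hu, hc, h' | h'⟩
      · exact Or.inl ⟨⟨h, hu, hc, h'.1⟩, fun ⟨_, _, _, h3⟩ => h'.2 h3⟩
      · exact Or.inr ⟨⟨h, hu, hc, h'.1⟩, fun ⟨_, _, _, h3⟩ => h'.2 h3⟩
    · rintro (⟨⟨h, hu, hc, h'⟩, h2⟩ | ⟨⟨h, hu, hc, h'⟩, h2⟩)
      · exact ⟨h, hu, hc, Or.inl ⟨h', fun h3 => h2 ⟨h, hu, hc, h3⟩⟩⟩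
      · exact ⟨h, hu, hc, Or.inr ⟨h', fun h3 => h2 ⟨h, hu, hc, h3⟩⟩⟩
  have h2 := Finset.card_sdiff_add_card (edgesN G) (edgesN H)
  have h3 := Finset.card_sdiff_add_card (edgesN H) (edgesN G)
  rw [Finset.union_comm] at h3
  rw [ncard_edgeSet, h1, Finset.card_union_of_disjoint disjoint_sdiff_sdiff]
  omega

/-! ### Scans by background passes -/

/-- The number of times before `κ` at which the residue `c` modulo `T` is processed. -/
def cnt (T c κ : ℕ) : ℕ := Nat.count (fun r => r % T = c) κ

variable {T c c' κ β : ℕ}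

theorem cnt_succ : cnt T c (κ + 1) = cnt T c κ + if κ % T = c then 1 else 0 := Nat.count_succ _ _

theorem cnt_mono (h : β ≤ κ) : cnt T c β ≤ cnt T c κ := Nat.count_monotone _ h

theorem cnt_add (hc : c < T) (κ : ℕ) : cnt T c (κ + T) = cnt T c κ + 1 := by
  induction κ with
  | zero =>
    rw [cnt, cnt, Nat.count_zero, zero_add, zero_add, Nat.count_eq_card_filter_range,
      Finset.card_eq_one]
    refine ⟨c, ?_⟩
    ext r
    simp only [Finset.mem_filter, Finset.mem_range, Finset.mem_singleton]
    constructor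
    · rintro ⟨h1, h2⟩; rwa [Nat.mod_eq_of_lt h1] at h2
    · rintro rfl; exact ⟨hc, Nat.mod_eq_of_lt hc⟩
  | succ κ ih =>
    rw [show κ + 1 + T = κ + T + 1 by ring, cnt_succ, cnt_succ, ih, Nat.add_mod_right]
    ring

/-- Between two scans of one residue, every other residue is scanned. -/
theorem cnt_other (hc : c < T) (hc' : c' < T) (h : cnt T c β + 2 ≤ cnt T c κ) :
    cnt T c' β < cnt T c' κ := by
  have h1 : β + T ≤ κ := by
    by_contra hh
    have := cnt_mono (T := T) (c := c) (show κ ≤ β + T by omega)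
    rw [cnt_add hc] at this
    omega
  have := cnt_mono (T := T) (c := c') h1
  rw [cnt_add hc'] at this
  omega

/-- Two background passes scan every residue twice. -/
theorem lt_of_cnt (hc : c < T) (h : cnt T c κ ≤ cnt T c β + 1) : κ < β + 2 * T := by
  by_contra hh
  have := cnt_mono (T := T) (c := c) (show β + T + T ≤ κ by omega)
  rw [cnt_add hc, cnt_add hc] at this
  omega

/-- At time `κ`, the state of an edge records how often it was scanned since its birth, and a
candidate for a witness is active if its pair was processed since the birth of both its edges. -/
structure Timely (T s κ : ℕ) (birth : ℕ → ℕ → ℕ) (M : Abs) : Prop where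
  birth_le : ∀ v a, M.st v a ≠ 0 → birth v a ≤ κ
  st : ∀ v a, M.st v a ≠ 0 → M.st v a =
    min 3 (1 + (cnt T (v * s + a / s) κ - cnt T (v * s + a / s) (birth v a)))
  act : ∀ x y v, v ∈ M.tot x y → v ∉ M.act x y →
    cnt T (x * s + y % s) κ ≤ cnt T (x * s + y % s) (max (birth v x) (birth v y))

variable {s : ℕ} {birth : ℕ → ℕ → ℕ} {M : Abs} {y : Tok} {q v a : ℕ}

/-- The counter of the residue `κ % T` increases, and it is the state of the edges of this slot that
changes. -/
theorem Timely.bg (h : Timely T s κ birth M) (hw : Wf n s M) (hs : 0 < s) (hn : n ≤ s * s) :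
    Timely T s (κ + 1) birth (bgAbs s (κ % T) M) := by
  refine ⟨?_, ?_, ?_⟩
  · intro v a hv
    have := h.birth_le v a (scanSt_ne_zero.1 hv)
    omega
  · intro v a hv
    have hv' := scanSt_ne_zero.1 hv
    have h1 := h.st v a hv'
    have h2 := cnt_mono (T := T) (c := v * s + a / s) (h.birth_le v a hv')
    have ha : a / s < s := Nat.div_lt_of_lt_mul (by have := hw.lt v a hv'; omega)
    have h3 : κ % T = v * s + a / s ↔ v = κ % T / s ∧ a / s = κ % T % s := by
      constructor
      · intro hh
        rw [hh, bucket_div ha, bucket_mod ha]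
        exact ⟨rfl, rfl⟩
      · rintro ⟨h4, h5⟩
        rw [h4, h5, mul_comm]
        exact (Nat.div_add_mod _ _).symm
    change scanSt s (κ % T / s) (κ % T % s) s M.st v a = _
    rw [cnt_succ]
    unfold scanSt
    by_cases hh : v = κ % T / s ∧ a / s = κ % T % s
    · rw [if_pos ⟨hh.1, hh.2, Nat.mod_lt _ hs⟩, if_pos (h3.2 hh), h1]
      unfold bump
      split_ifs <;> omega
    · rw [if_neg (by tauto), if_neg (mt h3.1 hh), h1]
      simp
  · intro x y v hv hva
    obtain ⟨h1, h2, -⟩ := hw.mem_tot.1 hv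
    simp only [bgAbs, upd2] at hva
    split_ifs at hva with hh
    · rw [← hh.1, ← hh.2] at hva
      exact absurd hv hva
    · rw [cnt_succ, if_neg]
      · exact h.act x y v hv hva
      · intro h3
        refine hh ?_
        have h4 : flipPair s (κ % T) = (x, y) := by
          unfold flipPair
          rw [h3, bucket_div (Nat.mod_lt _ hs), bucket_mod (Nat.mod_lt _ hs), ← bucket_eq h2.symm]
          simp [pr, h1]
        rw [h4]
        exact ⟨rfl, rfl⟩

/-- The births of edges after the change of the edge `(v, a)` at time `κ`. -/
def nextBirth (κ v a : ℕ) (M : Abs) (birth : ℕ → ℕ → ℕ) : ℕ → ℕ → ℕ :=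
  if M.st v a = 0 then upd2 birth v a κ else birth

theorem usrAbs_st (v' a' : ℕ) : (usrAbs n s q v a y M).st v' a' =
    if v' = v ∧ a' = a then (if M.st v a = 0 then 1 else 0) else M.st v' a' := by
  unfold usrAbs
  by_cases h : M.st v a = 0
  · rw [if_pos h, if_pos h]; rfl
  · rw [if_neg h, if_neg h]; rfl

theorem usrAbs_act (x z : ℕ) : (usrAbs n s q v a y M).act x z =
    if M.st v a = 0 then M.act x z else delAct v a M x z := by
  unfold usrAbs
  by_cases h : M.st v a = 0
  · rw [if_pos h, if_pos h]; rfl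
  · rw [if_neg h, if_neg h]; rfl

theorem Wf.usr (hw : Wf n s M) (hs : 0 < s) (hva : v < a) (ha : a < n) :
    Wf n s (usrAbs n s q v a y M) := by
  unfold usrAbs
  split_ifs with h
  · exact hw.insert hva ha h
  · exact hw.delete hs y ha

theorem Timely.usr (h : Timely T s κ birth M) (hw : Wf n s M) (hs : 0 < s) (hva : v < a)
    (ha : a < n) : Timely T s κ (nextBirth κ v a M birth) (usrAbs n s q v a y M) := by
  have hw' := hw.usr (q := q) (y := y) hs hva ha
  have hst := fun v' a' => usrAbs_st (n := n) (s := s) (q := q) (v := v) (a := a) (y := y) (M := M)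
    v' a'
  have hb : ∀ v' a', ¬ (v' = v ∧ a' = a) → nextBirth κ v a M birth v' a' = birth v' a' := by
    intro v' a' hh
    unfold nextBirth
    split_ifs
    · simp only [upd2, if_neg hh]
    · rfl
  have hb' : M.st v a = 0 → nextBirth κ v a M birth v a = κ := by
    intro h0
    rw [nextBirth, if_pos h0, upd2_self]
  refine ⟨?_, ?_, ?_⟩
  · intro v' a' hv'
    rw [hst] at hv'
    by_cases hh : v' = v ∧ a' = a
    · rw [if_pos hh] at hv'
      rw [hh.1, hh.2, hb' (by by_contra h0; simp [h0] at hv')]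
    · rw [if_neg hh] at hv'
      rw [hb _ _ hh]
      exact h.birth_le _ _ hv'
  · intro v' a' hv'
    rw [hst] at hv' ⊢
    by_cases hh : v' = v ∧ a' = a
    · rw [if_pos hh] at hv' ⊢
      have h0 : M.st v a = 0 := by by_contra h0; simp [h0] at hv'
      rw [hh.1, hh.2, hb' h0, if_pos h0]
      simp
    · rw [if_neg hh] at hv' ⊢
      rw [hb _ _ hh]
      exact h.st _ _ hv'
  · intro x z u hu hua
    obtain ⟨h1, h2, h3, h4⟩ := hw'.mem_tot.1 hu
    rw [hst] at h3 h4
    by_cases hx : u = v ∧ (x = a ∨ z = a)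
    · have h0 : M.st v a = 0 := by
        by_contra h0
        rcases hx.2 with h5 | h5
        · simp [hx.1, h5, h0] at h3
        · simp [hx.1, h5, h0] at h4
      refine cnt_mono ?_
      rcases hx with ⟨rfl, rfl | rfl⟩
      · rw [hb' h0]; exact le_max_left _ _
      · rw [hb' h0]; exact le_max_right _ _
    · have hx1 : ¬ (u = v ∧ x = a) := by tauto
      have hx2 : ¬ (u = v ∧ z = a) := by tauto
      rw [if_neg hx1] at h3
      rw [if_neg hx2] at h4
      rw [hb _ _ hx1, hb _ _ hx2]
      refine h.act x z u (hw.mem_tot.2 ⟨h1, h2, h3, h4⟩) fun hu' => hua ?_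
      rw [usrAbs_act]
      split_ifs with h0
      · exact hu'
      · unfold delAct
        split_ifs with h5
        · exact Finset.mem_erase.2 ⟨fun h6 => hx ⟨h6, h5⟩, hu'⟩
        · exact hu'

theorem Timely.upd (h : Timely T s κ birth M) (hw : Wf n s M) (hs : 0 < s) (hn : n ≤ s * s)
    (hva : v < a) (ha : a < n) :
    Timely T s (κ + 1) (nextBirth κ v a M birth) (updAbs n s (κ % T) v a y M) :=
  (h.usr hw hs hva ha).bg (hw.usr hs hva ha) hs hn

theorem Fresh.timely {st : ℕ → ℕ → ℕ} (h : Fresh n s st M) (h1 : ∀ v a, st v a ≤ 1) (i : ℕ)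
    (hs : 0 < s) (hn : n ≤ s * s) :
    Wf n s (bgIter s T M i) ∧ Timely T s i (fun _ _ => 0) (bgIter s T M i) := by
  induction i with
  | zero =>
    refine ⟨h.wf, ⟨fun _ _ _ => le_rfl, fun v a hv => ?_, fun x z v _ _ => ?_⟩⟩
    · change M.st v a = _
      have : M.st v a ≠ 0 := hv
      rw [h.st] at this ⊢
      have := h1 v a
      simp
      omega
    · simp
  | succ i ih => exact ⟨ih.1.bg hs _, ih.2.bg ih.1 hs hn⟩

/-! ### The output is a 3-spanner -/

/-- It suffices to bridge every edge by a path of length at most `3`. -/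
theorem isSpanner_three (hle : H ≤ G) (h : ∀ u v, G.Adj u v → H.edist u v ≤ 3) :
    IsSpanner 3 G H := by
  refine ⟨hle, fun u v => ⟨SimpleGraph.edist_anti hle, ?_⟩⟩
  have key : ∀ {u v : Fin n} (p : G.Walk u v), H.edist u v ≤ ((3 : ℕ) : ℕ∞) * p.length := by
    intro u v p
    induction p with
    | nil => simp
    | cons hadj p ih =>
      refine H.edist_triangle.trans ((add_le_add (h _ _ hadj) ih).trans (le_of_eq ?_))
      rw [SimpleGraph.Walk.length_cons]
      push_cast
      ring
  by_cases htop : G.edist u v = ⊤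
  · rw [htop, ENat.mul_top (by norm_num)]
    exact le_top
  · obtain ⟨p, hp⟩ := SimpleGraph.exists_walk_of_edist_ne_top htop
    rw [← hp]
    exact key p

theorem tokCount_pos {D : ℕ} : 0 < tokCount D y v a ↔
    ∃ p : ℕ × ℕ, p.1 < D ∧ p.2 < D ∧ y p = v + 1 ∧ (p.1 = a ∨ p.2 = a) := by
  unfold tokCount
  rw [Finset.sum_pos_iff]
  refine exists_congr fun p => ?_
  simp only [Finset.mem_product, Finset.mem_range, tokRef]
  constructor
  · rintro ⟨h1, h2⟩
    split_ifs at h2 with h3 h4 h5 h5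
    all_goals first | exact ⟨h1.1, h1.2, h3, by tauto⟩ | omega
  · rintro ⟨h1, h2, h3, h4⟩
    rw [if_pos h3]
    refine ⟨⟨h1, h2⟩, ?_⟩
    rcases h4 with h4 | h4
    · rw [if_pos h4]; omega
    · rw [if_pos h4]; omega

/-- The states of edges describe the graph `G`. -/
def Tracks (G : SimpleGraph (Fin n)) (M : Abs) : Prop :=
  ∀ u c, u < c → (AdjN G u c ↔ M.st u c ≠ 0)

variable {P : Par n} {σ : State n}

theorem Ok.mem_edges (ok : Ok P M σ) {u c : ℕ} : (u, c) ∈ edgesN σ.out ↔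
    u < c ∧ c < n ∧ 0 < M.base u c + tokCount P.D (tokOf P.D σ) u c := by
  rw [mem_edgesN]
  constructor
  · rintro ⟨h1, hu, hc, h⟩
    rw [ok.rep.out] at h
    simp only [min_eq_left h1.le, max_eq_right h1.le] at h
    exact ⟨h1, hc, h.2⟩
  · rintro ⟨h1, hc, h⟩
    refine ⟨h1, by omega, hc, ?_⟩
    rw [ok.rep.out]
    simp only [min_eq_left h1.le, max_eq_right h1.le]
    exact ⟨fun hh => by rw [Fin.mk.injEq] at hh; omega, h⟩

/-- A witness is an active candidate. -/
theorem Ok.witness (ok : Ok P M σ) {p : ℕ × ℕ} (h1 : p.1 < P.D) (h2 : p.2 < P.D) {v : ℕ}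
    (hp : tokOf P.D σ p = v + 1) : v ∈ M.act p.1 p.2 := by
  rcases ok.tok p h1 h2 with ⟨-, h3⟩ | ⟨u, hu, h3⟩
  · omega
  · obtain rfl : v = u := by omega
    exact hu

/-- Each edge in the output is an edge of the graph. -/
theorem Ok.st_ne_zero (ok : Ok P M σ) {u c : ℕ} (h : (u, c) ∈ edgesN σ.out) : M.st u c ≠ 0 := by
  obtain ⟨h1, h2, h3⟩ := ok.mem_edges.1 h
  by_contra h0
  have hb : M.base u c = 0 := by
    rw [ok.wf.base, baseOf, h0, if_neg (by omega), if_neg]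
    intro hc
    have := (ok.wf.cen1 _ _ _ hc).2
    omega
  rw [hb, zero_add, tokCount_pos] at h3
  obtain ⟨p, hp1, hp2, hp, hpc⟩ := h3
  have := ok.wf.mem_tot.1 (ok.wf.act _ _ (ok.witness hp1 hp2 hp))
  rcases hpc with rfl | rfl <;> tauto

theorem AdjN.symm {u c : ℕ} (h : AdjN G u c) : AdjN G c u := by
  obtain ⟨hu, hc, h⟩ := h
  exact ⟨hc, hu, h.symm⟩

/-- An edge that is not explicit is represented by its center and the witness of the pair of the
center and its upper endpoint. -/
theorem Ok.isSpanner (ok : Ok P M σ) (tm : Timely P.T P.s κ birth M) (tr : Tracks G M) :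
    IsSpanner 3 G σ.out := by
  have hD := P.n_le_D
  have hs := P.s_pos
  have key : ∀ u w, u < w → AdjN G u w → ∃ c v, AdjN σ.out u c ∧ AdjN σ.out c v ∧ AdjN σ.out v w ∨
      AdjN σ.out u w := by
    intro u w huw hadj
    have hst := (tr u w huw).1 hadj
    have hwn := (ok.wf.lt u w hst).2
    by_cases hH : (u, w) ∈ edgesN σ.out
    · exact ⟨0, 0, Or.inr (mem_edgesN.1 hH).2⟩
    have hb : M.base u w = 0 := by
      by_contra hh
      exact hH (ok.mem_edges.2 ⟨huw, hwn, by omega⟩)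
    have hle := ok.wf.le u w
    have h3 : M.st u w = 3 := by
      rw [ok.wf.base, baseOf] at hb
      split_ifs at hb <;> omega
    obtain ⟨c, hc⟩ := Nat.exists_eq_succ_of_ne_zero fun h0 => ok.wf.cen0 u w h0 h3
    obtain ⟨hcs, hc3⟩ := ok.wf.cen1 _ _ _ hc
    have hucn := ok.wf.lt u c (by omega)
    have hlt : ∀ x < n, ∀ j < P.s, x * P.s + j < P.T := by
      intro x hx j hj
      have : (x + 1) * P.s ≤ n * P.s := Nat.mul_le_mul_right _ hx
      rw [add_mul, one_mul] at this
      unfold Par.T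
      omega
    have hdiv : ∀ x < n, x / P.s < P.s := fun x hx =>
      Nat.div_lt_of_lt_mul (by have := P.n_le; omega)
    -- every slot was processed since the birth of an edge of state `3`
    have hscan : ∀ x, M.st u x = 3 → ∀ c' < P.T, cnt P.T c' (birth u x) < cnt P.T c' κ := by
      intro x hx c' hc'
      have hx' := ok.wf.lt u x (by omega)
      refine cnt_other (hlt u (by omega) (x / P.s) (hdiv x hx'.2)) hc' ?_
      have := tm.st u x (by omega)
      omega
    -- hence `u` is an active candidate for the pair of `c` and `w`, so that there is a witness
    have hpr : ∀ p : ℕ × ℕ, p = pr c w → u ∈ M.act p.1 p.2 := by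
      intro p hp
      have htot : u ∈ M.tot p.1 p.2 := by
        refine ok.wf.mem_tot.2 ?_
        subst hp
        simp only [pr]
        rcases le_total c w with h | h
        · rw [min_eq_left h, max_eq_right h]; exact ⟨h, hcs, by omega, by omega⟩
        · rw [min_eq_right h, max_eq_left h]; exact ⟨h, hcs.symm, by omega, by omega⟩
      by_contra hna
      have h4 := tm.act _ _ _ htot hna
      have h5 := hlt p.1 (by subst hp; simp only [pr]; omega) (p.2 % P.s) (Nat.mod_lt _ hs)
      have h6 : M.st u p.1 = 3 ∧ M.st u p.2 = 3 := by
        subst hp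
        simp only [pr]
        rcases le_total c w with h | h
        · rw [min_eq_left h, max_eq_right h]; exact ⟨hc3, h3⟩
        · rw [min_eq_right h, max_eq_left h]; exact ⟨h3, hc3⟩
      rcases max_choice (birth u p.1) (birth u p.2) with h7 | h7 <;> rw [h7] at h4
      · have := hscan _ h6.1 _ h5; omega
      · have := hscan _ h6.2 _ h5; omega
    have hp1 : (pr c w).1 < P.D := by simp only [pr]; omega
    have hp2 : (pr c w).2 < P.D := by simp only [pr]; omega
    have hact := hpr _ rfl
    obtain ⟨v, hv, htok⟩ : ∃ v ∈ M.act (pr c w).1 (pr c w).2, tokOf P.D σ (pr c w) = v + 1 := by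
      rcases ok.tok _ hp1 hp2 with ⟨h4, -⟩ | h4
      · rw [h4] at hact; exact absurd hact (Finset.notMem_empty u)
      · exact h4
    have hvlt := ok.wf.act_lt hv
    have hvcw : v < c ∧ v < w := by simp only [pr] at hvlt; omega
    refine ⟨c, v, Or.inl ⟨?_, AdjN.symm ?_, ?_⟩⟩
    · refine (mem_edgesN.1 (ok.mem_edges.2 ⟨hucn.1, hucn.2, ?_⟩)).2
      rw [ok.wf.base, baseOf, hcs, hc, if_pos (c := c.succ = c + 1) rfl]
      omega
    · refine (mem_edgesN.1 (ok.mem_edges.2 ⟨hvcw.1, hucn.2, Nat.add_pos_right _ ?_⟩)).2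
      refine tokCount_pos.2 ⟨_, hp1, hp2, htok, ?_⟩
      simp only [pr]
      omega
    · refine (mem_edgesN.1 (ok.mem_edges.2 ⟨hvcw.2, hwn, Nat.add_pos_right _ ?_⟩)).2
      refine tokCount_pos.2 ⟨_, hp1, hp2, htok, ?_⟩
      simp only [pr]
      omega
  have key2 : ∀ u w : Fin n, u < w → G.Adj u w → σ.out.edist u w ≤ 3 := by
    intro u w huw hadj
    obtain ⟨c, v, ⟨⟨_, h1, h2⟩, ⟨_, h3, h4⟩, ⟨_, _, h5⟩⟩ | ⟨_, _, h2⟩⟩ :=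
      key u w huw ⟨u.2, w.2, hadj⟩
    · exact SimpleGraph.edist_le (.cons h2 (.cons h4 (.cons h5 .nil)))
    · refine (SimpleGraph.edist_le (.cons h2 .nil)).trans ?_
      simp
  refine isSpanner_three ?_ ?_
  · have h1 : ∀ u w : Fin n, u < w → σ.out.Adj u w → G.Adj u w := by
      intro u w huw hadj
      have := ok.st_ne_zero (mem_edgesN.2 ⟨huw, u.2, w.2, hadj⟩)
      obtain ⟨_, _, h⟩ := (tr u w huw).2 this
      exact h
    intro u w hadj
    rcases lt_or_gt_of_ne hadj.ne with h | h
    · exact h1 u w h hadj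
    · exact (h1 w u h hadj.symm).symm
  · intro u w hadj
    rcases lt_or_gt_of_ne hadj.ne with h | h
    · exact key2 u w h hadj
    · rw [SimpleGraph.edist_comm]
      exact key2 w u h hadj.symm

end

/-! ### The number of edges of the output -/

section
variable {n : ℕ} {P : Par n} {M : Abs} {σ σ' : State n} {T s κ κ₀ t q v a : ℕ}
  {birth : ℕ → ℕ → ℕ} {ed : ℕ → ℕ × ℕ} {E₀ : Finset (ℕ × ℕ)}

/-- The edges present at time `κ₀ + t` were present in the beginning, with birth `0`, or were
inserted by the update `r` at time `κ₀ + r`, which changed the edge `ed r`. -/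
def Born (κ₀ t : ℕ) (E₀ : Finset (ℕ × ℕ)) (ed : ℕ → ℕ × ℕ) (birth : ℕ → ℕ → ℕ) (M : Abs) : Prop :=
  ∀ v a, M.st v a ≠ 0 → (birth v a = 0 ∧ (v, a) ∈ E₀) ∨
    ∃ r < t, birth v a = κ₀ + r ∧ ed r = (v, a)

theorem Born.upd {y : Tok} (h : Born κ₀ t E₀ ed birth M) :
    Born κ₀ (t + 1) E₀ (Function.update ed t (v, a)) (nextBirth (κ₀ + t) v a M birth)
      (updAbs n s q v a y M) := by
  intro v' a' hst
  have hst' : (usrAbs n s q v a y M).st v' a' ≠ 0 := scanSt_ne_zero.1 hst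
  rw [usrAbs_st] at hst'
  by_cases hh : M.st v a = 0 ∧ v' = v ∧ a' = a
  · obtain ⟨h0, rfl, rfl⟩ := hh
    refine Or.inr ⟨t, by omega, ?_, by simp⟩
    rw [nextBirth, if_pos h0, upd2_self]
  · have h1 : M.st v' a' ≠ 0 := by
      split_ifs at hst' with h2 h3
      · exact absurd ⟨h3, h2⟩ hh
      · exact absurd rfl hst'
      · exact hst'
    have h2 : nextBirth (κ₀ + t) v a M birth v' a' = birth v' a' := by
      unfold nextBirth
      split_ifs with h0
      · simp only [upd2]
        rw [if_neg fun h3 => hh ⟨h0, h3⟩]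
      · rfl
    rw [h2]
    rcases h v' a' h1 with h3 | ⟨r, hr, h3, h4⟩
    · exact Or.inl h3
    · refine Or.inr ⟨r, by omega, h3, ?_⟩
      rw [Function.update_of_ne (by omega)]
      exact h4

/-- Explicit edges are younger than two background passes. -/
theorem card_explicit_le {B : ℕ} (hw : Wf n s M) (tm : Timely T s (κ₀ + t) birth M)
    (hb : Born κ₀ t E₀ ed birth M) (hT : T = n * s) (hn : n ≤ s * s)
    (h0 : 2 * T ≤ κ₀ ∨ E₀.card ≤ B) (F : Finset (ℕ × ℕ))
    (hF : ∀ p ∈ F, M.st p.1 p.2 = 1 ∨ M.st p.1 p.2 = 2) : F.card ≤ B + 2 * T := by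
  classical
  -- an explicit edge that is not initial was inserted in the last `2 * T` updates
  have key : F ⊆ (if 2 * T ≤ κ₀ then ∅ else E₀) ∪ (Finset.Ico (t - 2 * T) t).image ed := by
    rintro ⟨v, a⟩ hp
    have hp := hF _ hp
    have hne : M.st v a ≠ 0 := by dsimp only at hp; omega
    have hva := hw.lt v a hne
    have hdiv : a / s < s := Nat.div_lt_of_lt_mul (by omega)
    have hc : v * s + a / s < T := by
      have : (v + 1) * s ≤ n * s := Nat.mul_le_mul_right _ (by omega)
      rw [add_mul, one_mul] at this
      omega
    have h1 := lt_of_cnt (β := birth v a) (κ := κ₀ + t) hc (by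
      have h2 := tm.st v a hne
      have h3 : M.st v a ≤ 2 := by dsimp only at hp; omega
      omega)
    rw [Finset.mem_union]
    rcases hb v a hne with ⟨h2, h3⟩ | ⟨r, hr, h2, h3⟩
    · left
      rw [if_neg (by omega)]
      exact h3
    · right
      exact Finset.mem_image.2 ⟨r, Finset.mem_Ico.2 (by omega), h3⟩
  refine (Finset.card_le_card key).trans ((Finset.card_union_le _ _).trans (add_le_add ?_ ?_))
  · split_ifs with h
    · simp
    · exact h0.resolve_left h
  · refine Finset.card_image_le.trans ?_
    rw [Nat.card_Ico]
    omega

/-- The position in its bucket of the second element of a pair that may have witnesses. -/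
theorem exists_cell (hs : 0 < s) {p : ℕ × ℕ} (h1 : p.1 ≤ p.2) (h2 : p.1 / s = p.2 / s)
    (h3 : p.1 = a ∨ p.2 = a) : ∃ j < s, p = pr a (a / s * s + j) := by
  obtain ⟨b, hb, hp⟩ := eq_pr_of h1 h2 h3
  exact ⟨b % s, Nat.mod_lt _ hs, hp.trans (by rw [← bucket_eq hb])⟩

/-- Besides the explicit edges, every vertex has at most one edge to a center in each of the `s`
buckets, and every pair inside a bucket accounts for two edges to its witness. -/
theorem Ok.card_edges_le {B : ℕ} (ok : Ok P M σ) (tm : Timely P.T P.s (κ₀ + t) birth M)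
    (hb : Born κ₀ t E₀ ed birth M) (h0 : 2 * P.T ≤ κ₀ ∨ E₀.card ≤ B) :
    (edgesN σ.out).card ≤ B + 4 * P.T := by
  classical
  have hs := P.s_pos
  set F := (edgesN σ.out).filter fun p => M.st p.1 p.2 = 1 ∨ M.st p.1 p.2 = 2 with hF
  have key : edgesN σ.out ⊆ (F ∪
      (Finset.range n ×ˢ Finset.range P.s).image fun p => (p.1, M.cen p.1 p.2 - 1)) ∪
      (Finset.range n ×ˢ Finset.range P.s).image
        fun p => (tokOf P.D σ (pr p.1 (p.1 / P.s * P.s + p.2)) - 1, p.1) := by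
    rintro ⟨u, c⟩ hp
    obtain ⟨huc, hc, hpos⟩ := ok.mem_edges.1 hp
    rw [Finset.mem_union, Finset.mem_union]
    by_cases hexp : M.st u c = 1 ∨ M.st u c = 2
    · exact Or.inl (Or.inl (Finset.mem_filter.2 ⟨hp, hexp⟩))
    by_cases hcen : M.cen u (c / P.s) = c + 1
    · refine Or.inl (Or.inr (Finset.mem_image.2 ⟨(u, c / P.s), ?_, by simp [hcen]⟩))
      simp only [Finset.mem_product, Finset.mem_range]
      exact ⟨by omega, Nat.div_lt_of_lt_mul (by have := P.n_le; omega)⟩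
    · right
      rw [ok.wf.base, baseOf, if_neg hexp, if_neg hcen, zero_add, zero_add, tokCount_pos] at hpos
      obtain ⟨p, h1, h2, h3, h4⟩ := hpos
      have h5 := ok.wf.mem_tot.1 (ok.wf.act _ _ (ok.witness h1 h2 h3))
      obtain ⟨j, hj, hpj⟩ := exists_cell hs h5.1 h5.2.1 h4
      refine Finset.mem_image.2 ⟨(c, j), by simp [hc, hj], ?_⟩
      simp only
      rw [← hpj, h3]
      rfl
  have h1 := card_explicit_le (F := F) ok.wf tm hb rfl P.n_le h0 fun p hp =>
    (Finset.mem_filter.1 hp).2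
  have h2 : ∀ f : ℕ × ℕ → ℕ × ℕ,
      ((Finset.range n ×ˢ Finset.range P.s).image f).card ≤ P.T := by
    intro f
    refine Finset.card_image_le.trans ?_
    rw [Finset.card_product, Finset.card_range, Finset.card_range]
    exact le_rfl
  refine (Finset.card_le_card key).trans ((Finset.card_union_le _ _).trans
    ((add_le_add ((Finset.card_union_le _ _).trans (add_le_add h1 (h2 _))) (h2 _)).trans ?_))
  omega

/-- An update inserts few edges into the output, besides those to resampled witnesses. -/
theorem Ok.inserted_le (ok : Ok P M σ)
    (ok' : Ok P (updAbs n P.s q v a (tokOf P.D σ) M) σ') {l : List ((ℕ × ℕ) × Finset ℕ)}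
    (hl : ∀ p, p ∉ l.map Prod.fst → tokOf P.D σ' p = tokOf P.D σ p) :
    (edgesN σ'.out \ edgesN σ.out).card ≤ 3 + 2 * l.length := by
  classical
  set y := tokOf P.D σ
  set M' := updAbs n P.s q v a y M with hM'
  have key : edgesN σ'.out \ edgesN σ.out ⊆
      ({(v, a), (v, M'.cen v (a / P.s) - 1), (q / P.s, M'.cen (q / P.s) (q % P.s) - 1)} ∪
      l.toFinset.image fun z => (tokOf P.D σ' z.1 - 1, z.1.1)) ∪
      l.toFinset.image fun z => (tokOf P.D σ' z.1 - 1, z.1.2) := by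
    rintro ⟨u, c⟩ hp
    rw [Finset.mem_sdiff, ok'.mem_edges, ok.mem_edges] at hp
    obtain ⟨⟨huc, hc, hpos⟩, hneg⟩ := hp
    have hz : M.base u c = 0 ∧ ¬ 0 < tokCount P.D y u c := by
      have : ¬ 0 < M.base u c + tokCount P.D y u c := fun h => hneg ⟨huc, hc, h⟩
      omega
    have hz1 := hz.1
    rw [ok.wf.base, baseOf] at hz1
    have hexp : ¬ (M.st u c = 1 ∨ M.st u c = 2) := by
      intro h; rw [if_pos h] at hz1; omega
    have hcen : M.cen u (c / P.s) ≠ c + 1 := by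
      intro h; rw [if_pos h] at hz1; omega
    simp only [Finset.mem_union, Finset.mem_insert, Finset.mem_singleton]
    by_cases htok : 0 < tokCount P.D (tokOf P.D σ') u c
    · obtain ⟨p, h1, h2, h3, h4⟩ := tokCount_pos.1 htok
      have hmem : p ∈ l.map Prod.fst := by
        by_contra hh
        rw [hl p hh] at h3
        exact hz.2 (tokCount_pos.2 ⟨p, h1, h2, h3, h4⟩)
      obtain ⟨z, hzl, rfl⟩ := List.mem_map.1 hmem
      rcases h4 with rfl | rfl
      · exact Or.inl (Or.inr (Finset.mem_image.2 ⟨z, by simpa using hzl, by simp [h3]⟩))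
      · exact Or.inr (Finset.mem_image.2 ⟨z, by simpa using hzl, by simp [h3]⟩)
    · have hb : 0 < M'.base u c := by omega
      refine Or.inl (Or.inl ?_)
      rw [ok'.wf.base, baseOf] at hb
      by_cases h1 : M'.cen u (c / P.s) = c + 1
      · by_cases h2 : u = v ∧ c / P.s = a / P.s
        · right; left
          rw [← h2.1, ← h2.2, h1]
          rfl
        by_cases h3 : u = q / P.s ∧ c / P.s = q % P.s
        · right; right
          rw [← h3.1, ← h3.2, h1]
          rfl
        refine absurd ?_ hcen
        rw [← h1, hM']
        simp only [updAbs, bgAbs, upd2, if_neg h3, usrAbs]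
        split_ifs
        · rfl
        · change _ = delCen P.s v a M u (c / P.s)
          unfold delCen
          split_ifs
          · simp only [upd2, if_neg h2]
          · rfl
      · rw [if_neg h1, add_zero] at hb
        have h2 : M'.st u c = 1 ∨ M'.st u c = 2 := by
          by_contra h; rw [if_neg h] at hb; omega
        left
        by_contra hne
        have hne' : ¬ (u = v ∧ c = a) := fun h => hne (Prod.ext h.1 h.2)
        change scanSt P.s (q / P.s) (q % P.s) P.s (usrAbs n P.s q v a y M).st u c = 1 ∨
          scanSt P.s (q / P.s) (q % P.s) P.s (usrAbs n P.s q v a y M).st u c = 2 at h2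
        have hle := ok.wf.le u c
        unfold scanSt at h2
        rw [usrAbs_st, if_neg hne'] at h2
        unfold bump at h2
        split_ifs at h2 <;> omega
  have h1 : ∀ f : (ℕ × ℕ) × Finset ℕ → ℕ × ℕ, (l.toFinset.image f).card ≤ l.length :=
    fun f => Finset.card_image_le.trans (List.toFinset_card_le l)
  refine (Finset.card_le_card key).trans ((Finset.card_union_le _ _).trans
    ((add_le_add ((Finset.card_union_le _ _).trans (add_le_add Finset.card_le_three (h1 _)))
      (h1 _)).trans ?_))
  omega

theorem Tracks.upd {G : SimpleGraph (Fin n)} {y : Tok} (h : Tracks G M) (p : Update n)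
    (hp : min (p.1.1 : ℕ) p.1.2 = v ∧ max (p.1.1 : ℕ) p.1.2 = a) :
    Tracks (p.apply G) (updAbs n s q v a y M) := by
  intro u c huc
  have h1 : (updAbs n s q v a y M).st u c ≠ 0 ↔ (usrAbs n s q v a y M).st u c ≠ 0 := scanSt_ne_zero
  have hva : v < n ∧ a < n ∧ v < a := by
    have := p.2
    have h2 : (p.1.1 : ℕ) ≠ p.1.2 := fun hh => this (Fin.ext hh)
    omega
  have h2 : ∀ (hu : u < n) (hc : c < n), (SimpleGraph.edge p.1.1 p.1.2).Adj ⟨u, hu⟩ ⟨c, hc⟩ ↔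
      u = v ∧ c = a := by
    intro hu hc
    rw [SimpleGraph.edge_adj]
    simp only [Fin.ext_iff, ne_eq]
    omega
  rw [h1, usrAbs_st]
  have h3 : AdjN (p.apply G) u c ↔ ∃ (hu : u < n) (hc : c < n),
      (AdjN G u c ∧ ¬ (u = v ∧ c = a) ∨ (u = v ∧ c = a) ∧ ¬ AdjN G u c) := by
    simp only [AdjN, Update.apply, symmDiff_def, SimpleGraph.sup_adj, SimpleGraph.sdiff_adj]
    refine exists_congr fun hu => exists_congr fun hc => ?_
    rw [h2 hu hc]
    have : (∃ (_ : u < n) (_ : c < n), G.Adj ⟨u, hu⟩ ⟨c, hc⟩) ↔ G.Adj ⟨u, hu⟩ ⟨c, hc⟩ :=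
      ⟨fun ⟨_, _, h⟩ => h, fun h => ⟨hu, hc, h⟩⟩
    rw [this]
  rw [h3]
  by_cases hh : u = v ∧ c = a
  · obtain ⟨rfl, rfl⟩ := hh
    rw [h u c huc]
    simp only [and_self, not_true_eq_false, and_false, if_true, true_and, false_or, hva.1, hva.2.1,
      exists_prop]
    by_cases h0 : M.st u c = 0 <;> simp [h0]
  · rw [if_neg hh, ← h u c huc]
    simp only [hh, not_false_eq_true, and_true, false_and, or_false]
    exact ⟨fun ⟨_, _, h⟩ => h, fun h => ⟨h.1, h.2.1, h⟩⟩

end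

open scoped ENNReal

/-! ### Expectations -/

/-- The expectation of `f` under `μ`. -/
noncomputable def ex {α : Type*} (μ : PMF α) (f : α → ℝ≥0∞) : ℝ≥0∞ := ∑' x, μ x * f x

section ex
variable {α β : Type*} {μ : PMF α} {f g : α → ℝ≥0∞} {c : ℝ≥0∞}

theorem ex_pure (a : α) (f : α → ℝ≥0∞) : ex (PMF.pure a) f = f a := by
  classical
  unfold ex
  rw [tsum_eq_single a]
  · simp
  · intro b hb; simp [PMF.pure_apply, hb]

theorem ex_bind (μ : PMF α) (ν : α → PMF β) (f : β → ℝ≥0∞) :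
    ex (μ.bind ν) f = ex μ fun x => ex (ν x) f := by
  unfold ex
  simp only [PMF.bind_apply, ← ENNReal.tsum_mul_right, ← ENNReal.tsum_mul_left, mul_assoc]
  exact ENNReal.tsum_comm

theorem ex_map (μ : PMF α) (h : α → β) (f : β → ℝ≥0∞) :
    ex (μ.map h) f = ex μ fun x => f (h x) := by
  unfold PMF.map
  rw [ex_bind]
  simp only [Function.comp_apply, ex_pure]

theorem ex_mono (h : ∀ x ∈ μ.support, f x ≤ g x) : ex μ f ≤ ex μ g := by
  refine ENNReal.tsum_le_tsum fun x => ?_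
  by_cases hx : x ∈ μ.support
  · exact mul_le_mul_right (h x hx) _
  · rw [PMF.mem_support_iff, not_not] at hx; simp [hx]

theorem ex_const (μ : PMF α) (c : ℝ≥0∞) : ex μ (fun _ => c) = c := by
  unfold ex; rw [ENNReal.tsum_mul_right, PMF.tsum_coe, one_mul]

theorem ex_add (μ : PMF α) (f g : α → ℝ≥0∞) : ex μ (fun x => f x + g x) = ex μ f + ex μ g := by
  unfold ex; simp only [mul_add]; exact ENNReal.tsum_add

theorem ex_sum {ι : Type*} (μ : PMF α) (s : Finset ι) (f : ι → α → ℝ≥0∞) :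
    ex μ (fun x => ∑ i ∈ s, f i x) = ∑ i ∈ s, ex μ (f i) := by
  classical
  induction s using Finset.induction_on with
  | empty => simp [ex]
  | insert i s hi ih => simp only [Finset.sum_insert hi, ex_add, ih]

theorem ex_mul_const (μ : PMF α) (f : α → ℝ≥0∞) (c : ℝ≥0∞) :
    ex μ (fun x => f x * c) = ex μ f * c := by
  unfold ex; rw [← ENNReal.tsum_mul_right]; simp only [mul_assoc]

end ex

/-! ### Resampled witnesses -/

/-- The factor by which a witness entry `o` contributes to `2` to the number of pairs with
witness `v`. -/
noncomputable def fac (v o : ℕ) : ℝ≥0∞ := if o = v + 1 then 2 else 1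

/-- The probability that a uniformly random element of `A` is `v`. -/
noncomputable def pick (v : ℕ) (A : Finset ℕ) : ℝ≥0∞ := if v ∈ A then (A.card : ℝ≥0∞)⁻¹ else 0

theorem ex_sampleTok (p : ℕ × ℕ) (A : Finset ℕ) (y : Tok) (v : ℕ) :
    ex (sampleTok p A y) (fun y' => fac v (y' p)) = 1 + pick v A := by
  unfold sampleTok
  split_ifs with h
  · rw [ex_map]
    have h0 : (A.card : ℝ≥0∞) ≠ 0 := by simpa using h.ne_empty
    have h1 : ∀ x, (PMF.uniformOfFinset A h) x * fac v (Function.update y p (x + 1) p) =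
        if x ∈ A then (A.card : ℝ≥0∞)⁻¹ + (if x = v then (A.card : ℝ≥0∞)⁻¹ else 0) else 0 := by
      intro x
      rw [PMF.uniformOfFinset_apply, Function.update_self, fac]
      by_cases hx : x ∈ A
      · rw [if_pos hx, if_pos hx]
        by_cases hv : x = v
        · rw [if_pos (by omega), if_pos hv, mul_two]
        · rw [if_neg (by omega), if_neg hv, mul_one, add_zero]
      · simp [hx]
    unfold ex
    simp only [h1]
    rw [tsum_eq_sum (s := A) (fun x hx => if_neg hx), Finset.sum_congr rfl fun x hx => if_pos hx,
      Finset.sum_add_distrib, Finset.sum_const, nsmul_eq_mul,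
      ENNReal.mul_inv_cancel h0 (ENNReal.natCast_ne_top _), Finset.sum_ite_eq', pick]
  · rw [ex_pure, Function.update_self, fac, if_neg (by omega), pick, if_neg, add_zero]
    intro hv
    exact h ⟨v, hv⟩

theorem sampleTok_support {p : ℕ × ℕ} {A : Finset ℕ} {y y' : Tok}
    (h : y' ∈ (sampleTok p A y).support) {r : ℕ × ℕ} (hr : r ≠ p) : y' r = y r := by
  unfold sampleTok at h
  split_ifs at h
  · rw [PMF.mem_support_map_iff] at h
    obtain ⟨v, -, rfl⟩ := h
    exact Function.update_of_ne hr _ _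
  · rw [PMF.support_pure, Set.mem_singleton_iff] at h
    rw [h]
    exact Function.update_of_ne hr _ _

theorem sampleAll_support {l : List ((ℕ × ℕ) × Finset ℕ)} {y y' : Tok}
    (h : y' ∈ (sampleAll l y).support) {r : ℕ × ℕ} (hr : r ∉ l.map Prod.fst) : y' r = y r := by
  induction l generalizing y with
  | nil =>
    rw [sampleAll, PMF.support_pure, Set.mem_singleton_iff] at h
    rw [h]
  | cons z l ih =>
    rw [sampleAll, PMF.mem_support_bind_iff] at h
    obtain ⟨y₁, h1, h2⟩ := h
    rw [List.map_cons, List.mem_cons, not_or] at hr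
    rw [ih h2 hr.2, sampleTok_support h1 hr.1]

/-- The witnesses of different pairs behave as if they were independent: only the last time counts
at which a witness is resampled. -/
theorem ex_sampleAll_le (v : ℕ) (Q : Finset (ℕ × ℕ)) (A : ℕ × ℕ → Finset ℕ)
    (l : List ((ℕ × ℕ) × Finset ℕ))
    (hl : ∀ l₁ z l₂, l = l₁ ++ z :: l₂ → z.1 ∉ l₂.map Prod.fst → z.2 = A z.1) (y : Tok) :
    ex (sampleAll l y) (fun y' => ∏ r ∈ Q, fac v (y' r)) ≤
      ∏ r ∈ Q, if r ∈ l.map Prod.fst then 1 + pick v (A r) else fac v (y r) := by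
  classical
  induction l generalizing y with
  | nil => simp [sampleAll, ex_pure]
  | cons z l ih =>
    have ih' := ih fun l₁ z' l₂ h => hl (z :: l₁) z' l₂ (by rw [h]; rfl)
    rw [sampleAll, ex_bind]
    refine (ex_mono fun y₁ _ => ih' y₁).trans ?_
    by_cases hz : z.1 ∈ Q ∧ z.1 ∉ l.map Prod.fst
    · have hA := hl [] z l rfl hz.2
      have h1 : ∀ y₁ ∈ (sampleTok z.1 z.2 y).support,
          (∏ r ∈ Q, if r ∈ l.map Prod.fst then 1 + pick v (A r) else fac v (y₁ r)) ≤
          fac v (y₁ z.1) * ∏ r ∈ Q.erase z.1,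
            if r ∈ l.map Prod.fst then 1 + pick v (A r) else fac v (y r) := by
        intro y₁ hy₁
        rw [← Finset.mul_prod_erase _ _ hz.1, if_neg hz.2]
        refine le_of_eq (congrArg _ (Finset.prod_congr rfl fun r hr => ?_))
        rw [sampleTok_support hy₁ (Finset.ne_of_mem_erase hr)]
      refine (ex_mono h1).trans ?_
      rw [ex_mul_const, ex_sampleTok, ← Finset.mul_prod_erase _ _ hz.1, hA]
      rw [if_pos (by simp)]
      refine le_of_eq (congrArg _ (Finset.prod_congr rfl fun r hr => ?_))
      have := Finset.ne_of_mem_erase hr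
      simp only [List.map_cons, List.mem_cons, this, false_or]
    · have h1 : ∀ y₁ ∈ (sampleTok z.1 z.2 y).support,
          (∏ r ∈ Q, if r ∈ l.map Prod.fst then 1 + pick v (A r) else fac v (y₁ r)) ≤
          ∏ r ∈ Q, if r ∈ (z :: l).map Prod.fst then 1 + pick v (A r) else fac v (y r) := by
        intro y₁ hy₁
        refine le_of_eq (Finset.prod_congr rfl fun r hr => ?_)
        simp only [List.map_cons, List.mem_cons]
        by_cases hrz : r = z.1
        · have : r ∈ l.map Prod.fst := by rw [hrz]; by_contra h; exact hz ⟨hrz ▸ hr, h⟩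
          simp [this]
        · rw [sampleTok_support hy₁ hrz]
          simp [hrz]
      exact (ex_mono h1).trans (ex_const _ _).le

/-! ### The schedule of resampling -/

/-- The pair of `a` and the `j`-th element of its bucket. -/
def cell (s a j : ℕ) : ℕ × ℕ := pr a (a / s * s + j)

theorem cell_inj {s a j j' : ℕ} (h : cell s a j = cell s a j') : j = j' := by
  have := pr_inj h
  omega

/-- The pairs that lose their witness when the edge `(v, a)` is changed. -/
def lostSet (s v a : ℕ) (y : Tok) (M : Abs) : Finset (ℕ × ℕ) :=
  if M.st v a = 0 then ∅ else ((Finset.range s).filter (Lost s v a M y)).image (cell s a)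

/-- The pairs in slot `r` of the log. -/
def slotSet (s r : ℕ) (M : Abs) : Finset (ℕ × ℕ) :=
  ((Finset.range s).filter fun j => M.bt (r / s) (r % s) j ≠ 0).image
    (cell s (M.la (r / s) (r % s)))

section
variable {n s T κ₀ t t₀ t₁ q v a : ℕ} {M : Abs} {y : Tok} {K : ℕ → Finset (ℕ × ℕ)}
  {p : ℕ × ℕ}

theorem mem_catList {α : Type*} {l : ℕ → List α} {i m : ℕ} {z : α} :
    z ∈ catList l i m ↔ ∃ j < m, z ∈ l (i + j) := by
  induction m generalizing i with
  | zero => simp [catList]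
  | succ m ih =>
    rw [catList, List.mem_append, ih]
    constructor
    · rintro (h | ⟨j, hj, h⟩)
      · exact ⟨0, by omega, h⟩
      · exact ⟨j + 1, by omega, by rwa [show i + (j + 1) = i + 1 + j by ring]⟩
    · rintro ⟨j, hj, h⟩
      cases j with
      | zero => exact Or.inl h
      | succ j => exact Or.inr ⟨j, by omega, by rwa [show i + 1 + j = i + (j + 1) by ring]⟩

theorem length_catList {α : Type*} (l : ℕ → List α) (i m : ℕ) :
    (catList l i m).length = ∑ j ∈ Finset.range m, (l (i + j)).length := by
  induction m generalizing i with
  | zero => simp [catList]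
  | succ m ih =>
    rw [catList, List.length_append, ih, Finset.sum_range_succ', add_comm]
    congr 1
    refine Finset.sum_congr rfl fun j _ => ?_
    rw [show i + 1 + j = i + (j + 1) by ring]

theorem length_catList_ite {α : Type*} (c : ℕ → Prop) [DecidablePred c] (x : ℕ → α) (m a : ℕ) :
    (catList (fun j => if c j then [x j] else []) 0 m).length =
      (((Finset.range m).filter c).image (cell s a)).card := by
  rw [length_catList, Finset.card_image_of_injOn fun j _ j' _ h => cell_inj h, Finset.card_filter]
  refine Finset.sum_congr rfl fun j _ => ?_
  rw [zero_add]
  split_ifs <;> rfl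

theorem mem_usrSam {z : (ℕ × ℕ) × Finset ℕ} : z ∈ usrSam s v a y M ↔
    z.1 ∈ lostSet s v a y M ∧ z.2 = (usrAbs n s q v a y M).act z.1.1 z.1.2 := by
  rw [usrAbs_act]
  unfold usrSam lostSet
  by_cases h : M.st v a = 0
  · simp [h]
  · rw [if_neg h, if_neg h, if_neg h]
    unfold delSam
    rw [mem_catList]
    simp only [zero_add, Finset.mem_image, Finset.mem_filter, Finset.mem_range]
    constructor
    · rintro ⟨j, hj, hz⟩
      split_ifs at hz with hL
      · rw [List.mem_singleton] at hz
        subst hz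
        exact ⟨⟨j, ⟨hj, hL⟩, rfl⟩, rfl⟩
      · simp at hz
    · rintro ⟨⟨j, ⟨hj, hL⟩, h1⟩, h2⟩
      refine ⟨j, hj, ?_⟩
      rw [if_pos hL, List.mem_singleton]
      refine Prod.ext h1.symm ?_
      rw [h2, ← h1]
      rfl

theorem mem_slotSam {r : ℕ} {z : (ℕ × ℕ) × Finset ℕ} : z ∈ slotSam s r M ↔
    z.1 ∈ slotSet s r M ∧ z.2 = M.act z.1.1 z.1.2 := by
  unfold slotSam slotSet
  rw [mem_catList]
  simp only [zero_add, Finset.mem_image, Finset.mem_filter, Finset.mem_range]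
  constructor
  · rintro ⟨j, hj, hz⟩
    split_ifs at hz with hL
    · rw [List.mem_singleton] at hz
      subst hz
      exact ⟨⟨j, ⟨hj, hL⟩, rfl⟩, rfl⟩
    · simp at hz
  · rintro ⟨⟨j, ⟨hj, hL⟩, h1⟩, h2⟩
    refine ⟨j, hj, ?_⟩
    rw [if_pos hL, List.mem_singleton]
    refine Prod.ext h1.symm ?_
    rw [h2, ← h1]
    rfl

/-- The log in memory holds the pairs `K r` that lost their witnesses in the last `T` updates,
when the number of updates is `t`. -/
def Logged (s T κ₀ t : ℕ) (K : ℕ → Finset (ℕ × ℕ)) (M : Abs) : Prop :=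
  ∀ d, 1 ≤ d → d ≤ T → slotSet s ((κ₀ + t + T - d) % T) M = if d ≤ t then K (t - d) else ∅

theorem slot_ne {x d : ℕ} (hd : 1 ≤ d) (hdT : d < T) : (x + T - d) % T ≠ x % T := by
  intro h
  have h1 : x % T = (x + T - d + d) % T := by
    rw [show x + T - d + d = x + T by omega, Nat.add_mod_right]
  have h2 : (x + T - d) ≡ x + T - d + d [MOD T] := by
    rw [Nat.ModEq, h, h1]
  have h3 := (Nat.modEq_iff_dvd' (Nat.le_add_right _ _)).1 h2
  rw [Nat.add_sub_cancel_left] at h3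
  exact absurd (Nat.le_of_dvd (by omega) h3) (by omega)

theorem slotSet_usr_self : slotSet s q (usrAbs n s q v a y M) = lostSet s v a y M := by
  unfold slotSet usrAbs lostSet
  by_cases h : M.st v a = 0
  · rw [if_pos h, if_pos h]
    simp only [insAbs, logAbs, upd2_self]
    rw [Finset.filter_false_of_mem]
    · rfl
    · intro j hj
      rw [if_pos (Finset.mem_range.1 hj)]
      simp
  · rw [if_neg h, if_neg h]
    simp only [delAbs, logAbs, upd2_self]
    congr 1
    refine Finset.filter_congr fun j hj => ?_
    rw [if_pos (Finset.mem_range.1 hj)]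
    split_ifs with h <;> simp [h]

theorem slotSet_usr_ne {r : ℕ} (h : r ≠ q) :
    slotSet s r (usrAbs n s q v a y M) = slotSet s r M := by
  have hne : ¬ (r / s = q / s ∧ r % s = q % s) := by
    rintro ⟨h1, h2⟩
    exact h (by rw [← Nat.div_add_mod r s, ← Nat.div_add_mod q s, h1, h2])
  unfold slotSet usrAbs
  split_ifs
  · simp only [insAbs, logAbs, upd2, if_neg hne]
  · simp only [delAbs, logAbs, upd2, if_neg hne]

theorem Logged.upd (h : Logged s T κ₀ t K M) :
    Logged s T κ₀ (t + 1) (Function.update K t (lostSet s v a y M))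
      (updAbs n s ((κ₀ + t) % T) v a y M) := by
  intro d h1 h2
  change slotSet s _ (usrAbs n s ((κ₀ + t) % T) v a y M) = _
  rcases Nat.eq_or_lt_of_le h1 with rfl | h3
  · rw [show κ₀ + (t + 1) + T - 1 = κ₀ + t + T by omega, Nat.add_mod_right, slotSet_usr_self]
    simp
  · rw [show κ₀ + (t + 1) + T - d = κ₀ + t + T - (d - 1) by omega,
      slotSet_usr_ne (slot_ne (by omega) (by omega)), h (d - 1) (by omega) (by omega)]
    by_cases h4 : d ≤ t + 1
    · rw [if_pos h4, if_pos (by omega), Function.update_of_ne (by omega),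
        show t + 1 - d = t - (d - 1) by omega]
    · rw [if_neg h4, if_neg (by omega)]

/-- The delays after which lost witnesses are resampled. -/
def offs (T : ℕ) : Finset ℕ := insert 0 ((Finset.range (Nat.clog 2 T)).image (2 ^ ·))

/-- At time `r`, the witness of `p` is resampled by a background pass or because it was lost at
some time up to `t₀`. -/
def Smp (s T κ₀ : ℕ) (K : ℕ → Finset (ℕ × ℕ)) (t₀ r : ℕ) (p : ℕ × ℕ) : Prop :=
  flipPair s ((κ₀ + r) % T) = p ∨ ∃ d ∈ offs T, d ≤ r ∧ r - d ≤ t₀ ∧ p ∈ K (r - d)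

theorem mod_sub {x d : ℕ} (hd : d ≤ T) : (x % T + T - d) % T = (x + T - d) % T := by
  have h := Nat.div_add_mod x T
  have : x + T - d = x % T + T - d + T * (x / T) := by omega
  rw [this, Nat.add_mul_mod_self_left]

theorem Logged.slot (h : Logged s T κ₀ t K M) {i : ℕ} (hi : i < Nat.clog 2 T) :
    slotSet s (((κ₀ + t) % T + T - 2 ^ i) % T) (usrAbs n s ((κ₀ + t) % T) v a y M) =
      if 2 ^ i ≤ t then K (t - 2 ^ i) else ∅ := by
  have h1 : 2 ^ i < T := (Nat.lt_clog_iff_pow_lt (by norm_num)).1 hi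
  have h2 : 1 ≤ 2 ^ i := Nat.one_le_two_pow
  rw [mod_sub h1.le, slotSet_usr_ne (slot_ne h2 h1), h _ h2 h1.le]

/-- An update resamples the pair of the background pass, the witnesses it destroys, and those that
were lost `2 ^ i` updates ago. -/
theorem mem_updSam (h : Logged s T κ₀ t K M) :
    p ∈ (updSam n s T ((κ₀ + t) % T) v a y M).map Prod.fst ↔
      Smp s T κ₀ (Function.update K t (lostSet s v a y M)) t t p := by
  unfold updSam schedSam bgSam Smp offs
  simp only [List.map_append, List.mem_append, List.mem_map, mem_catList, zero_add, List.mem_singleton]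
  constructor
  · rintro (⟨z, hz, rfl⟩ | ⟨z, ⟨i, hi, hz⟩, rfl⟩ | ⟨z, rfl, rfl⟩)
    · refine Or.inr ⟨0, by simp, by omega, by omega, ?_⟩
      rw [Nat.sub_zero, Function.update_self]
      exact ((mem_usrSam (n := n) (q := 0)).1 hz).1
    · have h1 := (mem_slotSam.1 hz).1
      rw [h.slot hi] at h1
      have h2 : 1 ≤ 2 ^ i := Nat.one_le_two_pow
      split_ifs at h1 with h3
      · refine Or.inr ⟨2 ^ i, ?_, h3, by omega, ?_⟩
        · exact Finset.mem_insert_of_mem (Finset.mem_image_of_mem _ (Finset.mem_range.2 hi))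
        · rwa [Function.update_of_ne (by omega)]
      · simp at h1
    · exact Or.inl rfl
  · rintro (h1 | ⟨d, hd, hdt, -, hp⟩)
    · exact Or.inr (Or.inr ⟨_, rfl, h1⟩)
    · rw [Finset.mem_insert, Finset.mem_image] at hd
      rcases hd with rfl | ⟨i, hi, rfl⟩
      · rw [Nat.sub_zero, Function.update_self] at hp
        exact Or.inl ⟨(p, (usrAbs n s 0 v a y M).act p.1 p.2),
          (mem_usrSam (n := n) (q := 0)).2 ⟨hp, rfl⟩, rfl⟩
      · have h2 : 1 ≤ 2 ^ i := Nat.one_le_two_pow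
        rw [Function.update_of_ne (by omega)] at hp
        refine Or.inr (Or.inl ⟨(p, (usrAbs n s ((κ₀ + t) % T) v a y M).act p.1 p.2), ⟨i, Finset.mem_range.1 hi, mem_slotSam.2 ⟨?_, rfl⟩⟩, rfl⟩)
        rw [h.slot (Finset.mem_range.1 hi), if_pos hdt]
        exact hp

/-- The last time it is resampled in an update, a witness is chosen among the candidates that are
active after the update. -/
theorem updSam_last {l₁ l₂ : List ((ℕ × ℕ) × Finset ℕ)} {z : (ℕ × ℕ) × Finset ℕ}
    (h : updSam n s T q v a y M = l₁ ++ z :: l₂) (hz : z.1 ∉ l₂.map Prod.fst) :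
    z.2 = (updAbs n s q v a y M).act z.1.1 z.1.2 := by
  unfold updSam bgSam at h
  rw [← List.append_assoc] at h
  simp only [updAbs, bgAbs]
  rcases List.eq_nil_or_concat l₂ with rfl | ⟨l₃, x, rfl⟩
  · obtain ⟨-, h2⟩ := List.append_inj' h rfl
    rw [List.cons.injEq] at h2
    rw [← h2.1]
    exact (upd2_self _ _ _ _).symm
  · rw [List.concat_eq_append] at h hz
    rw [← List.cons_append, ← List.append_assoc] at h
    obtain ⟨h1, h2⟩ := List.append_inj' h rfl
    rw [List.cons.injEq] at h2
    have hne : ¬ (z.1.1 = (flipPair s q).1 ∧ z.1.2 = (flipPair s q).2) := by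
      rintro ⟨h3, h4⟩
      refine hz (List.mem_map.2 ⟨x, by simp, ?_⟩)
      rw [← h2.1]
      exact (Prod.ext h3 h4).symm
    simp only [upd2, if_neg hne]
    have hmem : z ∈ usrSam s v a y M ++ schedSam s T q (usrAbs n s q v a y M) := by
      rw [h1]; simp
    rcases List.mem_append.1 hmem with h5 | h5
    · exact (mem_usrSam.1 h5).2
    · unfold schedSam at h5
      rw [mem_catList] at h5
      obtain ⟨i, -, h6⟩ := h5
      exact (mem_slotSam.1 h6).2

theorem length_updSam (h : Logged s T κ₀ t K M) :
    (updSam n s T ((κ₀ + t) % T) v a y M).length = (lostSet s v a y M).card +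
      ∑ i ∈ Finset.range (Nat.clog 2 T), (if 2 ^ i ≤ t then K (t - 2 ^ i) else ∅).card + 1 := by
  unfold updSam schedSam bgSam
  rw [List.length_append, List.length_append, length_catList, List.length_singleton, ← add_assoc]
  congr 2
  · unfold usrSam lostSet delSam
    split_ifs
    · rfl
    · exact length_catList_ite _ _ _ _
  · refine Finset.sum_congr rfl fun i hi => ?_
    rw [zero_add, ← h.slot (n := n) (v := v) (a := a) (y := y) (Finset.mem_range.1 hi)]
    unfold slotSam slotSet
    exact length_catList_ite _ _ _ _

end

/-! ### The load of an edge -/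

section
variable {n s T κ₀ t t₀ t₁ κ q v a v₁ a₁ j : ℕ} {M : Abs} {y : Tok} {K : ℕ → Finset (ℕ × ℕ)}
  {p : ℕ × ℕ} {g : ℕ → ℕ → ℕ → ℝ}

/-- The witness of `p` was resampled between the times `t₀` and `κ`, and no resampling of it that is
already known at time `t₀` will take place between the times `κ` and `t₁`. -/
def Done (s T κ₀ : ℕ) (K : ℕ → Finset (ℕ × ℕ)) (t₀ t₁ κ : ℕ) (p : ℕ × ℕ) : Prop :=
  (∃ r, t₀ ≤ r ∧ r < κ ∧ Smp s T κ₀ K t₀ r p) ∧ ∀ r, κ ≤ r → r < t₁ → ¬ Smp s T κ₀ K t₀ r p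

/-- The pair `p` has witness `v`, chosen between the times `t₀` and `κ`, and its witness was not lost
in the meantime. -/
def Counted (s T κ₀ : ℕ) (K : ℕ → Finset (ℕ × ℕ)) (t₀ t₁ κ : ℕ) (y : Tok) (v : ℕ) (p : ℕ × ℕ) :
    Prop :=
  Done s T κ₀ K t₀ t₁ κ p ∧ (∀ r, t₀ < r → r < κ → p ∉ K r) ∧ y p = v + 1

/-- An upper bound for the probability with which `v` was chosen as the witness of the pair of `a`
and the `j`-th element of its bucket. The part `g` is for candidates that became inactive after
the choice. -/
noncomputable def wgt (s : ℕ) (M : Abs) (g : ℕ → ℕ → ℕ → ℝ) (v a j : ℕ) : ℝ :=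
  (if v ∈ M.act (cell s a j).1 (cell s a j).2 then
    ((M.act (cell s a j).1 (cell s a j).2).card : ℝ)⁻¹ else 0) + g v a j

/-- The frozen weights after the change of the edge `(v, a)`: if it is deleted, its own weights are
reset, and the weights of the other edges of `v` in the bucket of `a` are frozen. -/
noncomputable def nextG (s v a : ℕ) (M : Abs) (g : ℕ → ℕ → ℕ → ℝ) (u x j : ℕ) : ℝ :=
  if M.st v a = 0 ∨ u ≠ v then g u x j
  else if x = a then 0
  else if x / s * s + j = a ∧ v ∈ M.act (cell s x j).1 (cell s x j).2 then
    g u x j + ((M.act (cell s x j).1 (cell s x j).2).card : ℝ)⁻¹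
  else g u x j

open Classical in
/-- The numbers `j` for which the cell `(a, j)` is counted. -/
noncomputable def countSet (s T κ₀ : ℕ) (K : ℕ → Finset (ℕ × ℕ)) (t₀ t₁ κ : ℕ) (y : Tok)
    (v a : ℕ) : Finset ℕ :=
  (Finset.range s).filter fun j => Counted s T κ₀ K t₀ t₁ κ y v (cell s a j)

open Classical in
/-- The numbers `j` for which the cell `(a, j)` is done. -/
noncomputable def doneSet (s T κ₀ : ℕ) (K : ℕ → Finset (ℕ × ℕ)) (t₀ t₁ κ : ℕ) (a : ℕ) : Finset ℕ :=
  (Finset.range s).filter fun j => Done s T κ₀ K t₀ t₁ κ (cell s a j)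

/-- An exponential moment of the number of pairs with witness `v`, normalized by the weights. It is
almost a supermartingale in the time `κ`, whatever the adversary does. -/
noncomputable def mart (s T κ₀ : ℕ) (K : ℕ → Finset (ℕ × ℕ)) (t₀ t₁ κ : ℕ) (M : Abs)
    (g : ℕ → ℕ → ℕ → ℝ) (y : Tok) (v a : ℕ) : ℝ≥0∞ :=
  2 ^ (countSet s T κ₀ K t₀ t₁ κ y v a).card *
    ENNReal.ofReal (Real.exp (-∑ j ∈ doneSet s T κ₀ K t₀ t₁ κ a, wgt s M g v a j))

theorem nextG_nonneg (hg : ∀ u x j, 0 ≤ g u x j) (u x j : ℕ) : 0 ≤ nextG s v a M g u x j := by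
  have := hg u x j
  unfold nextG
  split_ifs <;> positivity

theorem wgt_nonneg (hg : ∀ u x j, 0 ≤ g u x j) : 0 ≤ wgt s M g v a j := by
  have := hg v a j
  unfold wgt
  split_ifs <;> positivity

theorem updAbs_act (h : flipPair s q ≠ p) :
    (updAbs n s q v a y M).act p.1 p.2 = (usrAbs n s q v a y M).act p.1 p.2 := by
  simp only [updAbs, bgAbs, upd2]
  rw [if_neg]
  rintro ⟨h1, h2⟩
  exact h (Prod.ext h1.symm h2.symm)

theorem cell_mem : (cell s a j).1 = a ∨ (cell s a j).2 = a := by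
  simp only [cell, pr]; omega

theorem cell_mem' {x : ℕ} (h : (cell s a j).1 = x ∨ (cell s a j).2 = x) :
    x = a ∨ x = a / s * s + j := by
  simp only [cell, pr] at h; omega

theorem cell_mem_right : (cell s a j).1 = a / s * s + j ∨ (cell s a j).2 = a / s * s + j := by
  simp only [cell, pr]; omega

/-- Weights only grow, until the edge is deleted or the pair is processed by a background pass. -/
theorem wgt_le (hne : ¬ (M.st v₁ a₁ ≠ 0 ∧ v₁ = v ∧ a₁ = a)) (hf : flipPair s q ≠ cell s a j) :
    wgt s M g v a j ≤ wgt s (updAbs n s q v₁ a₁ y M) (nextG s v₁ a₁ M g) v a j := by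
  unfold wgt
  rw [updAbs_act hf, usrAbs_act]
  set B := M.act (cell s a j).1 (cell s a j).2 with hB
  by_cases h0 : M.st v₁ a₁ = 0
  · rw [if_pos h0, nextG, if_pos (Or.inl h0)]
  rw [if_neg h0]
  unfold delAct
  rw [← hB]
  by_cases h1 : v₁ = v
  · subst h1
    have h2 : a ≠ a₁ := fun h => hne ⟨h0, rfl, h.symm⟩
    rw [nextG, if_neg (c := M.st v₁ a₁ = 0 ∨ v₁ ≠ v₁) (by tauto), if_neg h2, ← hB]
    by_cases hv : v₁ ∈ B
    · by_cases h3 : a / s * s + j = a₁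
      · rw [if_pos hv, if_pos (c := a / s * s + j = a₁ ∧ v₁ ∈ B) ⟨h3, hv⟩]
        have : (0 : ℝ) ≤ if v₁ ∈ (if (cell s a j).1 = a₁ ∨ (cell s a j).2 = a₁ then B.erase v₁
            else B) then (((if (cell s a j).1 = a₁ ∨ (cell s a j).2 = a₁ then B.erase v₁
            else B).card : ℕ) : ℝ)⁻¹ else 0 := by
          split_ifs <;> positivity
        linarith
      · have h4 : ¬ ((cell s a j).1 = a₁ ∨ (cell s a j).2 = a₁) := fun h => by
          rcases cell_mem' h with h5 | h5
          · exact h2 h5.symm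
          · exact h3 h5.symm
        rw [if_neg h4, if_neg (c := a / s * s + j = a₁ ∧ v₁ ∈ B) (by tauto)]
    · rw [if_neg hv, if_neg (c := a / s * s + j = a₁ ∧ v₁ ∈ B) (by tauto), zero_add]
      have : ∀ c : Finset ℕ, (0 : ℝ) ≤ if v₁ ∈ c then (c.card : ℝ)⁻¹ else 0 := by
        intro c; split_ifs <;> positivity
      linarith [this (if (cell s a j).1 = a₁ ∨ (cell s a j).2 = a₁ then B.erase v₁ else B)]
  · rw [nextG, if_pos (Or.inr (Ne.symm h1))]
    refine add_le_add_left ?_ _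
    split_ifs with h2 h3 h4 h4
    · have h5 : v ∈ B.erase v₁ := h4
      exact inv_anti₀ (by exact_mod_cast Finset.card_pos.2 ⟨v, h5⟩)
        (by exact_mod_cast Finset.card_le_card (Finset.erase_subset _ _))
    · exact absurd (Finset.mem_erase.2 ⟨Ne.symm h1, h2⟩) h4
    · exact le_rfl
    · positivity
    all_goals exact le_rfl

/-- The factor by which a newly chosen witness increases the moment is paid for by its weight. -/
theorem one_add_pick_le (hg : ∀ u x j, 0 ≤ g u x j) :
    1 + pick v (M.act (cell s a j).1 (cell s a j).2) ≤
      ENNReal.ofReal (Real.exp (wgt s M g v a j)) := by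
  set B := M.act (cell s a j).1 (cell s a j).2 with hB
  have h1 : pick v B = ENNReal.ofReal (if v ∈ B then (B.card : ℝ)⁻¹ else 0) := by
    unfold pick
    split_ifs with h
    · rw [ENNReal.ofReal_inv_of_pos (by exact_mod_cast Finset.card_pos.2 ⟨v, h⟩),
        ENNReal.ofReal_natCast]
    · simp
  have h2 : (0 : ℝ) ≤ if v ∈ B then (B.card : ℝ)⁻¹ else 0 := by split_ifs <;> positivity
  rw [h1, ← ENNReal.ofReal_one, ← ENNReal.ofReal_add zero_le_one h2]
  refine ENNReal.ofReal_le_ofReal ?_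
  have h3 := Real.add_one_le_exp (wgt s M g v a j)
  have h4 := hg v a j
  unfold wgt at h3 ⊢
  rw [← hB] at h3 ⊢
  linarith

theorem Smp.mono {r : ℕ} (h : Smp s T κ₀ K t₀ r p) (ht : t₀ ≤ t) : Smp s T κ₀ K t r p := by
  rcases h with h | ⟨d, h1, h2, h3, h4⟩
  · exact Or.inl h
  · exact Or.inr ⟨d, h1, h2, by omega, h4⟩

theorem Smp.update {r : ℕ} {X : Finset (ℕ × ℕ)} (ht : t₀ < t) :
    Smp s T κ₀ (Function.update K t X) t₀ r p ↔ Smp s T κ₀ K t₀ r p := by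
  unfold Smp
  refine or_congr_right (exists_congr fun d => and_congr_right fun _ => and_congr_right fun _ =>
    and_congr_right fun h => ?_)
  rw [Function.update_of_ne (by omega)]

/-- Conditionally on the past, the moment increases by at most `1` in expectation. A pair becomes
done at the time of its last known resampling, and then it is counted with at most the probability
given by its weight; the weights of done pairs do not decrease. If the edge `(v, a)` itself is
deleted, weights are reset, but then no pair with witness `v` survives, and only the new ones
contribute, at most `1` in expectation. -/
theorem mart_step (hw : Wf n s M) (hTok : ∀ p v, y p = v + 1 → v ∈ M.act p.1 p.2)
    (hL : Logged s T κ₀ t K M) (hg : ∀ u x j, 0 ≤ g u x j) (h0 : t₀ ≤ t) (h1 : t < t₁) (v a : ℕ) :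
    ex (sampleAll (updSam n s T ((κ₀ + t) % T) v₁ a₁ y M) y) (fun y' =>
      mart s T κ₀ (Function.update K t (lostSet s v₁ a₁ y M)) t₀ t₁ (t + 1)
        (updAbs n s ((κ₀ + t) % T) v₁ a₁ y M) (nextG s v₁ a₁ M g) y' v a) ≤
      mart s T κ₀ K t₀ t₁ t M g y v a + 1 := by
  classical
  set l := updSam n s T ((κ₀ + t) % T) v₁ a₁ y M with hl
  set K' := Function.update K t (lostSet s v₁ a₁ y M) with hK'
  set M' := updAbs n s ((κ₀ + t) % T) v₁ a₁ y M with hM'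
  set g' := nextG s v₁ a₁ M g with hg'
  have hg0 : ∀ u x j, 0 ≤ g' u x j := nextG_nonneg hg
  have hmem : ∀ p, p ∈ l.map Prod.fst ↔ Smp s T κ₀ K' t t p := fun p => mem_updSam hL
  -- done pairs stay done, and they are not resampled on account of what is known at time `t₀`
  have hdone : ∀ p, Done s T κ₀ K t₀ t₁ t p → t₀ < t ∧ ¬ Smp s T κ₀ K' t₀ t p ∧
      Done s T κ₀ K' t₀ t₁ (t + 1) p := by
    rintro p ⟨⟨r, hr, hrt, hS⟩, hn⟩
    have ht : t₀ < t := by omega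
    refine ⟨ht, ?_, ⟨r, hr, by omega, (Smp.update ht).2 hS⟩, fun r' h2 h3 => ?_⟩
    · rw [Smp.update ht]; exact hn t le_rfl h1
    · rw [Smp.update ht]; exact hn r' (by omega) h3
  have hdone' : ∀ p, p ∉ l.map Prod.fst → Done s T κ₀ K' t₀ t₁ (t + 1) p →
      Done s T κ₀ K t₀ t₁ t p := by
    rintro p hp ⟨⟨r, hr, hrt, hS⟩, hn⟩
    rw [hmem] at hp
    have hp' : ¬ Smp s T κ₀ K' t₀ t p := fun h => hp (h.mono h0)
    have hne : r ≠ t := by rintro rfl; exact hp' hS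
    have ht : t₀ < t := by omega
    refine ⟨⟨r, hr, by omega, (Smp.update ht).1 hS⟩, fun r' h2 h3 => ?_⟩
    rw [← Smp.update ht (X := lostSet s v₁ a₁ y M)]
    rcases Nat.eq_or_lt_of_le h2 with rfl | h4
    · exact hp'
    · exact hn r' h4 h3
  set Dn := doneSet s T κ₀ K t₀ t₁ t a with hDn
  set D' := doneSet s T κ₀ K' t₀ t₁ (t + 1) a with hD'
  set N := D' \ Dn with hN
  have hsub : Dn ⊆ D' := by
    intro j hj
    rw [hDn, doneSet, Finset.mem_filter] at hj
    exact Finset.mem_filter.2 ⟨hj.1, (hdone _ hj.2).2.2⟩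
  have hNl : ∀ j ∈ N, cell s a j ∈ l.map Prod.fst := by
    intro j hj
    rw [hN, Finset.mem_sdiff, hD', hDn, doneSet, doneSet, Finset.mem_filter, Finset.mem_filter] at hj
    by_contra hh
    exact hj.2 ⟨hj.1.1, hdone' _ hh hj.1.2⟩
  set A := (countSet s T κ₀ K t₀ t₁ t y v a).filter
    fun j => cell s a j ∉ lostSet s v₁ a₁ y M with hA
  -- only newly done pairs and surviving old ones are counted after the step
  have hpt : ∀ y' ∈ (sampleAll l y).support,
      (2 : ℝ≥0∞) ^ (countSet s T κ₀ K' t₀ t₁ (t + 1) y' v a).card ≤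
        (∏ r ∈ N.image (cell s a), fac v (y' r)) * 2 ^ A.card := by
    intro y' hy'
    have h2 : countSet s T κ₀ K' t₀ t₁ (t + 1) y' v a ⊆
        N.filter (fun j => y' (cell s a j) = v + 1) ∪ A := by
      intro j hj
      rw [countSet, Finset.mem_filter] at hj
      obtain ⟨hjs, hd, hk, hy⟩ := hj
      rw [Finset.mem_union]
      by_cases hdj : Done s T κ₀ K t₀ t₁ t (cell s a j)
      · right
        obtain ⟨ht, hns, -⟩ := hdone _ hdj
        have hk' : cell s a j ∉ lostSet s v₁ a₁ y M := by
          have := hk t ht (by omega)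
          rwa [hK', Function.update_self] at this
        have hnl : cell s a j ∉ l.map Prod.fst := by
          rw [hmem]
          rintro (h3 | ⟨d, hd1, hd2, -, hd4⟩)
          · exact hns (Or.inl h3)
          · by_cases h4 : t - d ≤ t₀
            · exact hns (Or.inr ⟨d, hd1, hd2, h4, hd4⟩)
            · exact hk (t - d) (by omega) (by omega) hd4
        rw [sampleAll_support hy' hnl] at hy
        refine Finset.mem_filter.2 ⟨Finset.mem_filter.2 ⟨hjs, hdj, fun r h3 h4 => ?_, hy⟩, hk'⟩
        have := hk r h3 (by omega)
        rwa [hK', Function.update_of_ne (by omega)] at this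
      · left
        refine Finset.mem_filter.2 ⟨Finset.mem_sdiff.2 ⟨Finset.mem_filter.2 ⟨hjs, hd⟩, ?_⟩, hy⟩
        intro h3
        exact hdj (Finset.mem_filter.1 h3).2
    rw [Finset.prod_image fun j _ j' _ h => cell_inj h]
    unfold fac
    rw [Finset.prod_ite, Finset.prod_const_one, mul_one, Finset.prod_const, ← pow_add]
    exact pow_le_pow_right₀ (by norm_num) ((Finset.card_le_card h2).trans (Finset.card_union_le _ _))
  have hE : ex (sampleAll l y) (fun y' => ∏ r ∈ N.image (cell s a), fac v (y' r)) ≤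
      ENNReal.ofReal (Real.exp (∑ j ∈ N, wgt s M' g' v a j)) := by
    refine (ex_sampleAll_le v _ (fun p => M'.act p.1 p.2) l (fun l₁ z l₂ h2 h3 => ?_) y).trans ?_
    · exact updSam_last h2 h3
    · rw [Finset.prod_image fun j _ j' _ h => cell_inj h, Real.exp_sum,
        ENNReal.ofReal_prod_of_nonneg fun j _ => (Real.exp_pos _).le]
      refine Finset.prod_le_prod' fun j hj => ?_
      rw [if_pos (hNl j hj)]
      exact one_add_pick_le hg0
  -- the moments of the new witnesses cancel against the weights of the newly done pairs
  have hmain : ex (sampleAll l y) (fun y' => mart s T κ₀ K' t₀ t₁ (t + 1) M' g' y' v a) ≤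
      2 ^ A.card * ENNReal.ofReal (Real.exp (-∑ j ∈ Dn, wgt s M' g' v a j)) := by
    calc _ ≤ ex (sampleAll l y) (fun y' => (∏ r ∈ N.image (cell s a), fac v (y' r)) *
          (2 ^ A.card * ENNReal.ofReal (Real.exp (-∑ j ∈ D', wgt s M' g' v a j)))) := by
          refine ex_mono fun y' hy' => ?_
          rw [← mul_assoc]
          exact mul_le_mul_left (hpt y' hy') _
      _ ≤ ENNReal.ofReal (Real.exp (∑ j ∈ N, wgt s M' g' v a j)) *
          (2 ^ A.card * ENNReal.ofReal (Real.exp (-∑ j ∈ D', wgt s M' g' v a j))) := by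
          rw [ex_mul_const]
          exact mul_le_mul_left hE _
      _ = _ := by
          rw [mul_left_comm, ← ENNReal.ofReal_mul (Real.exp_pos _).le, ← Real.exp_add]
          congr 3
          rw [← Finset.sum_sdiff hsub]
          ring
  refine hmain.trans ?_
  by_cases hdel : M.st v₁ a₁ ≠ 0 ∧ v₁ = v ∧ a₁ = a
  · obtain ⟨hst, rfl, rfl⟩ := hdel
    -- all pairs with witness `v` are lost
    have hA0 : A = ∅ := by
      refine Finset.eq_empty_of_forall_notMem fun j hj => ?_
      rw [hA, Finset.mem_filter, countSet, Finset.mem_filter] at hj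
      obtain ⟨⟨hjs, -, -, hy⟩, hk⟩ := hj
      refine hk ?_
      rw [lostSet, if_neg hst]
      refine Finset.mem_image_of_mem _ (Finset.mem_filter.2 ⟨hjs, ?_, hy⟩)
      have h2 := hw.mem_tot.1 (hw.act _ _ (hTok _ _ hy))
      rcases cell_mem_right (s := s) (a := a₁) (j := j) with h3 | h3
      · rw [← h3]; exact h2.2.2.1
      · rw [← h3]; exact h2.2.2.2
    rw [hA0, Finset.card_empty, pow_zero, one_mul]
    refine le_add_left ?_
    rw [← ENNReal.ofReal_one]
    refine ENNReal.ofReal_le_ofReal (Real.exp_le_one_iff.2 ?_)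
    exact neg_nonpos.2 (Finset.sum_nonneg fun j _ => wgt_nonneg hg0)
  · refine le_add_right ?_
    unfold mart
    refine mul_le_mul' (pow_le_pow_right₀ (by norm_num) (Finset.card_le_card
      (Finset.filter_subset _ _))) (ENNReal.ofReal_le_ofReal (Real.exp_le_exp.2 (neg_le_neg ?_)))
    refine Finset.sum_le_sum fun j hj => wgt_le hdel fun hf => ?_
    exact (hdone _ (Finset.mem_filter.1 hj).2).2.1 (Or.inl hf)

theorem mart_start (t₀ t₁ : ℕ) (v a : ℕ) : mart s T κ₀ K t₀ t₁ t₀ M g y v a = 1 := by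
  classical
  have h1 : ∀ p, ¬ Done s T κ₀ K t₀ t₁ t₀ p := by
    rintro p ⟨⟨r, h1, h2, -⟩, -⟩; omega
  have h2 : countSet s T κ₀ K t₀ t₁ t₀ y v a = ∅ :=
    Finset.filter_false_of_mem fun j _ h => h1 _ h.1
  have h3 : doneSet s T κ₀ K t₀ t₁ t₀ a = ∅ := Finset.filter_false_of_mem fun j _ => h1 _
  unfold mart
  rw [h2, h3]
  simp

/-- As long as the moment is small, the number of counted pairs is close to the sum of their
weights. The factor `2` comes from `1 / log 2 < 2`. -/
theorem card_le_of_mart_lt {L : ℕ} (hg : ∀ u x j, 0 ≤ g u x j)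
    (h : mart s T κ₀ K t₀ t₁ κ M g y v a < 2 ^ L) :
    ((countSet s T κ₀ K t₀ t₁ κ y v a).card : ℝ) ≤ L + 2 * ∑ j ∈ Finset.range s, wgt s M g v a j := by
  classical
  set c := (countSet s T κ₀ K t₀ t₁ κ y v a).card
  set W := ∑ j ∈ doneSet s T κ₀ K t₀ t₁ κ a, wgt s M g v a j with hW
  have hWle : W ≤ ∑ j ∈ Finset.range s, wgt s M g v a j :=
    Finset.sum_le_sum_of_subset_of_nonneg (Finset.filter_subset _ _) fun _ _ _ => wgt_nonneg hg
  have h1 : (2 : ℝ) ^ c * Real.exp (-W) < 2 ^ L := by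
    have h2 : (2 : ℝ≥0∞) ^ c * ENNReal.ofReal (Real.exp (-W)) < 2 ^ L := h
    have h3 : ∀ k : ℕ, (2 : ℝ≥0∞) ^ k = ENNReal.ofReal (2 ^ k) := by
      intro k
      rw [ENNReal.ofReal_pow (by norm_num)]
      norm_num
    rw [h3, h3, ← ENNReal.ofReal_mul (by positivity)] at h2
    exact (ENNReal.ofReal_lt_ofReal_iff (by positivity)).1 h2
  have h2 : (2 : ℝ) ^ c < 2 ^ L * Real.exp W := by
    rw [Real.exp_neg, ← div_eq_mul_inv, div_lt_iff₀ (Real.exp_pos _)] at h1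
    exact h1
  have h3 := Real.log_lt_log (by positivity) h2
  rw [Real.log_mul (by positivity) (by positivity), Real.log_exp, Real.log_pow, Real.log_pow] at h3
  have h4 := Real.log_two_gt_d9
  have hW0 : 0 ≤ W := Finset.sum_nonneg fun j _ => wgt_nonneg hg
  have h5 : (c : ℝ) < L + 2 * W := by
    by_contra hh
    push Not at hh
    have : (L + 2 * W) * Real.log 2 ≤ c * Real.log 2 :=
      mul_le_mul_of_nonneg_right hh (by linarith)
    nlinarith
  linarith

/-- The witness of `p` was resampled in one of the first `t` updates. -/
def Sampled (s T κ₀ : ℕ) (K : ℕ → Finset (ℕ × ℕ)) (t : ℕ) (p : ℕ × ℕ) : Prop :=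
  ∃ r < t, Smp s T κ₀ K r r p

/-- A witness that was last resampled `δ + 1` updates ago with `2 ^ i ≤ δ < 2 ^ (i + 1)` was not lost
in the last `2 ^ (i + 1)` updates, for otherwise it would have been resampled `2 ^ i` updates after
the loss. -/
theorem exists_counted (hp : ∃ q < T, flipPair s q = p) (hs : Sampled s T κ₀ K t p)
    (hy : y p = v + 1) : ∃ i ≤ Nat.clog 2 T, Counted s T κ₀ K (t - 2 ^ i) t t y v p := by
  classical
  obtain ⟨r₀, hr₀, hS₀⟩ := hs
  set S := (Finset.range t).filter fun r => Smp s T κ₀ K r r p with hSdef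
  have hSne : S.Nonempty := ⟨r₀, Finset.mem_filter.2 ⟨Finset.mem_range.2 hr₀, hS₀⟩⟩
  obtain ⟨σ, hσ, hmax⟩ := S.exists_max_image id hSne
  rw [hSdef, Finset.mem_filter, Finset.mem_range] at hσ
  have hlast : ∀ r < t, Smp s T κ₀ K r r p → r ≤ σ := fun r h1 h2 =>
    hmax r (Finset.mem_filter.2 ⟨Finset.mem_range.2 h1, h2⟩)
  obtain ⟨hσt, hσS⟩ := hσ
  by_cases hδ : t = σ + 1
  · refine ⟨0, Nat.zero_le _, ⟨⟨σ, ?_, hσt, ?_⟩, fun r h1 h2 => by omega⟩, fun r h1 h2 => ?_, hy⟩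
    · rw [pow_zero]; omega
    · rw [pow_zero, hδ]; exact hσS
    · rw [pow_zero] at h1; omega
  -- a background pass resamples `p` at least once in `T` updates
  have hδT : t - 1 - σ < T := by
    by_contra hh
    obtain ⟨q, hq, hqp⟩ := hp
    set r := σ + 1 + (q + T - (κ₀ + σ + 1) % T) % T with hr
    have hT : 0 < T := by omega
    have h1 : (q + T - (κ₀ + σ + 1) % T) % T < T := Nat.mod_lt _ hT
    have h2 : (κ₀ + r) % T = q := by
      have h3 : (κ₀ + σ + 1) % T < T := Nat.mod_lt _ hT
      rw [hr, show κ₀ + (σ + 1 + (q + T - (κ₀ + σ + 1) % T) % T) =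
        (κ₀ + σ + 1) + (q + T - (κ₀ + σ + 1) % T) % T by ring, Nat.add_mod, Nat.mod_mod,
        ← Nat.add_mod]
      have h4 := Nat.div_add_mod (κ₀ + σ + 1) T
      rw [show κ₀ + σ + 1 + (q + T - (κ₀ + σ + 1) % T) =
        q + T * ((κ₀ + σ + 1) / T + 1) by rw [mul_add]; omega, Nat.add_mul_mod_self_left,
        Nat.mod_eq_of_lt hq]
    have := hlast r (by omega) (Or.inl (by rw [h2, hqp]))
    omega
  have hδ0 : t - 1 - σ ≠ 0 := by omega
  set i := Nat.log 2 (t - 1 - σ) with hi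
  have hi1 : 2 ^ i ≤ t - 1 - σ := Nat.pow_log_le_self 2 hδ0
  have hi2 : t - 1 - σ < 2 ^ (i + 1) := Nat.lt_pow_succ_log_self (by norm_num) _
  have hic : i < Nat.clog 2 T := (Nat.lt_clog_iff_pow_lt (by norm_num)).2 (by omega)
  have hpow : 2 ^ (i + 1) = 2 ^ i + 2 ^ i := by rw [pow_succ]; ring
  have hkill : ∀ r, t - 2 ^ (i + 1) ≤ r → r < t → p ∉ K r := by
    intro r h1 h2 hK
    have h3 := hlast r h2 (Or.inr ⟨0, by simp [offs], by omega, by omega, hK⟩)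
    have h4 := hlast (r + 2 ^ i) (by omega) (Or.inr ⟨2 ^ i, Finset.mem_insert_of_mem
      (Finset.mem_image_of_mem _ (Finset.mem_range.2 hic)), by omega, by omega, by
        rwa [Nat.add_sub_cancel]⟩)
    omega
  refine ⟨i + 1, hic, ⟨⟨σ, by omega, hσt, ?_⟩, fun r h1 h2 => by omega⟩, fun r h1 h2 =>
    hkill r h1.le h2, hy⟩
  rcases hσS with h1 | ⟨d, h1, h2, h3, h4⟩
  · exact Or.inl h1
  · refine Or.inr ⟨d, h1, h2, ?_, h4⟩
    by_contra h5
    exact hkill (σ - d) (by omega) (by omega) h4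

end

/-! ### The amortized number of lost witnesses -/

section
variable {n s T κ₀ t q v a x j : ℕ} {M : Abs} {y y' : Tok} {K : ℕ → Finset (ℕ × ℕ)}
  {p : ℕ × ℕ} {g : ℕ → ℕ → ℕ → ℝ}

/-- Harmonic numbers as real numbers. -/
noncomputable def harm (m : ℕ) : ℝ := (harmonic m : ℚ)

theorem harm_succ (m : ℕ) : harm (m + 1) = harm m + ((m + 1 : ℕ) : ℝ)⁻¹ := by
  unfold harm; rw [harmonic_succ]; push_cast; rfl

theorem harm_mono {m m' : ℕ} (h : m ≤ m') : harm m ≤ harm m' := by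
  induction h with
  | refl => rfl
  | step _ ih =>
    rw [harm_succ]
    exact ih.trans (le_add_of_nonneg_right (by positivity))

theorem harm_nonneg (m : ℕ) : 0 ≤ harm m := by
  have := harm_mono (Nat.zero_le m)
  simpa [harm] using this

theorem harm_erase (B : Finset ℕ) (v : ℕ) :
    harm (B.erase v).card + (if v ∈ B then (B.card : ℝ)⁻¹ else 0) = harm B.card := by
  split_ifs with h
  · obtain ⟨m, hm⟩ := Nat.exists_eq_succ_of_ne_zero (Finset.card_pos.2 ⟨v, h⟩).ne'
    rw [Finset.card_erase_of_mem h, hm, Nat.succ_eq_add_one, Nat.add_sub_cancel, harm_succ]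
  · rw [Finset.erase_eq_of_notMem h, add_zero]

/-- The contribution of a cell to the potential, for the active candidates `B`. -/
noncomputable def cellPot (n : ℕ) (B : Finset ℕ) (g : ℕ → ℕ → ℕ → ℝ) (x j : ℕ) : ℝ :=
  harm B.card + ∑ u ∈ Finset.range n, g u x j

/-- The potential that pays for the expected loads of deleted edges. Each pair of different vertices
contributes two cells. -/
noncomputable def pot (n s : ℕ) (M : Abs) (g : ℕ → ℕ → ℕ → ℝ) : ℝ :=
  ∑ x ∈ Finset.range n, ∑ j ∈ Finset.range s,
    cellPot n (M.act (cell s x j).1 (cell s x j).2) g x j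

theorem sum_nextG (hv : v < n) (x j : ℕ) :
    ∑ u ∈ Finset.range n, nextG s v a M g u x j + g v x j =
      ∑ u ∈ Finset.range n, g u x j + nextG s v a M g v x j := by
  rw [← Finset.sum_erase_add _ _ (Finset.mem_range.2 hv),
    ← Finset.sum_erase_add _ (fun u => g u x j) (Finset.mem_range.2 hv)]
  have : ∑ u ∈ (Finset.range n).erase v, nextG s v a M g u x j =
      ∑ u ∈ (Finset.range n).erase v, g u x j := by
    refine Finset.sum_congr rfl fun u hu => ?_
    rw [nextG, if_pos (Or.inr (Finset.ne_of_mem_erase hu))]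
  rw [this]
  ring

/-- A deletion takes the candidate `v` away from the cells of `a`, which lowers harmonic numbers by
the reciprocals of the numbers of candidates; where the other edge of `v` in the cell stays, this
amount is moved to the frozen weight of that edge. -/
theorem cellPot_usr (hv : v < n) (x j : ℕ) :
    cellPot n ((usrAbs n s q v a y M).act (cell s x j).1 (cell s x j).2) (nextG s v a M g) x j +
      (if M.st v a ≠ 0 ∧ x = a then wgt s M g v a j else 0) ≤
    cellPot n (M.act (cell s x j).1 (cell s x j).2) g x j := by
  unfold cellPot
  rw [usrAbs_act]
  by_cases h0 : M.st v a = 0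
  · rw [if_pos h0, if_neg (by tauto), add_zero]
    simp only [nextG, h0, true_or, if_true]
    exact le_rfl
  rw [if_neg h0]
  have h1 := sum_nextG (g := g) (s := s) (v := v) (a := a) (M := M) hv x j
  have h2 := harm_erase (M.act (cell s x j).1 (cell s x j).2) v
  set B := M.act (cell s x j).1 (cell s x j).2 with hB
  have hn : ¬ (M.st v a = 0 ∨ v ≠ v) := by tauto
  by_cases hx : x = a
  · subst hx
    rw [if_pos ⟨h0, rfl⟩, delAct, if_pos cell_mem, ← hB, wgt, ← hB]
    rw [nextG, if_neg hn, if_pos rfl] at h1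
    linarith
  · rw [if_neg (by tauto), delAct, ← hB]
    rw [nextG, if_neg hn, if_neg hx, ← hB] at h1
    by_cases hj : x / s * s + j = a
    · rw [if_pos (by rw [← hj]; exact cell_mem_right)]
      split_ifs at h1 h2 with h3 h4 h4
      · linarith
      · exact absurd h3.2 h4
      · exact absurd ⟨hj, h4⟩ h3
      · linarith
    · rw [if_neg]
      · rw [if_neg (by tauto)] at h1
        linarith
      · intro h3
        rcases cell_mem' h3 with h4 | h4
        · exact hx h4.symm
        · exact hj h4.symm

theorem cellPot_upd (hw : Wf n s M) (hs : 0 < s) (hva : v < a) (ha : a < n) (x j : ℕ) :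
    cellPot n ((updAbs n s q v a y M).act (cell s x j).1 (cell s x j).2) (nextG s v a M g) x j +
      (if M.st v a ≠ 0 ∧ x = a then wgt s M g v a j else 0) ≤
    cellPot n (M.act (cell s x j).1 (cell s x j).2) g x j +
      if cell s x j = flipPair s q then harm n else 0 := by
  refine le_trans ?_ (add_le_add_left (cellPot_usr (a := a) (q := q) (y := y) (hva.trans ha) x j) _)
  rw [add_right_comm]
  refine add_le_add_left ?_ _
  by_cases hf : cell s x j = flipPair s q
  · rw [if_pos hf]
    unfold cellPot
    have hw' : Wf n s (updAbs n s q v a y M) := (hw.usr (q := q) (y := y) hs hva ha).bg hs q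
    have h1 : ((updAbs n s q v a y M).act (cell s x j).1 (cell s x j).2).card ≤ n := by
      refine (Finset.card_le_card (t := Finset.range n) fun u hu => ?_).trans
        (Finset.card_range n).le
      have := hw'.act_lt hu
      exact Finset.mem_range.2 (by omega)
    have h2 := harm_mono h1
    have h3 := harm_nonneg ((usrAbs n s q v a y M).act (cell s x j).1 (cell s x j).2).card
    linarith
  · rw [if_neg hf, add_zero, updAbs_act (Ne.symm hf)]

/-- The expected load of the edge `(v, a)`, if it is deleted. -/
noncomputable def load (s : ℕ) (M : Abs) (g : ℕ → ℕ → ℕ → ℝ) (v a : ℕ) : ℝ :=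
  if M.st v a = 0 then 0 else ∑ j ∈ Finset.range s, wgt s M g v a j

/-- The potential pays for the load of a deleted edge, and the background pass refills the two cells
of one pair. -/
theorem pot_upd (hw : Wf n s M) (hs : 0 < s) (hva : v < a) (ha : a < n) :
    pot n s (updAbs n s q v a y M) (nextG s v a M g) + load s M g v a ≤
      pot n s M g + 2 * harm n := by
  have h1 := Finset.sum_le_sum fun x (_ : x ∈ Finset.range n) =>
    Finset.sum_le_sum fun j (_ : j ∈ Finset.range s) =>
      cellPot_upd (q := q) (y := y) (g := g) hw hs hva ha x j
  simp only [Finset.sum_add_distrib] at h1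
  have h2 : ∑ x ∈ Finset.range n, ∑ j ∈ Finset.range s,
      (if M.st v a ≠ 0 ∧ x = a then wgt s M g v a j else 0) = load s M g v a := by
    rw [Finset.sum_eq_single_of_mem a (Finset.mem_range.2 ha)]
    · unfold load
      by_cases h0 : M.st v a = 0 <;> simp [h0]
    · intro x _ hx
      simp [hx]
  have h3 : ∑ x ∈ Finset.range n, ∑ j ∈ Finset.range s,
      (if cell s x j = flipPair s q then harm n else 0) ≤ 2 * harm n := by
    have h4 : ∀ x, ∑ j ∈ Finset.range s, (if cell s x j = flipPair s q then harm n else 0) ≤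
        if x ∈ ({(flipPair s q).1, (flipPair s q).2} : Finset ℕ) then harm n else 0 := by
      intro x
      rw [← Finset.sum_filter, Finset.sum_const, nsmul_eq_mul]
      by_cases hx : x ∈ ({(flipPair s q).1, (flipPair s q).2} : Finset ℕ)
      · rw [if_pos hx]
        have : ((Finset.range s).filter fun j => cell s x j = flipPair s q).card ≤ 1 := by
          rw [Finset.card_le_one]
          intro j hj j' hj'
          rw [Finset.mem_filter] at hj hj'
          exact cell_inj (hj.2.trans hj'.2.symm)
        exact mul_le_of_le_one_left (harm_nonneg n) (by exact_mod_cast this)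
      · rw [if_neg hx, Finset.filter_false_of_mem]
        · simp
        · intro j _ hj
          rw [← hj, Finset.mem_insert, Finset.mem_singleton] at hx
          rcases cell_mem (s := s) (a := x) (j := j) with h | h
          · exact hx (Or.inl h.symm)
          · exact hx (Or.inr h.symm)
    refine (Finset.sum_le_sum fun x _ => h4 x).trans ?_
    rw [← Finset.sum_filter, Finset.sum_const, nsmul_eq_mul]
    refine mul_le_mul_of_nonneg_right ?_ (harm_nonneg n)
    have : ((Finset.range n).filter (· ∈ ({(flipPair s q).1, (flipPair s q).2} : Finset ℕ))).card
        ≤ 2 := (Finset.card_le_card fun x hx => (Finset.mem_filter.1 hx).2).trans Finset.card_le_two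
    exact_mod_cast this
  rw [h2] at h1
  unfold pot
  linarith

open Classical in
/-- The pairs with a witness from preprocessing. -/
noncomputable def unsampled (n s T κ₀ : ℕ) (K : ℕ → Finset (ℕ × ℕ)) (t : ℕ) (y : Tok) :
    Finset (ℕ × ℕ) :=
  (Finset.range n ×ˢ Finset.range n).filter fun p => ¬ Sampled s T κ₀ K t p ∧ y p ≠ 0

/-- Some exponential moment for the edge `(v, a)` is large. -/
def Bad (s T κ₀ L : ℕ) (K : ℕ → Finset (ℕ × ℕ)) (t : ℕ) (M : Abs) (g : ℕ → ℕ → ℕ → ℝ) (y : Tok)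
    (v a : ℕ) : Prop :=
  ∃ i ≤ Nat.clog 2 T, 2 ^ L ≤ mart s T κ₀ K (t - 2 ^ i) t t M g y v a

theorem mem_lostSet (hp : p ∈ lostSet s v a y M) :
    M.st v a ≠ 0 ∧ y p = v + 1 ∧ ∃ j < s, M.st v (a / s * s + j) ≠ 0 ∧ p = cell s a j := by
  unfold lostSet at hp
  split_ifs at hp with h0
  · simp at hp
  · obtain ⟨j, hj, rfl⟩ := Finset.mem_image.1 hp
    obtain ⟨hjs, h1, h2⟩ := Finset.mem_filter.1 hj
    exact ⟨h0, h2, j, Finset.mem_range.1 hjs, h1, rfl⟩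

open Classical in
/-- A lost witness is either still the one from preprocessing, or it is counted for one of the
logarithmically many starting times `t - 2 ^ i`, and none of these counts is large. -/
theorem card_lostSet_le {L : ℕ} (hw : Wf n s M) (hT : T = n * s)
    (hg : ∀ u x j, 0 ≤ g u x j) (hB : ¬ Bad s T κ₀ L K t M g y v a) :
    ((lostSet s v a y M).card : ℝ) ≤
      ((lostSet s v a y M).filter fun p => ¬ Sampled s T κ₀ K t p).card +
      (Nat.clog 2 T + 1) * (L + 2 * load s M g v a) := by
  set c := Nat.clog 2 T with hc
  set C := fun i => countSet s T κ₀ K (t - 2 ^ i) t t y v a with hC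
  have hL0 : 0 ≤ load s M g v a := by
    unfold load
    split_ifs
    · exact le_rfl
    · exact Finset.sum_nonneg fun j _ => wgt_nonneg hg
  by_cases h0 : M.st v a = 0
  · rw [lostSet, if_pos h0, Finset.card_empty, Nat.cast_zero]
    positivity
  have h1 : lostSet s v a y M ⊆ ((lostSet s v a y M).filter fun p => ¬ Sampled s T κ₀ K t p) ∪
      (Finset.range (c + 1)).biUnion fun i => (C i).image (cell s a) := by
    intro p hp
    rw [Finset.mem_union]
    by_cases hS : Sampled s T κ₀ K t p
    · right
      obtain ⟨-, hy, j, hj, hst, rfl⟩ := mem_lostSet hp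
      have han := (hw.lt v a h0).2
      have hflip : ∃ q < T, flipPair s q = cell s a j := by
        refine ⟨a * s + j, ?_, ?_⟩
        · have : (a + 1) * s ≤ n * s := Nat.mul_le_mul_right _ han
          rw [add_mul, one_mul] at this
          omega
        · unfold flipPair cell
          rw [bucket_div hj, bucket_mod hj]
      obtain ⟨i, hi, hcnt⟩ := exists_counted hflip hS hy
      exact Finset.mem_biUnion.2 ⟨i, Finset.mem_range.2 (by omega), Finset.mem_image_of_mem _
        (Finset.mem_filter.2 ⟨Finset.mem_range.2 hj, hcnt⟩)⟩
    · exact Or.inl (Finset.mem_filter.2 ⟨hp, hS⟩)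
  have h2 : ∀ i ∈ Finset.range (c + 1), (((C i).image (cell s a)).card : ℝ) ≤
      L + 2 * load s M g v a := by
    intro i hi
    unfold Bad at hB
    push Not at hB
    have h3 := card_le_of_mart_lt hg (hB i (by have := Finset.mem_range.1 hi; omega))
    rw [load, if_neg h0]
    refine le_trans ?_ h3
    exact_mod_cast Finset.card_image_le
  have h4 := (Finset.card_le_card h1).trans ((Finset.card_union_le _ _).trans
    (add_le_add_right Finset.card_biUnion_le _))
  have h5 := Finset.sum_le_sum h2
  rw [Finset.sum_const, Finset.card_range, nsmul_eq_mul] at h5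
  push_cast at h5
  calc ((lostSet s v a y M).card : ℝ) ≤ _ := Nat.cast_le.2 h4
    _ ≤ _ := by push_cast; linarith

open Classical in
/-- Each witness from preprocessing is lost at most once. -/
theorem card_unsampled (hw : Wf n s M) (hTok : ∀ p v, y p = v + 1 → v ∈ M.act p.1 p.2)
    (hL : Logged s T κ₀ t K M)
    (hy : y' ∈ (sampleAll (updSam n s T ((κ₀ + t) % T) v a y M) y).support) :
    (unsampled n s T κ₀ (Function.update K t (lostSet s v a y M)) (t + 1) y').card +
      ((lostSet s v a y M).filter fun p => ¬ Sampled s T κ₀ K t p).card ≤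
    (unsampled n s T κ₀ K t y).card := by
  set K' := Function.update K t (lostSet s v a y M) with hK'
  have hS : ∀ p, Sampled s T κ₀ K t p → Sampled s T κ₀ K' (t + 1) p := by
    rintro p ⟨r, hr, h⟩
    exact ⟨r, by omega, (Smp.update hr).2 h⟩
  have hlost : ∀ p, p ∈ lostSet s v a y M → Sampled s T κ₀ K' (t + 1) p := by
    intro p hp
    refine ⟨t, by omega, Or.inr ⟨0, by simp [offs], by omega, by omega, ?_⟩⟩
    rwa [Nat.sub_zero, hK', Function.update_self]
  rw [← Finset.card_union_of_disjoint]
  · refine Finset.card_le_card (Finset.union_subset (fun p hp => ?_) fun p hp => ?_)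
    · rw [unsampled, Finset.mem_filter] at hp ⊢
      refine ⟨hp.1, fun h => hp.2.1 (hS p h), ?_⟩
      rw [← sampleAll_support hy]
      · exact hp.2.2
      · rw [mem_updSam hL]
        exact fun h => hp.2.1 ⟨t, by omega, h⟩
    · rw [Finset.mem_filter] at hp
      obtain ⟨-, h1, -⟩ := mem_lostSet hp.1
      have h2 := hw.act_lt (hTok _ _ h1)
      refine Finset.mem_filter.2 ⟨?_, hp.2, by omega⟩
      simp only [Finset.mem_product, Finset.mem_range]
      omega
  · rw [Finset.disjoint_left]
    intro p hp hp'
    exact (Finset.mem_filter.1 hp).2.1 (hlost p (Finset.mem_filter.1 hp').1)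

/-- The number of witnesses resampled in update `r`. -/
def numSam (T : ℕ) (K : ℕ → Finset (ℕ × ℕ)) (r : ℕ) : ℕ :=
  (K r).card + ∑ i ∈ Finset.range (Nat.clog 2 T), (if 2 ^ i ≤ r then K (r - 2 ^ i) else ∅).card + 1

theorem numSam_update {r : ℕ} {X : Finset (ℕ × ℕ)} (hr : r < t) :
    numSam T (Function.update K t X) r = numSam T K r := by
  unfold numSam
  rw [Function.update_of_ne (by omega)]
  congr 2
  refine Finset.sum_congr rfl fun i _ => ?_
  rw [Function.update_of_ne (Nat.sub_le r _ |>.trans_lt hr).ne]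

theorem sum_shift (f : ℕ → ℕ) (d t : ℕ) :
    ∑ r ∈ Finset.range t, (if d ≤ r then f (r - d) else 0) ≤ ∑ r ∈ Finset.range t, f r := by
  have : ∑ r ∈ Finset.range t, (if d ≤ r then f (r - d) else 0) =
      ∑ r ∈ Finset.range (t - d), f r := by
    induction t with
    | zero => simp
    | succ t ih =>
      rw [Finset.sum_range_succ, ih]
      split_ifs with h
      · rw [show t + 1 - d = t - d + 1 by omega, Finset.sum_range_succ]
      · rw [show t + 1 - d = t - d by omega, add_zero]
  rw [this]
  exact Finset.sum_le_sum_of_subset (Finset.range_mono (by omega))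

/-- Each lost witness is resampled at most `clog 2 T + 1` times on its account. -/
theorem sum_numSam (t : ℕ) : ∑ r ∈ Finset.range t, numSam T K r ≤
    t + (Nat.clog 2 T + 1) * ∑ r ∈ Finset.range t, (K r).card := by
  unfold numSam
  rw [Finset.sum_add_distrib, Finset.sum_add_distrib, Finset.sum_comm]
  have h1 : ∀ i ∈ Finset.range (Nat.clog 2 T), ∑ r ∈ Finset.range t,
      (if 2 ^ i ≤ r then K (r - 2 ^ i) else ∅).card ≤ ∑ r ∈ Finset.range t, (K r).card := by
    intro i _
    refine le_trans (le_of_eq (Finset.sum_congr rfl fun r _ => ?_))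
      (sum_shift (fun r => (K r).card) (2 ^ i) t)
    split_ifs <;> simp
  have h2 := Finset.sum_le_sum h1
  simp only [Finset.sum_const, Finset.card_range, smul_eq_mul] at h2 ⊢
  rw [add_mul, one_mul, mul_one]
  omega

end

/-! ### The run of the algorithm -/

/-- The data that accompany a run in the analysis: the data `M` in memory, the pairs `K r` that lost
their witnesses in update `r`, the frozen weights `g`, the births of edges, the edges `ed r` that
were changed, and whether no exponential moment has been large so far. -/
structure Ghost where
  M : Abs
  K : ℕ → Finset (ℕ × ℕ)
  g : ℕ → ℕ → ℕ → ℝ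
  birth : ℕ → ℕ → ℕ
  ed : ℕ → ℕ × ℕ
  fine : Prop

/-- The parameters of a run: the initial value `κ₀` of the clock, the logarithm `L` of the bound for
exponential moments, the edges `E₀` of the initial graph, bounds `e₀` for the number of edges of the
initial output and `B` for the number of those edges that are explicit, and the budget for losses of
witnesses. -/
structure Cfg (n : ℕ) where
  P : Par n
  κ₀ : ℕ
  L : ℕ
  e₀ : ℕ
  B : ℕ
  E₀ : Finset (ℕ × ℕ)
  Bud : ℝ
  hE : 2 * P.T ≤ κ₀ ∨ E₀.card ≤ B

/-- The number of delays in the schedule. -/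
def Cfg.c {n : ℕ} (Γ : Cfg n) : ℕ := Nat.clog 2 Γ.P.T

/-- The bound for the number of lost witnesses in `t` updates. -/
noncomputable def Cfg.losses {n : ℕ} (Γ : Cfg n) (t : ℕ) : ℝ :=
  Γ.Bud + t * ((Γ.c + 1) * (Γ.L + 4 * harm n))

/-- The claim about the graph and the output `x` after the history `l`. -/
def Cfg.Concl {n : ℕ} (Γ : Cfg n) (x : SimpleGraph (Fin n) × SimpleGraph (Fin n))
    (l : History n) : Prop :=
  IsSpanner 3 x.1 x.2 ∧ x.2.edgeSet.ncard ≤ Γ.B + 4 * Γ.P.T ∧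
    (recourse (x :: l) : ℝ) ≤ Γ.e₀ + 10 * l.length + 4 * (Γ.c + 1) * Γ.losses l.length

/-- The data after the change of the edge `(v, a)` in update `t`. -/
noncomputable def Ghost.next {n : ℕ} (Γ : Cfg n) (t v a : ℕ) (y : Tok) (γ : Ghost) : Ghost where
  M := updAbs n Γ.P.s ((Γ.κ₀ + t) % Γ.P.T) v a y γ.M
  K := Function.update γ.K t (lostSet Γ.P.s v a y γ.M)
  g := nextG Γ.P.s v a γ.M γ.g
  birth := nextBirth (Γ.κ₀ + t) v a γ.M γ.birth
  ed := Function.update γ.ed t (v, a)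
  fine := γ.fine ∧ ¬ Bad Γ.P.s Γ.P.T Γ.κ₀ Γ.L γ.K t γ.M γ.g y v a

/-- The invariants of a run after `t` updates that do not look back at the history. -/
structure Core {n : ℕ} (Γ : Cfg n) (t : ℕ) (h : History n) (σ : State n) (γ : Ghost) : Prop where
  ok : Ok Γ.P γ.M σ
  v7 : σ.var 7 = (Γ.κ₀ + t) % Γ.P.T
  hist : ∃ G l, h = (G, σ.out) :: l ∧ l.length = t ∧ Tracks G γ.M
  timely : Timely Γ.P.T Γ.P.s (Γ.κ₀ + t) γ.birth γ.M
  born : Born Γ.κ₀ t Γ.E₀ γ.ed γ.birth γ.M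
  logged : Logged Γ.P.s Γ.P.T Γ.κ₀ t γ.K γ.M
  nonneg : ∀ u x j, 0 ≤ γ.g u x j
  rec_le : recourse h + (edgesN σ.out).card ≤
    Γ.e₀ + ∑ r ∈ Finset.range t, (6 + 4 * numSam Γ.P.T γ.K r)
  acct : γ.fine → (∑ r ∈ Finset.range t, (γ.K r).card : ℕ) +
    ((unsampled n Γ.P.s Γ.P.T Γ.κ₀ γ.K t (tokOf Γ.P.D σ)).card : ℝ) +
    2 * (Γ.c + 1) * pot n Γ.P.s γ.M γ.g ≤ Γ.losses t

section
variable {n : ℕ} {Γ : Cfg n} {t : ℕ} {h : History n} {σ σ' : State n} {γ : Ghost} {G : SimpleGraph (Fin n)}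

theorem Ok.tok_act {P : Par n} {M : Abs} (ok : Ok P M σ) (p : ℕ × ℕ) (v : ℕ)
    (hp : tokOf P.D σ p = v + 1) : v ∈ M.act p.1 p.2 := by
  by_cases hD : p.1 < P.D ∧ p.2 < P.D
  · exact ok.witness hD.1 hD.2 hp
  · rw [tokOf, if_neg hD] at hp
    omega

theorem pot_nonneg {s : ℕ} {M : Abs} {g : ℕ → ℕ → ℕ → ℝ} (hg : ∀ u x j, 0 ≤ g u x j) :
    0 ≤ pot n s M g :=
  Finset.sum_nonneg fun x _ => Finset.sum_nonneg fun j _ =>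
    add_nonneg (harm_nonneg _) (Finset.sum_nonneg fun u _ => hg u x j)

/-- As long as no moment has been large, the invariants imply the claim about the current graph and
output. -/
theorem Core.concl (H : Core Γ t h σ γ) (hf : γ.fine) {x l} (hx : h = x :: l) : Γ.Concl x l := by
  obtain ⟨G, l', h1, h2, h3⟩ := H.hist
  rw [hx, List.cons.injEq] at h1
  obtain ⟨rfl, rfl⟩ := h1
  refine ⟨H.ok.isSpanner H.timely h3, ?_, ?_⟩
  · rw [ncard_edgeSet]
    exact H.ok.card_edges_le H.timely H.born Γ.hE
  · have h4 := H.rec_le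
    have h5 := H.acct hf
    have h6 := sum_numSam (T := Γ.P.T) (K := γ.K) t
    rw [Finset.sum_add_distrib, Finset.sum_const, Finset.card_range, ← Finset.mul_sum,
      smul_eq_mul] at h4
    have h7 : 0 ≤ 2 * ((Γ.c : ℝ) + 1) * pot n Γ.P.s γ.M γ.g :=
      mul_nonneg (by positivity) (pot_nonneg H.nonneg)
    set S := ∑ r ∈ Finset.range t, (γ.K r).card
    have h8 : (S : ℝ) ≤ Γ.losses t := by
      have : (0 : ℝ) ≤ (unsampled n Γ.P.s Γ.P.T Γ.κ₀ γ.K t (tokOf Γ.P.D σ)).card := by positivity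
      linarith
    have h9 : recourse h ≤ Γ.e₀ + 10 * t + 4 * ((Γ.c + 1) * S) := by
      change _ ≤ t + (Γ.c + 1) * S at h6
      omega
    have h10 : (recourse h : ℝ) ≤ Γ.e₀ + 10 * t + 4 * ((Γ.c + 1) * S) := by exact_mod_cast h9
    rw [← hx, h2]
    have h11 : ((Γ.c : ℝ) + 1) * S ≤ (Γ.c + 1) * Γ.losses t :=
      mul_le_mul_of_nonneg_left h8 (by positivity)
    linarith

theorem numSam_next {T s v a : ℕ} {y : Tok} {M : Abs} {K : ℕ → Finset (ℕ × ℕ)} {κ₀ : ℕ}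
    (hL : Logged s T κ₀ t K M) :
    (updSam n s T ((κ₀ + t) % T) v a y M).length =
      numSam T (Function.update K t (lostSet s v a y M)) t := by
  rw [length_updSam hL, numSam, Function.update_self]
  congr 2
  refine Finset.sum_congr rfl fun i _ => ?_
  have : 1 ≤ 2 ^ i := Nat.one_le_two_pow
  split_ifs
  · rw [Function.update_of_ne (by omega)]
  · rfl

theorem update_lt (p : Update n) :
    min (p.1.1 : ℕ) p.1.2 < max (p.1.1 : ℕ) p.1.2 ∧ max (p.1.1 : ℕ) p.1.2 < n := by
  have h2 : (p.1.1 : ℕ) ≠ p.1.2 := fun hh => p.2 (Fin.ext hh)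
  omega

/-- The invariants are preserved by an update. -/
theorem Core.step (H : Core Γ t ((G, σ.out) :: h) σ γ) (p : Update n)
    (ok' : Ok Γ.P (γ.next Γ t (min p.1.1 p.1.2) (max p.1.1 p.1.2) (tokOf Γ.P.D σ)).M σ')
    (h7 : σ'.var 7 = (σ.var 7 + 1) % Γ.P.T)
    (hy : tokOf Γ.P.D σ' ∈ (sampleAll (updSam n Γ.P.s Γ.P.T ((Γ.κ₀ + t) % Γ.P.T) (min p.1.1 p.1.2)
      (max p.1.1 p.1.2) (tokOf Γ.P.D σ) γ.M) (tokOf Γ.P.D σ)).support) :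
    Core Γ (t + 1) ((p.apply G, σ'.out) :: (G, σ.out) :: h) σ'
      (γ.next Γ t (min p.1.1 p.1.2) (max p.1.1 p.1.2) (tokOf Γ.P.D σ)) := by
  classical
  obtain ⟨hva, ha⟩ := update_lt p
  obtain ⟨G', l, h1, h2, h3⟩ := H.hist
  rw [List.cons.injEq, Prod.mk.injEq] at h1
  obtain ⟨⟨rfl, -⟩, rfl⟩ := h1
  have hs := Γ.P.s_pos
  have hw := H.ok.wf
  refine ⟨ok', ?_, ⟨_, _, rfl, by simp [h2], h3.upd p ⟨rfl, rfl⟩⟩,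
    H.timely.upd hw hs Γ.P.n_le hva ha, H.born.upd, H.logged.upd, nextG_nonneg H.nonneg, ?_, ?_⟩
  · rw [h7, H.v7, Nat.mod_add_mod, add_assoc]
  · have h4 := ncard_symmDiff_add σ'.out σ.out
    have h5 := H.ok.inserted_le ok' fun r hr => sampleAll_support hy hr
    rw [numSam_next H.logged] at h5
    have h6 := H.rec_le
    rw [Finset.sum_range_succ]
    have h8 : ∑ r ∈ Finset.range t, (6 + 4 * numSam Γ.P.T
        (γ.next Γ t (min p.1.1 p.1.2) (max p.1.1 p.1.2) (tokOf Γ.P.D σ)).K r) =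
        ∑ r ∈ Finset.range t, (6 + 4 * numSam Γ.P.T γ.K r) := by
      refine Finset.sum_congr rfl fun r hr => ?_
      rw [Ghost.next, numSam_update (Finset.mem_range.1 hr)]
    rw [h8]
    simp only [recourse]
    change _ ≤ _ + (_ + (6 + 4 * numSam Γ.P.T (Function.update γ.K t _) t))
    omega
  · rintro ⟨hf, hB⟩
    have h4 := H.acct hf
    have h5 := card_lostSet_le (T := Γ.P.T) hw rfl H.nonneg hB
    have h6 := card_unsampled hw H.ok.tok_act H.logged hy
    have h8 := pot_upd (q := (Γ.κ₀ + t) % Γ.P.T) (y := tokOf Γ.P.D σ) (g := γ.g) hw hs hva ha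
    have h9 : ∑ r ∈ Finset.range (t + 1), ((γ.next Γ t (min p.1.1 p.1.2) (max p.1.1 p.1.2)
        (tokOf Γ.P.D σ)).K r).card = (∑ r ∈ Finset.range t, (γ.K r).card) +
        (lostSet Γ.P.s (min p.1.1 p.1.2) (max p.1.1 p.1.2) (tokOf Γ.P.D σ) γ.M).card := by
      rw [Finset.sum_range_succ]
      congr 1
      · refine Finset.sum_congr rfl fun r hr => ?_
        change (Function.update γ.K t _ r).card = _
        rw [Function.update_of_ne (Finset.mem_range.1 hr).ne]
      · change (Function.update γ.K t _ t).card = _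
        rw [Function.update_self]
    rw [h9]
    have h6' := (Nat.cast_le (α := ℝ)).2 h6
    change _ + ((unsampled n _ _ _ (Function.update γ.K t _) (t + 1) _).card : ℝ) +
      _ * pot n _ (updAbs n _ _ _ _ _ _) (nextG _ _ _ _ _) ≤ _
    unfold Cfg.losses at h4 ⊢
    push_cast at h4 h6' ⊢
    have h10 : (Nat.clog 2 Γ.P.T : ℝ) = Γ.c := rfl
    rw [h10] at h5
    have h11 := mul_le_mul_of_nonneg_left h8 (show (0 : ℝ) ≤ 2 * (Γ.c + 1) by positivity)
    linarith

/-- The update program runs as described by the list of resampled witnesses. -/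
theorem Core.exec (H : Core Γ t ((G, σ.out) :: h) σ γ) (p : Update n) {N : ℕ}
    (hN : updCost Γ.P.s Γ.c ≤ N) :
    ∃ μ : PMF (State n), run Γ.P.w N [updC] (p.announce G σ) = μ.map some ∧
      (∀ σ' ∈ μ.support, Core Γ (t + 1) ((p.apply G, σ'.out) :: (G, σ.out) :: h) σ'
        (γ.next Γ t (min p.1.1 p.1.2) (max p.1.1 p.1.2) (tokOf Γ.P.D σ))) ∧
      μ.map (tokOf Γ.P.D) = sampleAll (updSam n Γ.P.s Γ.P.T ((Γ.κ₀ + t) % Γ.P.T) (min p.1.1 p.1.2)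
        (max p.1.1 p.1.2) (tokOf Γ.P.D σ) γ.M) (tokOf Γ.P.D σ) := by
  classical
  obtain ⟨hva, ha⟩ := update_lt p
  obtain ⟨G', l, h1, h2, h3⟩ := H.hist
  rw [List.cons.injEq, Prod.mk.injEq] at h1
  obtain ⟨⟨rfl, -⟩, rfl⟩ := h1
  have hadj : G.Adj p.1.1 p.1.2 ↔ γ.M.st (min p.1.1 p.1.2) (max p.1.1 p.1.2) ≠ 0 := by
    rw [← h3 _ _ hva]
    rcases le_total (p.1.1 : ℕ) p.1.2 with hle | hle
    · rw [min_eq_left hle, max_eq_right hle]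
      exact ⟨fun hh => ⟨p.1.1.2, p.1.2.2, hh⟩, fun ⟨_, _, hh⟩ => hh⟩
    · rw [min_eq_right hle, max_eq_left hle]
      exact ⟨fun hh => ⟨p.1.2.2, p.1.1.2, hh.symm⟩, fun ⟨_, _, hh⟩ => hh.symm⟩
  have ok1 : Ok Γ.P γ.M (p.announce G σ) :=
    ((H.ok.setVar_lt (by omega)).setVar_lt (by omega)).setVar_lt (by omega)
  have hv7 : (p.announce G σ).var 7 = (Γ.κ₀ + t) % Γ.P.T :=
    (State.setVar_var_ne (by omega)).trans ((State.setVar_var_ne (by omega)).trans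
      ((State.setVar_var_ne (by omega)).trans H.v7))
  obtain ⟨μ, e1, e2, e3⟩ := ok1.upd (u := p.1.1) (c := p.1.2) (N := Γ.P.s) hv7
    (Nat.mod_lt _ (Γ.P.T_pos (by omega))) (fun hh => p.2 (Fin.ext hh)) p.1.1.2 p.1.2.2
    (by
      simp only [Update.announce, State.setVar]
      rw [Function.update_of_ne (by omega), Function.update_of_ne (by omega), Function.update_self]
      by_cases hh : G.Adj p.1.1 p.1.2
      · rw [if_pos hh, if_neg (hadj.1 hh)]
      · rw [if_neg hh, if_pos (not_not.1 (mt hadj.2 hh))])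
    (by simp [Update.announce, State.setVar]) (by simp [Update.announce, State.setVar]) le_rfl
  refine ⟨μ, e1.run_eq hN, fun σ' hσ' => H.step p (e2 σ' hσ').1 ?_ ?_, e3⟩
  · rw [(e2 σ' hσ').2, H.v7]
  · have : tokOf Γ.P.D σ' ∈ (μ.map (tokOf Γ.P.D)).support :=
      (PMF.mem_support_map_iff _ _ _).2 ⟨σ', hσ', rfl⟩
    rw [e3] at this
    exact this

end

/-- The history, the state of the machine, and the data of the analysis. -/
abbrev Full (n : ℕ) := History n × State n × Ghost

/-- The exponential moment for `(v, a)` at time `t`. -/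
noncomputable def Cfg.moment {n : ℕ} (Γ : Cfg n) (t₀ t₁ t v a : ℕ) (z : Full n) : ℝ≥0∞ :=
  mart Γ.P.s Γ.P.T Γ.κ₀ z.2.2.K t₀ t₁ t z.2.2.M z.2.2.g (tokOf Γ.P.D z.2.1) v a

/-- The invariants of a run after `t` updates. -/
def Cfg.Inv {n : ℕ} (Γ : Cfg n) (t : ℕ) (z : Full n) : Prop :=
  Core Γ t z.1 z.2.1 z.2.2 ∧ (z.2.2.fine → ∀ x l, (x :: l) <:+ z.1 → Γ.Concl x l)

open Classical in
/-- The run after `t` updates is distributed as described by `X`, the exponential moments have small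
expectations, and it is likely that none of them has been large. -/
structure Cfg.Law {n : ℕ} (Γ : Cfg n) (p : PMF (Option (History n × State n))) (ε : ℝ≥0∞) (t : ℕ)
    (X : PMF (Full n)) : Prop where
  eq : p = X.map fun z => some (z.1, z.2.1)
  inv : ∀ z ∈ X.support, Γ.Inv t z
  moment : ∀ t₀ t₁ v a, t₀ ≤ t → t ≤ t₁ → ex X (Γ.moment t₀ t₁ t v a) ≤ 1 + (t - t₀ : ℕ)
  fine : ex X (fun z => if z.2.2.fine then 0 else 1) ≤ t * ε

section
variable {n : ℕ} {Γ : Cfg n} {t N : ℕ} {X : PMF (Full n)} {ε : ℝ≥0∞}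

/-- A failure probability per update that suffices for `N` updates. -/
noncomputable def Cfg.err (Γ : Cfg n) (N : ℕ) : ℝ≥0∞ :=
  ((Γ.c + 1) * (n * n) * (N + 1) : ℕ) * (2 ^ Γ.L)⁻¹

open Classical in
/-- By Markov's inequality and the union bound. -/
theorem Cfg.Law.bad {p} (H : Γ.Law p ε t X) (htN : t ≤ N) (v a : Full n → ℕ)
    (hva : ∀ z ∈ X.support, v z < n ∧ a z < n) :
    ex X (fun z => if Bad Γ.P.s Γ.P.T Γ.κ₀ Γ.L z.2.2.K t z.2.2.M z.2.2.g (tokOf Γ.P.D z.2.1)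
      (v z) (a z) then 1 else 0) ≤ Γ.err N := by
  have h1 : ∀ z ∈ X.support, (if Bad Γ.P.s Γ.P.T Γ.κ₀ Γ.L z.2.2.K t z.2.2.M z.2.2.g
      (tokOf Γ.P.D z.2.1) (v z) (a z) then (1 : ℝ≥0∞) else 0) ≤
      (∑ k ∈ Finset.range (Γ.c + 1) ×ˢ (Finset.range n ×ˢ Finset.range n),
        Γ.moment (t - 2 ^ k.1) t t k.2.1 k.2.2 z) * (2 ^ Γ.L)⁻¹ := by
    intro z hz
    split_ifs with hb
    · obtain ⟨i, hi, hb⟩ := hb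
      have hmem : (i, v z, a z) ∈ Finset.range (Γ.c + 1) ×ˢ (Finset.range n ×ˢ Finset.range n) := by
        simp only [Finset.mem_product, Finset.mem_range]
        exact ⟨Nat.lt_succ_of_le hi, hva z hz⟩
      generalize hf : (fun k : ℕ × ℕ × ℕ => Γ.moment (t - 2 ^ k.1) t t k.2.1 k.2.2 z) = f
      have h2 : f (i, v z, a z) ≤ ∑ k ∈ Finset.range (Γ.c + 1) ×ˢ (Finset.range n ×ˢ Finset.range n),
        f k := Finset.single_le_sum (fun _ _ => zero_le) hmem
      have h3 : 2 ^ Γ.L ≤ f (i, v z, a z) := by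
        rw [← hf]
        exact hb
      have h2 := h3.trans h2
      rw [← div_eq_mul_inv]
      rwa [ENNReal.le_div_iff_mul_le (Or.inl (by positivity)) (Or.inl (by simp)), one_mul]
    · exact zero_le
  refine (ex_mono h1).trans ?_
  rw [ex_mul_const, ex_sum, Cfg.err]
  refine mul_le_mul_left ?_ _
  have h2 : ∀ k ∈ Finset.range (Γ.c + 1) ×ˢ (Finset.range n ×ˢ Finset.range n),
      ex X (Γ.moment (t - 2 ^ k.1) t t k.2.1 k.2.2) ≤ ((N + 1 : ℕ) : ℝ≥0∞) := by
    intro k _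
    refine (H.moment _ _ _ _ (Nat.sub_le _ _) le_rfl).trans ?_
    rw [add_comm]
    exact_mod_cast (by omega : t - (t - 2 ^ k.1) + 1 ≤ N + 1)
  refine (Finset.sum_le_sum h2).trans ?_
  rw [Finset.sum_const, Finset.card_product, Finset.card_product, Finset.card_range,
    Finset.card_range, nsmul_eq_mul, ← Nat.cast_mul]

theorem bind_congr {α β : Type*} {μ : PMF α} {f g : α → PMF β} (h : ∀ a ∈ μ.support, f a = g a) :
    μ.bind f = μ.bind g := by
  ext b
  rw [PMF.bind_apply, PMF.bind_apply]
  refine tsum_congr fun a => ?_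
  by_cases ha : a ∈ μ.support
  · rw [h a ha]
  · rw [PMF.mem_support_iff, not_not] at ha
    simp [ha]

/-- One update: the choice of the adversary depends on the history only, and the program resamples
witnesses as described by `Core.exec`, so `mart_step` applies conditionally on the history and the
state. -/
theorem Cfg.Law.step {𝒜 : Algorithm} {B₀ B : ℕ} {G₀ : SimpleGraph (Fin n)} {adv : Adversary n}
    (hw : 𝒜.wordLength n = Γ.P.w) (hu : 𝒜.upd = updC) (hB : updCost Γ.P.s Γ.c ≤ B) (ht : t < N)
    (H : Γ.Law (play 𝒜 B₀ B G₀ adv t) (Γ.err N) t X) :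
    ∃ X', Γ.Law (play 𝒜 B₀ B G₀ adv (t + 1)) (Γ.err N) (t + 1) X' := by
  classical
  set v : Full n → ℕ := fun z => min (adv z.1).1.1 (adv z.1).1.2 with hv
  set a : Full n → ℕ := fun z => max (adv z.1).1.1 (adv z.1).1.2 with ha
  set γ' : Full n → Ghost := fun z => z.2.2.next Γ t (v z) (a z) (tokOf Γ.P.D z.2.1) with hγ'
  -- the transition of `play`
  set F : Option (History n × State n) → PMF (Option (History n × State n)) := fun
      | none => PMF.pure none
      | some ([], _) => PMF.pure none
      | some (x :: l, s) =>
          (run (𝒜.wordLength n) B [𝒜.upd] ((adv (x :: l)).announce x.1 s)).map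
            fun r => r.map fun s' => (((adv (x :: l)).apply x.1, s'.out) :: x :: l, s') with hF
  have key : ∀ z : Full n, ∃ μ : PMF (State n), ∃ h' : State n → History n, z ∈ X.support →
      F (some (z.1, z.2.1)) = μ.map (fun σ' => some (h' σ', σ')) ∧
      (∀ σ' ∈ μ.support, Γ.Inv (t + 1) (h' σ', σ', γ' z)) ∧
      μ.map (tokOf Γ.P.D) = sampleAll (updSam n Γ.P.s Γ.P.T ((Γ.κ₀ + t) % Γ.P.T) (v z) (a z)
        (tokOf Γ.P.D z.2.1) z.2.2.M) (tokOf Γ.P.D z.2.1) := by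
    rintro ⟨h, σ, γ⟩
    by_cases hz : (h, σ, γ) ∈ X.support
    · obtain ⟨hc, hg⟩ := H.inv _ hz
      obtain ⟨G, l, hh, -, -⟩ := id hc.hist
      obtain rfl : h = (G, σ.out) :: l := hh
      obtain ⟨μ, e1, e2, e3⟩ := hc.exec (adv ((G, σ.out) :: l)) hB
      refine ⟨μ, fun σ' => ((adv ((G, σ.out) :: l)).apply G, σ'.out) :: (G, σ.out) :: l,
        fun _ => ⟨?_, fun σ' hσ' => ⟨e2 σ' hσ', fun hf x l' hsuf => ?_⟩, e3⟩⟩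
      · simp only [hF]
        rw [hw, hu, e1, PMF.map_comp]
        rfl
      · rcases List.suffix_cons_iff.1 hsuf with h1 | h1
        · exact (e2 σ' hσ').concl hf h1.symm
        · exact hg hf.1 x l' h1
    · exact ⟨PMF.pure σ, fun _ => [], fun hh => absurd hh hz⟩
  choose μ h' hμ using key
  set X' : PMF (Full n) := X.bind fun z => (μ z).map fun σ' => (h' z σ', σ', γ' z) with hX'
  refine ⟨X', ?_, ?_, ?_, ?_⟩
  · have h1 : play 𝒜 B₀ B G₀ adv (t + 1) = (play 𝒜 B₀ B G₀ adv t).bind F := rfl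
    rw [h1, H.eq, PMF.bind_map, hX', PMF.map_bind]
    refine bind_congr fun z hz => ?_
    rw [PMF.map_comp]
    exact (hμ z hz).1
  · intro z' hz'
    rw [hX', PMF.mem_support_bind_iff] at hz'
    obtain ⟨z, hz, hz'⟩ := hz'
    rw [PMF.mem_support_map_iff] at hz'
    obtain ⟨σ', hσ', rfl⟩ := hz'
    exact (hμ z hz).2.1 σ' hσ'
  · intro t₀ t₁ v₀ a₀ h0 h1
    rcases Nat.eq_or_lt_of_le h0 with rfl | h2
    · have : Γ.moment (t + 1) t₁ (t + 1) v₀ a₀ = fun _ => 1 := by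
        funext z; exact mart_start _ _ _ _
      rw [this, ex_const]
      exact le_self_add
    · rw [hX', ex_bind]
      have h3 : ∀ z ∈ X.support, ex ((μ z).map fun σ' => (h' z σ', σ', γ' z))
          (Γ.moment t₀ t₁ (t + 1) v₀ a₀) ≤ Γ.moment t₀ t₁ t v₀ a₀ z + 1 := by
        intro z hz
        have hc := (H.inv z hz).1
        have h4 := mart_step (v₁ := v z) (a₁ := a z) (t₀ := t₀) (t₁ := t₁) hc.ok.wf hc.ok.tok_act
          hc.logged hc.nonneg (by omega) (by omega) v₀ a₀
        rw [← (hμ z hz).2.2, ex_map] at h4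
        rw [ex_map]
        exact h4
      refine (ex_mono h3).trans ?_
      rw [ex_add, ex_const]
      refine (add_le_add_left (H.moment t₀ t₁ v₀ a₀ (by omega) (by omega)) _).trans ?_
      rw [add_assoc]
      refine add_le_add_right ?_ _
      exact_mod_cast (by omega : t - t₀ + 1 ≤ t + 1 - t₀)
  · rw [hX', ex_bind]
    simp only [ex_map]
    have h1 : ∀ z ∈ X.support, (if (γ' z).fine then (0 : ℝ≥0∞) else 1) ≤
        (if z.2.2.fine then 0 else 1) + if Bad Γ.P.s Γ.P.T Γ.κ₀ Γ.L z.2.2.K t z.2.2.M z.2.2.g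
          (tokOf Γ.P.D z.2.1) (v z) (a z) then 1 else 0 := by
      intro z _
      by_cases h2 : z.2.2.fine
      · by_cases h3 : Bad Γ.P.s Γ.P.T Γ.κ₀ Γ.L z.2.2.K t z.2.2.M z.2.2.g (tokOf Γ.P.D z.2.1)
          (v z) (a z)
        · rw [if_pos h3]
          exact le_add_left (by split_ifs <;> simp)
        · rw [if_pos (show (γ' z).fine from ⟨h2, h3⟩)]
          exact zero_le
      · rw [if_neg h2]
        exact le_add_right (by split_ifs <;> simp)
    refine (ex_mono fun z hz => (ex_const _ _).le.trans (h1 z hz)).trans ?_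
    rw [ex_add]
    refine (add_le_add H.fine (H.bad ht.le v a fun z _ => ?_)).trans ?_
    · have := update_lt (adv z.1)
      exact ⟨this.1.trans this.2, this.2⟩
    · push_cast
      rw [add_mul, one_mul]

end

section
variable {n : ℕ} {P : Par n} {M : Abs} {σ : State n} {G : SimpleGraph (Fin n)} {s T : ℕ}

theorem bgIter_st_ne_zero (i v a : ℕ) : (bgIter s T M i).st v a ≠ 0 ↔ M.st v a ≠ 0 := by
  induction i with
  | zero => rfl
  | succ i ih =>
    rw [← ih]
    exact scanSt_ne_zero

theorem bgIter_bt (i : ℕ) : (bgIter s T M i).bt = M.bt := by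
  induction i with
  | zero => rfl
  | succ i ih => exact ih

/-- Background passes do not change which edges there are. -/
theorem Fresh.tracks (h : Fresh n s (fillSt G n 0) M) (i : ℕ) : Tracks G (bgIter s T M i) := by
  intro u c huc
  rw [bgIter_st_ne_zero, h.st]
  unfold fillSt
  constructor
  · intro hh
    rw [if_pos ⟨huc, hh, Or.inl hh.1⟩]
    exact one_ne_zero
  · intro hh
    split_ifs at hh with h1
    · exact h1.2.1
    · exact absurd rfl hh

/-- There is at most one witness for each pair inside a bucket. -/
theorem card_witnesses_le {κ₀ : ℕ} {K : ℕ → Finset (ℕ × ℕ)} {y : Tok} {t : ℕ} (hw : Wf n s M) (hs : 0 < s)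
    (hy : ∀ p v, y p = v + 1 → v ∈ M.act p.1 p.2) : (unsampled n s T κ₀ K t y).card ≤ n * s := by
  classical
  have : unsampled n s T κ₀ K t y ⊆
      (Finset.range n ×ˢ Finset.range s).image fun p => cell s p.1 p.2 := by
    rintro p hp
    simp only [unsampled, Finset.mem_filter, Finset.mem_product, Finset.mem_range] at hp
    obtain ⟨⟨h1, h2⟩, -, h3⟩ := hp
    obtain ⟨v, hv⟩ := Nat.exists_eq_succ_of_ne_zero h3
    have h4 := hw.act _ _ (hy p v hv)
    rw [hw.tot, totOf] at h4
    split_ifs at h4 with h5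
    · obtain ⟨j, hj, hp⟩ := exists_cell hs h5.1 h5.2 (Or.inl rfl)
      exact Finset.mem_image.2 ⟨(p.1, j), by simp [h1, hj], hp.symm⟩
    · simp at h4
  refine (Finset.card_le_card this).trans (Finset.card_image_le.trans ?_)
  simp

theorem pot_zero_le (hw : Wf n s M) :
    pot n s M (fun _ _ _ => 0) ≤ (n * s : ℕ) * harm n := by
  unfold pot cellPot
  have h1 : ∀ x ∈ Finset.range n, ∑ j ∈ Finset.range s,
      (harm (M.act (cell s x j).1 (cell s x j).2).card + ∑ u ∈ Finset.range n, (0 : ℝ)) ≤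
      s * harm n := by
    intro x _
    have h2 : ∀ j ∈ Finset.range s, harm (M.act (cell s x j).1 (cell s x j).2).card +
        ∑ u ∈ Finset.range n, (0 : ℝ) ≤ harm n := by
      intro j _
      rw [Finset.sum_const_zero, add_zero]
      refine harm_mono ?_
      refine (Finset.card_le_card (hw.act _ _)).trans ?_
      rw [hw.tot, totOf]
      split_ifs
      · exact (Finset.card_filter_le _ _).trans (Finset.card_range n).le
      · simp
    refine (Finset.sum_le_sum h2).trans ?_
    rw [Finset.sum_const, Finset.card_range, nsmul_eq_mul]
  refine (Finset.sum_le_sum h1).trans ?_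
  rw [Finset.sum_const, Finset.card_range, nsmul_eq_mul]
  push_cast
  rw [mul_assoc]

/-- The data of the analysis after preprocessing. -/
def Ghost.start (M : Abs) : Ghost :=
  ⟨M, fun _ => ∅, fun _ _ _ => 0, fun _ _ => 0, fun _ => (0, 0), True⟩

open Classical in
/-- The parameters for the initial graph `G`. It decides about the background passes of the
preprocessing whether `G` has more than `D * s` edges. -/
noncomputable def Cfg.start (P : Par n) (G : SimpleGraph (Fin n)) (L : ℕ) : Cfg n where
  P := P
  κ₀ := if P.D * P.s < numE G then 2 * P.T else 0
  L := L
  e₀ := if P.D * P.s < numE G then P.D * P.s + 4 * P.T else numE G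
  B := P.D * P.s
  E₀ := edgesN G
  Bud := if P.D * P.s < numE G then P.T + 2 * (Nat.clog 2 P.T + 1) * (P.T * harm n) else 0
  hE := by
    by_cases h : P.D * P.s < numE G
    · rw [if_pos h]
      exact Or.inl le_rfl
    · exact Or.inr (not_lt.1 h)

open Classical in
/-- The invariants hold after preprocessing. If the initial graph has few edges, then all of them
are explicit and there are no witnesses. Otherwise there may be arbitrary witnesses, and the budget
for losses covers all of them and the initial potential. -/
theorem Core.start (L : ℕ) (h : Prepared P G σ) :
    ∃ M, Core (Cfg.start P G L) 0 [(G, σ.out)] σ (Ghost.start M) := by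
  obtain ⟨M, hM, h7, ok⟩ := h
  have h1 : ∀ v a, fillSt G n 0 v a ≤ 1 := by
    intro v a
    unfold fillSt
    split_ifs <;> omega
  obtain ⟨κ₀, hκ, hκT, ok'⟩ : ∃ κ₀, (Cfg.start P G L).κ₀ = κ₀ ∧ κ₀ % P.T = 0 ∧
      Ok P (bgIter P.s P.T M κ₀) σ := by
    refine ⟨_, rfl, ?_, ?_⟩
    · change (if _ then _ else _) % _ = _
      split_ifs <;> simp
    · change Ok P (bgIter _ _ _ (if _ then _ else _)) σ
      split_ifs at ok ⊢ <;> exact ok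
  obtain ⟨hw, tm⟩ := hM.timely (T := P.T) h1 κ₀ P.s_pos P.n_le
  have tr := hM.tracks (T := P.T) κ₀
  have hb : Born κ₀ 0 (edgesN G) (fun _ => (0, 0)) (fun _ _ => 0) (bgIter P.s P.T M κ₀) := by
    intro v a hva
    have := (hw.lt v a hva).1
    exact Or.inl ⟨rfl, mem_edgesN.2 ⟨this, (tr _ _ this).2 hva⟩⟩
  refine ⟨bgIter P.s P.T M κ₀, ok', ?_, ⟨G, [], rfl, rfl, tr⟩, ?_, ?_, ?_, fun _ _ _ => le_rfl,
    ?_, fun _ => ?_⟩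
  · rw [hκ, add_zero, h7]
    exact hκT.symm
  · rw [hκ]
    exact tm
  · rw [hκ]
    exact hb
  · intro d hd _
    rw [if_neg (by omega)]
    change slotSet _ _ (bgIter P.s P.T M κ₀) = ∅
    unfold slotSet
    rw [bgIter_bt]
    simp [hM.bt]
  · simp only [recourse, Finset.range_zero, Finset.sum_empty, add_zero, zero_add]
    by_cases hc : P.D * P.s < numE G
    · have e : (Cfg.start P G L).e₀ = P.D * P.s + 4 * P.T := if_pos hc
      rw [e]
      exact ok'.card_edges_le (κ₀ := κ₀) (t := 0) tm hb (hκ ▸ (Cfg.start P G L).hE)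
    · have e : (Cfg.start P G L).e₀ = numE G := if_neg hc
      rw [e]
      refine Finset.card_le_card ?_
      rintro ⟨u, c⟩ hp
      have huc := (mem_edgesN.1 hp).1
      exact mem_edgesN.2 ⟨huc, (tr u c huc).2 (ok'.st_ne_zero hp)⟩
  · rw [Finset.range_zero, Finset.sum_empty, Nat.cast_zero, zero_add]
    change ((unsampled n P.s P.T _ _ 0 (tokOf P.D σ)).card : ℝ) +
      2 * ((Nat.clog 2 P.T : ℝ) + 1) * pot n P.s (bgIter P.s P.T M κ₀) (fun _ _ _ => 0) ≤ Cfg.losses _ 0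
    unfold Cfg.losses
    rw [Nat.cast_zero, zero_mul, add_zero]
    by_cases hc : P.D * P.s < numE G
    · have e : (Cfg.start P G L).Bud = P.T + 2 * (Nat.clog 2 P.T + 1) * (P.T * harm n) := if_pos hc
      rw [e]
      refine add_le_add ?_ (mul_le_mul_of_nonneg_left (pot_zero_le hw) (by positivity))
      exact_mod_cast card_witnesses_le hw P.s_pos ok'.tok_act
    · have e : (Cfg.start P G L).Bud = 0 := if_neg hc
      have e' : κ₀ = 0 := by rw [← hκ]; exact if_neg hc
      subst e'
      have h2 : ∀ x y, (bgIter P.s P.T M 0).act x y = ∅ := hM.act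
      have h3 : pot n P.s (bgIter P.s P.T M 0) (fun _ _ _ => 0) = 0 := by
        simp [pot, cellPot, h2, harm]
      rw [e, h3, mul_zero, add_zero]
      refine (Nat.cast_eq_zero.2 (Finset.card_eq_zero.2 (Finset.filter_eq_empty_iff.2 ?_))).le
      rintro p - ⟨-, hp⟩
      obtain ⟨v, hv⟩ := Nat.exists_eq_succ_of_ne_zero hp
      have := ok'.tok_act p v hv
      rw [h2] at this
      simp at this

theorem Cfg.Law.start {𝒜 : Algorithm} {B₀ B N : ℕ} {adv : Adversary n} {Γ : Cfg n} {ε : ℝ≥0∞}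
    (hw : 𝒜.wordLength n = Γ.P.w) (hp : 𝒜.prep = prepC) (hB : prepC.cost N ≤ B₀)
    (he : ExecW Γ.P.w prepC (initState G) (prepC.cost N) fun σ =>
      ∃ M, Core Γ 0 [(G, σ.out)] σ (Ghost.start M)) :
    ∃ X, Γ.Law (play 𝒜 B₀ B G adv 0) ε 0 X := by
  classical
  obtain ⟨μ, h1, h2⟩ := he
  have key : ∀ σ, ∃ M, σ ∈ μ.support → Core Γ 0 [(G, σ.out)] σ (Ghost.start M) := by
    intro σ
    by_cases hσ : σ ∈ μ.support
    · obtain ⟨M, hM⟩ := h2 σ hσ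
      exact ⟨M, fun _ => hM⟩
    · exact ⟨zeroAbs, fun h => absurd h hσ⟩
  choose M hM using key
  refine ⟨μ.map fun σ => ([(G, σ.out)], σ, Ghost.start (M σ)), ?_, ?_, ?_, ?_⟩
  · have : play 𝒜 B₀ B G adv 0 = (run (𝒜.wordLength n) B₀ [𝒜.prep] (initState G)).map
      fun r => r.map fun s => ([(G, s.out)], s) := rfl
    rw [this, hw, hp, h1.run_eq hB, PMF.map_comp, PMF.map_comp]
    rfl
  · intro z hz
    obtain ⟨σ, hσ, rfl⟩ := (PMF.mem_support_map_iff _ _ _).1 hz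
    refine ⟨hM σ hσ, fun hf x l hs => ?_⟩
    rcases List.suffix_cons_iff.1 hs with h3 | h3
    · exact (hM σ hσ).concl hf h3.symm
    · simp at h3
  · intro t₀ t₁ v a h0 _
    obtain rfl : t₀ = 0 := by omega
    have : Γ.moment 0 t₁ 0 v a = fun _ => 1 := by
      funext z; exact mart_start _ _ _ _
    rw [this, ex_const]
    exact le_self_add
  · rw [ex_map]
    simp [Ghost.start, ex]

end

section
variable {n N : ℕ} {P : Par n} {G : SimpleGraph (Fin n)} {Γ : Cfg n}

/-- With high probability the claim holds at all times. -/
theorem Cfg.Law.prob {p : PMF (Option (History n × State n))} {X : PMF (Full n)}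
    {ε : ℝ≥0∞} {t : ℕ} (H : Γ.Law p ε t X) :
    1 - t * ε ≤ p.toOuterMeasure {r | ∃ (h : History n) (s : State n), r = some (h, s) ∧
      ∀ x l, (x :: l) <:+ h → Γ.Concl x l} := by
  classical
  set S : Set (Option (History n × State n)) := {r | ∃ (h : History n) (s : State n), r = some (h, s) ∧
      ∀ x l, (x :: l) <:+ h → Γ.Concl x l} with hS
  have h1 : p.toOuterMeasure S = ex X (fun z => if some (z.1, z.2.1) ∈ S then 1 else 0) := by
    rw [H.eq, PMF.toOuterMeasure_map_apply, PMF.toOuterMeasure_apply]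
    refine tsum_congr fun z => ?_
    by_cases hz : some (z.1, z.2.1) ∈ S
    · rw [Set.indicator_of_mem (by exact hz)]
      simp [hz]
    · rw [Set.indicator_of_notMem (by exact hz)]
      simp [hz]
  have h2 : (1 : ℝ≥0∞) ≤ p.toOuterMeasure S + t * ε := by
    refine le_trans ?_ (add_le_add le_rfl H.fine)
    rw [h1, ← ex_add]
    refine (ex_const X 1).symm.le.trans (ex_mono fun z hz => ?_)
    by_cases hf : z.2.2.fine
    · rw [if_pos (show some (z.1, z.2.1) ∈ S from ⟨_, _, rfl, (H.inv z hz).2 hf⟩)]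
      exact le_self_add
    · rw [if_neg hf]
      exact le_add_self
  exact tsub_le_iff_right.2 h2

end

/-! ### Estimates of the parameters -/

/-- The algorithm: words have `16` times as many bits as `n`. -/
def spannerAlg : Algorithm := ⟨prepC, updC, 16⟩

/-- The constant in the time bound for updates. -/
def updConst : ℕ :=
  15 + (Cmd.cond (.var 0) insC delC).cost 1 + schedBodyC.cost 1 + bgC.cost 1

theorem updCost_le (N L : ℕ) : updCost N L ≤ updConst * ((L + 1) * (N + 1)) := by
  have h1 : (Cmd.cond (.var 0) insC delC).cost N ≤ _ * (N + 1) ^ 1 := Cmd.cost_le N _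
  have h2 : schedBodyC.cost N ≤ _ * (N + 1) ^ 1 := Cmd.cost_le N _
  have h3 : bgC.cost N ≤ _ * (N + 1) ^ 1 := Cmd.cost_le N _
  unfold updCost updConst
  rw [pow_one] at h1 h2 h3
  generalize (Cmd.cond (.var 0) insC delC).cost 1 = x₁ at *
  generalize (Cmd.cond (.var 0) insC delC).cost N = y₁ at *
  generalize schedBodyC.cost 1 = x₂ at *
  generalize schedBodyC.cost N = y₂ at *
  generalize bgC.cost 1 = x₃ at *
  generalize bgC.cost N = y₃ at *
  have h4 : L * (1 + y₂) ≤ L * (1 + x₂ * (N + 1)) := Nat.mul_le_mul_left _ (by omega)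
  nlinarith [Nat.zero_le (L * N * x₁), Nat.zero_le (L * x₁), Nat.zero_le (L * N * x₃),
    Nat.zero_le (L * x₃), Nat.zero_le (N * x₂), Nat.zero_le (L * N), Nat.zero_le x₂]

section
variable {n : ℕ}

theorem Par.std_s_le (hn : 0 < n) : (Par.std hn).s ≤ n := by
  have h : (Par.std hn).s = Nat.sqrt (n - 1) + 1 := rfl
  have := Nat.sqrt_le_self (n - 1)
  omega

theorem Par.std_T_le (hn : 0 < n) : (Par.std hn).T ≤ n * n :=
  Nat.mul_le_mul_left _ (Par.std_s_le hn)

theorem prepCost_le (hn : 0 < n) :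
    prepC.cost (2 * (Par.std hn).T) ≤ prepC.cost 1 * 3 ^ prepC.depth * n ^ (2 * prepC.depth) := by
  refine (Cmd.cost_le _ _).trans ?_
  rw [mul_assoc, pow_mul, ← mul_pow]
  refine Nat.mul_le_mul_left _ (Nat.pow_le_pow_left ?_ _)
  have h1 := Par.std_T_le hn
  have h2 : 0 < n * n := Nat.mul_pos hn hn
  rw [pow_two]
  omega

theorem clog_T_le (hn : 0 < n) : Nat.clog 2 (Par.std hn).T ≤ 2 * Nat.size n := by
  refine Nat.clog_le_of_le_pow ((Par.std_T_le hn).trans ?_)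
  have := (Nat.lt_size_self n).le
  calc n * n ≤ 2 ^ n.size * 2 ^ n.size := Nat.mul_le_mul this this
    _ = 2 ^ (2 * n.size) := by rw [← pow_add, two_mul]

/-- The logarithm of the bound for exponential moments. -/
def momentBound (n a : ℕ) : ℕ := (3 * a + 10) * Nat.size n

/-- The union bound is over all updates, delays, edges and starting times; `momentBound` is chosen
such that it leaves an error of `n ^ (-a)`. -/
theorem err_le (hn : 0 < n) (G : SimpleGraph (Fin n)) (a : ℕ) :
    ((n ^ a : ℕ) : ℝ≥0∞) * (Cfg.start (Par.std hn) G (momentBound n a)).err (n ^ a) ≤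
      ((n : ℝ≥0∞) ^ a)⁻¹ := by
  set ℓ := Nat.size n with hℓ
  have h1 : n ≤ 2 ^ ℓ := (Nat.lt_size_self n).le
  have h2 : 1 ≤ ℓ := Nat.size_pos.2 hn
  have hc : Nat.clog 2 (Par.std hn).T + 1 ≤ 2 ^ (3 * ℓ) := by
    have h3 := clog_T_le hn
    have h4 : 3 * ℓ < 2 ^ (3 * ℓ) := Nat.lt_two_pow_self
    omega
  have hN : n ^ a ≤ 2 ^ (a * ℓ) := by
    rw [mul_comm, pow_mul]
    exact Nat.pow_le_pow_left h1 a
  have hN1 : n ^ a + 1 ≤ 2 ^ (a * ℓ + ℓ) := by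
    have h3 : 2 ^ 1 ≤ 2 ^ ℓ := Nat.pow_le_pow_right (by omega) h2
    have h4 : 1 ≤ 2 ^ (a * ℓ) := Nat.one_le_two_pow
    rw [pow_add]
    nlinarith
  have key : n ^ a * ((Nat.clog 2 (Par.std hn).T + 1) * (n * n) * (n ^ a + 1)) * n ^ a ≤
      2 ^ momentBound n a :=
    calc _ ≤ 2 ^ (a * ℓ) * (2 ^ (3 * ℓ) * (2 ^ ℓ * 2 ^ ℓ) * 2 ^ (a * ℓ + ℓ)) * 2 ^ (a * ℓ) := by
          gcongr
      _ = 2 ^ (a * ℓ + (3 * ℓ + (ℓ + ℓ) + (a * ℓ + ℓ)) + a * ℓ) := by simp only [pow_add]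
      _ ≤ 2 ^ momentBound n a := Nat.pow_le_pow_right (by omega) (by unfold momentBound; nlinarith)
  have hn' : (n : ℝ≥0∞) ^ a ≠ 0 := pow_ne_zero _ (Nat.cast_ne_zero.2 hn.ne')
  have hn'' : (n : ℝ≥0∞) ^ a ≠ ∞ := ENNReal.pow_ne_top (ENNReal.natCast_ne_top n)
  rw [ENNReal.le_inv_iff_mul_le, Cfg.err, ← mul_assoc, mul_right_comm, ← div_eq_mul_inv]
  refine ENNReal.div_le_of_le_mul ?_
  rw [one_mul]
  exact_mod_cast key

/-- The run follows its law at all times. -/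
theorem exists_law (hn : 0 < n) {B₀ B N : ℕ} (G : SimpleGraph (Fin n)) (adv : Adversary n) (L : ℕ)
    (hB₀ : prepC.cost (2 * (Par.std hn).T) ≤ B₀)
    (hB : updCost (Par.std hn).s (Nat.clog 2 (Par.std hn).T) ≤ B) {t : ℕ} (ht : t ≤ N) :
    ∃ X, (Cfg.start (Par.std hn) G L).Law (play spannerAlg B₀ B G adv t)
      ((Cfg.start (Par.std hn) G L).err N) t X := by
  induction t with
  | zero => exact Cfg.Law.start rfl rfl hB₀ ((prep_exec hn G le_rfl).imp fun _ => Core.start L)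
  | succ t ih =>
    obtain ⟨X, hX⟩ := ih (by omega)
    exact hX.step rfl rfl hB (by omega)

theorem one_le_log (hn : 2 ≤ n) : 1 ≤ 3 / 2 * Real.log n := by
  have h1 := Real.log_two_gt_d9
  have h2 : Real.log 2 ≤ Real.log n := Real.log_le_log (by norm_num) (by exact_mod_cast hn)
  linarith

theorem size_le_log (hn : 2 ≤ n) : (Nat.size n : ℝ) ≤ 2 * (3 / 2 * Real.log n) := by
  have h1 := Real.log_two_gt_d9
  have h0 : 1 ≤ Nat.size n := Nat.size_pos.2 (by omega)
  have h2 : 2 ^ (Nat.size n - 1) ≤ n := Nat.lt_size.1 (by omega)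
  have h3 : ((Nat.size n - 1 : ℕ) : ℝ) * Real.log 2 ≤ Real.log n := by
    rw [← Real.log_pow]
    exact Real.log_le_log (by positivity) (by exact_mod_cast h2)
  have h4 : Real.log 2 ≤ Real.log n := Real.log_le_log (by norm_num) (by exact_mod_cast hn)
  rw [Nat.cast_sub h0, Nat.cast_one] at h3
  have h5 : (1 : ℝ) ≤ Nat.size n := by exact_mod_cast h0
  nlinarith

theorem harm_le_log (hn : 2 ≤ n) : harm n ≤ 2 * (3 / 2 * Real.log n) := by
  have h1 := harmonic_le_one_add_log n
  have h2 := one_le_log hn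
  unfold harm
  linarith

theorem Par.s_le_sqrt (P : Par n) : (P.s : ℝ) ≤ 2 * √n := by
  have h1 : (P.s : ℝ) * P.s ≤ 4 * n := by exact_mod_cast P.s_le
  have h2 := Real.sqrt_nonneg (n : ℝ)
  have h3 := Real.mul_self_sqrt (Nat.cast_nonneg (α := ℝ) n)
  nlinarith

theorem rpow_three_half : (n : ℝ) ^ (1.5 : ℝ) = n * √n := by
  rcases Nat.eq_zero_or_pos n with rfl | hn
  · norm_num
  · have : (0 : ℝ) < n := by exact_mod_cast hn
    rw [show (1.5 : ℝ) = 1 + 1 / 2 by norm_num, Real.rpow_add this, Real.rpow_one,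
      ← Real.sqrt_eq_rpow]

theorem Par.T_le_rpow (P : Par n) : (P.T : ℝ) ≤ 2 * (n : ℝ) ^ (1.5 : ℝ) := by
  rw [rpow_three_half, Par.T]
  push_cast
  have := mul_le_mul_of_nonneg_left P.s_le_sqrt (Nat.cast_nonneg (α := ℝ) n)
  linarith

theorem Par.Ds_le_rpow (P : Par n) : ((P.D * P.s : ℕ) : ℝ) ≤ 8 * (n : ℝ) ^ (1.5 : ℝ) := by
  rw [rpow_three_half]
  have h1 : ((P.D * P.s : ℕ) : ℝ) ≤ 4 * n * P.s := by exact_mod_cast Nat.mul_le_mul_right _ P.s_le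
  have := mul_le_mul_of_nonneg_left P.s_le_sqrt (show (0 : ℝ) ≤ 4 * n by positivity)
  linarith

theorem Par.rpow_le_Ds (P : Par n) : (n : ℝ) ^ (1.5 : ℝ) ≤ (P.D * P.s : ℕ) := by
  rw [rpow_three_half]
  have h1 : (n : ℝ) ≤ P.s ^ 2 := by exact_mod_cast P.n_le.trans (pow_two P.s).ge
  have h2 : √(n : ℝ) ≤ P.s := Real.sqrt_le_iff.2 ⟨Nat.cast_nonneg _, h1⟩
  have h3 : ((P.D * P.s : ℕ) : ℝ) = P.s ^ 2 * P.s := by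
    rw [Par.D]
    push_cast
    ring
  rw [h3]
  exact mul_le_mul h1 h2 (Real.sqrt_nonneg _) (by positivity)

/-- The bound of `Cfg.Concl` for the recourse, in terms of the number of updates and the initial
number of edges. If the initial graph has at most `s ^ 3` edges, then it is charged only for its
edges, and otherwise its number of edges exceeds `n ^ 1.5`, which is what the preprocessing is
charged. -/
theorem losses_le (hn : 2 ≤ n) (G : SimpleGraph (Fin n)) (a t : ℕ) :
    ((Cfg.start (Par.std (by omega)) G (momentBound n a)).e₀ + 10 * t +
      4 * ((Cfg.start (Par.std (by omega)) G (momentBound n a)).c + 1) *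
      (Cfg.start (Par.std (by omega)) G (momentBound n a)).losses t : ℝ) ≤
    (864 * a + 4100) * (3 / 2 * Real.log n) ^ 3 *
      (t + min (G.edgeSet.ncard : ℝ) ((n : ℝ) ^ (1.5 : ℝ))) := by
  set P := Par.std (show 0 < n by omega) with hP
  set Γ := Cfg.start P G (momentBound n a) with hΓ
  set K := 3 / 2 * Real.log n with hK
  set R := (n : ℝ) ^ (1.5 : ℝ) with hR
  have hR0 : 0 ≤ R := by positivity
  have hK1 : 1 ≤ K := one_le_log hn
  have hh : harm n ≤ 2 * K := harm_le_log hn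
  have hh0 := harm_nonneg n
  have hsz : (Nat.size n : ℝ) ≤ 2 * K := size_le_log hn
  have hL : (Γ.L : ℝ) ≤ (6 * a + 20) * K := by
    have : (Γ.L : ℝ) = (3 * a + 10) * Nat.size n := by
      change ((momentBound n a : ℕ) : ℝ) = _
      unfold momentBound
      push_cast
      ring
    rw [this]
    nlinarith [mul_le_mul_of_nonneg_left hsz (show (0 : ℝ) ≤ 3 * a + 10 by positivity)]
  have hc : (Γ.c : ℝ) + 1 ≤ 6 * K := by
    have h1 : Γ.c ≤ 2 * Nat.size n := clog_T_le (by omega)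
    have h2 : (Γ.c : ℝ) ≤ 2 * Nat.size n := by exact_mod_cast h1
    linarith
  have hc0 : (0 : ℝ) ≤ Γ.c + 1 := by positivity
  have hK2 : K ^ 2 ≤ K ^ 3 := pow_le_pow_right₀ hK1 (by omega)
  have hK3 : 1 ≤ K ^ 3 := one_le_pow₀ hK1
  have hm : ((edgesN G).card : ℝ) = G.edgeSet.ncard := by rw [ncard_edgeSet]
  have hLh : ((Γ.c : ℝ) + 1) * (Γ.L + 4 * harm n) ≤ 6 * K * ((6 * a + 28) * K) :=
    mul_le_mul hc (by linarith) (by positivity) (by positivity)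
  -- the part that does not depend on the number of updates
  have h0 : (Γ.e₀ : ℝ) + 4 * ((Γ.c + 1) * Γ.Bud) ≤ 1216 * K ^ 3 * min (G.edgeSet.ncard : ℝ) R := by
    by_cases hb : P.D * P.s < numE G
    · have e1 : Γ.e₀ = P.D * P.s + 4 * P.T := if_pos hb
      have e2 : Γ.Bud = P.T + 2 * (Γ.c + 1) * (P.T * harm n) := if_pos hb
      have h1 : R ≤ G.edgeSet.ncard := by
        rw [← hm]
        exact P.rpow_le_Ds.trans (by exact_mod_cast hb.le)
      have h2 := P.Ds_le_rpow
      have h3 := P.T_le_rpow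
      have h4 : (P.T : ℝ) * harm n ≤ 2 * R * (2 * K) := mul_le_mul h3 hh hh0 (by positivity)
      have h5 : ((Γ.c : ℝ) + 1) * (P.T * harm n) ≤ 6 * K * (2 * R * (2 * K)) :=
        mul_le_mul hc h4 (by positivity) (by positivity)
      have h6 : Γ.Bud ≤ 50 * K ^ 2 * R := by
        rw [e2]
        have : R ≤ K ^ 2 * R := le_mul_of_one_le_left hR0 (one_le_pow₀ hK1)
        nlinarith
      have h7 : 0 ≤ Γ.Bud := by rw [e2]; positivity
      have h8 : ((Γ.c : ℝ) + 1) * Γ.Bud ≤ 6 * K * (50 * K ^ 2 * R) :=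
        mul_le_mul hc h6 h7 (by positivity)
      have h9 : R ≤ K ^ 3 * R := le_mul_of_one_le_left hR0 hK3
      rw [min_eq_right h1, e1]
      push_cast at h2 ⊢
      nlinarith
    · have e1 : Γ.e₀ = numE G := if_neg hb
      have e2 : Γ.Bud = 0 := if_neg hb
      have e3 : (Γ.e₀ : ℝ) = G.edgeSet.ncard := by rw [e1, ← hm]; rfl
      have h1 : (G.edgeSet.ncard : ℝ) ≤ 8 * R := by
        rw [← e3, e1]
        exact le_trans (by exact_mod_cast not_lt.1 hb) P.Ds_le_rpow
      rw [e2, mul_zero, mul_zero, add_zero, e3]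
      have h2 : (G.edgeSet.ncard : ℝ) ≤ 8 * min (G.edgeSet.ncard : ℝ) R := by
        rcases min_choice (G.edgeSet.ncard : ℝ) R with h | h <;> rw [h]
        · have : (0 : ℝ) ≤ G.edgeSet.ncard := by positivity
          linarith
        · exact h1
      have h3 : 0 ≤ min (G.edgeSet.ncard : ℝ) R := le_min (by positivity) hR0
      have h4 := le_mul_of_one_le_left h3 hK3
      nlinarith
  have h1 : (10 : ℝ) + 4 * ((Γ.c + 1) * ((Γ.c + 1) * (Γ.L + 4 * harm n))) ≤
      (864 * a + 4100) * K ^ 3 := by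
    have := mul_le_mul hc hLh (by positivity) (by positivity)
    nlinarith
  have h2 := mul_le_mul_of_nonneg_left h1 (Nat.cast_nonneg (α := ℝ) t)
  have h3 : 0 ≤ K ^ 3 * min (G.edgeSet.ncard : ℝ) R :=
    mul_nonneg (by positivity) (le_min (by positivity) hR0)
  have h4 : 1216 * K ^ 3 * min (G.edgeSet.ncard : ℝ) R ≤
      (864 * a + 4100) * K ^ 3 * min (G.edgeSet.ncard : ℝ) R := by
    have : (0 : ℝ) ≤ a := by positivity
    nlinarith
  unfold Cfg.losses
  linarith

end

end DynSpanner

open DynSpanner in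
/-- There are a randomized word-RAM algorithm and exponents `k`, `d` such that for every exponent
`a` there is a constant `C` such that, for every initial graph on `n` vertices and every adaptive
adversary, with probability at least `1 - n ^ (-a)` the following holds throughout `n ^ a` updates:
preprocessing takes at most `C * n ^ d` steps, every update takes at most
`C * √n * (log n) ^ k` steps, and at every time the output is a `3`-spanner of the current graph
with at most `C * n ^ 1.5 * (log n) ^ k` edges, and the total recourse of the first `t` updates is
at most `C * (log n) ^ k * (t + min (m₀, n ^ 1.5))`, `m₀` being the number of edges of the initial
graph. -/
theorem theorem2 :
    ∃ (𝒜 : Algorithm) (k d : ℕ), ∀ a : ℕ, ∃ C : ℝ,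
      ∀ (n : ℕ) (G₀ : SimpleGraph (Fin n)) (adv : Adversary n),
        1 - ((n : ENNReal) ^ a)⁻¹ ≤
          (play 𝒜 ⌊C * (n : ℝ) ^ d⌋₊ ⌊C * √(n : ℝ) * Real.log n ^ k⌋₊ G₀ adv
            (n ^ a)).toOuterMeasure
          {r | ∃ (h : History n) (s : State n), r = some (h, s) ∧
            ∀ x l, (x :: l) <:+ h →
              IsSpanner 3 x.1 x.2 ∧
              (x.2.edgeSet.ncard : ℝ) ≤ C * (n : ℝ) ^ (1.5 : ℝ) * Real.log n ^ k ∧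
              (recourse (x :: l) : ℝ) ≤ C * Real.log n ^ k *
                ((l.length : ℝ) + min (G₀.edgeSet.ncard : ℝ) ((n : ℝ) ^ (1.5 : ℝ)))} := by
  refine ⟨spannerAlg, 3, 2 * prepC.depth, fun a => ?_⟩
  set C : ℝ := prepC.cost 1 * 3 ^ prepC.depth + 72 * updConst + (3456 * a + 16400) with hC
  refine ⟨C, fun n G adv => ?_⟩
  -- there is no update of a graph with fewer than two vertices
  have hn : 2 ≤ n := by
    have h1 := update_lt (adv [])
    omega
  have hn0 : 0 < n := by omega
  set P := Par.std hn0 with hP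
  have hK1 := one_le_log hn
  have hK3 : (3 / 2 * Real.log n) ^ 3 ≤ 4 * Real.log n ^ 3 := by
    rw [mul_pow]
    have : 0 ≤ Real.log n := by linarith
    nlinarith [pow_nonneg this 3]
  have hlog : 0 ≤ Real.log n ^ 3 := pow_nonneg (by linarith) 3
  have hone : 1 ≤ (3 / 2 * Real.log n) ^ 3 := one_le_pow₀ hK1
  have hC1 : (prepC.cost 1 * 3 ^ prepC.depth : ℝ) ≤ C := by
    rw [hC, add_assoc]
    exact le_add_of_nonneg_right (by positivity)
  have hC2 : (72 * updConst : ℝ) ≤ C := by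
    rw [hC, add_assoc]
    exact (le_add_of_nonneg_right (by positivity)).trans (le_add_of_nonneg_left (by positivity))
  have hC3 : (3456 * a + 16400 : ℝ) ≤ C := by
    rw [hC]
    exact le_add_of_nonneg_left (by positivity)
  have hB₀ : prepC.cost (2 * P.T) ≤ ⌊C * (n : ℝ) ^ (2 * prepC.depth)⌋₊ := by
    refine Nat.le_floor ?_
    have h1 : (prepC.cost (2 * P.T) : ℝ) ≤
        prepC.cost 1 * 3 ^ prepC.depth * n ^ (2 * prepC.depth) := by exact_mod_cast prepCost_le hn0
    exact h1.trans (mul_le_mul_of_nonneg_right hC1 (by positivity))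
  have hB : updCost P.s (Nat.clog 2 P.T) ≤ ⌊C * √(n : ℝ) * Real.log n ^ 3⌋₊ := by
    refine Nat.le_floor ?_
    have h1 : (updCost P.s (Nat.clog 2 P.T) : ℝ) ≤
        updConst * ((Nat.clog 2 P.T + 1) * (P.s + 1)) := by exact_mod_cast updCost_le _ _
    have h2 : ((Nat.clog 2 P.T : ℝ) + 1) ≤ 6 * (3 / 2 * Real.log n) ^ 3 := by
      have h3 : (Nat.clog 2 P.T : ℝ) ≤ 2 * Nat.size n := by exact_mod_cast clog_T_le hn0
      have h4 := size_le_log hn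
      have h5 := le_self_pow₀ hK1 (show 3 ≠ 0 by omega)
      linarith
    have h3 : (P.s : ℝ) + 1 ≤ 3 * √n := by
      have h4 : 1 ≤ √(n : ℝ) := Real.one_le_sqrt.2 (by exact_mod_cast hn0)
      have := P.s_le_sqrt
      linarith
    have h4 : ((Nat.clog 2 P.T : ℝ) + 1) * (P.s + 1) ≤ 6 * (4 * Real.log n ^ 3) * (3 * √n) :=
      mul_le_mul (by linarith) h3 (by positivity) (by positivity)
    calc _ ≤ _ := h1
      _ ≤ updConst * (6 * (4 * Real.log n ^ 3) * (3 * √n)) :=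
        mul_le_mul_of_nonneg_left h4 (by positivity)
      _ = 72 * updConst * (√n * Real.log n ^ 3) := by ring
      _ ≤ C * (√n * Real.log n ^ 3) := mul_le_mul_of_nonneg_right hC2 (by positivity)
      _ = _ := by ring
  obtain ⟨X, hX⟩ := exists_law hn0 G adv (momentBound n a) hB₀ hB (le_refl (n ^ a))
  refine (tsub_le_tsub_left (err_le hn0 G a) 1).trans (hX.prob.trans ?_)
  refine MeasureTheory.measure_mono ?_
  rintro r ⟨h, s, rfl, hr⟩
  refine ⟨h, s, rfl, fun x l hx => ?_⟩
  obtain ⟨h1, h2, h3⟩ := hr x l hx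
  refine ⟨h1, ?_, ?_⟩
  · have h4 : (x.2.edgeSet.ncard : ℝ) ≤ (P.D * P.s : ℕ) + 4 * P.T := by exact_mod_cast h2
    have h5 := P.Ds_le_rpow
    have h6 := P.T_le_rpow
    have h7 : (16 : ℝ) * (4 * Real.log n ^ 3) ≤ C * Real.log n ^ 3 := by
      have : (64 : ℝ) ≤ C := by
        have : (0 : ℝ) ≤ a := by positivity
        linarith
      nlinarith
    have hR : (0 : ℝ) ≤ (n : ℝ) ^ (1.5 : ℝ) := by positivity
    have h8 : (x.2.edgeSet.ncard : ℝ) ≤ 16 * (4 * Real.log n ^ 3) * (n : ℝ) ^ (1.5 : ℝ) := by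
      have : (1 : ℝ) ≤ 4 * Real.log n ^ 3 := hone.trans hK3
      nlinarith
    calc _ ≤ _ := h8
      _ ≤ C * Real.log n ^ 3 * (n : ℝ) ^ (1.5 : ℝ) := mul_le_mul_of_nonneg_right h7 hR
      _ = _ := by ring
  · refine h3.trans ((losses_le hn G a l.length).trans ?_)
    refine mul_le_mul_of_nonneg_right ?_ (by positivity)
    have : (0 : ℝ) ≤ 864 * a + 4100 := by positivity
    nlinarith
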